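/- \textbf{Model.} Let the set of link states be $\mathsf S=\{\mathrm{LOS},\mathrm{NLOS}\}$. Given are densities $\lambda_{BS},\lambda_{MT}>0$ of base stations (BSs) and mobile terminals, an integer $N_{RB}\ge 1$ of resource blocks per BS, $P_{BS}>0$ and $P_{RB}=P_{BS}/N_{RB}$, a noise power $\sigma_N^2>0$ and, for $s\in\mathsf S$, path-loss constants $\kappa_s>0$ and slopes $\alpha_s>2$, log-normal shadowing parameters $\mu_s\in\mathbb R$, $\sigma_s\ge 0$ (in dB), gamma fading parameters $m_s,\Omega_s>0$; a radius $0<\hat D_1<\infty$ and probabilities $\hat q_s^{[0,\hat D_1]},\hat q_s^{[\hat D_1,\infty]}\ge 0$ with $\sum_s\hat q_s^{[0,\hat D_1]}=\sum_s\hat q_s^{[\hat D_1,\infty]}=1$; put $\hat p_s(r)=\hat q_s^{[0,\hat D_1]}$ for $0\le r<\hat D_1$ and $\hat p_s(r)=\hat q_s^{[\hat D_1,\infty]}$ for $r\ge\hat D_1$. For $t\in\{BS,MT\}$ the antenna pattern is $G_t(\theta)=\sum_{l=1}^{K_t}\gamma_t^{(l)}\mathbb 1\{\varphi_t^{(l-1)}\le|\theta|<\varphi_t^{(l)}\}$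 with $\gamma_t^{(l)}\ge0$, $0=\varphi_t^{(0)}<\dots<\varphi_t^{(K_t)}=\pi$, $\int_{-\pi}^{\pi}G_t=2\pi$; put $\omega_t^{(l)}=2(\varphi_t^{(l)}-\varphi_t^{(l-1)})$. The intended link has gain $G^{(0)}>0$, the product of the boresight gains of the two antennas. Let $$\Theta_s=\exp\!\Big(\tfrac{2\tilde\mu_s}{\alpha_s}+\tfrac{2\tilde\sigma_s^2}{\alpha_s^2}\Big),\qquad \tilde\mu_s=\tfrac{\ln 10}{10}\mu_s,\quad \tilde\sigma_s=\tfrac{\ln 10}{10}\sigma_s .$$ \textbf{Load.} Let $f$ be the gamma density with shape $3.5$ and mean $1/\lambda_{BS}$ (cell area), and $\Pr\{N=n\}=\int_0^\infty e^{-\lambda_{MT}a}\frac{(\lambda_{MT}a)^n}{n!}f(a)\,da$, $\Pr\{N'=n\}=\int_0^\infty e^{-\lambda_{MT}a}\frac{(\lambda_{MT}a)^n}{n!}\lambda_{BS}\,a f(a)\,da$. Put $p_{sel}=\sum_{n<N_{RB}}\Pr\{N'=n\}+\sum_{n\ge N_{RB}}\frac{N_{RB}}{n+1}\Pr\{N'=n\}$,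 $p_{off}=\sum_{n=0}^{N_{RB}}(1-\frac n{N_{RB}})\Pr\{N=n\}$ and $\lambda_{BS}^{(I)}=(1-p_{off})\lambda_{BS}$. \textbf{Network.} For $s\in\mathsf S$ the BSs in state $s$ form independent planar Poisson processes of density $\lambda_{BS}\Theta_s\hat p_s(|y|)$. The $n$-th BS in state $s$, at $y$, has path-loss $L_s^{(n)}=\kappa_s|y|^{\alpha_s}$; independently of everything else it is active with probability $1-p_{off}$, its interfering link has gamma fading $g_s^{(n)}$ (shape $m_s$, mean $\Omega_s$) and gain $G_s^{(n)}=G_{BS}(\theta)G_{MT}(\theta')$ with independent $\theta,\theta'$ uniform on $[-\pi,\pi)$. Let $L_s^{(0)}=\min_nL_s^{(n)}$, $L^{(0)}=\min_sL_s^{(0)}$, let $s^\ast$ be the state with $L^{(0)}=L_{s^\ast}^{(0)}$, and let $g_s^{(0)}$ be independent gamma variables (shape $m_s$, mean $\Omega_s$). Put $$I(x)=\sum_{s}\sum_{n\ \mathrm{active}}\frac{P_{RB}G_s^{(n)}g_s^{(n)}}{L_s^{(n)}}\mathbb 1\{L_s^{(n)}>x\},\qquad \mathrm{SINR}=\frac{P_{RB}G^{(0)}g_{s^\ast}^{(0)}/L^{(0)}}{\sigma_N^2+I(L^{(0)})},$$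 $\mathrm{ASE}=\frac{\lambda_{MT}p_{sel}}{\ln2}\mathbb E[\ln(1+\mathrm{SINR})]$ and, for $T>0$, $\mathrm{PT}=\lambda_{MT}p_{sel}\log_2(1+T)\Pr\{\mathrm{SINR}\ge T\}$. \textbf{Notation.} $\mathcal H(x)=1$ for $x\ge0$ and $0$ for $x<0$; $\overline{\mathcal H}=1-\mathcal H$; $\mathcal M_s(z)=(1+z\Omega_s/m_s)^{-m_s}$; with ${}_2F_1$ the Gauss hypergeometric function on $\mathbb C\setminus[1,\infty)$, $$\mathcal F_s(z)=1-\sum_{l_1=1}^{K_{BS}}\sum_{l_2=1}^{K_{MT}}\frac{\omega_{BS}^{(l_1)}}{2\pi}\frac{\omega_{MT}^{(l_2)}}{2\pi}\,{}_2F_1\!\Big(m_s,-\tfrac2{\alpha_s};1-\tfrac2{\alpha_s};-z\tfrac{\Omega_s}{m_s}\gamma_{BS}^{(l_1)}\gamma_{MT}^{(l_2)}\Big);$$ $\hat\Lambda_s([0,\xi))=2\pi\lambda_{BS}\Theta_s\int_0^{(\xi/\kappa_s)^{1/\alpha_s}}\hat p_s(r)\,r\,dr$ and $\hat\Lambda_s^{(1)}$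 is its derivative, given by the multi-ball formula; $\mathcal L_s(x)=\hat\Lambda^{(1)}_s([0,x))\exp(-\sum_r\hat\Lambda_r([0,x)))$. With $B$ balls, $\hat D_0=0$, $\hat D_{B+1}=\infty$, $\hat q_r^{(b)}=\hat q_r^{[\hat D_{b-1},\hat D_b]}$, $h_{r,b}=\mathcal H(x-\kappa_r\hat D_b^{\alpha_r})$, $\bar h_{r,b}=1-h_{r,b}$, $F_{r,b}=\hat D_b^2\mathcal F_r\big(\tfrac{xz}{\kappa_r\hat D_b^{\alpha_r}}\big)$ ($F_{r,0}=0$), the multi-ball formulas are $$\hat\Lambda_s^{(1)}([0,x))=\pi\lambda_{BS}\Theta_s\tfrac2{\alpha_s}\kappa_s^{-2/\alpha_s}x^{2/\alpha_s-1}\Big(\sum_{b=1}^{B}\hat q_s^{(b)}\bar h_{s,b}h_{s,b-1}+\hat q_s^{(B+1)}h_{s,B}\Big),$$ $$\hat{\mathcal T}_r(z,x)=\pi\lambda_{BS}^{(I)}\Theta_r\Big[\big(\tfrac x{\kappa_r}\big)^{2/\alpha_r}\mathcal F_r(z)\sum_{b=1}^{B}\hat q_r^{(b)}\bar h_{r,b}h_{r,b-1}+\sum_{b=1}^{B}\hat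 q_r^{(b)}\big(F_{r,b-1}\bar h_{r,b-1}-F_{r,b}\bar h_{r,b}\big)+\hat q_r^{(B+1)}\big(F_{r,B}\bar h_{r,B}+\big(\tfrac x{\kappa_r}\big)^{2/\alpha_r}\mathcal F_r(z)h_{r,B}\big)\Big].$$ \textbf{Claim.} Take $B=1$ and put $\mathcal M_I(z|x)=\exp(\hat{\mathcal T}_{LOS}(z,x)+\hat{\mathcal T}_{NLOS}(z,x))$. (1) $\ln(1+\mathrm{SINR})$ is integrable, the double integrals below converge absolutely, and $$\mathrm{ASE}=\frac{\lambda_{MT}p_{sel}}{\ln 2}\sum_{s}\int_0^\infty\!\!\int_0^\infty \exp\!\Big(-\frac{zx\sigma_N^2}{G^{(0)}P_{RB}}\Big)\mathcal M_I\Big(\frac z{G^{(0)}}\Big|x\Big)(1-\mathcal M_s(z))\,\mathcal L_s(x)\,\frac{dz\,dx}{z}.$$ (2) For $T>0$, $\mathrm{PT}=\lambda_{MT}p_{sel}\log_2(1+T)\big(\tfrac12-\tfrac1\pi\bar{\mathcal C}(T)\big)$, where the following integrals converge absolutely: $$\bar{\mathcal C}(T)=\sum_s\int_0^\infty\!\!\int_0^\infty\mathrm{Im}\Big\{\exp\!\Big(\frac{\mathrm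 jzx\sigma_N^2T}{G^{(0)}P_{RB}}\Big)\mathcal M_s(\mathrm jz)\,\mathcal M_I\Big(-\frac{\mathrm jzT}{G^{(0)}}\Big|x\Big)\Big\}\mathcal L_s(x)\,\frac{dz\,dx}{z}.$$ (3) $\mathcal M_I$ is the moment generating function of the interference normalized by $P_{RB}/x$: for $\mathrm{Re}\,z\ge0$ and $x>0$, $\mathbb E[e^{-zxI(x)/P_{RB}}]=\mathcal M_I(z|x)$, and $\mathbb E[e^{-zL^{(0)}I(L^{(0)})/P_{RB}}\mid s^\ast,L^{(0)}]=\mathcal M_I(z|L^{(0)})$ almost surely. (4) For $\xi\ge0$, $\hat\Lambda_s([0,\xi))$ is the mean number of links in state $s$ with path-loss in $[0,\xi)$, and $$\hat\Lambda_s([0,\xi))=\pi\lambda_{BS}\Theta_s\hat q_s^{[0,\hat D_1]}\big((\xi/\kappa_s)^{2/\alpha_s}\overline{\mathcal H}(\xi-\kappa_s\hat D_1^{\alpha_s})+\hat D_1^2\mathcal H(\xi-\kappa_s\hat D_1^{\alpha_s})\big)+\pi\lambda_{BS}\Theta_s\hat q_s^{[\hat D_1,\infty]}\big((\xi/\kappa_s)^{2/\alpha_s}-\hat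 D_1^2\big)\mathcal H(\xi-\kappa_s\hat D_1^{\alpha_s}).$$ (5) For $\xi>0$, $$\hat\Lambda_s^{(1)}([0,\xi))=\pi\lambda_{BS}\Theta_s\tfrac2{\alpha_s}\kappa_s^{-2/\alpha_s}\xi^{2/\alpha_s-1}\big(\hat q_s^{[0,\hat D_1]}\overline{\mathcal H}(\xi-\kappa_s\hat D_1^{\alpha_s})+\hat q_s^{[\hat D_1,\infty]}\mathcal H(\xi-\kappa_s\hat D_1^{\alpha_s})\big),$$ and this is the derivative of $\xi\mapsto\hat\Lambda_s([0,\xi))$ if $\xi\ne\kappa_s\hat D_1^{\alpha_s}$, and its right derivative for every $\xi>0$. (6) For $z\in\mathbb C$ with $\mathrm{Re}\,z\ge0$ and $x\ge0$, $$\hat{\mathcal T}_r(z,x)=\pi\lambda^{(I)}_{BS}\Theta_r\hat q_r^{[0,\hat D_1]}\Big(\big(\tfrac x{\kappa_r}\big)^{2/\alpha_r}\mathcal F_r(z)-\hat D_1^2\mathcal F_r\big(\tfrac{xz}{\kappa_r\hat D_1^{\alpha_r}}\big)\Big)\overline{\mathcal H}(x-\kappa_r\hat D_1^{\alpha_r})$$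 $$+\pi\lambda^{(I)}_{BS}\Theta_r\hat q_r^{[\hat D_1,\infty]}\Big(\big(\tfrac x{\kappa_r}\big)^{2/\alpha_r}\mathcal F_r(z)\mathcal H(x-\kappa_r\hat D_1^{\alpha_r})+\hat D_1^2\mathcal F_r\big(\tfrac{xz}{\kappa_r\hat D_1^{\alpha_r}}\big)\overline{\mathcal H}(x-\kappa_r\hat D_1^{\alpha_r})\Big).$$ -/

import Mathlib

open MeasureTheory ProbabilityTheory Set
open scoped ENNReal

noncomputable section

/-! ### The Gauss hypergeometric function on the cut plane -/

/-- `F` is the principal branch of `₂F₁(a, b; c; ·)`: it is holomorphic on `ℂ ∖ [1, ∞)` and is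
given by the hypergeometric series on the unit disc. These two properties determine `F` on
`ℂ ∖ [1, ∞)`. -/
def IsGaussHypergeometric (a b c : ℂ) (F : ℂ → ℂ) : Prop :=
  DifferentiableOn ℂ F {z | 1 - z ∈ Complex.slitPlane} ∧
    ∀ z : ℂ, ‖z‖ < 1 → F z = ordinaryHypergeometric a b c z

open Classical in
/-- The Gauss hypergeometric function, i.e. the analytic continuation of the hypergeometric series
to `ℂ ∖ [1, ∞)`. -/
def gaussHypergeometric (a b c z : ℂ) : ℂ :=
  if h : ∃ F : ℂ → ℂ, IsGaussHypergeometric a b c F then h.choose z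
  else ordinaryHypergeometric a b c z

/-! ### Heaviside functions -/

/-- Heaviside function, equal to `1` at the origin. -/
def heaviside (x : ℝ) : ℝ := if 0 ≤ x then 1 else 0

/-- Complementary Heaviside function. -/
def heavisideCompl (x : ℝ) : ℝ := 1 - heaviside x

/-! ### Poisson point processes -/

/-- Number of points of the enumerated point process `{X n | n < N}` that lie in `A`. -/
def pointCount {Ω E : Type*} (N : Ω → ℕ∞) (X : ℕ → Ω → E) (A : Set E) (ω : Ω) : ℕ∞ :=
  Set.encard {n : ℕ | (n : ℕ∞) < N ω ∧ X n ω ∈ A}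

/-- The point process `{X n | n < N}` (with a random, possibly infinite, number `N` of points) is a
Poisson point process with intensity measure `ν`. -/
structure IsPoissonProcess {Ω E : Type*} [MeasurableSpace Ω] [MeasurableSpace E]
    (N : Ω → ℕ∞) (X : ℕ → Ω → E) (ν : Measure E) (μ : Measure Ω) : Prop where
  measurable_count : Measurable N
  measurable_point : ∀ n, Measurable (X n)
  poisson : ∀ A : Set E, MeasurableSet A → ν A < ∞ → ∀ k : ℕ,
    μ {ω | pointCount N X A ω = k} =
      ENNReal.ofReal (Real.exp (-(ν A).toReal) * (ν A).toReal ^ k / k.factorial)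
  independent : ∀ (m : ℕ) (A : Fin m → Set E), (∀ i, MeasurableSet (A i)) →
    (∀ i j, i ≠ j → Disjoint (A i) (A j)) → iIndepFun (fun i => pointCount N X (A i)) μ

/-! ### Parameters of the network -/

/-- The two ends of a link: base station and mobile terminal. -/
inductive Terminal
  | bs
  | mt

/-- Line-of-sight and non-line-of-sight link states. -/
inductive LinkState
  | los
  | nlos
  deriving DecidableEq

instance : Fintype LinkState where
  elems := {LinkState.los, LinkState.nlos}
  complete s := by cases s <;> simp

instance : Nonempty LinkState := ⟨LinkState.los⟩

instance : MeasurableSpace LinkState := ⊤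

/-- Parameters of a cellular network with set of link states `S` and `B` balls. -/
structure NetworkParams (S : Type*) [Fintype S] (B : ℕ) where
  /-- density of base stations -/
  lamBS : ℝ
  /-- density of mobile terminals -/
  lamMT : ℝ
  /-- number of resource blocks per base station -/
  NRB : ℕ
  /-- power budget of a base station -/
  PBS : ℝ
  /-- noise power `σ_N²` in a resource block -/
  noise : ℝ
  /-- path-loss constant -/
  kap : S → ℝ
  /-- path-loss slope -/
  alp : S → ℝ
  /-- mean (in dB) of the log-normal shadowing -/
  shMean : S → ℝ
  /-- standard deviation (in dB) of the log-normal shadowing -/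
  shStd : S → ℝ
  /-- fading parameter -/
  m : S → ℝ
  /-- mean of the fading power gain -/
  Om : S → ℝ
  /-- radii of the balls; only `D 0, …, D B` are used, and `D (B + 1)` stands for `∞` -/
  D : ℕ → ℝ
  /-- `q s b` is the probability of state `s` on `[D (b - 1), D b)`, for `b = 1, …, B + 1` -/
  q : S → ℕ → ℝ
  /-- number of lobes of the multi-lobe antenna pattern -/
  K : Terminal → ℕ
  /-- gains of the lobes `1, …, K` -/
  gam : Terminal → ℕ → ℝ
  /-- angles `φ 0, …, φ K` delimiting the lobes -/
  phi : Terminal → ℕ → ℝ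
  /-- boresight gain of the antennas on the intended link -/
  boresight : Terminal → ℝ
  lamBS_pos : 0 < lamBS
  lamMT_pos : 0 < lamMT
  NRB_pos : 0 < NRB
  PBS_pos : 0 < PBS
  noise_pos : 0 < noise
  kap_pos : ∀ s, 0 < kap s
  two_lt_alp : ∀ s, 2 < alp s
  shStd_nonneg : ∀ s, 0 ≤ shStd s
  m_pos : ∀ s, 0 < m s
  Om_pos : ∀ s, 0 < Om s
  D_zero : D 0 = 0
  D_lt : ∀ b < B, D b < D (b + 1)
  q_nonneg : ∀ s, ∀ b ∈ Finset.Icc 1 (B + 1), 0 ≤ q s b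
  q_sum : ∀ b ∈ Finset.Icc 1 (B + 1), ∑ s, q s b = 1
  gam_nonneg : ∀ t, ∀ l ∈ Finset.Icc 1 (K t), 0 ≤ gam t l
  phi_zero : ∀ t, phi t 0 = 0
  phi_lt : ∀ t, ∀ l < K t, phi t l < phi t (l + 1)
  phi_last : ∀ t, phi t (K t) = Real.pi
  /-- normalization `∫_{-π}^{π} G_t(θ) dθ = 2π` of the antenna pattern -/
  gam_normalized : ∀ t,
    ∑ l ∈ Finset.Icc 1 (K t), gam t l * (2 * (phi t l - phi t (l - 1))) = 2 * Real.pi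
  boresight_pos : ∀ t, 0 < boresight t

namespace NetworkParams

variable {S : Type*} [Fintype S] {B : ℕ} (p : NetworkParams S B)

/-- Transmit power per resource block. -/
def PRB : ℝ := p.PBS / p.NRB

/-- Directivity gain `G⁽⁰⁾` of the intended link. -/
def G0 : ℝ := p.boresight Terminal.bs * p.boresight Terminal.mt

/-- `Θ_s = 𝔼[𝒳_s^{2/α_s}]`, the fractional moment of the log-normal shadowing. -/
def Theta (s : S) : ℝ :=
  Real.exp (2 * (p.shMean s * Real.log 10 / 10) / p.alp s +
    2 * (p.shStd s * Real.log 10 / 10) ^ 2 / p.alp s ^ 2)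

/-- Multi-ball link state probability `p_s(r)`. -/
def linkProb (s : S) (r : ℝ) : ℝ :=
  ∑ b ∈ Finset.Icc 1 B, p.q s b * (Ico (p.D (b - 1)) (p.D b)).indicator 1 r +
    p.q s (B + 1) * (Ici (p.D B)).indicator 1 r

/-- Path-loss `κ_s r^{α_s}`. -/
def pathLoss (s : S) (r : ℝ) : ℝ := p.kap s * r ^ p.alp s

/-- Intensity measure on the plane of the base stations in state `s` of the intensity-matched
model: density `λ_BS p_s(r) Θ_s` at distance `r` from the typical terminal. -/
def planarIntensity (s : S) : Measure (EuclideanSpace ℝ (Fin 2)) :=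
  volume.withDensity fun y => ENNReal.ofReal (p.lamBS * p.linkProb s ‖y‖ * p.Theta s)

/-- Multi-lobe antenna radiation pattern. -/
def pattern (t : Terminal) (θ : ℝ) : ℝ :=
  ∑ l ∈ Finset.Icc 1 (p.K t), p.gam t l * (Ico (p.phi t (l - 1)) (p.phi t l)).indicator 1 |θ|

/-- Angular width `ω_t^{(l)}` of the `l`-th lobe. -/
def lobeWidth (t : Terminal) (l : ℕ) : ℝ := 2 * (p.phi t l - p.phi t (l - 1))

/-! #### Load model -/

/-- Distribution of the area of a cell: gamma with shape `3.5` and mean `1 / λ_BS`. -/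
def cellArea : Measure ℝ := gammaMeasure (7 / 2) (7 / 2 * p.lamBS)

/-- Probability that `n` mobile terminals are associated with a base station. -/
def loadProb (n : ℕ) : ℝ :=
  ∫ x, Real.exp (-(p.lamMT * x)) * (p.lamMT * x) ^ n / n.factorial ∂p.cellArea

/-- Probability that `n` other mobile terminals are associated with the base station of a given
mobile terminal. The cell of a given terminal is area-biased; the mean area is `1 / λ_BS`. -/
def otherLoadProb (n : ℕ) : ℝ :=
  ∫ x, p.lamBS * x * (Real.exp (-(p.lamMT * x)) * (p.lamMT * x) ^ n / n.factorial) ∂p.cellArea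

/-- Probability that a mobile terminal is scheduled for transmission in a resource block. -/
def pSel : ℝ :=
  ∑ n ∈ Finset.range p.NRB, p.otherLoadProb n +
    ∑' k : ℕ, (p.NRB : ℝ) / ((p.NRB + k : ℕ) + 1) * p.otherLoadProb (p.NRB + k)

/-- Probability that a base station does not transmit in a resource block. -/
def pOff : ℝ :=
  ∑ n ∈ Finset.range (p.NRB + 1), (1 - (n : ℝ) / p.NRB) * p.loadProb n

/-- Density of the base stations that are active in a resource block. -/
def lamI : ℝ := (1 - p.pOff) * p.lamBS

/-! #### Analytical expressions -/

/-- Approximated intensity measure `Λ_s([0, ξ))` of the path-loss process of state `s`. -/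
def intensity (s : S) (ξ : ℝ) : ℝ :=
  2 * Real.pi * p.lamBS * p.Theta s *
    ∫ r in (0 : ℝ)..(ξ / p.kap s) ^ (1 / p.alp s), p.linkProb s r * r

/-- Multi-ball formula for the first derivative `Λ_s⁽¹⁾([0, ξ))`. -/
def intensityDeriv (s : S) (ξ : ℝ) : ℝ :=
  Real.pi * p.lamBS * p.Theta s * (2 / p.alp s) * p.kap s ^ (-(2 / p.alp s)) *
      ξ ^ (2 / p.alp s - 1) *
      ∑ b ∈ Finset.Icc 1 B, p.q s b * heavisideCompl (ξ - p.kap s * p.D b ^ p.alp s) *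
        heaviside (ξ - p.kap s * p.D (b - 1) ^ p.alp s) +
    Real.pi * p.lamBS * p.Theta s * (2 / p.alp s) * p.kap s ^ (-(2 / p.alp s)) *
      ξ ^ (2 / p.alp s - 1) * p.q s (B + 1) * heaviside (ξ - p.kap s * p.D B ^ p.alp s)

/-- `ℒ_s(x) = Λ_s⁽¹⁾([0, x)) exp(-∑_r Λ_r([0, x)))`. -/
def servingDensity (s : S) (x : ℝ) : ℝ :=
  p.intensityDeriv s x * Real.exp (-∑ r, p.intensity r x)

/-- Moment generating function `(1 + z Ω_s / m_s)^{-m_s}` of the fading power gain. -/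
def fadingMGF (s : S) (z : ℂ) : ℂ :=
  (1 + z * ((p.Om s / p.m s : ℝ) : ℂ)) ^ (-(p.m s : ℂ))

/-- The function `ℱ_s`. -/
def calF (s : S) (z : ℂ) : ℂ :=
  1 - ∑ l₁ ∈ Finset.Icc 1 (p.K Terminal.bs), ∑ l₂ ∈ Finset.Icc 1 (p.K Terminal.mt),
    ((p.lobeWidth Terminal.bs l₁ / (2 * Real.pi) *
        (p.lobeWidth Terminal.mt l₂ / (2 * Real.pi)) : ℝ) : ℂ) *
      gaussHypergeometric (p.m s) (-((2 / p.alp s : ℝ) : ℂ)) (1 - ((2 / p.alp s : ℝ) : ℂ))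
        (-(z * ((p.Om s / p.m s * p.gam Terminal.bs l₁ * p.gam Terminal.mt l₂ : ℝ) : ℂ)))

/-- Multi-ball formula for the exponent `T_r(z, x)`. -/
def exponent (r : S) (z : ℂ) (x : ℝ) : ℂ :=
  ((Real.pi * p.lamI * p.Theta r * (x / p.kap r) ^ (2 / p.alp r) : ℝ) : ℂ) * p.calF r z *
      ∑ b ∈ Finset.Icc 1 B, ((p.q r b * (heavisideCompl (x - p.kap r * p.D b ^ p.alp r) *
        heaviside (x - p.kap r * p.D (b - 1) ^ p.alp r)) : ℝ) : ℂ) +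
    ((Real.pi * p.lamI * p.Theta r : ℝ) : ℂ) *
      ∑ b ∈ Finset.Icc 1 B, (p.q r b : ℂ) *
        ((p.D (b - 1) : ℂ) ^ 2 *
            p.calF r ((x : ℂ) * z / ((p.kap r * p.D (b - 1) ^ p.alp r : ℝ) : ℂ)) *
            (heavisideCompl (x - p.kap r * p.D (b - 1) ^ p.alp r) : ℂ) -
          (p.D b : ℂ) ^ 2 *
            p.calF r ((x : ℂ) * z / ((p.kap r * p.D b ^ p.alp r : ℝ) : ℂ)) *
            (heavisideCompl (x - p.kap r * p.D b ^ p.alp r) : ℂ)) +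
    ((Real.pi * p.lamI * p.Theta r * p.q r (B + 1) : ℝ) : ℂ) *
      ((p.D B : ℂ) ^ 2 *
          p.calF r ((x : ℂ) * z / ((p.kap r * p.D B ^ p.alp r : ℝ) : ℂ)) *
          (heavisideCompl (x - p.kap r * p.D B ^ p.alp r) : ℂ) +
        (((x / p.kap r) ^ (2 / p.alp r) : ℝ) : ℂ) * p.calF r z *
          (heaviside (x - p.kap r * p.D B ^ p.alp r) : ℂ))

/-- Integrand of the ASE formula, for a given moment generating function `M` of the other-cell
interference. -/
def aseIntegrand (M : ℂ → ℝ → ℂ) (s : S) (z x : ℝ) : ℂ :=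
  Complex.exp (-((z * x * p.noise / (p.G0 * p.PRB) : ℝ) : ℂ)) *
    M ((z / p.G0 : ℝ) : ℂ) x * (1 - p.fadingMGF s z) * (p.servingDensity s x : ℂ) / (z : ℂ)

/-- Integrand of the coverage integral in the PT formula, for a given moment generating function
`M` of the other-cell interference and a decoding threshold `T`. -/
def ptIntegrand (M : ℂ → ℝ → ℂ) (T : ℝ) (s : S) (z x : ℝ) : ℝ :=
  (Complex.exp (Complex.I * ((z * x * p.noise * T / (p.G0 * p.PRB) : ℝ) : ℂ)) *
    p.fadingMGF s (Complex.I * z) * M (-(Complex.I * ((z * T / p.G0 : ℝ) : ℂ))) x).im *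
    p.servingDensity s x / z

/-- The interference moment generating function for two link states. -/
def twoStateMGF (p : NetworkParams LinkState 1) (z : ℂ) (x : ℝ) : ℂ :=
  Complex.exp (p.exponent LinkState.los z x + p.exponent LinkState.nlos z x)

end NetworkParams

/-! ### The random network -/

/-- The random elements of a network seen from the typical mobile terminal at the origin: for each
link state `s`, base stations at the points `pos s n`, `n < count s`. -/
structure Network (S Ω : Type*) where
  /-- number of base stations in a given state -/
  count : S → Ω → ℕ∞
  /-- position of the `n`-th base station in a given state -/
  pos : S → ℕ → Ω → EuclideanSpace ℝ (Fin 2)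
  /-- whether the `n`-th base station transmits in the resource block -/
  active : S → ℕ → Ω → Bool
  /-- fading power gain of the `n`-th (interfering) link -/
  fading : S → ℕ → Ω → ℝ
  /-- angles to boresight at the two ends of the `n`-th (interfering) link -/
  angle : Terminal → S → ℕ → Ω → ℝ
  /-- fading power gain of the intended link when it is in a given state -/
  servingFading : S → Ω → ℝ

namespace Network

/-- Labels of the independent sources of randomness. -/
inductive Source (S : Type*)
  | process (s : S)
  | active (s : S) (n : ℕ)
  | fading (s : S) (n : ℕ)
  | angle (t : Terminal) (s : S) (n : ℕ)
  | serving (s : S)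

variable {S Ω : Type*} [Fintype S] {B : ℕ}

/-- The σ-algebra generated by a source of randomness. -/
@[reducible] def sourceAlgebra (net : Network S Ω) : Source S → MeasurableSpace Ω
  | .process s => MeasurableSpace.comap (fun ω => (net.count s ω, fun n => net.pos s n ω))
      inferInstance
  | .active s n => MeasurableSpace.comap (net.active s n) inferInstance
  | .fading s n => MeasurableSpace.comap (net.fading s n) inferInstance
  | .angle t s n => MeasurableSpace.comap (net.angle t s n) inferInstance
  | .serving s => MeasurableSpace.comap (net.servingFading s) inferInstance

/-- `net` is a realization, on the probability space `(Ω, μ)`, of the intensity-matched system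
model with parameters `p`: independent planar Poisson processes of base stations, one per link
state, with independent activity, gamma fading and uniform antenna orientation. -/
structure IsModel [MeasurableSpace Ω] (net : Network S Ω) (p : NetworkParams S B)
    (μ : Measure Ω) : Prop where
  poisson : ∀ s, IsPoissonProcess (net.count s) (net.pos s) (p.planarIntensity s) μ
  measurable_active : ∀ s n, Measurable (net.active s n)
  measurable_fading : ∀ s n, Measurable (net.fading s n)
  measurable_angle : ∀ t s n, Measurable (net.angle t s n)
  measurable_serving : ∀ s, Measurable (net.servingFading s)
  active_law : ∀ s n, μ {ω | net.active s n ω = true} = ENNReal.ofReal (1 - p.pOff)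
  fading_law : ∀ s n, μ.map (net.fading s n) = gammaMeasure (p.m s) (p.m s / p.Om s)
  angle_law : ∀ t s n, pdf.IsUniform (net.angle t s n) (Ico (-Real.pi) Real.pi) μ
  serving_law : ∀ s, μ.map (net.servingFading s) = gammaMeasure (p.m s) (p.m s / p.Om s)
  independent : iIndep net.sourceAlgebra μ

variable (net : Network S Ω) (p : NetworkParams S B)

/-- Path-loss `L_s^{(n)}` of the `n`-th link in state `s`. -/
def loss (s : S) (n : ℕ) (ω : Ω) : ℝ := p.pathLoss s ‖net.pos s n ω‖

/-- Number of links in state `s` whose path-loss lies in `[0, ξ)`. -/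
def lossCount (s : S) (ξ : ℝ) (ω : Ω) : ℕ∞ :=
  pointCount (net.count s) (net.loss p s) (Ico 0 ξ) ω

/-- Smallest path-loss `L_s^{(0)}` of the links in state `s` (`∞` if there is no such link). -/
def minLoss (s : S) (ω : Ω) : ℝ≥0∞ :=
  ⨅ (n : ℕ) (_ : (n : ℕ∞) < net.count s ω), ENNReal.ofReal (net.loss p s n ω)

/-- Smallest path-loss `L^{(0)}` over all links, i.e. the path-loss of the intended link. -/
def servingLoss (ω : Ω) : ℝ := (⨅ s, net.minLoss p s ω).toReal

/-- State of the intended link, i.e. the state with the smallest path-loss (ties have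
probability zero). -/
def servingState [Nonempty S] (ω : Ω) : S :=
  (Finite.exists_min fun s => net.minLoss p s ω).choose

open Classical in
/-- Aggregate interference of the active base stations with path-loss larger than `x`. -/
def interference (x : ℝ) (ω : Ω) : ℝ≥0∞ :=
  ∑ s, ∑' n : ℕ,
    if (n : ℕ∞) < net.count s ω ∧ net.active s n ω = true ∧ x < net.loss p s n ω then
      ENNReal.ofReal (p.PRB *
        (p.pattern Terminal.bs (net.angle Terminal.bs s n ω) *
          p.pattern Terminal.mt (net.angle Terminal.mt s n ω)) *
        net.fading s n ω / net.loss p s n ω)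
    else 0

/-- Signal-to-interference-plus-noise ratio of the typical mobile terminal. -/
def sinr [Nonempty S] (ω : Ω) : ℝ :=
  p.PRB * p.G0 * net.servingFading (net.servingState p ω) ω / net.servingLoss p ω /
    (p.noise + (net.interference p (net.servingLoss p ω) ω).toReal)

/-- Area spectral efficiency. -/
def ase [Nonempty S] [MeasurableSpace Ω] (μ : Measure Ω) : ℝ :=
  p.lamMT * p.pSel / Real.log 2 * ∫ ω, Real.log (1 + net.sinr p ω) ∂μ

/-- Potential throughput for the decoding threshold `T`. -/
def pt [Nonempty S] [MeasurableSpace Ω] (μ : Measure Ω) (T : ℝ) : ℝ :=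
  p.lamMT * p.pSel * Real.logb 2 (1 + T) * μ.real {ω | T ≤ net.sinr p ω}

end Network

end

/-! Write `g` for the fading of the intended link, `L` for its path-loss, `U` for the interference
normalized by `P_RB / L`, and `Y = c L + U / G⁽⁰⁾` with `c` the noise coefficient. Then `SINR = g /
Y` almost surely (`ae_sinr_eq`), and both formulas express a function of `g / Y` through
exponentials. For the ASE this is Frullani's integral `ln (1 + g / Y) = ∫ e^{-zY} (1 - e^{-zg}) dz /
z`. For the PT it is Gil-Pelaez inversion for the sign of `T Y - g`, regularized by a factor
`e^{-εz}`: the damped integral of `sin (z X) / z` is `arctan (X / ε)`, which tends to `± π / 2`.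
After Fubini only the joint transform of `(g, L, U)` on each event `{s* = s}` is needed. It has
three ingredients: `g` is independent of the rest, `(s*, L)` has density `ℒ_s` on `{s* = s}`, and
the conditional Laplace transform of `U` given `(s*, L)` is `ℳ_I(· | L)`.

The Poisson input is the Laplace functional of a marked Poisson process, `𝔼 ∏ f = exp (-∫ (1 - ψ)
dν)` with `ψ` the mean of `f` over the mark (`tendsto_integral_prod_marks`). It is applied to a
factor that is `0` at points with path-loss below `t` and `exp (-z x · mark / loss)` at points with
path-loss beyond `x ≥ t`. This gives the void probability and the interference transform together,
and they factor as `exp (-Λ_s(t)) · exp (T_s(z, x))` (`integral_void_exp_tailSum`). Since the void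
events form a π-system, the interference beyond `x` is independent of the smallest path-losses
truncated at `x` (`setIntegral_exp_tailTotal`).

To set `x = L` one cannot condition on a null event, so `L` is rounded up to a grid. On the cell
where the rounded value is `c`, the event depends only on path-losses below `c`, and the
independence applies with the deterministic level `c`; the interference is right-continuous in its
level, so the mesh can tend to zero (`setIntegral_exp_normInterference`).

The closed form of `T_s` comes from polar coordinates and the substitution `t = (ρ / r)^α`, which
turn `∫ (1 - ℳ_s)` into an Euler-type integral for `₂F₁(m, -δ; 1 - δ; ·)` with `δ = 2 / α < 1`. That
integral is holomorphic on the cut plane and agrees with the hypergeometric series on the disc,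
hence is the continuation.

The law of `L` follows from the void probabilities: a survival function `exp (-Λ)` has density `Λ'
exp (-Λ)`, where right derivatives suffice, so the jump of `Λ'` at the ball radius is harmless. For
the joint law with `s*`, only an upper bound per state is proved directly; the bounds add up to the
law of `L`, so each is an equality and ties have no mass.

Absolute convergence near `z = 0` rests on first moments of fading, path-loss and interference. At
infinity it rests on the noise for the ASE, through a negative moment of `L`, and for the PT on the
decay `|ℳ_s(jz)| = O(z^{-m_s})`. -/

noncomputable section


/-! ### An integral formula for the hypergeometric function -/

section Hypergeometric

open Filter Topology

/-- The plane cut along `[1, ∞)`. -/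
abbrev cutPlane : Set ℂ := {w | 1 - w ∈ Complex.slitPlane}

lemma isOpen_cutPlane : IsOpen cutPlane :=
  Complex.isOpen_slitPlane.preimage (by fun_prop)

lemma zero_mem_cutPlane : (0 : ℂ) ∈ cutPlane := by simp [cutPlane, Complex.slitPlane]

/-- The slit plane is star-shaped about `1`, hence the cut plane about `0`. This keeps `k (t w)`
meaningful for all `t` in the integral below. -/
lemma mul_mem_cutPlane {w : ℂ} (hw : w ∈ cutPlane) {t : ℝ} (ht : t ∈ Icc (0 : ℝ) 1) :
    (t : ℂ) * w ∈ cutPlane := by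
  have h := Complex.starConvex_one_slitPlane hw (sub_nonneg.2 ht.2) ht.1 (by ring)
  have : (1 - t) • (1 : ℂ) + t • (1 - w) = 1 - (t : ℂ) * w := by
    simp only [Complex.real_smul]; push_cast; ring
  rw [this] at h
  exact h

lemma isPreconnected_cutPlane : IsPreconnected cutPlane := by
  have : StarConvex ℝ (0 : ℂ) cutPlane := by
    intro y hy a b ha hb hab
    have := mul_mem_cutPlane hy (t := b) ⟨hb, by linarith⟩
    simpa using this
  exact (this.isPathConnected zero_mem_cutPlane).isConnected.isPreconnected

lemma neg_mem_cutPlane {z : ℂ} (hz : 0 ≤ z.re) : -z ∈ cutPlane := by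
  show 1 - -z ∈ Complex.slitPlane
  left; simp; linarith

/-- If `k` is holomorphic on the cut plane, so is `w ↦ ∫₀¹ t^{-δ} k (t w) dt`. -/
lemma differentiableOn_integral_rpow_mul_comp {δ : ℝ} (hδ : δ < 1) {k : ℂ → ℂ}
    (hk : DifferentiableOn ℂ k cutPlane) :
    DifferentiableOn ℂ (fun w => ∫ t in Ioc (0 : ℝ) 1, ((t ^ (-δ) : ℝ) : ℂ) * k (t * w))
      cutPlane := by
  intro w hw
  obtain ⟨ε, hε, hball⟩ := Metric.nhds_basis_closedBall.mem_iff.1 (isOpen_cutPlane.mem_nhds hw)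
  have hdk : ContinuousOn (deriv k) cutPlane := (hk.deriv isOpen_cutPlane).continuousOn
  have hmaps : ∀ t ∈ Icc (0 : ℝ) 1, ∀ v ∈ Metric.closedBall w ε, (t : ℂ) * v ∈ cutPlane :=
    fun t ht v hv => mul_mem_cutPlane (hball hv) ht
  -- All products `t v` with `t ∈ [0, 1]` and `v` near `w` fill a compact part of the cut plane, so
  -- one constant bounds `deriv k` there and `C t^{-δ}` dominates the derivative of the integrand.
  have hcomp : IsCompact ((fun u : ℝ × ℂ => (u.1 : ℂ) * u.2) ''
      (Icc (0 : ℝ) 1 ×ˢ Metric.closedBall w ε)) :=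
    (isCompact_Icc.prod (isCompact_closedBall w ε)).image (by fun_prop)
  obtain ⟨C, hC⟩ := hcomp.exists_bound_of_continuousOn (f := deriv k) (hdk.mono (by
    rintro _ ⟨⟨t, v⟩, ⟨ht, hv⟩, rfl⟩
    exact hmaps t ht v hv))
  have hrpow : IntegrableOn (fun t : ℝ => t ^ (-δ)) (Ioc (0 : ℝ) 1) := by
    have := intervalIntegral.intervalIntegrable_rpow' (a := 0) (b := 1) (r := -δ) (by linarith)
    rwa [intervalIntegrable_iff_integrableOn_Ioc_of_le zero_le_one] at this
  have hcont : ∀ v ∈ Metric.closedBall w ε, ∀ g : ℂ → ℂ, ContinuousOn g cutPlane →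
      ContinuousOn (fun t : ℝ => g (t * v)) (Icc 0 1) := fun v hv g hg =>
    hg.comp (by fun_prop) fun t ht => hmaps t ht v hv
  have hmeas : ∀ v ∈ Metric.closedBall w ε, ∀ g : ℂ → ℂ, ContinuousOn g cutPlane →
      AEStronglyMeasurable (fun t : ℝ => g (t * v)) (volume.restrict (Ioc (0 : ℝ) 1)) :=
    fun v hv g hg => ((hcont v hv g hg).mono Ioc_subset_Icc_self).aestronglyMeasurable
      measurableSet_Ioc
  have hmr : AEStronglyMeasurable (fun t : ℝ => ((t ^ (-δ) : ℝ) : ℂ))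
      (volume.restrict (Ioc (0 : ℝ) 1)) := by
    apply Measurable.aestronglyMeasurable; fun_prop
  have hint : ∀ v ∈ Metric.closedBall w ε, ∀ g : ℂ → ℂ, ContinuousOn g cutPlane →
      IntegrableOn (fun t : ℝ => ((t ^ (-δ) : ℝ) : ℂ) * g (t * v)) (Ioc (0 : ℝ) 1) := by
    intro v hv g hg
    obtain ⟨C, hC⟩ := isCompact_Icc.exists_bound_of_continuousOn (hcont v hv g hg)
    refine Integrable.mul_bdd (c := C) hrpow.ofReal (hmeas v hv g hg) ?_
    exact (ae_restrict_iff' measurableSet_Ioc).2 (.of_forall fun t ht =>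
      hC t (Ioc_subset_Icc_self ht))
  have hw' : w ∈ Metric.closedBall w ε := Metric.mem_closedBall_self hε.le
  have := hasDerivAt_integral_of_dominated_loc_of_deriv_le (𝕜 := ℂ)
    (μ := volume.restrict (Ioc (0 : ℝ) 1)) (x₀ := w) (s := Metric.closedBall w ε)
    (F := fun v t => ((t ^ (-δ) : ℝ) : ℂ) * k (t * v))
    (F' := fun v t => ((t ^ (-δ) : ℝ) : ℂ) * (deriv k (t * v) * t))
    (bound := fun t => t ^ (-δ) * C) (Metric.closedBall_mem_nhds w hε)
    (by
      filter_upwards [Metric.closedBall_mem_nhds w hε] with v hv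
      exact hmr.mul (hmeas v hv k hk.continuousOn))
    (hint w hw' k hk.continuousOn)
    (by
      refine hmr.mul ((hmeas w hw' _ hdk).mul ?_)
      apply Measurable.aestronglyMeasurable; fun_prop)
    (by
      refine (ae_restrict_iff' measurableSet_Ioc).2 (.of_forall fun t ht v hv => ?_)
      have h1 : ‖deriv k (t * v)‖ ≤ C := hC _ ⟨(t, v), ⟨Ioc_subset_Icc_self ht, hv⟩, rfl⟩
      have h0 : 0 ≤ t ^ (-δ) := Real.rpow_nonneg ht.1.le _
      rw [norm_mul, norm_mul, Complex.norm_real, Complex.norm_real, Real.norm_of_nonneg h0,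
        Real.norm_of_nonneg ht.1.le]
      refine mul_le_mul_of_nonneg_left ?_ h0
      calc _ ≤ C * 1 := mul_le_mul h1 ht.2 ht.1.le ((norm_nonneg _).trans h1)
        _ = C := mul_one C)
    (hrpow.mul_const C)
    (by
      refine (ae_restrict_iff' measurableSet_Ioc).2 (.of_forall fun t ht v hv => ?_)
      refine HasDerivAt.const_mul _ ?_
      have h1 : HasDerivAt k (deriv k (t * v)) (t * v) :=
        (hk.differentiableAt (isOpen_cutPlane.mem_nhds
          (hmaps t (Ioc_subset_Icc_self ht) v hv))).hasDerivAt
      have h2 : HasDerivAt (fun v : ℂ => (t : ℂ) * v) t v := by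
        simpa using (hasDerivAt_id v).const_mul (t : ℂ)
      exact h1.comp v h2)
  exact this.2.differentiableAt.differentiableWithinAt

/-- The integral representing `₂F₁(m, -δ; 1 - δ; ·)` for `0 < δ < 1`. -/
def hypergeometricIntegral (m δ : ℝ) (w : ℂ) : ℂ :=
  1 - δ * ∫ t in Ioc (0 : ℝ) 1, ((t ^ (-δ - 1) : ℝ) : ℂ) * ((1 - t * w) ^ (-(m : ℂ)) - 1)

lemma differentiableOn_one_sub_cpow (m : ℂ) :
    DifferentiableOn ℂ (fun w : ℂ => (1 - w) ^ m) cutPlane := fun w hw =>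
  (DifferentiableAt.cpow (by fun_prop) (by fun_prop) hw).differentiableWithinAt

lemma one_sub_cpow_sub_one (m w : ℂ) :
    (1 - w) ^ m - 1 = w * dslope (fun w : ℂ => (1 - w) ^ m) 0 w := by
  have := sub_smul_dslope (fun w : ℂ => (1 - w) ^ m) 0 w
  simpa using this.symm

/-- The bracket vanishes to first order at `t = 0`. Extracting `t w` with a divided difference
replaces `t^{-δ-1}`, which is not integrable for `δ ≥ 0`, by `t^{-δ}`, and leaves a holomorphic
factor. -/
lemma rpow_sub_one_mul_eq {t : ℝ} (ht : 0 < t) (m δ : ℝ) (w : ℂ) :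
    ((t ^ (-δ - 1) : ℝ) : ℂ) * ((1 - t * w) ^ (-(m : ℂ)) - 1) =
      w * (((t ^ (-δ) : ℝ) : ℂ) * dslope (fun w : ℂ => (1 - w) ^ (-(m : ℂ))) 0 (t * w)) := by
  rw [one_sub_cpow_sub_one, Real.rpow_sub_one ht.ne']
  have : (t : ℂ) ≠ 0 := by exact_mod_cast ht.ne'
  push_cast
  field_simp

lemma hypergeometricIntegral_eq (m δ : ℝ) (w : ℂ) :
    hypergeometricIntegral m δ w = 1 - δ * (w * ∫ t in Ioc (0 : ℝ) 1, ((t ^ (-δ) : ℝ) : ℂ) *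
      dslope (fun w : ℂ => (1 - w) ^ (-(m : ℂ))) 0 (t * w)) := by
  rw [hypergeometricIntegral, ← integral_const_mul w]
  congr 2
  exact setIntegral_congr_fun measurableSet_Ioc fun t ht => rpow_sub_one_mul_eq ht.1 m δ w

lemma differentiableOn_hypergeometricIntegral (m : ℝ) {δ : ℝ} (hδ : δ < 1) :
    DifferentiableOn ℂ (hypergeometricIntegral m δ) cutPlane := by
  have h := differentiableOn_integral_rpow_mul_comp hδ
    (k := dslope (fun w : ℂ => (1 - w) ^ (-(m : ℂ))) 0)
    ((Complex.differentiableOn_dslope (isOpen_cutPlane.mem_nhds zero_mem_cutPlane)).2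
      (differentiableOn_one_sub_cpow _))
  have : hypergeometricIntegral m δ = fun w => _ := funext (hypergeometricIntegral_eq m δ)
  rw [this]
  fun_prop

lemma integral_Ioc_rpow {r : ℝ} (hr : -1 < r) : ∫ t in Ioc (0 : ℝ) 1, t ^ r = 1 / (r + 1) := by
  rw [← intervalIntegral.integral_of_le zero_le_one, integral_rpow (Or.inl hr)]
  simp [Real.zero_rpow (by linarith : r + 1 ≠ 0)]

/-- The parameters `-δ` and `1 - δ` differ by one, so the ratio of their Pochhammer symbols
telescopes to `-δ / (n - δ)`. This is why the series is the termwise integral of a binomial series.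
-/
lemma ascPochhammer_eval_neg_mul (δ : ℂ) (n : ℕ) :
    (ascPochhammer ℂ n).eval (-δ) * (n - δ) = -δ * (ascPochhammer ℂ n).eval (1 - δ) := by
  induction n with
  | zero => simp
  | succ n ih =>
    rw [ascPochhammer_succ_eval, ascPochhammer_succ_eval]
    push_cast
    linear_combination (n + 1 - δ) * ih

lemma ascPochhammer_eval_one_sub_ne_zero {δ : ℝ} (hδ : δ < 1) (n : ℕ) :
    (ascPochhammer ℂ n).eval (1 - (δ : ℂ)) ≠ 0 := by
  have h := (ascPochhammer_pos n (1 - δ) (by linarith)).ne'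
  rw [show 1 - (δ : ℂ) = algebraMap ℝ ℂ (1 - δ) by simp, ← ascPochhammer_map (algebraMap ℝ ℂ),
    Polynomial.eval_map, Polynomial.eval₂_at_apply]
  exact (map_ne_zero _).2 h

/-- Coefficients of the binomial series of `(1 - w) ^ (-m)`. -/
abbrev binomialCoeff (m : ℂ) (n : ℕ) : ℂ := (ascPochhammer ℂ n).eval m / n.factorial

lemma ringChoose_eq_binomialCoeff (m : ℂ) (n : ℕ) :
    Ring.choose (m + n - 1) n = binomialCoeff m n := by
  have h := Ring.factorial_nsmul_multichoose_eq_ascPochhammer m n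
  rw [Ring.choose, show m + n - 1 - n + 1 = m by ring, eq_div_iff
    (Nat.cast_ne_zero.2 n.factorial_ne_zero)]
  rw [nsmul_eq_mul, mul_comm] at h
  rw [h, ← Polynomial.aeval_eq_smeval, ← ascPochhammer_map (algebraMap ℕ ℂ),
    Polynomial.eval_map_algebraMap]

lemma hasFPowerSeriesOnBall_one_sub_cpow (m : ℂ) :
    HasFPowerSeriesOnBall (fun x : ℂ => (1 - x) ^ (-m)) (.ofScalars ℂ (binomialCoeff m)) 0 1 := by
  have h := Complex.one_div_one_sub_cpow_hasFPowerSeriesOnBall_zero m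
  simp_rw [ringChoose_eq_binomialCoeff, one_div, ← Complex.cpow_neg] at h
  exact h

lemma summable_norm_binomialCoeff (m : ℂ) {w : ℂ} (hw : ‖w‖ < 1) :
    Summable fun n => ‖binomialCoeff m n * w ^ n‖ := by
  have h0 := hasFPowerSeriesOnBall_one_sub_cpow m
  have h := FormalMultilinearSeries.summable_norm_apply _ (x := w)
    (Metric.eball_subset_eball h0.r_le (by simpa [← ofReal_norm, ENNReal.ofReal_lt_one] using hw))
  simpa [FormalMultilinearSeries.ofScalars_apply_eq, mul_comm] using h

lemma hasSum_binomialCoeff (m : ℂ) {w : ℂ} (hw : ‖w‖ < 1) :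
    HasSum (fun n => binomialCoeff m n * w ^ n) ((1 - w) ^ (-m)) := by
  have h := (hasFPowerSeriesOnBall_one_sub_cpow m).hasSum (y := w) (by
    simpa [← ofReal_norm, ENNReal.ofReal_lt_one] using hw)
  simpa [FormalMultilinearSeries.ofScalars_apply_eq, mul_comm] using h

/-- On the disc the binomial series of `(1 - t w)^{-m}` may be integrated term by term against
`t^{-δ-1}`. Subtracting `1` removes the term `n = 0`, the only one that would not be integrable for
`0 ≤ δ < 1`. -/
lemma hypergeometricIntegral_eq_ordinaryHypergeometric (m : ℝ) {δ : ℝ} (hδ : δ < 1) {w : ℂ}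
    (hw : ‖w‖ < 1) :
    hypergeometricIntegral m δ w = ordinaryHypergeometric (m : ℂ) (-(δ : ℂ)) (1 - (δ : ℂ)) w := by
  have hsum := summable_norm_binomialCoeff m hw
  set a := binomialCoeff (m : ℂ) with ha
  have hnorm : ∀ n : ℕ, ∀ t ∈ Ioc (0 : ℝ) 1,
      ‖a (n + 1) * w ^ (n + 1) * ((t ^ ((n : ℝ) - δ) : ℝ) : ℂ)‖ =
        ‖a (n + 1) * w ^ (n + 1)‖ * t ^ ((n : ℝ) - δ) := fun n t ht => by
    rw [norm_mul, Complex.norm_real, Real.norm_of_nonneg (Real.rpow_nonneg ht.1.le _)]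
  have hlt : ∀ n : ℕ, -1 < (n : ℝ) - δ := fun n => by
    have : (0 : ℝ) ≤ n := n.cast_nonneg
    linarith
  have hrpow : ∀ n : ℕ, IntegrableOn (fun t : ℝ => t ^ ((n : ℝ) - δ)) (Ioc (0 : ℝ) 1) := by
    intro n
    have := intervalIntegral.intervalIntegrable_rpow' (a := 0) (b := 1) (hlt n)
    rwa [intervalIntegrable_iff_integrableOn_Ioc_of_le zero_le_one] at this
  have hval : ∀ n : ℕ, ∫ t in Ioc (0 : ℝ) 1, a (n + 1) * w ^ (n + 1) *
      ((t ^ ((n : ℝ) - δ) : ℝ) : ℂ) = a (n + 1) * w ^ (n + 1) / (n + 1 - δ) := by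
    intro n
    rw [integral_const_mul, integral_complex_ofReal, integral_Ioc_rpow (hlt n)]
    push_cast
    rw [mul_one_div]
    congr 1
    ring
  have hint := hasSum_integral_of_summable_integral_norm
    (μ := volume.restrict (Ioc (0 : ℝ) 1))
    (F := fun (n : ℕ) (t : ℝ) => a (n + 1) * w ^ (n + 1) * ((t ^ ((n : ℝ) - δ) : ℝ) : ℂ))
    (fun n => ((hrpow n).ofReal (𝕜 := ℂ)).const_mul _) (by
      -- Each `∫ t^{n-δ} dt = 1 / (n + 1 - δ)` is at most its value at `n = 0`.
      have h1 : Summable fun n => ‖a (n + 1) * w ^ (n + 1)‖ * (1 / (1 - δ)) :=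
        ((summable_nat_add_iff 1).2 hsum).mul_right _
      refine h1.of_nonneg_of_le (fun n => integral_nonneg fun t => norm_nonneg _) fun n => ?_
      rw [setIntegral_congr_fun measurableSet_Ioc (hnorm n), integral_const_mul,
        integral_Ioc_rpow (hlt n)]
      refine mul_le_mul_of_nonneg_left ?_ (norm_nonneg _)
      have : (0 : ℝ) ≤ n := n.cast_nonneg
      exact one_div_le_one_div_of_le (by linarith) (by linarith))
  have hcongr : ∫ t in Ioc (0 : ℝ) 1, ((t ^ (-δ - 1) : ℝ) : ℂ) * ((1 - t * w) ^ (-(m : ℂ)) - 1) =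
      ∫ t in Ioc (0 : ℝ) 1, ∑' n : ℕ, a (n + 1) * w ^ (n + 1) * ((t ^ ((n : ℝ) - δ) : ℝ) : ℂ) := by
    refine setIntegral_congr_fun measurableSet_Ioc fun t ht => ?_
    have htw : ‖(t : ℂ) * w‖ < 1 := by
      rw [norm_mul, Complex.norm_real, Real.norm_of_nonneg ht.1.le]
      exact (mul_le_of_le_one_left (norm_nonneg _) ht.2).trans_lt hw
    have h1 := (hasSum_nat_add_iff' 1).2 (hasSum_binomialCoeff m htw)
    have h2 := h1.mul_left ((t ^ (-δ - 1) : ℝ) : ℂ)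
    simp only [Finset.range_one, Finset.sum_singleton, binomialCoeff, ascPochhammer_zero,
      Polynomial.eval_one, Nat.factorial_zero, Nat.cast_one, div_one, pow_zero, mul_one] at h2
    rw [← h2.tsum_eq]
    refine tsum_congr fun n => ?_
    have h3 : t ^ ((n : ℝ) - δ) = t ^ (-δ - 1) * t ^ (n + 1) := by
      rw [← Real.rpow_natCast, ← Real.rpow_add ht.1]
      congr 1
      push_cast
      ring
    rw [h3, ha]
    push_cast
    rw [mul_pow]
    ring
  rw [hypergeometricIntegral, hcongr, ← hint.tsum_eq, ordinaryHypergeometric_eq_tsum]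
  beta_reduce
  -- The index `n = 0` is set aside because `δ = 0` is allowed: the quotient would then be `0 / 0 =
  -- 0` instead of `1`.
  have hterm : ∀ n : ℕ, ((n.factorial : ℂ)⁻¹ * (ascPochhammer ℂ n).eval (m : ℂ) *
      (ascPochhammer ℂ n).eval (-(δ : ℂ)) * ((ascPochhammer ℂ n).eval (1 - (δ : ℂ)))⁻¹) • w ^ n =
      a n * w ^ n * (-δ / (n - δ)) ∨ n = 0 := by
    intro n
    rcases Nat.eq_zero_or_pos n with rfl | hn
    · exact Or.inr rfl
    left
    have h1 := ascPochhammer_eval_neg_mul (δ : ℂ) n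
    have h2 := ascPochhammer_eval_one_sub_ne_zero hδ n
    have h3 : (n : ℂ) - δ ≠ 0 := by
      have : (1 : ℝ) ≤ n := by exact_mod_cast hn
      have : (n : ℝ) - δ ≠ 0 := by linarith
      exact_mod_cast this
    have h4 : (ascPochhammer ℂ n).eval (-(δ : ℂ)) * ((ascPochhammer ℂ n).eval (1 - (δ : ℂ)))⁻¹ =
        -δ / (n - δ) := by
      rw [eq_div_iff h3, mul_right_comm, h1, mul_assoc, mul_inv_cancel₀ h2, mul_one]
    rw [mul_assoc, h4, ha, smul_eq_mul, binomialCoeff]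
    ring
  have hS : Summable fun n : ℕ => ((n.factorial : ℂ)⁻¹ * (ascPochhammer ℂ n).eval (m : ℂ) *
      (ascPochhammer ℂ n).eval (-(δ : ℂ)) *
      ((ascPochhammer ℂ n).eval (1 - (δ : ℂ)))⁻¹) • w ^ n := by
    rw [← summable_nat_add_iff 1]
    have h1 := hint.summable.mul_left (-(δ : ℂ))
    refine h1.congr fun n => ?_
    rw [(hterm (n + 1)).resolve_right (by omega), hval]
    push_cast
    ring
  rw [hS.tsum_eq_zero_add, sub_eq_add_neg]
  congr 1
  · simp
  rw [← tsum_mul_left, ← tsum_neg]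
  refine tsum_congr fun n => ?_
  rw [(hterm (n + 1)).resolve_right (by omega), hval]
  push_cast
  ring

lemma isGaussHypergeometric_hypergeometricIntegral (m : ℝ) {δ : ℝ} (hδ : δ < 1) :
    IsGaussHypergeometric m (-(δ : ℂ)) (1 - (δ : ℂ)) (hypergeometricIntegral m δ) :=
  ⟨differentiableOn_hypergeometricIntegral m hδ,
    fun _ hz => hypergeometricIntegral_eq_ordinaryHypergeometric m hδ hz⟩

/-- Identity theorem on the connected cut plane. It makes the choice inside `gaussHypergeometric`
irrelevant. -/
lemma IsGaussHypergeometric.eqOn {a b c : ℂ} {F G : ℂ → ℂ} (hF : IsGaussHypergeometric a b c F)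
    (hG : IsGaussHypergeometric a b c G) : EqOn F G cutPlane := by
  refine (hF.1.analyticOnNhd isOpen_cutPlane).eqOn_of_preconnected_of_eventuallyEq
    (hG.1.analyticOnNhd isOpen_cutPlane) isPreconnected_cutPlane zero_mem_cutPlane ?_
  filter_upwards [Metric.ball_mem_nhds (0 : ℂ) one_pos] with z hz
  rw [mem_ball_zero_iff] at hz
  rw [hF.2 z hz, hG.2 z hz]

/-- Integral representation of `₂F₁(m, -δ; 1 - δ; ·)` on the cut plane. -/
theorem gaussHypergeometric_eq_integral (m : ℝ) {δ : ℝ} (hδ : δ < 1) {w : ℂ} (hw : w ∈ cutPlane) :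
    gaussHypergeometric m (-(δ : ℂ)) (1 - (δ : ℂ)) w = hypergeometricIntegral m δ w := by
  have hex : ∃ F : ℂ → ℂ, IsGaussHypergeometric m (-(δ : ℂ)) (1 - (δ : ℂ)) F :=
    ⟨_, isGaussHypergeometric_hypergeometricIntegral m hδ⟩
  rw [gaussHypergeometric, dif_pos hex]
  exact hex.choose_spec.eqOn (isGaussHypergeometric_hypergeometricIntegral m hδ) hw

end Hypergeometric


/-! ### The intensity of the path-loss process for a single ball -/

lemma heaviside_of_nonneg {x : ℝ} (h : 0 ≤ x) : heaviside x = 1 := if_pos h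

lemma heaviside_of_neg {x : ℝ} (h : x < 0) : heaviside x = 0 := if_neg h.not_ge

lemma heavisideCompl_of_nonneg {x : ℝ} (h : 0 ≤ x) : heavisideCompl x = 0 := by
  rw [heavisideCompl, heaviside_of_nonneg h, sub_self]

lemma heavisideCompl_of_neg {x : ℝ} (h : x < 0) : heavisideCompl x = 1 := by
  rw [heavisideCompl, heaviside_of_neg h, sub_zero]

namespace NetworkParams

section SingleBall

variable {S : Type*} [Fintype S] (p : NetworkParams S 1)

lemma alp_pos (s : S) : 0 < p.alp s := zero_lt_two.trans (p.two_lt_alp s)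

lemma two_div_alp_pos (s : S) : 0 < 2 / p.alp s := div_pos two_pos (p.alp_pos s)

lemma two_div_alp_lt_one (s : S) : 2 / p.alp s < 1 :=
  (div_lt_one (p.alp_pos s)).2 (p.two_lt_alp s)

lemma D_one_pos : 0 < p.D 1 := by
  have := p.D_lt 0 one_pos
  rwa [p.D_zero] at this

/-- Path-loss of a link of state `s` at the boundary of the ball. -/
def threshold (s : S) : ℝ := p.kap s * p.D 1 ^ p.alp s

lemma threshold_pos (s : S) : 0 < p.threshold s :=
  mul_pos (p.kap_pos s) (Real.rpow_pos_of_pos p.D_one_pos _)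

lemma Theta_pos (s : S) : 0 < p.Theta s := Real.exp_pos _

lemma q_one_nonneg (s : S) : 0 ≤ p.q s 1 := p.q_nonneg s 1 (by simp)

lemma q_two_nonneg (s : S) : 0 ≤ p.q s 2 := p.q_nonneg s 2 (by simp)

lemma q_le_one (s : S) {b : ℕ} (hb : b ∈ Finset.Icc 1 (1 + 1)) : p.q s b ≤ 1 := by
  rw [← p.q_sum b hb]
  exact Finset.single_le_sum (f := fun s => p.q s b) (fun i _ => p.q_nonneg i b hb)
    (Finset.mem_univ s)

lemma linkProb_eq (s : S) {r : ℝ} (hr : 0 ≤ r) :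
    p.linkProb s r = if r < p.D 1 then p.q s 1 else p.q s 2 := by
  simp only [linkProb, Finset.Icc_self, Finset.sum_singleton, Nat.sub_self, p.D_zero,
    indicator, mem_Ico, mem_Ici, hr, true_and, Pi.one_apply]
  split_ifs with h1 h2 h2
  · exact absurd h1 h2.not_gt
  · simp
  · simp
  · exact absurd (not_lt.1 h1) h2

lemma linkProb_nonneg (s : S) (r : ℝ) : 0 ≤ p.linkProb s r := by
  have h1 := p.q_one_nonneg s
  have h2 := p.q_two_nonneg s
  simp only [linkProb, Finset.Icc_self, Finset.sum_singleton, Nat.sub_self, indicator,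
    Pi.one_apply]
  split_ifs <;> simp <;> linarith

lemma measurable_linkProb (s : S) : Measurable (p.linkProb s) := by
  unfold linkProb
  refine Measurable.add (Finset.measurable_sum _ fun b _ => ?_) ?_
  · exact ((measurable_const (a := (1 : ℝ))).indicator measurableSet_Ico).const_mul _
  · exact ((measurable_const (a := (1 : ℝ))).indicator measurableSet_Ici).const_mul _

lemma linkProb_le_one (s : S) {r : ℝ} (hr : 0 ≤ r) : p.linkProb s r ≤ 1 := by
  rw [p.linkProb_eq s hr]
  split_ifs
  · exact p.q_le_one s (by simp)
  · exact p.q_le_one s (by simp)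

lemma integral_Ioc_mul_id (c : ℝ) {a b : ℝ} :
    ∫ r in a..b, c * r = c * ((b ^ 2 - a ^ 2) / 2) := by
  rw [intervalIntegral.integral_const_mul, integral_id]

lemma integral_linkProb_of_le (s : S) {R : ℝ} (h0 : 0 ≤ R) (hR : R ≤ p.D 1) :
    ∫ r in (0 : ℝ)..R, p.linkProb s r * r = p.q s 1 * (R ^ 2 / 2) := by
  have : ∫ r in (0 : ℝ)..R, p.linkProb s r * r = ∫ r in (0 : ℝ)..R, p.q s 1 * r := by
    rw [intervalIntegral.integral_of_le h0, intervalIntegral.integral_of_le h0,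
      integral_Ioc_eq_integral_Ioo, integral_Ioc_eq_integral_Ioo]
    refine setIntegral_congr_fun measurableSet_Ioo fun r hr => ?_
    simp only [p.linkProb_eq s hr.1.le, if_pos (hr.2.trans_le hR)]
  rw [this, integral_Ioc_mul_id]
  ring

lemma intervalIntegrable_linkProb (s : S) (a b : ℝ) (ha : 0 ≤ a) (hb : 0 ≤ b) :
    IntervalIntegrable (fun r => p.linkProb s r * r) volume a b := by
  refine (intervalIntegral.intervalIntegrable_id (μ := volume) (a := a) (b := b)).mono_fun ?_ ?_
  · exact ((p.measurable_linkProb s).mul measurable_id).aestronglyMeasurable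
  · refine (ae_restrict_iff' measurableSet_uIoc).2 (.of_forall fun r hr => ?_)
    have hr0 : 0 ≤ r := by
      rcases le_total a b with h | h
      · rw [uIoc_of_le h] at hr; exact ha.trans hr.1.le
      · rw [uIoc_of_ge h] at hr; exact hb.trans hr.1.le
    simp only [norm_mul, Real.norm_of_nonneg (p.linkProb_nonneg s r)]
    exact mul_le_of_le_one_left (norm_nonneg _) (p.linkProb_le_one s hr0)

lemma integral_linkProb_of_ge (s : S) {R : ℝ} (hR : p.D 1 ≤ R) :
    ∫ r in (0 : ℝ)..R, p.linkProb s r * r =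
      p.q s 1 * (p.D 1 ^ 2 / 2) + p.q s 2 * ((R ^ 2 - p.D 1 ^ 2) / 2) := by
  have hD := p.D_one_pos.le
  rw [← intervalIntegral.integral_add_adjacent_intervals
    (p.intervalIntegrable_linkProb s 0 (p.D 1) le_rfl hD)
    (p.intervalIntegrable_linkProb s (p.D 1) R hD (hD.trans hR)),
    p.integral_linkProb_of_le s hD le_rfl, ← integral_Ioc_mul_id]
  congr 1
  rw [intervalIntegral.integral_of_le hR, intervalIntegral.integral_of_le hR]
  refine setIntegral_congr_fun measurableSet_Ioc fun r hr => ?_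
  simp only [p.linkProb_eq s (hD.trans hr.1.le), if_neg hr.1.le.not_gt]

/-- Distance at which a link of state `s` has path-loss `ξ`. -/
def lossRadius (s : S) (ξ : ℝ) : ℝ := (ξ / p.kap s) ^ (1 / p.alp s)

lemma lossRadius_nonneg (s : S) {ξ : ℝ} (hξ : 0 ≤ ξ) : 0 ≤ p.lossRadius s ξ :=
  Real.rpow_nonneg (div_nonneg hξ (p.kap_pos s).le) _

lemma lossRadius_pos (s : S) {ξ : ℝ} (hξ : 0 < ξ) : 0 < p.lossRadius s ξ :=
  Real.rpow_pos_of_pos (div_pos hξ (p.kap_pos s)) _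

lemma pathLoss_lossRadius (s : S) {ξ : ℝ} (hξ : 0 ≤ ξ) :
    p.pathLoss s (p.lossRadius s ξ) = ξ := by
  rw [pathLoss, lossRadius, ← Real.rpow_mul (div_nonneg hξ (p.kap_pos s).le),
    one_div_mul_cancel (p.alp_pos s).ne', Real.rpow_one, mul_div_cancel₀ _ (p.kap_pos s).ne']

lemma pathLoss_lt_pathLoss (s : S) {a b : ℝ} (ha : 0 ≤ a) (hb : 0 ≤ b) :
    p.pathLoss s a < p.pathLoss s b ↔ a < b := by
  rw [pathLoss, pathLoss, mul_lt_mul_iff_right₀ (p.kap_pos s),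
    Real.rpow_lt_rpow_iff ha hb (p.alp_pos s)]

lemma pathLoss_lt_iff (s : S) {r ξ : ℝ} (hr : 0 ≤ r) (hξ : 0 ≤ ξ) :
    p.pathLoss s r < ξ ↔ r < p.lossRadius s ξ := by
  conv_lhs => rw [← p.pathLoss_lossRadius s hξ]
  exact p.pathLoss_lt_pathLoss s hr (p.lossRadius_nonneg s hξ)

lemma lt_pathLoss_iff (s : S) {r ξ : ℝ} (hr : 0 ≤ r) (hξ : 0 ≤ ξ) :
    ξ < p.pathLoss s r ↔ p.lossRadius s ξ < r := by
  conv_lhs => rw [← p.pathLoss_lossRadius s hξ]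
  exact p.pathLoss_lt_pathLoss s (p.lossRadius_nonneg s hξ) hr

lemma threshold_eq_pathLoss (s : S) : p.threshold s = p.pathLoss s (p.D 1) := rfl

lemma lossRadius_sq (s : S) {ξ : ℝ} (hξ : 0 ≤ ξ) :
    p.lossRadius s ξ ^ 2 = (ξ / p.kap s) ^ (2 / p.alp s) := by
  rw [lossRadius, ← Real.rpow_natCast, ← Real.rpow_mul (div_nonneg hξ (p.kap_pos s).le)]
  congr 1
  push_cast
  ring

/-- The expressions for `Λ_s` inside and outside the ball agree at the threshold, so both are
available there. Only the derivative distinguishes the two sides. -/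
lemma intensity_of_le (s : S) {ξ : ℝ} (hξ : 0 ≤ ξ) (h : ξ ≤ p.threshold s) :
    p.intensity s ξ = Real.pi * p.lamBS * p.Theta s * p.q s 1 * (ξ / p.kap s) ^ (2 / p.alp s) := by
  have h1 : p.lossRadius s ξ ≤ p.D 1 := by
    rw [← not_lt, ← p.pathLoss_lt_iff s p.D_one_pos.le hξ, not_lt]
    exact h
  rw [intensity, ← lossRadius, p.integral_linkProb_of_le s (p.lossRadius_nonneg s hξ) h1,
    p.lossRadius_sq s hξ]
  ring

lemma intensity_of_ge (s : S) {ξ : ℝ} (h : p.threshold s ≤ ξ) :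
    p.intensity s ξ = Real.pi * p.lamBS * p.Theta s * p.q s 1 * p.D 1 ^ 2 +
      Real.pi * p.lamBS * p.Theta s * p.q s 2 * ((ξ / p.kap s) ^ (2 / p.alp s) - p.D 1 ^ 2) := by
  have hξ := (p.threshold_pos s).le.trans h
  have h1 : p.D 1 ≤ p.lossRadius s ξ := by
    rw [← not_lt, ← p.lt_pathLoss_iff s p.D_one_pos.le hξ, not_lt]
    exact h
  rw [intensity, ← lossRadius, p.integral_linkProb_of_ge s h1, p.lossRadius_sq s hξ]
  ring

theorem intensity_eq (s : S) {ξ : ℝ} (hξ : 0 ≤ ξ) :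
    p.intensity s ξ =
      Real.pi * p.lamBS * p.Theta s * p.q s 1 *
          ((ξ / p.kap s) ^ (2 / p.alp s) * heavisideCompl (ξ - p.kap s * p.D 1 ^ p.alp s) +
            p.D 1 ^ 2 * heaviside (ξ - p.kap s * p.D 1 ^ p.alp s)) +
        Real.pi * p.lamBS * p.Theta s * p.q s 2 *
          ((ξ / p.kap s) ^ (2 / p.alp s) - p.D 1 ^ 2) *
            heaviside (ξ - p.kap s * p.D 1 ^ p.alp s) := by
  rcases lt_or_ge ξ (p.kap s * p.D 1 ^ p.alp s) with h | h
  · rw [p.intensity_of_le s hξ h.le, heaviside_of_neg (sub_neg.2 h),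
      heavisideCompl_of_neg (sub_neg.2 h)]
    ring
  · rw [p.intensity_of_ge s h, heaviside_of_nonneg (sub_nonneg.2 h),
      heavisideCompl_of_nonneg (sub_nonneg.2 h)]
    ring

theorem intensityDeriv_eq (s : S) {ξ : ℝ} (hξ : 0 < ξ) :
    p.intensityDeriv s ξ =
      Real.pi * p.lamBS * p.Theta s * p.q s 1 * (2 / p.alp s) * p.kap s ^ (-(2 / p.alp s)) *
          ξ ^ (2 / p.alp s - 1) * heavisideCompl (ξ - p.kap s * p.D 1 ^ p.alp s) +
        Real.pi * p.lamBS * p.Theta s * p.q s 2 * (2 / p.alp s) * p.kap s ^ (-(2 / p.alp s)) *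
          ξ ^ (2 / p.alp s - 1) * heaviside (ξ - p.kap s * p.D 1 ^ p.alp s) := by
  -- Here `D 0 = 0` and `0 ^ α = 0`, so the Heaviside factor of the inner boundary is `ℋ(ξ) = 1`.
  simp only [intensityDeriv, Finset.Icc_self, Finset.sum_singleton, Nat.sub_self, p.D_zero,
    Real.zero_rpow (p.alp_pos s).ne', mul_zero, sub_zero, heaviside_of_nonneg hξ.le, mul_one]
  norm_num
  ring

lemma hasDerivAt_div_rpow (s : S) {ξ : ℝ} (hξ : 0 < ξ) :
    HasDerivAt (fun ξ => (ξ / p.kap s) ^ (2 / p.alp s))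
      ((2 / p.alp s) * p.kap s ^ (-(2 / p.alp s)) * ξ ^ (2 / p.alp s - 1)) ξ := by
  have h1 : HasDerivAt (fun ξ : ℝ => ξ ^ (2 / p.alp s) * p.kap s ^ (-(2 / p.alp s)))
      ((2 / p.alp s) * ξ ^ (2 / p.alp s - 1) * p.kap s ^ (-(2 / p.alp s))) ξ :=
    (Real.hasDerivAt_rpow_const (Or.inl hξ.ne')).mul_const _
  have h2 := h1.congr_of_eventuallyEq (f₁ := fun ξ => (ξ / p.kap s) ^ (2 / p.alp s)) (by
    filter_upwards [eventually_gt_nhds hξ] with y hy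
    rw [Real.div_rpow hy.le (p.kap_pos s).le, Real.rpow_neg (p.kap_pos s).le, div_eq_mul_inv])
  rwa [mul_right_comm] at h2

lemma intensityDeriv_of_lt (s : S) {ξ : ℝ} (hξ : 0 < ξ) (h : ξ < p.threshold s) :
    p.intensityDeriv s ξ = Real.pi * p.lamBS * p.Theta s * p.q s 1 *
      ((2 / p.alp s) * p.kap s ^ (-(2 / p.alp s)) * ξ ^ (2 / p.alp s - 1)) := by
  unfold threshold at h
  rw [p.intensityDeriv_eq s hξ, heaviside_of_neg (sub_neg.2 h), heavisideCompl_of_neg (sub_neg.2 h)]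
  ring

lemma intensityDeriv_of_ge (s : S) {ξ : ℝ} (h : p.threshold s ≤ ξ) :
    p.intensityDeriv s ξ = Real.pi * p.lamBS * p.Theta s * p.q s 2 *
      ((2 / p.alp s) * p.kap s ^ (-(2 / p.alp s)) * ξ ^ (2 / p.alp s - 1)) := by
  have hξ := (p.threshold_pos s).trans_le h
  unfold threshold at h
  rw [p.intensityDeriv_eq s hξ, heaviside_of_nonneg (sub_nonneg.2 h),
    heavisideCompl_of_nonneg (sub_nonneg.2 h)]
  ring

lemma hasDerivAt_intensity_of_lt (s : S) {ξ : ℝ} (hξ : 0 < ξ) (h : ξ < p.threshold s) :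
    HasDerivAt (p.intensity s) (p.intensityDeriv s ξ) ξ := by
  rw [p.intensityDeriv_of_lt s hξ h]
  refine ((p.hasDerivAt_div_rpow s hξ).const_mul _).congr_of_eventuallyEq ?_
  filter_upwards [eventually_gt_nhds hξ, eventually_lt_nhds h] with y hy hy2
  exact p.intensity_of_le s hy.le hy2.le

/-- The set `t` is left free so that one argument covers the right derivative, which exists at the
threshold too, and the two-sided derivative strictly beyond it. -/
lemma hasDerivWithinAt_intensity_of_ge (s : S) {ξ : ℝ} (h : p.threshold s ≤ ξ) (t : Set ℝ)
    (ht : ∀ᶠ y in nhdsWithin ξ t, p.threshold s ≤ y) :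
    HasDerivWithinAt (p.intensity s) (p.intensityDeriv s ξ) t ξ := by
  rw [p.intensityDeriv_of_ge s h]
  have hξ := (p.threshold_pos s).trans_le h
  refine ((((p.hasDerivAt_div_rpow s hξ).sub_const (p.D 1 ^ 2)).const_mul _).const_add
    (Real.pi * p.lamBS * p.Theta s * p.q s 1 * p.D 1 ^ 2)).hasDerivWithinAt.congr_of_eventuallyEq
    ?_ (p.intensity_of_ge s h)
  filter_upwards [ht] with y hy
  exact p.intensity_of_ge s hy

theorem hasDerivWithinAt_intensity (s : S) {ξ : ℝ} (hξ : 0 < ξ) :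
    HasDerivWithinAt (p.intensity s) (p.intensityDeriv s ξ) (Ici ξ) ξ := by
  rcases lt_or_ge ξ (p.threshold s) with h | h
  · exact (p.hasDerivAt_intensity_of_lt s hξ h).hasDerivWithinAt
  · refine p.hasDerivWithinAt_intensity_of_ge s h _ ?_
    filter_upwards [self_mem_nhdsWithin] with y hy using h.trans hy

theorem hasDerivAt_intensity (s : S) {ξ : ℝ} (hξ : 0 < ξ) (hne : ξ ≠ p.threshold s) :
    HasDerivAt (p.intensity s) (p.intensityDeriv s ξ) ξ := by
  rcases hne.lt_or_gt with h | h
  · exact p.hasDerivAt_intensity_of_lt s hξ h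
  · rw [← hasDerivWithinAt_univ]
    refine p.hasDerivWithinAt_intensity_of_ge s h.le _ ?_
    rw [nhdsWithin_univ]
    filter_upwards [eventually_gt_nhds h] with y hy using hy.le

theorem exponent_eq (r : S) (z : ℂ) {x : ℝ} (hx : 0 ≤ x) :
    p.exponent r z x =
      ((Real.pi * p.lamI * p.Theta r * p.q r 1 : ℝ) : ℂ) *
          ((((x / p.kap r) ^ (2 / p.alp r) : ℝ) : ℂ) * p.calF r z *
              (heavisideCompl (x - p.kap r * p.D 1 ^ p.alp r) : ℂ) -
            (p.D 1 : ℂ) ^ 2 *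
              p.calF r ((x : ℂ) * z / ((p.kap r * p.D 1 ^ p.alp r : ℝ) : ℂ)) *
              (heavisideCompl (x - p.kap r * p.D 1 ^ p.alp r) : ℂ)) +
        ((Real.pi * p.lamI * p.Theta r * p.q r 2 : ℝ) : ℂ) *
          ((((x / p.kap r) ^ (2 / p.alp r) : ℝ) : ℂ) * p.calF r z *
              (heaviside (x - p.kap r * p.D 1 ^ p.alp r) : ℂ) +
            (p.D 1 : ℂ) ^ 2 *
              p.calF r ((x : ℂ) * z / ((p.kap r * p.D 1 ^ p.alp r : ℝ) : ℂ)) *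
              (heavisideCompl (x - p.kap r * p.D 1 ^ p.alp r) : ℂ)) := by
  -- The boundary term at `D 0` carries the factor `(D 0)² = 0`, so the quotient by `κ · 0 ^ α = 0`
  -- inside `calF` has no effect. No property of `calF` enters, which is why every `z` is allowed.
  simp only [exponent, Finset.Icc_self, Finset.sum_singleton, Nat.sub_self, p.D_zero,
    Real.zero_rpow (p.alp_pos r).ne', mul_zero, sub_zero, heaviside_of_nonneg hx, mul_one]
  push_cast
  ring_nf

end SingleBall

end NetworkParams


/-! ### Poisson point processes: mean measure and Laplace functional -/

namespace IsPoissonProcess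

open Filter Topology NNReal

variable {Ω E : Type*} {N : Ω → ℕ∞} {X : ℕ → Ω → E}

/-- As a sum of indicators over the labels, the count becomes accessible to measurability and to
termwise integration. -/
lemma coe_pointCount (N : Ω → ℕ∞) (X : ℕ → Ω → E) (A : Set E) (ω : Ω) :
    (pointCount N X A ω : ℝ≥0∞) =
      ∑' n : ℕ, {ω | (n : ℕ∞) < N ω ∧ X n ω ∈ A}.indicator (1 : Ω → ℝ≥0∞) ω := by
  rw [pointCount, ← Measure.count_apply MeasurableSet.of_discrete, ← lintegral_indicator_one
    MeasurableSet.of_discrete, lintegral_count]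
  rfl

/-- Product of the values of a function at the points of the process that lie in `K`. -/
def pointProd (N : Ω → ℕ∞) (X : ℕ → Ω → E) (K : Set E) (v : E → ℂ) (ω : Ω) : ℂ :=
  ∏ᶠ n ∈ {n : ℕ | (n : ℕ∞) < N ω ∧ X n ω ∈ K}, v (X n ω)

lemma finite_of_pointCount_ne_top {K : Set E} {ω : Ω} (h : pointCount N X K ω ≠ ⊤) :
    {n : ℕ | (n : ℕ∞) < N ω ∧ X n ω ∈ K}.Finite :=
  Set.encard_ne_top_iff.1 h

open Classical in
-- Only finitely many labels point into `K`, so the partial products over all labels are eventually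
-- constant. This links the enumeration of the points to the unordered product.
lemma prod_range_eq_pointProd {K : Set E} {v : E → ℂ} {ω : Ω} (h : pointCount N X K ω ≠ ⊤) :
    ∀ᶠ M in atTop, ∏ n ∈ Finset.range M,
      (if (n : ℕ∞) < N ω ∧ X n ω ∈ K then v (X n ω) else 1) = pointProd N X K v ω := by
  have hfin := finite_of_pointCount_ne_top h
  obtain ⟨b, hb⟩ := hfin.bddAbove
  filter_upwards [eventually_gt_atTop b] with M hM
  rw [pointProd, finprod_mem_eq_finite_toFinset_prod _ hfin, ← Finset.prod_filter]
  refine Finset.prod_congr ?_ fun _ _ => rfl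
  ext n
  simp only [Finset.mem_filter, Finset.mem_range, Finite.mem_toFinset, mem_ofPred_eq,
    and_iff_right_iff_imp]
  intro hn
  exact (hb hn).trans_lt hM

lemma norm_pointProd_le {K : Set E} {v : E → ℂ} (hv : ∀ y, ‖v y‖ ≤ 1) {ω : Ω}
    (h : pointCount N X K ω ≠ ⊤) : ‖pointProd N X K v ω‖ ≤ 1 := by
  rw [pointProd, finprod_mem_eq_finite_toFinset_prod _ (finite_of_pointCount_ne_top h), norm_prod]
  exact Finset.prod_le_one (fun _ _ => norm_nonneg _) fun _ _ => hv _

variable [MeasurableSpace E] {ν : Measure E}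

/-- Points are grouped by the value of `u`; the product then depends only on the counts in the
disjoint level sets, whose law is part of the definition of a Poisson process. -/
lemma pointProd_one_sub_simpleFunc (K : Set E) (u : SimpleFunc E ℂ) {ω : Ω}
    (h : pointCount N X K ω ≠ ⊤) :
    pointProd N X K (fun y => 1 - u y) ω =
      ∏ c ∈ u.range, (1 - c) ^ (pointCount N X (u ⁻¹' {c} ∩ K) ω).toNat := by
  classical
  have hfin := finite_of_pointCount_ne_top h
  rw [pointProd, finprod_mem_eq_finite_toFinset_prod _ hfin,
    ← Finset.prod_fiberwise_of_maps_to' (t := u.range) (g := fun n => u (X n ω))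
      (fun _ _ => u.mem_range_self _) (fun c => 1 - c)]
  refine Finset.prod_congr rfl fun c _ => ?_
  rw [Finset.prod_const]
  congr 1
  rw [pointCount, ← Set.ncard_def, ← Set.ncard_coe_finset]
  congr 1
  ext n
  simp only [Finset.coe_filter, Finite.mem_toFinset, mem_ofPred_eq, mem_inter_iff, mem_preimage,
    mem_singleton_iff]
  tauto

variable [MeasurableSpace Ω] {μ : Measure Ω}

lemma measurableSet_lt (h : IsPoissonProcess N X ν μ) (n : ℕ) :
    MeasurableSet {ω | (n : ℕ∞) < N ω} :=
  h.measurable_count (MeasurableSet.of_discrete (s := {k : ℕ∞ | (n : ℕ∞) < k}))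

lemma measurableSet_mem (h : IsPoissonProcess N X ν μ) {A : Set E} (hA : MeasurableSet A) (n : ℕ) :
    MeasurableSet {ω | (n : ℕ∞) < N ω ∧ X n ω ∈ A} :=
  (h.measurableSet_lt n).inter (h.measurable_point n hA)

lemma measurable_pointCount (h : IsPoissonProcess N X ν μ) {A : Set E} (hA : MeasurableSet A) :
    Measurable (pointCount N X A) := by
  have h1 : Measurable fun ω => (pointCount N X A ω : ℝ≥0∞) := by
    simp_rw [coe_pointCount]
    exact Measurable.tsum fun n =>
      measurable_one.indicator (h.measurableSet_mem hA n)
  refine measurable_to_countable' fun k => ?_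
  have : pointCount N X A ⁻¹' {k} = (fun ω => (pointCount N X A ω : ℝ≥0∞)) ⁻¹' {(k : ℝ≥0∞)} := by
    ext ω
    simp
  rw [this]
  exact h1 (measurableSet_singleton _)

/-- The Poisson weights of the finite counts already sum to `1`, leaving no mass for `⊤`. -/
lemma ae_pointCount_ne_top [IsProbabilityMeasure μ] (h : IsPoissonProcess N X ν μ) {A : Set E}
    (hA : MeasurableSet A) (hν : ν A < ∞) : ∀ᵐ ω ∂μ, pointCount N X A ω ≠ ⊤ := by
  have hm := h.measurable_pointCount hA
  have h1 : μ (⋃ k : ℕ, {ω | pointCount N X A ω = k}) = 1 := by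
    rw [measure_iUnion]
    · simp_rw [h.poisson A hA hν]
      have := hasSum_one_poissonMeasure (ν A).toNNReal
      simp only [ENNReal.coe_toNNReal_eq_toReal] at this
      rw [← ENNReal.ofReal_tsum_of_nonneg (fun n => by positivity) this.summable]
      exact (congrArg ENNReal.ofReal this.tsum_eq).trans ENNReal.ofReal_one
    · intro i j hij
      refine Set.disjoint_left.2 fun ω hi hj => hij ?_
      simp only [mem_ofPred_eq] at hi hj
      exact_mod_cast hi.symm.trans hj
    · exact fun k => hm (measurableSet_singleton _)
  have h2 : ∀ᵐ ω ∂μ, ω ∈ ⋃ k : ℕ, {ω | pointCount N X A ω = k} := by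
    rw [ae_iff_prob_eq_one]
    · exact h1
    · exact (MeasurableSet.iUnion fun k => hm (measurableSet_singleton _)).mem
  filter_upwards [h2] with ω hω
  obtain ⟨k, hk⟩ := mem_iUnion.1 hω
  rw [show pointCount N X A ω = k from hk]
  exact ENat.natCast_ne_top k

/-- The number of points in a set of finite intensity follows a Poisson distribution. -/
lemma map_toNat_pointCount [IsProbabilityMeasure μ] (h : IsPoissonProcess N X ν μ) {A : Set E}
    (hA : MeasurableSet A) (hν : ν A < ∞) :
    μ.map (fun ω => (pointCount N X A ω).toNat) = poissonMeasure (ν A).toNNReal := by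
  have hm : Measurable fun ω => (pointCount N X A ω).toNat :=
    (measurable_of_countable ENat.toNat).comp (h.measurable_pointCount hA)
  refine Measure.ext_of_singleton fun k => ?_
  rw [Measure.map_apply hm (measurableSet_singleton k), poissonMeasure_singleton]
  refine Eq.trans (measure_congr ?_) (h.poisson A hA hν k)
  filter_upwards [h.ae_pointCount_ne_top hA hν] with ω hω
  apply propext
  change (pointCount N X A ω).toNat = k ↔ pointCount N X A ω = k
  obtain ⟨j, hj⟩ := ENat.ne_top_iff_exists.1 hω
  rw [← hj]
  simp

/-- Probability generating function of a Poisson variable, evaluated at `1 - c`. -/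
lemma integral_pow_pointCount [IsProbabilityMeasure μ] (h : IsPoissonProcess N X ν μ) {A : Set E}
    (hA : MeasurableSet A) (hν : ν A < ∞) (c : ℂ) :
    ∫ ω, (1 - c) ^ (pointCount N X A ω).toNat ∂μ = Complex.exp (-(((ν A).toReal : ℂ) * c)) := by
  have hm : Measurable fun ω => (pointCount N X A ω).toNat :=
    (measurable_of_countable ENat.toNat).comp (h.measurable_pointCount hA)
  rw [← integral_map (f := fun k : ℕ => (1 - c) ^ k) hm.aemeasurable
    (measurable_of_countable _).aestronglyMeasurable, h.map_toNat_pointCount hA hν,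
    integral_poissonMeasure]
  change ∑' n : ℕ, (Real.exp (-(ν A).toReal) * (ν A).toReal ^ n / n.factorial) • (1 - c) ^ n = _
  have h2 := (NormedSpace.expSeries_div_hasSum_exp (((ν A).toReal : ℂ) * (1 - c))).mul_left
    (Complex.exp (-(ν A).toReal))
  rw [← Complex.exp_eq_exp_ℂ, ← Complex.exp_add] at h2
  rw [show -(((ν A).toReal : ℂ) * c) = -((ν A).toReal : ℂ) + (ν A).toReal * (1 - c) by ring,
    ← h2.tsum_eq]
  refine tsum_congr fun n => ?_
  rw [Complex.real_smul, mul_pow]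
  push_cast
  ring

/-- The identity `(n + 1) P(n + 1) = r P(n)` shifts the sum for the mean onto `r` times the total
mass. -/
lemma lintegral_natCast_poissonMeasure (r : ℝ≥0) :
    ∫⁻ n, (n : ℝ≥0∞) ∂(poissonMeasure r) = r := by
  have h1 : ∑' n : ℕ, poissonMeasure r {n} = 1 := by
    have := lintegral_countable' (μ := poissonMeasure r) (fun _ => (1 : ℝ≥0∞))
    simpa using this.symm
  rw [lintegral_countable', tsum_eq_zero_add' ENNReal.summable, Nat.cast_zero, zero_mul, zero_add]
  have h2 : ∀ n : ℕ, ((n + 1 : ℕ) : ℝ≥0∞) * poissonMeasure r {n + 1} =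
      r * poissonMeasure r {n} := by
    intro n
    rw [poissonMeasure_singleton, poissonMeasure_singleton, ← ENNReal.ofReal_natCast,
      ← ENNReal.ofReal_coe_nnreal, ← ENNReal.ofReal_mul (by positivity),
      ← ENNReal.ofReal_mul (by positivity)]
    congr 1
    rw [Nat.factorial_succ]
    push_cast
    field_simp
    ring
  simp_rw [h2]
  rw [ENNReal.tsum_mul_left, h1, mul_one]

lemma lintegral_pointCount_of_lt_top [IsProbabilityMeasure μ] (h : IsPoissonProcess N X ν μ)
    {A : Set E} (hA : MeasurableSet A) (hν : ν A < ∞) :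
    ∫⁻ ω, (pointCount N X A ω : ℝ≥0∞) ∂μ = ν A := by
  have hm : Measurable fun ω => (pointCount N X A ω).toNat :=
    (measurable_of_countable ENat.toNat).comp (h.measurable_pointCount hA)
  have h1 : ∫⁻ ω, (pointCount N X A ω : ℝ≥0∞) ∂μ =
      ∫⁻ ω, (((pointCount N X A ω).toNat : ℕ) : ℝ≥0∞) ∂μ := by
    refine lintegral_congr_ae ?_
    filter_upwards [h.ae_pointCount_ne_top hA hν] with ω hω
    obtain ⟨j, hj⟩ := ENat.ne_top_iff_exists.1 hω
    rw [← hj]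
    simp
  rw [h1, ← lintegral_map (f := fun k : ℕ => (k : ℝ≥0∞)) (measurable_of_countable _) hm,
    h.map_toNat_pointCount hA hν, lintegral_natCast_poissonMeasure, ENNReal.coe_toNNReal hν.ne]

/-- The mean measure of a Poisson process is its intensity measure. -/
theorem sum_map_eq [IsProbabilityMeasure μ] [SigmaFinite ν] (h : IsPoissonProcess N X ν μ) :
    Measure.sum (fun n : ℕ => (μ.restrict {ω | (n : ℕ∞) < N ω}).map (X n)) = ν := by
  have key : ∀ A, MeasurableSet A → ν A < ∞ →
      Measure.sum (fun n : ℕ => (μ.restrict {ω | (n : ℕ∞) < N ω}).map (X n)) A = ν A := by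
    intro A hA hν
    rw [Measure.sum_apply _ hA, ← h.lintegral_pointCount_of_lt_top hA hν]
    simp_rw [coe_pointCount]
    rw [lintegral_tsum fun n =>
      (measurable_one.indicator (h.measurableSet_mem hA n)).aemeasurable]
    refine tsum_congr fun n => ?_
    rw [lintegral_indicator_one (h.measurableSet_mem hA n),
      Measure.map_apply (h.measurable_point n) hA,
      Measure.restrict_apply (h.measurable_point n hA), inter_comm]
    rfl
  -- The Poisson law is postulated only for sets of finite intensity, so equality is checked on an
  -- exhaustion by such sets.
  refine Measure.ext_of_iUnion_eq_univ (iUnion_spanningSets ν) fun i => ?_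
  ext A hA
  rw [Measure.restrict_apply hA, Measure.restrict_apply hA]
  refine key _ (hA.inter (measurableSet_spanningSets ν i)) ?_
  exact (measure_mono inter_subset_right).trans_lt (measure_spanningSets_lt_top ν i)

/-- Campbell's formula. -/
theorem tsum_lintegral_eq [IsProbabilityMeasure μ] [SigmaFinite ν] (h : IsPoissonProcess N X ν μ)
    {f : E → ℝ≥0∞} (hf : Measurable f) :
    ∑' n : ℕ, ∫⁻ ω in {ω | (n : ℕ∞) < N ω}, f (X n ω) ∂μ = ∫⁻ y, f y ∂ν := by
  conv_rhs => rw [← h.sum_map_eq]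
  rw [lintegral_sum_measure]
  exact tsum_congr fun n => (lintegral_map hf (h.measurable_point n)).symm

lemma lintegral_pointCount [IsProbabilityMeasure μ] [SigmaFinite ν] (h : IsPoissonProcess N X ν μ)
    {A : Set E} (hA : MeasurableSet A) : ∫⁻ ω, (pointCount N X A ω : ℝ≥0∞) ∂μ = ν A := by
  have := h.tsum_lintegral_eq (f := A.indicator 1) (measurable_one.indicator hA)
  rw [lintegral_indicator_one hA] at this
  rw [← this]
  simp_rw [coe_pointCount]
  rw [lintegral_tsum fun n => (measurable_one.indicator (h.measurableSet_mem hA n)).aemeasurable]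
  refine tsum_congr fun n => ?_
  rw [← lintegral_indicator (h.measurableSet_lt n)]
  refine lintegral_congr fun ω => ?_
  by_cases h1 : (n : ℕ∞) < N ω <;> by_cases h2 : X n ω ∈ A <;> simp [h1, h2]

lemma aestronglyMeasurable_pointProd [IsProbabilityMeasure μ] (h : IsPoissonProcess N X ν μ)
    {K : Set E} (hK : MeasurableSet K) (hν : ν K < ∞) {v : E → ℂ} (hv : Measurable v) :
    AEStronglyMeasurable (pointProd N X K v) μ := by
  classical
  refine aestronglyMeasurable_of_tendsto_ae atTop (f := fun (M : ℕ) ω => ∏ n ∈ Finset.range M,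
      (if (n : ℕ∞) < N ω ∧ X n ω ∈ K then v (X n ω) else 1)) (fun M => ?_) ?_
  · exact (Finset.measurable_fun_prod _ fun n _ => Measurable.ite (h.measurableSet_mem hK n)
      (hv.comp (h.measurable_point n)) measurable_const).aestronglyMeasurable
  · filter_upwards [h.ae_pointCount_ne_top hK hν] with ω hω
    exact tendsto_const_nhds.congr' ((prod_range_eq_pointProd hω).mono fun _ h => h.symm)

/-- Counts in disjoint level sets are independent, so the expectation is a product of Poisson
generating functions, and the exponents add up to the integral of `u`. -/
lemma integral_pointProd_simpleFunc [IsProbabilityMeasure μ] (h : IsPoissonProcess N X ν μ)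
    {K : Set E} (hK : MeasurableSet K) (hν : ν K < ∞) (u : SimpleFunc E ℂ) :
    ∫ ω, pointProd N X K (fun y => 1 - u y) ω ∂μ = Complex.exp (-∫ y in K, u y ∂ν) := by
  have h1 : ∫ ω, pointProd N X K (fun y => 1 - u y) ω ∂μ =
      ∫ ω, ∏ c ∈ u.range, (1 - c) ^ (pointCount N X (u ⁻¹' {c} ∩ K) ω).toNat ∂μ := by
    refine integral_congr_ae ?_
    filter_upwards [h.ae_pointCount_ne_top hK hν] with ω hω
    exact pointProd_one_sub_simpleFunc K u hω
  have hA : ∀ c : ℂ, MeasurableSet (u ⁻¹' {c} ∩ K) := fun c => (u.measurableSet_fiber c).inter hK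
  have hAν : ∀ c : ℂ, ν (u ⁻¹' {c} ∩ K) < ∞ := fun c =>
    (measure_mono inter_subset_right).trans_lt hν
  -- Independence of counts is given for families indexed by `Fin m`, hence the re-indexing of the
  -- values of `u`.
  let e := u.range.equivFin
  have hprod : ∀ g : ℂ → ℂ, ∏ c ∈ u.range, g c = ∏ i, g (e.symm i) := fun g => by
    rw [← Finset.prod_coe_sort, ← Equiv.prod_comp e.symm]
  have hind := h.independent _ (fun i => u ⁻¹' {(e.symm i : ℂ)} ∩ K) (fun i => hA _) (by
    intro i j hij
    refine Set.disjoint_left.2 fun y hi hj => hij ?_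
    have : (e.symm i : ℂ) = e.symm j := by
      rw [← mem_singleton_iff.1 (mem_preimage.1 hi.1), ← mem_singleton_iff.1 (mem_preimage.1 hj.1)]
    exact e.symm.injective (Subtype.ext this))
  have hind2 := hind.comp (fun i k => (1 - (e.symm i : ℂ)) ^ k.toNat)
    fun i => measurable_of_countable _
  rw [h1]
  simp_rw [hprod]
  have h2 := hind2.integral_fun_prod_eq_prod_integral fun i =>
    ((measurable_of_countable _).comp (h.measurable_pointCount (hA _))).aestronglyMeasurable
  simp only [Function.comp_def] at h2
  rw [h2]
  simp_rw [h.integral_pow_pointCount (hA _) (hAν _)]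
  have hint : Integrable u (ν.restrict K) := by
    have : IsFiniteMeasure (ν.restrict K) := isFiniteMeasure_restrict.2 hν.ne
    exact u.integrable_of_isFiniteMeasure
  rw [← Complex.exp_sum, Finset.sum_neg_distrib, SimpleFunc.integral_eq_sum _ hint,
    ← Finset.sum_coe_sort u.range, ← Equiv.sum_comp e.symm]
  congr 2
  refine Finset.sum_congr rfl fun i _ => ?_
  rw [measureReal_def, Measure.restrict_apply (u.measurableSet_fiber _), Complex.real_smul]

/-- Laplace functional of a Poisson process, for a function on a set of finite intensity. -/
theorem integral_pointProd [IsProbabilityMeasure μ] (h : IsPoissonProcess N X ν μ)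
    {K : Set E} (hK : MeasurableSet K) (hν : ν K < ∞) {v : E → ℂ} (hv : Measurable v)
    (hv1 : ∀ y, ‖v y‖ ≤ 1) :
    ∫ ω, pointProd N X K v ω ∂μ = Complex.exp (-∫ y in K, (1 - v y) ∂ν) := by
  have hfin : IsFiniteMeasure (ν.restrict K) := isFiniteMeasure_restrict.2 hν.ne
  have hsm := hv.stronglyMeasurable
  -- It is `v` that is approximated, by simple functions of norm at most `1`, and `u k` is the
  -- complement. This keeps every product over the points bounded by `1`, which is the domination
  -- needed for the limit.
  let u : ℕ → SimpleFunc E ℂ := fun k => SimpleFunc.const E 1 - hsm.approxBounded 1 k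
  have hu : ∀ k y, 1 - u k y = hsm.approxBounded 1 k y := fun k y => by
    simp only [u, SimpleFunc.coe_sub, Pi.sub_apply, SimpleFunc.const_apply]
    ring
  have hb : ∀ k y, ‖1 - u k y‖ ≤ 1 := fun k y => by
    rw [hu]
    exact hsm.norm_approxBounded_le zero_le_one k y
  have hlim : ∀ y, Tendsto (fun k => 1 - u k y) atTop (𝓝 (v y)) := fun y => by
    simp_rw [hu]
    exact hsm.tendsto_approxBounded_of_norm_le (hv1 y)
  have hlim2 : ∀ y, Tendsto (fun k => u k y) atTop (𝓝 (1 - v y)) := fun y => by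
    simpa using (hlim y).const_sub 1
  have hL : Tendsto (fun k => ∫ ω, pointProd N X K (fun y => 1 - u k y) ω ∂μ) atTop
      (𝓝 (∫ ω, pointProd N X K v ω ∂μ)) := by
    refine tendsto_integral_of_dominated_convergence (fun _ => 1) (fun k => ?_)
      (integrable_const _) (fun k => ?_) ?_
    · exact h.aestronglyMeasurable_pointProd hK hν (measurable_const.sub (u k).measurable)
    · filter_upwards [h.ae_pointCount_ne_top hK hν] with ω hω using norm_pointProd_le (hb k) hω
    · filter_upwards [h.ae_pointCount_ne_top hK hν] with ω hω
      have hf := finite_of_pointCount_ne_top hω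
      simp only [pointProd, finprod_mem_eq_finite_toFinset_prod _ hf]
      exact tendsto_finsetProd _ fun n _ => hlim _
  have hR : Tendsto (fun k => ∫ y in K, u k y ∂ν) atTop (𝓝 (∫ y in K, (1 - v y) ∂ν)) := by
    refine tendsto_integral_of_dominated_convergence (fun _ => 2) (fun k => ?_)
      (integrable_const _) (fun k => ?_) (.of_forall hlim2)
    · exact (u k).measurable.aestronglyMeasurable
    · refine .of_forall fun y => ?_
      calc ‖u k y‖ = ‖1 - (1 - u k y)‖ := by rw [sub_sub_cancel]
        _ ≤ ‖(1 : ℂ)‖ + ‖1 - u k y‖ := norm_sub_le _ _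
        _ ≤ 2 := by rw [norm_one]; linarith [hb k y]
  refine tendsto_nhds_unique hL ?_
  simp_rw [h.integral_pointProd_simpleFunc hK hν]
  exact (Complex.continuous_exp.tendsto _).comp hR.neg

/-- Integrating out independent marks. -/
lemma integral_prod_marks {α : Type*} [MeasurableSpace α] [IsProbabilityMeasure μ] {Φ : Ω → α}
    {J : ℕ → Ω → ℝ} (hΦ : Measurable Φ) (hJ : ∀ n, Measurable (J n))
    (hind : IndepFun Φ (fun ω n => J n ω) μ) (hJi : iIndepFun J μ) (M : ℕ)
    {F : ℕ → α → ℝ → ℂ} (hF : ∀ n, Measurable fun u : α × ℝ => F n u.1 u.2)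
    (hb : ∀ n a j, ‖F n a j‖ ≤ 1) :
    ∫ ω, ∏ n ∈ Finset.range M, F n (Φ ω) (J n ω) ∂μ =
      ∫ ω, ∏ n ∈ Finset.range M, ∫ ω', F n (Φ ω) (J n ω') ∂μ ∂μ := by
  have hJ' : Measurable fun ω n => J n ω := measurable_pi_lambda _ hJ
  have : IsProbabilityMeasure (μ.map Φ) := Measure.isProbabilityMeasure_map hΦ.aemeasurable
  have : IsProbabilityMeasure (μ.map fun ω n => J n ω) :=
    Measure.isProbabilityMeasure_map hJ'.aemeasurable
  have hmeas : Measurable fun u : α × (ℕ → ℝ) => ∏ n ∈ Finset.range M, F n u.1 (u.2 n) :=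
    Finset.measurable_fun_prod _ fun n _ => (hF n).comp
      (measurable_fst.prodMk ((measurable_pi_apply n).comp measurable_snd))
  have hle : ∀ a (j : ℕ → ℝ), ‖∏ n ∈ Finset.range M, F n a (j n)‖ ≤ 1 := fun a j => by
    rw [norm_prod]
    exact Finset.prod_le_one (fun _ _ => norm_nonneg _) fun _ _ => hb _ _ _
  -- Independence turns the joint law of `Φ` and the marks into a product measure. Fubini then
  -- freezes `Φ`, and for frozen `Φ` the factors are independent across `n`.
  have h1 : ∫ ω, ∏ n ∈ Finset.range M, F n (Φ ω) (J n ω) ∂μ =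
      ∫ u, ∏ n ∈ Finset.range M, F n u.1 (u.2 n) ∂((μ.map Φ).prod (μ.map fun ω n => J n ω)) := by
    rw [← (indepFun_iff_map_prod_eq_prod_map_map hΦ.aemeasurable hJ'.aemeasurable).1 hind,
      integral_map (hΦ.prodMk hJ').aemeasurable hmeas.aestronglyMeasurable]
  have hint : Integrable (fun u : α × (ℕ → ℝ) => ∏ n ∈ Finset.range M, F n u.1 (u.2 n))
      ((μ.map Φ).prod (μ.map fun ω n => J n ω)) :=
    (integrable_const (1 : ℝ)).mono' hmeas.aestronglyMeasurable (.of_forall fun u => hle _ _)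
  rw [h1, integral_prod _ hint, integral_map hΦ.aemeasurable
    hmeas.stronglyMeasurable.integral_prod_right'.aestronglyMeasurable]
  refine integral_congr_ae (.of_forall fun ω => ?_)
  change ∫ j, ∏ n ∈ Finset.range M, F n (Φ ω) (j n) ∂(μ.map fun ω n => J n ω) = _
  have hFm : ∀ n, Measurable (F n (Φ ω)) := fun n => (hF n).comp measurable_prodMk_left
  have hm2 : Measurable fun j : ℕ → ℝ => ∏ n ∈ Finset.range M, F n (Φ ω) (j n) :=
    hmeas.comp measurable_prodMk_left
  rw [integral_map hJ'.aemeasurable hm2.aestronglyMeasurable]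
  have h2 := ((hJi.precomp Fin.val_injective).comp (fun (n : Fin M) => F n (Φ ω))
    fun n => hFm n).integral_fun_prod_eq_prod_integral fun n =>
      ((hFm n).comp (hJ n)).aestronglyMeasurable
  simpa [Function.comp_def, Finset.prod_range] using h2

open Classical in
/-- Laplace functional of a marked Poisson process. -/
theorem tendsto_integral_prod_marks [IsProbabilityMeasure μ] (h : IsPoissonProcess N X ν μ)
    {J : ℕ → Ω → ℝ} (hJ : ∀ n, Measurable (J n))
    (hind : IndepFun (fun ω => (N ω, fun n => X n ω)) (fun ω n => J n ω) μ) (hJi : iIndepFun J μ)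
    {K : Set E} (hK : MeasurableSet K) (hν : ν K < ∞) {f : E → ℝ → ℂ}
    (hf : Measurable fun u : E × ℝ => f u.1 u.2) (hb : ∀ y j, ‖f y j‖ ≤ 1)
    (hf1 : ∀ y ∉ K, ∀ j, f y j = 1) {ψ : E → ℂ} (hψ : ∀ n y, ∫ ω, f y (J n ω) ∂μ = ψ y) :
    Tendsto (fun M => ∫ ω, ∏ n ∈ Finset.range M,
      (if (n : ℕ∞) < N ω then f (X n ω) (J n ω) else 1) ∂μ) atTop
      (𝓝 (Complex.exp (-∫ y, (1 - ψ y) ∂ν))) := by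
  have hψm : Measurable ψ := by
    have : ψ = fun y => ∫ ω, f y (J 0 ω) ∂μ := funext fun y => (hψ 0 y).symm
    rw [this]
    have hm : Measurable fun u : E × Ω => f u.1 (J 0 u.2) :=
      hf.comp (measurable_fst.prodMk ((hJ 0).comp measurable_snd))
    exact hm.stronglyMeasurable.integral_prod_right'.measurable
  have hψ1 : ∀ y, ‖ψ y‖ ≤ 1 := fun y => by
    rw [← hψ 0 y]
    refine (norm_integral_le_integral_norm _).trans ?_
    have := integral_mono_of_nonneg (μ := μ) (f := fun ω => ‖f y (J 0 ω)‖) (g := fun _ => (1 : ℝ))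
      (.of_forall fun _ => norm_nonneg _) (integrable_const _) (.of_forall fun ω => hb _ _)
    simpa using this
  have hψK : ∀ y ∉ K, ψ y = 1 := fun y hy => by
    rw [← hψ 0 y]
    simp [hf1 y hy]
  -- Averaging over the marks replaces `f` by `ψ`. As `ψ = 1` off `K`, the condition `X n ∈ K` can
  -- be inserted freely, which leaves finitely many relevant points.
  have hkey : ∀ M, ∫ ω, ∏ n ∈ Finset.range M,
      (if (n : ℕ∞) < N ω then f (X n ω) (J n ω) else 1) ∂μ =
      ∫ ω, ∏ n ∈ Finset.range M, (if (n : ℕ∞) < N ω ∧ X n ω ∈ K then ψ (X n ω) else 1) ∂μ := by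
    intro M
    have hX : Measurable fun ω => (N ω, fun n => X n ω) :=
      h.measurable_count.prodMk (measurable_pi_lambda _ h.measurable_point)
    have := integral_prod_marks hX hJ hind hJi M
      (F := fun n (a : ℕ∞ × (ℕ → E)) j => if (n : ℕ∞) < a.1 then f (a.2 n) j else 1)
      (fun n => by
        refine Measurable.ite ?_ ?_ measurable_const
        · exact (measurable_fst.comp measurable_fst)
            (MeasurableSet.of_discrete (s := {k : ℕ∞ | (n : ℕ∞) < k}))
        · have hm : Measurable fun u : (ℕ∞ × (ℕ → E)) × ℝ => (u.1.2 n, u.2) :=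
            ((measurable_pi_apply n).comp (measurable_snd.comp measurable_fst)).prodMk
              measurable_snd
          exact hf.comp hm)
      (fun n a j => by
        split_ifs
        · exact hb _ _
        · simp)
    rw [this]
    refine integral_congr_ae (.of_forall fun ω => ?_)
    refine Finset.prod_congr rfl fun n _ => ?_
    by_cases h1 : (n : ℕ∞) < N ω
    · simp only [h1, if_true, true_and, hψ]
      split_ifs with h2
      · rfl
      · exact hψK _ h2
    · simp [h1]
  simp_rw [hkey]
  have hset : ∫ y, (1 - ψ y) ∂ν = ∫ y in K, (1 - ψ y) ∂ν := by
    rw [setIntegral_eq_integral_of_forall_compl_eq_zero]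
    intro y hy
    rw [hψK y hy, sub_self]
  rw [hset, ← h.integral_pointProd hK hν hψm hψ1]
  refine tendsto_integral_of_dominated_convergence (fun _ => 1) (fun M => ?_)
    (integrable_const _) (fun M => .of_forall fun ω => ?_) ?_
  · exact (Finset.measurable_fun_prod _ fun n _ => Measurable.ite (h.measurableSet_mem hK n)
      (hψm.comp (h.measurable_point n)) measurable_const).aestronglyMeasurable
  · rw [norm_prod]
    refine Finset.prod_le_one (fun _ _ => norm_nonneg _) fun n _ => ?_
    split_ifs
    · exact hψ1 _
    · simp
  · filter_upwards [h.ae_pointCount_ne_top hK hν] with ω hω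
    exact tendsto_const_nhds.congr' ((prod_range_eq_pointProd hω).mono fun _ h => h.symm)

/-- Campbell's inequality for a marked Poisson process. -/
theorem tsum_lintegral_mul_mark_le [IsProbabilityMeasure μ] [SigmaFinite ν]
    (h : IsPoissonProcess N X ν μ) {J : ℕ → Ω → ℝ≥0∞} (hJ : ∀ n, Measurable (J n))
    (hind : ∀ n, IndepFun (fun ω => (N ω, X n ω)) (J n) μ) {c : ℝ≥0∞}
    (hc : ∀ n, ∫⁻ ω, J n ω ∂μ ≤ c) {f : E → ℝ≥0∞} (hf : Measurable f) :
    ∑' n : ℕ, ∫⁻ ω in {ω | (n : ℕ∞) < N ω}, f (X n ω) * J n ω ∂μ ≤ (∫⁻ y, f y ∂ν) * c := by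
  rw [← h.tsum_lintegral_eq hf, ← ENNReal.tsum_mul_right]
  refine ENNReal.tsum_le_tsum fun n => ?_
  rw [← lintegral_indicator (h.measurableSet_lt n), ← lintegral_indicator (h.measurableSet_lt n)]
  refine le_trans (le_of_eq ?_) (mul_le_mul_right (hc n) _)
  -- The restriction to `n < N` is absorbed into a function of `(N, X n)`, so that independence from
  -- the mark applies to the whole factor.
  let g : ℕ∞ × E → ℝ≥0∞ := fun u => {u : ℕ∞ × E | (n : ℕ∞) < u.1}.indicator (fun u => f u.2) u
  have hg : Measurable g := (hf.comp measurable_snd).indicator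
    (measurable_fst (MeasurableSet.of_discrete (s := {k : ℕ∞ | (n : ℕ∞) < k})))
  have h2 := lintegral_mul_eq_lintegral_mul_lintegral_of_indepFun
    (hg.comp (h.measurable_count.prodMk (h.measurable_point n))) (hJ n)
    ((hind n).comp hg measurable_id)
  rw [show {ω | (n : ℕ∞) < N ω}.indicator (fun ω => f (X n ω)) = g ∘ fun ω => (N ω, X n ω) from rfl,
    ← h2]
  refine lintegral_congr fun ω => ?_
  by_cases h1 : (n : ℕ∞) < N ω <;> simp [h1, g]

end IsPoissonProcess

/-! ### Grouping independent σ-algebras -/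

/-- The σ-algebras generated by disjoint groups of independent σ-algebras are independent. -/
lemma ProbabilityTheory.iIndep.iSup_of_pairwise_disjoint {Ω ι κ : Type*} {mΩ : MeasurableSpace Ω}
    {μ : Measure Ω} {m : ι → MeasurableSpace Ω} (hm : ∀ i, m i ≤ mΩ) (h : iIndep m μ)
    {S : κ → Set ι} (hS : Pairwise fun i j => Disjoint (S i) (S j)) :
    iIndep (fun k => ⨆ i ∈ S k, m i) μ := by
  classical
  have := h.isProbabilityMeasure
  rw [iIndep_iff]
  intro T f hf
  induction T using Finset.induction_on with
  | empty => simp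
  | insert a T ha ih =>
    have hdisj : Disjoint (S a) (⋃ k ∈ T, S k) := by
      simp only [Set.disjoint_iUnion_right]
      intro k hk
      exact hS (ne_of_mem_of_not_mem hk ha).symm
    have hind := indep_iSup_of_disjoint hm h hdisj
    rw [Indep_iff] at hind
    rw [Finset.set_biInter_insert, Finset.prod_insert ha, hind _ _ (hf a (Finset.mem_insert_self _ _)),
      ih fun k hk => hf k (Finset.mem_insert_of_mem hk)]
    refine Finset.measurableSet_biInter _ fun k hk => ?_
    refine (iSup₂_mono' fun i hi => ⟨i, mem_biUnion hk hi, le_rfl⟩ : ⨆ i ∈ S k, m i ≤ _) _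
      (hf k (Finset.mem_insert_of_mem hk))


/-! ### The gamma distribution -/

section Gamma

open Filter Topology

/-- Exponential tilting: `e^{tx}` only changes the rate from `r` to `r - t`, and the constant that
appears is the moment generating function. -/
lemma exp_mul_gammaPDF {a r t x : ℝ} (hr : 0 < r) (ht : t < r) :
    ENNReal.ofReal (Real.exp (t * x)) * gammaPDF a r x =
      ENNReal.ofReal ((r / (r - t)) ^ a) * gammaPDF a (r - t) x := by
  have hrt : 0 < r - t := sub_pos.2 ht
  rcases lt_or_ge x 0 with hx | hx
  · simp [gammaPDF_of_neg hx]
  rw [gammaPDF_of_nonneg hx, gammaPDF_of_nonneg hx, ← ENNReal.ofReal_mul (Real.exp_pos _).le,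
    ← ENNReal.ofReal_mul (by positivity), Real.div_rpow hr.le hrt.le,
    show -((r - t) * x) = t * x + -(r * x) by ring, Real.exp_add]
  congr 1
  have : (r - t) ^ a ≠ 0 := (Real.rpow_pos_of_pos hrt a).ne'
  field_simp

lemma measurable_gammaPDF (a r : ℝ) : Measurable (gammaPDF a r) :=
  (measurable_gammaPDFReal a r).ennreal_ofReal

lemma lintegral_gammaMeasure {a r : ℝ} {f : ℝ → ℝ≥0∞} (hf : Measurable f) :
    ∫⁻ x, f x ∂(gammaMeasure a r) = ∫⁻ x, f x * gammaPDF a r x := by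
  rw [gammaMeasure, lintegral_withDensity_eq_lintegral_mul _ (measurable_gammaPDF a r) hf]
  simp_rw [Pi.mul_apply, mul_comm]

lemma lintegral_exp_mul_gammaMeasure {a r t : ℝ} (ha : 0 < a) (hr : 0 < r) (ht : t < r) :
    ∫⁻ x, ENNReal.ofReal (Real.exp (t * x)) ∂(gammaMeasure a r) =
      ENNReal.ofReal ((r / (r - t)) ^ a) := by
  rw [lintegral_gammaMeasure (by fun_prop)]
  simp_rw [exp_mul_gammaPDF hr ht]
  rw [lintegral_const_mul' _ _ ENNReal.ofReal_ne_top, lintegral_gammaPDF_eq_one ha (sub_pos.2 ht),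
    mul_one]

lemma integrable_exp_mul_gammaMeasure {a r t : ℝ} (ha : 0 < a) (hr : 0 < r) (ht : t < r) :
    Integrable (fun x => Real.exp (t * x)) (gammaMeasure a r) := by
  refine ⟨by fun_prop, ?_⟩
  rw [hasFiniteIntegral_iff_ofReal (.of_forall fun x => (Real.exp_pos _).le),
    lintegral_exp_mul_gammaMeasure ha hr ht]
  exact ENNReal.ofReal_lt_top

lemma mgf_gammaMeasure {a r t : ℝ} (ha : 0 < a) (hr : 0 < r) (ht : t < r) :
    mgf id (gammaMeasure a r) t = (r / (r - t)) ^ a := by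
  rw [mgf, integral_eq_lintegral_of_nonneg_ae (.of_forall fun x => (Real.exp_pos _).le)
    (by fun_prop)]
  simp only [id]
  rw [lintegral_exp_mul_gammaMeasure ha hr ht, ENNReal.toReal_ofReal]
  have := sub_pos.2 ht
  positivity

/-- Laplace transform of the gamma distribution on the closed right half-plane. -/
theorem integral_cexp_neg_mul_gammaMeasure {a r : ℝ} (ha : 0 < a) (hr : 0 < r) {w : ℂ}
    (hw : 0 ≤ w.re) :
    ∫ x, Complex.exp (-(w * x)) ∂(gammaMeasure a r) = (1 + w * ((1 / r : ℝ) : ℂ)) ^ (-(a : ℂ)) := by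
  -- Both sides are analytic on this half-plane and agree at real points near `0`, hence throughout.
  -- It contains `-w` whenever `Re w ≥ 0`.
  let U : Set ℂ := {z | z.re < r}
  have hsub : ∀ z ∈ U, z.re ∈ interior (integrableExpSet id (gammaMeasure a r)) := by
    have : Iio r ⊆ interior (integrableExpSet id (gammaMeasure a r)) :=
      interior_maximal (fun t ht => integrable_exp_mul_gammaMeasure ha hr ht) isOpen_Iio
    exact fun z hz => this hz
  have hslit : ∀ z ∈ U, 1 - z * ((1 / r : ℝ) : ℂ) ∈ Complex.slitPlane := by
    intro z hz
    left
    have : z.re < r := hz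
    simp only [Complex.sub_re, Complex.one_re, Complex.mul_re, Complex.ofReal_re,
      Complex.ofReal_im, mul_zero, sub_zero, sub_pos]
    rwa [mul_one_div, div_lt_one hr]
  have hUo : IsOpen U := isOpen_lt Complex.continuous_re continuous_const
  have h1 : AnalyticOnNhd ℂ (complexMGF id (gammaMeasure a r)) U :=
    analyticOnNhd_complexMGF.mono hsub
  have h2 : AnalyticOnNhd ℂ (fun z : ℂ => (1 - z * ((1 / r : ℝ) : ℂ)) ^ (-(a : ℂ))) U := by
    refine DifferentiableOn.analyticOnNhd (fun z hz => ?_) hUo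
    have hd : DifferentiableAt ℂ (fun z : ℂ => 1 - z * ((1 / r : ℝ) : ℂ)) z := by fun_prop
    exact (hd.cpow (differentiableAt_const _) (hslit z hz)).differentiableWithinAt
  have hreal : ∀ t : ℝ, t < r → complexMGF id (gammaMeasure a r) t =
      (1 - (t : ℂ) * ((1 / r : ℝ) : ℂ)) ^ (-(a : ℂ)) := by
    intro t ht
    have hrt := sub_pos.2 ht
    have h0 : 0 < 1 - t * (1 / r) := by
      rw [mul_one_div, sub_pos, div_lt_one hr]
      exact ht
    rw [complexMGF_ofReal, mgf_gammaMeasure ha hr ht,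
      show r / (r - t) = (1 - t * (1 / r))⁻¹ by field_simp, Real.inv_rpow h0.le,
      ← Real.rpow_neg h0.le, Complex.ofReal_cpow h0.le]
    push_cast
    rfl
  have heq : EqOn (complexMGF id (gammaMeasure a r))
      (fun z : ℂ => (1 - z * ((1 / r : ℝ) : ℂ)) ^ (-(a : ℂ))) U := by
    refine h1.eqOn_of_preconnected_of_frequently_eq h2 (convex_halfSpace_re_lt r).isPreconnected
      (z₀ := 0) (by simpa [U] using hr) ?_
    have ht : Tendsto (fun t : ℝ => (t : ℂ)) (𝓝[≠] 0) (𝓝[≠] 0) := by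
      refine tendsto_nhdsWithin_iff.2 ⟨?_, ?_⟩
      · exact (Complex.continuous_ofReal.tendsto' 0 0 (by simp)).mono_left nhdsWithin_le_nhds
      · filter_upwards [self_mem_nhdsWithin] with t ht
        simpa using ht
    refine ht.frequently (Eventually.frequently ?_)
    filter_upwards [nhdsWithin_le_nhds (Iio_mem_nhds hr)] with t ht using hreal t ht
  have := heq (x := -w) (by
    change (-w).re < r
    rw [Complex.neg_re]
    linarith)
  simpa [complexMGF, neg_mul, sub_neg_eq_add] using this

/-- Multiplying the density of shape `a` by `x` gives `a / r` times the density of shape `a + 1`. -/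
lemma lintegral_ofReal_gammaMeasure {a r : ℝ} (ha : 0 < a) (hr : 0 < r) :
    ∫⁻ x, ENNReal.ofReal x ∂(gammaMeasure a r) = ENNReal.ofReal (a / r) := by
  rw [lintegral_gammaMeasure (by fun_prop)]
  have : ∀ᵐ x : ℝ, ENNReal.ofReal x * gammaPDF a r x =
      ENNReal.ofReal (a / r) * gammaPDF (a + 1) r x := by
    filter_upwards [Measure.ae_ne volume (0 : ℝ)] with x hx0
    rcases lt_or_ge x 0 with hx | hx
    · simp [gammaPDF_of_neg hx]
    have hx' : 0 < x := lt_of_le_of_ne hx hx0.symm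
    rw [gammaPDF_of_nonneg hx, gammaPDF_of_nonneg hx, ← ENNReal.ofReal_mul hx,
      ← ENNReal.ofReal_mul (by positivity)]
    congr 1
    rw [Real.Gamma_add_one ha.ne', Real.rpow_add_one hr.ne', add_sub_cancel_right,
      Real.rpow_sub_one hx'.ne']
    have := (Real.Gamma_pos_of_pos ha).ne'
    field_simp
  rw [lintegral_congr_ae this, lintegral_const_mul' _ _ ENNReal.ofReal_ne_top,
    lintegral_gammaPDF_eq_one (by linarith) hr, mul_one]

lemma ae_pos_gammaMeasure (a r : ℝ) : ∀ᵐ x ∂(gammaMeasure a r), 0 < x := by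
  rw [gammaMeasure, ae_withDensity_iff (measurable_gammaPDF a r)]
  filter_upwards [Measure.ae_ne volume (0 : ℝ)] with x hx h
  by_contra hneg
  exact h (gammaPDF_of_neg (lt_of_le_of_ne (not_lt.1 hneg) hx))

end Gamma

namespace NetworkParams

variable {S : Type*} [Fintype S] {B : ℕ} (p : NetworkParams S B)

/-! ### The probability that a base station is silent -/

lemma integrable_poisson_weight (n : ℕ) :
    Integrable (fun x => Real.exp (-(p.lamMT * x)) * (p.lamMT * x) ^ n / n.factorial)
      p.cellArea := by
  have hprob : IsProbabilityMeasure p.cellArea :=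
    isProbabilityMeasure_gammaMeasure (by norm_num) (mul_pos (by norm_num) p.lamBS_pos)
  refine (integrable_const (1 : ℝ)).mono' (by fun_prop) ?_
  filter_upwards [ae_pos_gammaMeasure _ _] with x hx
  have hx' : 0 ≤ p.lamMT * x := mul_nonneg p.lamMT_pos.le hx.le
  rw [Real.norm_of_nonneg (by positivity), mul_div_assoc, Real.exp_neg,
    inv_mul_le_iff₀ (Real.exp_pos _), mul_one]
  exact Real.pow_div_factorial_le_exp _ hx' n

lemma loadProb_nonneg (n : ℕ) : 0 ≤ p.loadProb n := by
  refine integral_nonneg_of_ae ?_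
  filter_upwards [ae_pos_gammaMeasure _ _] with x hx
  have hx' : 0 ≤ p.lamMT * x := mul_nonneg p.lamMT_pos.le hx.le
  simp only [Pi.zero_apply]
  positivity

lemma sum_loadProb_le_one (M : ℕ) : ∑ n ∈ Finset.range M, p.loadProb n ≤ 1 := by
  have hprob : IsProbabilityMeasure p.cellArea :=
    isProbabilityMeasure_gammaMeasure (by norm_num) (mul_pos (by norm_num) p.lamBS_pos)
  unfold loadProb
  rw [← integral_finsetSum _ fun n _ => p.integrable_poisson_weight n]
  have h : ∫ x, ∑ n ∈ Finset.range M, Real.exp (-(p.lamMT * x)) * (p.lamMT * x) ^ n / n.factorial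
      ∂p.cellArea ≤ ∫ _, (1 : ℝ) ∂p.cellArea := by
    refine integral_mono_ae (integrable_finsetSum _ fun n _ => p.integrable_poisson_weight n)
      (integrable_const _) ?_
    filter_upwards [ae_pos_gammaMeasure _ _] with x hx
    have hx' : 0 ≤ p.lamMT * x := mul_nonneg p.lamMT_pos.le hx.le
    simp_rw [mul_div_assoc]
    rw [← Finset.mul_sum, Real.exp_neg, inv_mul_le_iff₀ (Real.exp_pos _), mul_one]
    exact Real.sum_le_exp_of_nonneg hx' M
  simpa using h

/-- The weights are at most `1` and the load probabilities sum to at most `1`. The bound ensures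
that `ENNReal.ofReal (1 - p.pOff)` in the law of activity is not a truncation. -/
lemma pOff_le_one : p.pOff ≤ 1 := by
  refine le_trans (Finset.sum_le_sum fun n _ => ?_) (p.sum_loadProb_le_one (p.NRB + 1))
  refine mul_le_of_le_one_left (p.loadProb_nonneg n) ?_
  have : (0 : ℝ) ≤ n / p.NRB := by positivity
  linarith

lemma PRB_pos : 0 < p.PRB := div_pos p.PBS_pos (Nat.cast_pos.2 p.NRB_pos)

lemma G0_pos : 0 < p.G0 := mul_pos (p.boresight_pos _) (p.boresight_pos _)

/-! ### The antenna pattern -/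

lemma phi_le_phi (t : Terminal) {i j : ℕ} (hij : i ≤ j) (hj : j ≤ p.K t) :
    p.phi t i ≤ p.phi t j := by
  induction j, hij using Nat.le_induction with
  | base => exact le_rfl
  | succ k _ ih => exact (ih (by omega)).trans (p.phi_lt t k (by omega)).le

lemma phi_nonneg (t : Terminal) {j : ℕ} (hj : j ≤ p.K t) : 0 ≤ p.phi t j := by
  rw [← p.phi_zero t]
  exact p.phi_le_phi t (Nat.zero_le _) hj

lemma phi_le_pi (t : Terminal) {j : ℕ} (hj : j ≤ p.K t) : p.phi t j ≤ Real.pi := by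
  rw [← p.phi_last t]
  exact p.phi_le_phi t hj le_rfl

lemma lobeWidth_nonneg (t : Terminal) {l : ℕ} (hl : l ∈ Finset.Icc 1 (p.K t)) :
    0 ≤ p.lobeWidth t l := by
  have := p.phi_le_phi t (Nat.sub_le l 1) (Finset.mem_Icc.1 hl).2
  unfold lobeWidth
  linarith

lemma sum_lobeWidth (t : Terminal) :
    ∑ l ∈ Finset.Icc 1 (p.K t), p.lobeWidth t l / (2 * Real.pi) = 1 := by
  have h : ∀ k, ∑ l ∈ Finset.Icc 1 k, p.lobeWidth t l = 2 * (p.phi t k - p.phi t 0) := by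
    intro k
    induction k with
    | zero => simp
    | succ k ih =>
      rw [Finset.sum_Icc_succ_top (by omega), ih, lobeWidth, Nat.add_sub_cancel]
      ring
  rw [← Finset.sum_div, h, p.phi_last, p.phi_zero, sub_zero]
  exact div_self (by positivity)

/-- The set of angles that belong to the `l`-th lobe. -/
def lobe (t : Terminal) (l : ℕ) : Set ℝ := {θ | |θ| ∈ Ico (p.phi t (l - 1)) (p.phi t l)}

lemma measurableSet_lobe (t : Terminal) (l : ℕ) : MeasurableSet (p.lobe t l) :=
  measurableSet_Ico.preimage (by fun_prop : Measurable fun θ : ℝ => |θ|)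

lemma pattern_eq_sum (t : Terminal) (θ : ℝ) :
    p.pattern t θ = ∑ l ∈ Finset.Icc 1 (p.K t), p.gam t l * (p.lobe t l).indicator 1 θ := rfl

lemma measurable_pattern (t : Terminal) : Measurable (p.pattern t) := by
  have : p.pattern t = fun θ => _ := funext (p.pattern_eq_sum t)
  rw [this]
  exact Finset.measurable_sum _ fun l _ =>
    (measurable_one.indicator (p.measurableSet_lobe t l)).const_mul _

lemma pattern_nonneg (t : Terminal) (θ : ℝ) : 0 ≤ p.pattern t θ :=
  Finset.sum_nonneg fun l hl => mul_nonneg (p.gam_nonneg t l hl)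
    (indicator_nonneg (fun _ _ => zero_le_one) _)

/-- An upper bound of the antenna gain. -/
def maxGain (t : Terminal) : ℝ := ∑ l ∈ Finset.Icc 1 (p.K t), p.gam t l

lemma pattern_le_maxGain (t : Terminal) (θ : ℝ) : p.pattern t θ ≤ p.maxGain t := by
  refine Finset.sum_le_sum fun l hl => mul_le_of_le_one_right (p.gam_nonneg t l hl) ?_
  exact indicator_le_self' (fun _ _ => zero_le_one) _

lemma maxGain_nonneg (t : Terminal) : 0 ≤ p.maxGain t :=
  Finset.sum_nonneg fun l hl => p.gam_nonneg t l hl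

lemma exists_mem_lobe (t : Terminal) {θ : ℝ} (hθ : |θ| < Real.pi) :
    ∃ l ∈ Finset.Icc 1 (p.K t), θ ∈ p.lobe t l := by
  have h : ∀ k ≤ p.K t, |θ| < p.phi t k → ∃ l ∈ Finset.Icc 1 k, θ ∈ p.lobe t l := by
    intro k
    induction k with
    | zero =>
      intro _ h
      rw [p.phi_zero] at h
      exact absurd (abs_nonneg θ) h.not_ge
    | succ k ih =>
      intro hk h
      rcases lt_or_ge |θ| (p.phi t k) with h1 | h1
      · obtain ⟨l, hl, hm⟩ := ih (by omega) h1
        exact ⟨l, Finset.Icc_subset_Icc_right (Nat.le_succ k) hl, hm⟩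
      · exact ⟨k + 1, by simp, h1, h⟩
  exact h _ le_rfl (by rwa [p.phi_last])

lemma eq_of_mem_lobe (t : Terminal) {θ : ℝ} {l l' : ℕ} (hl : l ∈ Finset.Icc 1 (p.K t))
    (hl' : l' ∈ Finset.Icc 1 (p.K t)) (h : θ ∈ p.lobe t l) (h' : θ ∈ p.lobe t l') : l = l' := by
  have key : ∀ a b : ℕ, b ∈ Finset.Icc 1 (p.K t) → θ ∈ p.lobe t a → θ ∈ p.lobe t b → ¬ a < b := by
    intro a b hb ha' hb' hab
    have := p.phi_le_phi t (i := a) (j := b - 1) (by omega)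
      ((Nat.sub_le b 1).trans (Finset.mem_Icc.1 hb).2)
    exact absurd (ha'.2.trans_le this) hb'.1.not_gt
  exact le_antisymm (not_lt.1 (key _ _ hl h' h)) (not_lt.1 (key _ _ hl' h h'))

/-- Expansion of a function of the antenna gain over the lobes. -/
lemma sum_lobe_indicator (t : Terminal) {θ : ℝ} (hθ : |θ| < Real.pi) (F : ℝ → ℂ) :
    F (p.pattern t θ) =
      ∑ l ∈ Finset.Icc 1 (p.K t), (p.lobe t l).indicator (fun _ => F (p.gam t l)) θ := by
  obtain ⟨l, hl, hm⟩ := p.exists_mem_lobe t hθ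
  have hz : ∀ l' ∈ Finset.Icc 1 (p.K t), l' ≠ l → θ ∉ p.lobe t l' := fun l' hl' hne h =>
    hne (p.eq_of_mem_lobe t hl' hl h hm)
  rw [p.pattern_eq_sum, Finset.sum_eq_single_of_mem l hl fun l' hl' hne => by
      rw [indicator_of_notMem (hz l' hl' hne), mul_zero],
    Finset.sum_eq_single_of_mem l hl fun l' hl' hne => by
      rw [indicator_of_notMem (hz l' hl' hne)],
    indicator_of_mem hm, indicator_of_mem hm, Pi.one_apply, mul_one]

/-- A lobe is symmetric in the sign of the angle: it is the difference of two centred open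
intervals, which accounts for the factor `2` in `lobeWidth`. -/
lemma volume_lobe (t : Terminal) {l : ℕ} (hl : l ∈ Finset.Icc 1 (p.K t)) :
    volume (Ico (-Real.pi) Real.pi ∩ p.lobe t l) = ENNReal.ofReal (p.lobeWidth t l) := by
  have hl2 := (Finset.mem_Icc.1 hl).2
  have ha := p.phi_nonneg t ((Nat.sub_le l 1).trans hl2)
  have hab := p.phi_le_phi t (Nat.sub_le l 1) hl2
  have hb := p.phi_le_pi t hl2
  have : Ico (-Real.pi) Real.pi ∩ p.lobe t l =
      Ioo (-p.phi t l) (p.phi t l) \ Ioo (-p.phi t (l - 1)) (p.phi t (l - 1)) := by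
    ext θ
    simp only [lobe, mem_inter_iff, mem_Ico, mem_ofPred_eq, Set.mem_sdiff, ← abs_lt, mem_Ioo,
      not_lt]
    constructor
    · exact fun h => ⟨h.2.2, h.2.1⟩
    · intro h
      have := abs_lt.1 (h.1.trans_le hb)
      exact ⟨⟨this.1.le, this.2⟩, h.2, h.1⟩
  rw [this, measure_sdiff (Ioo_subset_Ioo (by linarith) hab) nullMeasurableSet_Ioo (by simp),
    Real.volume_Ioo, Real.volume_Ioo, ← ENNReal.ofReal_sub _ (by linarith), lobeWidth]
  congr 1
  ring

end NetworkParams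


/-! ### The marks of the base stations -/

namespace NetworkParams

variable {S : Type*} [Fintype S] {B : ℕ} (p : NetworkParams S B)

/-- Laplace transform of the mark of a base station in state `s`. -/
def markLaplace (s : S) (w : ℂ) : ℂ :=
  p.pOff + (1 - p.pOff) * ∑ l₁ ∈ Finset.Icc 1 (p.K Terminal.bs),
    ∑ l₂ ∈ Finset.Icc 1 (p.K Terminal.mt),
      ((p.lobeWidth Terminal.bs l₁ / (2 * Real.pi) *
        (p.lobeWidth Terminal.mt l₂ / (2 * Real.pi)) : ℝ) : ℂ) *
        p.fadingMGF s (w * ((p.gam Terminal.bs l₁ * p.gam Terminal.mt l₂ : ℝ) : ℂ))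

/-- An upper bound of the mean mark of a base station in state `s`. -/
def maxMeanMark (s : S) : ℝ := p.maxGain Terminal.bs * p.maxGain Terminal.mt * p.Om s

lemma maxMeanMark_nonneg (s : S) : 0 ≤ p.maxMeanMark s :=
  mul_nonneg (mul_nonneg (p.maxGain_nonneg _) (p.maxGain_nonneg _)) (p.Om_pos s).le

lemma fadingMGF_eq_integral (s : S) {w : ℂ} (hw : 0 ≤ w.re) :
    ∫ x, Complex.exp (-(w * x)) ∂(gammaMeasure (p.m s) (p.m s / p.Om s)) = p.fadingMGF s w := by
  rw [integral_cexp_neg_mul_gammaMeasure (p.m_pos s) (div_pos (p.m_pos s) (p.Om_pos s)) hw,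
    fadingMGF, one_div_div]

end NetworkParams

namespace Network

lemma IsModel.measurableSet_iSup_sourceAlgebra {S Ω : Type*} {net : Network S Ω}
    {T : Set (Source S)} {i : Source S} (hi : i ∈ T) {A : Set Ω}
    (hA : MeasurableSet[net.sourceAlgebra i] A) :
    MeasurableSet[⨆ i ∈ T, net.sourceAlgebra i] A :=
  le_iSup₂_of_le (f := fun i (_ : i ∈ T) => net.sourceAlgebra i) i hi le_rfl _ hA

variable {S Ω : Type*} [Fintype S] {B : ℕ} (net : Network S Ω) (p : NetworkParams S B)

/-- Mark of the `n`-th base station in state `s`: product of the activity indicator, the antenna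
gain and the fading power gain. -/
def mark (s : S) (n : ℕ) (ω : Ω) : ℝ :=
  if net.active s n ω = true then
    p.pattern Terminal.bs (net.angle Terminal.bs s n ω) *
      p.pattern Terminal.mt (net.angle Terminal.mt s n ω) * max (net.fading s n ω) 0
  else 0

/-- The truncation of the fading at `0` inside `mark` makes this hold surely rather than almost
surely. It does not alter the interference, where negative terms are cut by `ENNReal.ofReal`. -/
lemma mark_nonneg (s : S) (n : ℕ) (ω : Ω) : 0 ≤ net.mark p s n ω := by
  unfold mark
  split_ifs
  · exact mul_nonneg (mul_nonneg (p.pattern_nonneg _ _) (p.pattern_nonneg _ _)) (le_max_right _ _)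
  · exact le_rfl

lemma mark_le (s : S) (n : ℕ) (ω : Ω) :
    net.mark p s n ω ≤
      p.maxGain Terminal.bs * p.maxGain Terminal.mt * max (net.fading s n ω) 0 := by
  have h0 : 0 ≤ max (net.fading s n ω) 0 := le_max_right _ _
  unfold mark
  split_ifs
  · exact mul_le_mul_of_nonneg_right (mul_le_mul (p.pattern_le_maxGain _ _)
      (p.pattern_le_maxGain _ _) (p.pattern_nonneg _ _) (p.maxGain_nonneg _)) h0
  · exact mul_nonneg (mul_nonneg (p.maxGain_nonneg _) (p.maxGain_nonneg _)) h0

/-- Labels of the sources of randomness attached to the `n`-th base station in state `s`. -/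
def markSources (s : S) (n : ℕ) : Set (Source S) :=
  {.active s n, .fading s n, .angle .bs s n, .angle .mt s n}

/-- Measurability with respect to the sources of this one base station is what transfers the
independence of the sources to the marks. -/
lemma measurable_mark (s : S) (n : ℕ) :
    Measurable[⨆ i ∈ markSources s n, net.sourceAlgebra i] (net.mark p s n) := by
  have hle : ∀ i ∈ markSources s n,
      net.sourceAlgebra i ≤ ⨆ i ∈ markSources s n, net.sourceAlgebra i :=
    fun i hi => le_iSup₂_of_le i hi le_rfl
  set m := ⨆ i ∈ markSources s n, net.sourceAlgebra i
  have ha : Measurable[m] (net.active s n) :=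
    (comap_measurable _).mono (hle (.active s n) (by simp [markSources])) le_rfl
  have hf : Measurable[m] (net.fading s n) :=
    (comap_measurable _).mono (hle (.fading s n) (by simp [markSources])) le_rfl
  have h1 : Measurable[m] (net.angle .bs s n) :=
    (comap_measurable _).mono (hle (.angle .bs s n) (by simp [markSources])) le_rfl
  have h2 : Measurable[m] (net.angle .mt s n) :=
    (comap_measurable _).mono (hle (.angle .mt s n) (by simp [markSources])) le_rfl
  refine Measurable.ite (ha (measurableSet_singleton true)) ?_ measurable_const
  exact (((p.measurable_pattern _).comp h1).mul ((p.measurable_pattern _).comp h2)).mul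
    (hf.max measurable_const)

variable [MeasurableSpace Ω] {μ : Measure Ω} {net p}

namespace IsModel

lemma sourceAlgebra_le (hnet : net.IsModel p μ) (i : Source S) :
    net.sourceAlgebra i ≤ ‹MeasurableSpace Ω› := by
  cases i with
  | process s =>
    exact ((hnet.poisson s).measurable_count.prodMk
      (measurable_pi_lambda _ (hnet.poisson s).measurable_point)).comap_le
  | active s n => exact (hnet.measurable_active s n).comap_le
  | fading s n => exact (hnet.measurable_fading s n).comap_le
  | angle t s n => exact (hnet.measurable_angle t s n).comap_le
  | serving s => exact (hnet.measurable_serving s).comap_le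

lemma iSup_sourceAlgebra_le (hnet : net.IsModel p μ) (T : Set (Source S)) :
    ⨆ i ∈ T, net.sourceAlgebra i ≤ ‹MeasurableSpace Ω› :=
  iSup₂_le fun i _ => hnet.sourceAlgebra_le i

lemma measurable_mark (hnet : net.IsModel p μ) (s : S) (n : ℕ) : Measurable (net.mark p s n) :=
  (net.measurable_mark p s n).mono (hnet.iSup_sourceAlgebra_le _) le_rfl

lemma integral_comp_fading (hnet : net.IsModel p μ) (s : S) (n : ℕ) {w : ℂ} (hw : 0 ≤ w.re) :
    ∫ ω, Complex.exp (-(w * (net.fading s n ω : ℂ))) ∂μ = p.fadingMGF s w := by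
  rw [← p.fadingMGF_eq_integral s hw, ← hnet.fading_law s n,
    integral_map (hnet.measurable_fading s n).aemeasurable]
  exact (by fun_prop : Measurable fun x : ℝ => Complex.exp (-(w * x))).aestronglyMeasurable

lemma integral_comp_servingFading (hnet : net.IsModel p μ) (s : S) {w : ℂ} (hw : 0 ≤ w.re) :
    ∫ ω, Complex.exp (-(w * (net.servingFading s ω : ℂ))) ∂μ = p.fadingMGF s w := by
  rw [← p.fadingMGF_eq_integral s hw, ← hnet.serving_law s,
    integral_map (hnet.measurable_serving s).aemeasurable]
  exact (by fun_prop : Measurable fun x : ℝ => Complex.exp (-(w * x))).aestronglyMeasurable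

lemma ae_fading_pos (hnet : net.IsModel p μ) (s : S) (n : ℕ) : ∀ᵐ ω ∂μ, 0 < net.fading s n ω := by
  have := ae_pos_gammaMeasure (p.m s) (p.m s / p.Om s)
  rw [← hnet.fading_law s n] at this
  exact ae_of_ae_map (hnet.measurable_fading s n).aemeasurable this

lemma ae_servingFading_pos (hnet : net.IsModel p μ) (s : S) :
    ∀ᵐ ω ∂μ, 0 < net.servingFading s ω := by
  have := ae_pos_gammaMeasure (p.m s) (p.m s / p.Om s)
  rw [← hnet.serving_law s] at this
  exact ae_of_ae_map (hnet.measurable_serving s).aemeasurable this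

/-- Excludes the angle `-π`, which belongs to `[-π, π)` but to no lobe. -/
lemma ae_abs_angle_lt (hnet : net.IsModel p μ) (t : Terminal) (s : S) (n : ℕ) :
    ∀ᵐ ω ∂μ, |net.angle t s n ω| < Real.pi := by
  have h := hnet.angle_law t s n
  rw [pdf.IsUniform] at h
  refine ae_of_ae_map (p := fun θ => |θ| < Real.pi) (hnet.measurable_angle t s n).aemeasurable ?_
  rw [h, ProbabilityTheory.cond]
  refine Measure.ae_smul_measure ?_ _
  refine (ae_restrict_iff' measurableSet_Ico).2 ?_
  filter_upwards [Measure.ae_ne volume (-Real.pi)] with θ hθ hm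
  exact abs_lt.2 ⟨lt_of_le_of_ne hm.1 hθ.symm, hm.2⟩

lemma measure_angle_mem_lobe (hnet : net.IsModel p μ) (t : Terminal) (s : S) (n : ℕ) {l : ℕ}
    (hl : l ∈ Finset.Icc 1 (p.K t)) :
    μ (net.angle t s n ⁻¹' p.lobe t l) = ENNReal.ofReal (p.lobeWidth t l / (2 * Real.pi)) := by
  have h := hnet.angle_law t s n
  rw [pdf.IsUniform] at h
  rw [← Measure.map_apply (hnet.measurable_angle t s n) (p.measurableSet_lobe t l), h,
    cond_apply measurableSet_Ico, p.volume_lobe t hl, Real.volume_Ico, sub_neg_eq_add, ← two_mul,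
    ← ENNReal.ofReal_inv_of_pos (by positivity), ← ENNReal.ofReal_mul (by positivity)]
  congr 1
  field_simp

variable (net p) in
/-- The event that the `n`-th base station in state `s` is active and that its interfering link
falls into given lobes of the two antennas. -/
def lobeEvent (s : S) (n l₁ l₂ : ℕ) : Set Ω :=
  net.active s n ⁻¹' {true} ∩ (net.angle .bs s n ⁻¹' p.lobe .bs l₁ ∩
    net.angle .mt s n ⁻¹' p.lobe .mt l₂)

/-- Labels of the sources of randomness that determine `lobeEvent`. -/
def lobeSources (s : S) (n : ℕ) : Set (Source S) :=
  {.active s n, .angle .bs s n, .angle .mt s n}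

lemma measurableSet_lobeEvent (s : S) (n l₁ l₂ : ℕ) :
    MeasurableSet[⨆ i ∈ lobeSources s n, net.sourceAlgebra i] (lobeEvent net p s n l₁ l₂) := by
  refine MeasurableSet.inter ?_ (MeasurableSet.inter ?_ ?_)
  · exact measurableSet_iSup_sourceAlgebra (i := .active s n) (by simp [lobeSources])
      ⟨_, measurableSet_singleton true, rfl⟩
  · exact measurableSet_iSup_sourceAlgebra (i := .angle .bs s n) (by simp [lobeSources])
      ⟨_, p.measurableSet_lobe _ _, rfl⟩
  · exact measurableSet_iSup_sourceAlgebra (i := .angle .mt s n) (by simp [lobeSources])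
      ⟨_, p.measurableSet_lobe _ _, rfl⟩

lemma measureReal_lobeEvent (hnet : net.IsModel p μ) (s : S) (n : ℕ) {l₁ l₂ : ℕ}
    (h₁ : l₁ ∈ Finset.Icc 1 (p.K .bs)) (h₂ : l₂ ∈ Finset.Icc 1 (p.K .mt)) :
    μ.real (lobeEvent net p s n l₁ l₂) =
      (1 - p.pOff) *
        (p.lobeWidth .bs l₁ / (2 * Real.pi) * (p.lobeWidth .mt l₂ / (2 * Real.pi))) := by
  have hi1 := hnet.independent.indep (i := .angle .bs s n) (j := .angle .mt s n) (by simp)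
  have hi2 := indep_iSup_of_disjoint hnet.sourceAlgebra_le hnet.independent
    (S := {.active s n}) (T := {.angle .bs s n, .angle .mt s n}) (by simp)
  rw [iSup_singleton] at hi2
  have e1 : μ (net.angle .bs s n ⁻¹' p.lobe .bs l₁ ∩ net.angle .mt s n ⁻¹' p.lobe .mt l₂) =
      μ (net.angle .bs s n ⁻¹' p.lobe .bs l₁) * μ (net.angle .mt s n ⁻¹' p.lobe .mt l₂) :=
    (Indep_iff _ _ _).1 hi1 _ _ ⟨_, p.measurableSet_lobe .bs l₁, rfl⟩
      ⟨_, p.measurableSet_lobe .mt l₂, rfl⟩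
  have e2 : μ (lobeEvent net p s n l₁ l₂) = μ (net.active s n ⁻¹' {true}) *
      μ (net.angle .bs s n ⁻¹' p.lobe .bs l₁ ∩ net.angle .mt s n ⁻¹' p.lobe .mt l₂) := by
    refine (Indep_iff _ _ _).1 hi2 _ _ ⟨_, measurableSet_singleton true, rfl⟩
      (MeasurableSet.inter ?_ ?_)
    · exact measurableSet_iSup_sourceAlgebra (i := .angle .bs s n) (by simp)
        ⟨_, p.measurableSet_lobe _ _, rfl⟩
    · exact measurableSet_iSup_sourceAlgebra (i := .angle .mt s n) (by simp)
        ⟨_, p.measurableSet_lobe _ _, rfl⟩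
  have hA : μ (net.active s n ⁻¹' {true}) = ENNReal.ofReal (1 - p.pOff) := hnet.active_law s n
  rw [measureReal_def, e2, e1, hA, hnet.measure_angle_mem_lobe .bs s n h₁,
    hnet.measure_angle_mem_lobe .mt s n h₂, ENNReal.toReal_mul, ENNReal.toReal_mul,
    ENNReal.toReal_ofReal (sub_nonneg.2 p.pOff_le_one),
    ENNReal.toReal_ofReal (div_nonneg (p.lobeWidth_nonneg _ h₁) (by positivity)),
    ENNReal.toReal_ofReal (div_nonneg (p.lobeWidth_nonneg _ h₂) (by positivity))]

lemma indep_lobeSources_fading (hnet : net.IsModel p μ) (s : S) (n : ℕ) :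
    Indep (⨆ i ∈ lobeSources s n, net.sourceAlgebra i)
      (MeasurableSpace.comap (net.fading s n) inferInstance) μ := by
  have := indep_iSup_of_disjoint hnet.sourceAlgebra_le hnet.independent
    (S := lobeSources s n) (T := {.fading s n}) (by simp [lobeSources])
  rwa [iSup_singleton] at this

/-- Laplace transform of the marks. -/
theorem integral_exp_neg_mul_mark [IsProbabilityMeasure μ] (hnet : net.IsModel p μ) (s : S) (n : ℕ)
    {w : ℂ} (hw : 0 ≤ w.re) :
    ∫ ω, Complex.exp (-(w * (net.mark p s n ω : ℂ))) ∂μ = p.markLaplace s w := by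
  classical
  let A := net.active s n ⁻¹' {true}
  let C : ℕ → ℕ → Set Ω := lobeEvent net p s n
  let Z : ℕ → ℕ → Ω → ℂ := fun l₁ l₂ ω =>
    Complex.exp (-(w * ((p.gam .bs l₁ * p.gam .mt l₂ : ℝ) : ℂ) * (net.fading s n ω : ℂ)))
  have hAm : MeasurableSet A := hnet.measurable_active s n (measurableSet_singleton true)
  have hCm : ∀ l₁ l₂, MeasurableSet (C l₁ l₂) := fun l₁ l₂ =>
    hnet.iSup_sourceAlgebra_le _ _ (measurableSet_lobeEvent s n l₁ l₂)
  have hAr : μ.real A = 1 - p.pOff := by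
    rw [measureReal_def, show μ A = ENNReal.ofReal (1 - p.pOff) from hnet.active_law s n,
      ENNReal.toReal_ofReal (sub_nonneg.2 p.pOff_le_one)]
  have hZm : ∀ l₁ l₂, Measurable (Z l₁ l₂) := fun l₁ l₂ => by
    have := hnet.measurable_fading s n
    fun_prop
  have hwre : ∀ l₁ ∈ Finset.Icc 1 (p.K .bs), ∀ l₂ ∈ Finset.Icc 1 (p.K .mt),
      0 ≤ (w * ((p.gam .bs l₁ * p.gam .mt l₂ : ℝ) : ℂ)).re := fun l₁ h₁ l₂ h₂ => by
    rw [Complex.re_mul_ofReal]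
    exact mul_nonneg hw (mul_nonneg (p.gam_nonneg _ _ h₁) (p.gam_nonneg _ _ h₂))
  have hZint : ∀ l₁ ∈ Finset.Icc 1 (p.K .bs), ∀ l₂ ∈ Finset.Icc 1 (p.K .mt),
      Integrable (Z l₁ l₂) μ := by
    intro l₁ h₁ l₂ h₂
    refine (integrable_const (1 : ℝ)).mono' (hZm l₁ l₂).aestronglyMeasurable ?_
    filter_upwards [hnet.ae_fading_pos s n] with ω hω
    rw [Complex.norm_exp, Real.exp_le_one_iff, Complex.neg_re, Complex.re_mul_ofReal]
    exact neg_nonpos.2 (mul_nonneg (hwre l₁ h₁ l₂ h₂) hω.le)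
  have hCZ : ∀ l₁ ∈ Finset.Icc 1 (p.K .bs), ∀ l₂ ∈ Finset.Icc 1 (p.K .mt),
      ∫ ω, (C l₁ l₂).indicator (Z l₁ l₂) ω ∂μ =
        ((1 - p.pOff : ℝ) : ℂ) * (((p.lobeWidth .bs l₁ / (2 * Real.pi) *
          (p.lobeWidth .mt l₂ / (2 * Real.pi)) : ℝ) : ℂ) *
          p.fadingMGF s (w * ((p.gam .bs l₁ * p.gam .mt l₂ : ℝ) : ℂ))) := by
    intro l₁ h₁ l₂ h₂
    rw [integral_indicator (hCm l₁ l₂)]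
    have := (hnet.indep_lobeSources_fading s n).setIntegral_eq_smul (hnet.iSup_sourceAlgebra_le _)
      (f := fun x : ℝ => Complex.exp (-(w * ((p.gam .bs l₁ * p.gam .mt l₂ : ℝ) : ℂ) * x)))
      (hnet.measurable_fading s n).aemeasurable
      (measurableSet_lobeEvent (net := net) (p := p) s n l₁ l₂)
      (by apply Measurable.aestronglyMeasurable; fun_prop)
    rw [this, hnet.integral_comp_fading s n (hwre l₁ h₁ l₂ h₂), hnet.measureReal_lobeEvent s n h₁ h₂,
      Complex.real_smul]
    push_cast
    ring
  -- An inactive station contributes the constant `1`. For an active one exactly one pair of lobes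
  -- occurs, and on that event the mark is a deterministic gain times the fading.
  have hdecomp : (fun ω => Complex.exp (-(w * (net.mark p s n ω : ℂ)))) =ᵐ[μ] fun ω =>
      Aᶜ.indicator (fun _ => (1 : ℂ)) ω + ∑ l₁ ∈ Finset.Icc 1 (p.K .bs),
        ∑ l₂ ∈ Finset.Icc 1 (p.K .mt), (C l₁ l₂).indicator (Z l₁ l₂) ω := by
    filter_upwards [hnet.ae_fading_pos s n, hnet.ae_abs_angle_lt .bs s n,
      hnet.ae_abs_angle_lt .mt s n] with ω h0 h1 h2
    by_cases hω : net.active s n ω = true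
    · have hωA : ω ∈ A := hω
      rw [indicator_of_notMem (by simpa using hωA), zero_add, mark, if_pos hω, max_eq_left h0.le]
      rw [p.sum_lobe_indicator .bs h1 (fun g => Complex.exp (-(w *
        ((g * p.pattern .mt (net.angle .mt s n ω) * net.fading s n ω : ℝ) : ℂ))))]
      refine Finset.sum_congr rfl fun l₁ _ => ?_
      rw [p.sum_lobe_indicator .mt h2 (fun g => (p.lobe .bs l₁).indicator (fun _ =>
        Complex.exp (-(w * ((p.gam .bs l₁ * g * net.fading s n ω : ℝ) : ℂ))))
          (net.angle .bs s n ω))]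
      refine Finset.sum_congr rfl fun l₂ _ => ?_
      by_cases ha : net.angle .bs s n ω ∈ p.lobe .bs l₁ <;>
        by_cases hb : net.angle .mt s n ω ∈ p.lobe .mt l₂ <;>
        simp [indicator, C, lobeEvent, Z, ha, hb, hω, mul_assoc]
    · have hωA : ω ∉ A := hω
      rw [indicator_of_mem (by simpa using hωA), mark, if_neg hω]
      simp [C, lobeEvent, hω]
  have hAc : μ.real Aᶜ = p.pOff := by
    rw [probReal_compl_eq_one_sub hAm, hAr]
    ring
  have hsum : Integrable (fun ω => ∑ l₁ ∈ Finset.Icc 1 (p.K .bs),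
      ∑ l₂ ∈ Finset.Icc 1 (p.K .mt), (C l₁ l₂).indicator (Z l₁ l₂) ω) μ :=
    integrable_finsetSum _ fun l₁ h₁ => integrable_finsetSum _ fun l₂ h₂ =>
      (hZint l₁ h₁ l₂ h₂).indicator (hCm l₁ l₂)
  rw [integral_congr_ae hdecomp, integral_add ((integrable_const _).indicator hAm.compl) hsum,
    integral_indicator_const _ hAm.compl, hAc,
    integral_finsetSum _ fun l₁ h₁ => integrable_finsetSum _ fun l₂ h₂ =>
      (hZint l₁ h₁ l₂ h₂).indicator (hCm l₁ l₂), NetworkParams.markLaplace, Finset.mul_sum]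
  congr 1
  · simp
  refine Finset.sum_congr rfl fun l₁ h₁ => ?_
  rw [integral_finsetSum _ fun l₂ h₂ => (hZint l₁ h₁ l₂ h₂).indicator (hCm l₁ l₂), Finset.mul_sum]
  refine Finset.sum_congr rfl fun l₂ h₂ => ?_
  rw [hCZ l₁ h₁ l₂ h₂]
  push_cast
  ring

lemma lintegral_mark_le (hnet : net.IsModel p μ) (s : S) (n : ℕ) :
    ∫⁻ ω, ENNReal.ofReal (net.mark p s n ω) ∂μ ≤ ENNReal.ofReal (p.maxMeanMark s) := by
  have h0 : 0 ≤ p.maxGain .bs * p.maxGain .mt :=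
    mul_nonneg (p.maxGain_nonneg _) (p.maxGain_nonneg _)
  calc ∫⁻ ω, ENNReal.ofReal (net.mark p s n ω) ∂μ
      ≤ ∫⁻ ω, ENNReal.ofReal (p.maxGain .bs * p.maxGain .mt) *
          ENNReal.ofReal (net.fading s n ω) ∂μ := by
        refine lintegral_mono fun ω => ?_
        rw [← ENNReal.ofReal_mul h0]
        refine (ENNReal.ofReal_le_ofReal (net.mark_le p s n ω)).trans ?_
        rw [ENNReal.ofReal_mul h0, ENNReal.ofReal_mul h0, ENNReal.ofReal_max]
        simp
    _ = ENNReal.ofReal (p.maxMeanMark s) := by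
        rw [lintegral_const_mul' _ _ ENNReal.ofReal_ne_top,
          ← lintegral_map (f := fun x : ℝ => ENNReal.ofReal x) (by fun_prop)
            (hnet.measurable_fading s n), hnet.fading_law s n,
          lintegral_ofReal_gammaMeasure (p.m_pos s) (div_pos (p.m_pos s) (p.Om_pos s)),
          ← ENNReal.ofReal_mul h0, NetworkParams.maxMeanMark]
        congr 2
        have := (p.m_pos s).ne'
        have := (p.Om_pos s).ne'
        field_simp

end IsModel

end Network


/-! ### Integrals against the planar intensity measure -/

/-- Mean value inequality for `exp` on the convex half-plane `Re ≤ 0`, where its derivative has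
modulus at most `1`. -/
lemma norm_one_sub_exp_neg_le {v : ℂ} (hv : 0 ≤ v.re) : ‖1 - Complex.exp (-v)‖ ≤ ‖v‖ := by
  have h := (convex_halfSpace_re_le 0).norm_image_sub_le_of_norm_hasDerivWithin_le
    (f := Complex.exp) (f' := Complex.exp) (C := 1) (x := -v) (y := 0)
    (fun x _ => (Complex.hasDerivAt_exp x).hasDerivWithinAt)
    (fun x hx => by
      rw [Complex.norm_exp, Real.exp_le_one_iff]
      exact hx)
    (by simpa using hv) (by simp)
  simpa using h

lemma norm_exp_neg_le_one {v : ℂ} (hv : 0 ≤ v.re) : ‖Complex.exp (-v)‖ ≤ 1 := by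
  rw [Complex.norm_exp, Real.exp_le_one_iff, Complex.neg_re]
  linarith

namespace NetworkParams

variable {S : Type*} [Fintype S] (p : NetworkParams S 1)

lemma measurable_pathLoss (s : S) : Measurable (p.pathLoss s) := by
  unfold pathLoss
  fun_prop

lemma pathLoss_nonneg (s : S) {r : ℝ} (hr : 0 ≤ r) : 0 ≤ p.pathLoss s r :=
  mul_nonneg (p.kap_pos s).le (Real.rpow_nonneg hr _)

instance sigmaFinite_planarIntensity (s : S) : SigmaFinite (p.planarIntensity s) :=
  SigmaFinite.withDensity_of_ne_top' fun _ => ENNReal.ofReal_ne_top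

lemma density_nonneg (s : S) (r : ℝ) : 0 ≤ p.lamBS * p.linkProb s r * p.Theta s :=
  mul_nonneg (mul_nonneg p.lamBS_pos.le (p.linkProb_nonneg s r)) (p.Theta_pos s).le

lemma measurable_density (s : S) :
    Measurable fun y : EuclideanSpace ℝ (Fin 2) =>
      ENNReal.ofReal (p.lamBS * p.linkProb s ‖y‖ * p.Theta s) := by
  have := (p.measurable_linkProb s).comp (measurable_norm (α := EuclideanSpace ℝ (Fin 2)))
  exact ((this.const_mul _).mul_const _).ennreal_ofReal

variable {F : Type*} [NormedAddCommGroup F] [NormedSpace ℝ F]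

lemma integrable_norm_planarIntensity (s : S) {g : ℝ → F} :
    Integrable (fun y => g ‖y‖) (p.planarIntensity s) ↔
      IntegrableOn (fun r => (r * p.linkProb s r) • g r) (Ioi 0) := by
  rw [planarIntensity, integrable_withDensity_iff_integrable_smul' (p.measurable_density s)
    (.of_forall fun _ => ENNReal.ofReal_lt_top)]
  simp_rw [ENNReal.toReal_ofReal (p.density_nonneg s _)]
  rw [integrable_fun_norm_addHaar volume
    (f := fun r => (p.lamBS * p.linkProb s r * p.Theta s) • g r)]
  have h0 : p.lamBS * p.Theta s ≠ 0 := (mul_pos p.lamBS_pos (p.Theta_pos s)).ne'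
  have : (fun y : ℝ => y ^ (Module.finrank ℝ (EuclideanSpace ℝ (Fin 2)) - 1) •
      (p.lamBS * p.linkProb s y * p.Theta s) • g y) =
      fun r => (p.lamBS * p.Theta s) • ((r * p.linkProb s r) • g r) := by
    ext y
    rw [finrank_euclideanSpace_fin, smul_smul, smul_smul]
    congr 1
    ring
  rw [this]
  exact integrable_smul_iff h0 _

/-- Polar coordinates: twice the area `π` of the unit disc, weighted by `r`. -/
lemma integral_norm_planarIntensity (s : S) (g : ℝ → F) :
    ∫ y, g ‖y‖ ∂(p.planarIntensity s) =
      (2 * Real.pi * p.lamBS * p.Theta s) • ∫ r in Ioi (0 : ℝ), (r * p.linkProb s r) • g r := by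
  rw [planarIntensity, integral_withDensity_eq_integral_toReal_smul (p.measurable_density s)
    (.of_forall fun _ => ENNReal.ofReal_lt_top)]
  simp_rw [ENNReal.toReal_ofReal (p.density_nonneg s _)]
  rw [integral_fun_norm_addHaar volume
    (f := fun r => (p.lamBS * p.linkProb s r * p.Theta s) • g r), finrank_euclideanSpace_fin]
  have hball : volume.real (Metric.ball (0 : EuclideanSpace ℝ (Fin 2)) 1) = Real.pi := by
    rw [measureReal_def, EuclideanSpace.volume_ball_fin_two]
    simp [Real.pi_pos.le]
  have : ∀ y : ℝ, y ^ (2 - 1) • (p.lamBS * p.linkProb s y * p.Theta s) • g y =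
      (p.lamBS * p.Theta s) • ((y * p.linkProb s y) • g y) := fun y => by
    rw [smul_smul, smul_smul]
    congr 1
    ring
  simp_rw [this]
  rw [integral_smul, hball, ← Nat.cast_smul_eq_nsmul ℝ, smul_smul, smul_smul]
  congr 1
  push_cast
  ring

/-- Region of the plane where the path-loss of a link of state `s` is less than `ξ`. -/
def lossBall (s : S) (ξ : ℝ) : Set (EuclideanSpace ℝ (Fin 2)) := {y | p.pathLoss s ‖y‖ < ξ}

lemma measurableSet_lossBall (s : S) (ξ : ℝ) : MeasurableSet (p.lossBall s ξ) :=
  measurableSet_lt ((p.measurable_pathLoss s).comp measurable_norm) measurable_const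

lemma lossBall_indicator (s : S) {ξ : ℝ} (hξ : 0 ≤ ξ) {y : EuclideanSpace ℝ (Fin 2)} :
    (p.lossBall s ξ).indicator (fun _ => (1 : ℝ)) y =
      (Iio (p.lossRadius s ξ)).indicator (fun _ => (1 : ℝ)) ‖y‖ := by
  have := p.pathLoss_lt_iff s (norm_nonneg y) hξ
  by_cases h : ‖y‖ < p.lossRadius s ξ <;> simp [indicator, lossBall, this, h]

lemma mul_linkProb_smul_indicator (s : S) (R : ℝ) :
    (fun r => (r * p.linkProb s r) • (Iio R).indicator (fun _ => (1 : ℝ)) r) =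
      (Iio R).indicator (fun r => p.linkProb s r * r) := by
  ext r
  by_cases h : r < R <;> simp [indicator, h, mul_comm]

/-- Path-loss is increasing in the distance, so this region is a disc. The lemma identifies the
analytic `Λ_s([0, ξ))` with an intensity of the planar process; finiteness is established first so
that real integrals can be compared. -/
lemma planarIntensity_lossBall (s : S) {ξ : ℝ} (hξ : 0 ≤ ξ) :
    p.planarIntensity s (p.lossBall s ξ) = ENNReal.ofReal (p.intensity s ξ) := by
  have hR := p.lossRadius_nonneg s hξ
  have hint : Integrable ((p.lossBall s ξ).indicator fun _ => (1 : ℝ)) (p.planarIntensity s) := by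
    have : (p.lossBall s ξ).indicator (fun _ => (1 : ℝ)) =
        fun y => (Iio (p.lossRadius s ξ)).indicator (fun _ => (1 : ℝ)) ‖y‖ :=
      funext fun y => p.lossBall_indicator s hξ
    rw [this, p.integrable_norm_planarIntensity, p.mul_linkProb_smul_indicator, IntegrableOn,
      integrable_indicator_iff measurableSet_Iio, IntegrableOn,
      Measure.restrict_restrict measurableSet_Iio, inter_comm, Ioi_inter_Iio]
    have h := p.intervalIntegrable_linkProb s 0 _ le_rfl hR
    rw [intervalIntegrable_iff_integrableOn_Ioo_of_le hR] at h
    exact h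
  have hfin : p.planarIntensity s (p.lossBall s ξ) ≠ ∞ := by
    rw [integrable_indicator_iff (p.measurableSet_lossBall s ξ)] at hint
    have := (integrableOn_const_iff (by simp)).1 hint
    simpa [lt_top_iff_ne_top] using this
  rw [← ENNReal.ofReal_toReal hfin, ← measureReal_def]
  congr 1
  have h1 := integral_indicator_const (μ := p.planarIntensity s) (1 : ℝ)
    (p.measurableSet_lossBall s ξ)
  simp_rw [p.lossBall_indicator s hξ] at h1
  rw [p.integral_norm_planarIntensity s, p.mul_linkProb_smul_indicator,
    integral_indicator measurableSet_Iio, Measure.restrict_restrict measurableSet_Iio, inter_comm,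
    Ioi_inter_Iio, ← integral_Ioc_eq_integral_Ioo, ← intervalIntegral.integral_of_le hR] at h1
  rw [smul_eq_mul, smul_eq_mul, mul_one] at h1
  exact h1.symm

lemma intensity_nonneg (s : S) {ξ : ℝ} (hξ : 0 ≤ ξ) : 0 ≤ p.intensity s ξ := by
  have := p.lossRadius_nonneg s hξ
  refine mul_nonneg (mul_nonneg (mul_nonneg (by positivity) p.lamBS_pos.le) (p.Theta_pos s).le) ?_
  exact intervalIntegral.integral_nonneg this fun r hr =>
    mul_nonneg (p.linkProb_nonneg s r) hr.1

/-! ### The exponent as an integral -/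

/-- The transform is an expectation over the gamma law, so `|1 - e^{-wX}| ≤ |w| X` integrates to
`|w|` times the mean. -/
lemma norm_one_sub_fadingMGF_le (s : S) {w : ℂ} (hw : 0 ≤ w.re) :
    ‖1 - p.fadingMGF s w‖ ≤ ‖w‖ * p.Om s := by
  have hm := p.m_pos s
  have hO := p.Om_pos s
  have hprob : IsProbabilityMeasure (gammaMeasure (p.m s) (p.m s / p.Om s)) :=
    isProbabilityMeasure_gammaMeasure hm (div_pos hm hO)
  have hmeas : Measurable fun x : ℝ => Complex.exp (-(w * x)) := by fun_prop
  have hre : ∀ x : ℝ, 0 < x → 0 ≤ (w * x).re := fun x hx => by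
    rw [Complex.re_mul_ofReal]
    exact mul_nonneg hw hx.le
  have hint : Integrable (fun x : ℝ => Complex.exp (-(w * x)))
      (gammaMeasure (p.m s) (p.m s / p.Om s)) := by
    refine (integrable_const (1 : ℝ)).mono' hmeas.aestronglyMeasurable ?_
    filter_upwards [ae_pos_gammaMeasure _ _] with x hx using norm_exp_neg_le_one (hre x hx)
  rw [← p.fadingMGF_eq_integral s hw]
  have h1 : 1 - ∫ x, Complex.exp (-(w * x)) ∂(gammaMeasure (p.m s) (p.m s / p.Om s)) =
      ∫ x, (1 - Complex.exp (-(w * x))) ∂(gammaMeasure (p.m s) (p.m s / p.Om s)) := by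
    rw [integral_sub (integrable_const _) hint]
    simp
  rw [h1]
  have hlint : ∫⁻ x, ENNReal.ofReal x ∂(gammaMeasure (p.m s) (p.m s / p.Om s)) =
      ENNReal.ofReal (p.Om s) := by
    rw [lintegral_ofReal_gammaMeasure hm (div_pos hm hO), div_div_cancel₀ hm.ne']
  have hnn : ∀ᵐ x ∂(gammaMeasure (p.m s) (p.m s / p.Om s)), 0 ≤ x := by
    filter_upwards [ae_pos_gammaMeasure _ _] with x hx using hx.le
  have hid : Integrable (fun x : ℝ => x) (gammaMeasure (p.m s) (p.m s / p.Om s)) := by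
    refine ⟨by fun_prop, ?_⟩
    rw [hasFiniteIntegral_iff_ofReal hnn, hlint]
    exact ENNReal.ofReal_lt_top
  have hmean : ∫ x, x ∂(gammaMeasure (p.m s) (p.m s / p.Om s)) = p.Om s := by
    rw [integral_eq_lintegral_of_nonneg_ae hnn (by fun_prop), hlint, ENNReal.toReal_ofReal hO.le]
  calc ‖∫ x, (1 - Complex.exp (-(w * x))) ∂(gammaMeasure (p.m s) (p.m s / p.Om s))‖
      ≤ ∫ x, ‖w‖ * x ∂(gammaMeasure (p.m s) (p.m s / p.Om s)) := by
        refine norm_integral_le_of_norm_le (hid.const_mul _) ?_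
        filter_upwards [ae_pos_gammaMeasure _ _] with x hx
        refine (norm_one_sub_exp_neg_le (hre x hx)).trans (le_of_eq ?_)
        rw [norm_mul, Complex.norm_real, Real.norm_of_nonneg hx.le]
    _ = ‖w‖ * p.Om s := by rw [integral_const_mul, hmean]

/-- The integrand decays like `r^{1-α}`; this is where `α > 2` makes the total far interference have
finite mean. -/
lemma integrableOn_rpow_neg (s : S) {ρ : ℝ} (hρ : 0 < ρ) :
    IntegrableOn (fun r : ℝ => r * (ρ / r) ^ p.alp s) (Ioi ρ) := by
  have h : IntegrableOn (fun x : ℝ => ρ ^ p.alp s * x ^ (1 - p.alp s)) (Ioi ρ) :=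
    (integrableOn_Ioi_rpow_of_lt (by linarith [p.two_lt_alp s]) hρ).const_mul _
  refine h.congr_fun (fun r hr => ?_) measurableSet_Ioi
  have hr0 : 0 < r := hρ.trans hr
  beta_reduce
  rw [Real.div_rpow hρ.le hr0.le, Real.rpow_sub hr0, Real.rpow_one]
  field_simp

lemma integral_rpow_neg (s : S) {ρ : ℝ} (hρ : 0 < ρ) :
    ∫ r in Ioi ρ, r * (ρ / r) ^ p.alp s = ρ ^ 2 / (p.alp s - 2) := by
  have h2 := p.two_lt_alp s
  have h : ∫ r in Ioi ρ, r * (ρ / r) ^ p.alp s = ∫ r in Ioi ρ, ρ ^ p.alp s * r ^ (1 - p.alp s) := by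
    refine setIntegral_congr_fun measurableSet_Ioi fun r hr => ?_
    have hr0 : 0 < r := hρ.trans hr
    rw [Real.div_rpow hρ.le hr0.le, Real.rpow_sub hr0, Real.rpow_one]
    field_simp
  rw [h, integral_const_mul, integral_Ioi_rpow_of_lt (by linarith) hρ]
  have h3 : ρ ^ p.alp s * ρ ^ (1 - p.alp s + 1) = ρ ^ 2 := by
    rw [← Real.rpow_add hρ, ← Real.rpow_natCast]
    congr 1
    push_cast
    ring
  have h4 : 1 - p.alp s + 1 ≠ 0 := by linarith
  have h5 : p.alp s - 2 ≠ 0 := by linarith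
  rw [mul_div_assoc', mul_neg, h3, div_eq_div_iff h4 h5]
  ring

/-- Scaling by `ρ` extracts `ρ²`, and the substitution `t = u^{-α}` maps `(1, ∞)` onto `(0, 1)` and
produces the hypergeometric integral with `δ = 2 / α`. -/
lemma integral_mul_one_sub_cpow (s : S) (c : ℂ) {ρ : ℝ} (hρ : 0 < ρ) :
    ∫ r in Ioi ρ, (r : ℂ) * (1 - (1 + c * (((ρ / r) ^ p.alp s : ℝ) : ℂ)) ^ (-(p.m s : ℂ))) =
      ρ ^ 2 / 2 * (hypergeometricIntegral (p.m s) (2 / p.alp s) (-c) - 1) := by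
  have hα := p.alp_pos s
  set α := p.alp s with hαdef
  set δ := 2 / α with hδ
  let h : ℝ → ℂ := fun t => 1 - (1 + c * (t : ℂ)) ^ (-(p.m s : ℂ))
  let G : ℝ → ℂ := (Iio (1 : ℝ)).indicator fun t => ((δ * t ^ (-δ - 1) : ℝ) : ℂ) * h t
  have e1 : ∫ r in Ioi ρ, (r : ℂ) * h ((ρ / r) ^ α) =
      ρ ^ 2 * ∫ u in Ioi (1 : ℝ), (u : ℂ) * h (u ^ (-α)) := by
    have h1 := integral_comp_mul_left_Ioi (fun r : ℝ => (r : ℂ) * h ((ρ / r) ^ α)) 1 hρ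
    rw [mul_one] at h1
    have h2 : ∫ u in Ioi (1 : ℝ), ((ρ * u : ℝ) : ℂ) * h ((ρ / (ρ * u)) ^ α) =
        ρ * ∫ u in Ioi (1 : ℝ), (u : ℂ) * h (u ^ (-α)) := by
      rw [← integral_const_mul]
      refine setIntegral_congr_fun measurableSet_Ioi fun u hu => ?_
      have hu0 : 0 < u := one_pos.trans hu
      rw [show ρ / (ρ * u) = u⁻¹ by field_simp, Real.inv_rpow hu0.le, ← Real.rpow_neg hu0.le]
      push_cast
      ring
    rw [h2, Complex.real_smul] at h1
    have hρ' : (ρ : ℂ) ≠ 0 := by exact_mod_cast hρ.ne'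
    rw [eq_comm, Complex.ofReal_inv, inv_mul_eq_iff_eq_mul₀ hρ'] at h1
    rw [h1]
    ring
  have e2 : ∫ u in Ioi (1 : ℝ), (u : ℂ) * h (u ^ (-α)) = (1 / 2 : ℂ) * ∫ t in Ioi (0 : ℝ), G t := by
    rw [← integral_comp_rpow_Ioi G (neg_ne_zero.2 hα.ne'), ← integral_const_mul,
      ← integral_indicator measurableSet_Ioi, ← integral_indicator measurableSet_Ioi]
    refine integral_congr_ae ?_
    filter_upwards [Measure.ae_ne volume (1 : ℝ)] with u hu1
    rcases lt_trichotomy u 1 with hlt | heq | hgt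
    · rw [indicator_of_notMem (by simpa using hlt.le)]
      by_cases hu0 : 0 < u
      · rw [indicator_of_mem (show u ∈ Ioi 0 from hu0)]
        have : (1 : ℝ) ≤ u ^ (-α) := Real.one_le_rpow_of_pos_of_le_one_of_nonpos hu0 hlt.le
          (by linarith)
        simp [G, indicator_of_notMem, this.not_gt]
      · rw [indicator_of_notMem (by simpa using hu0)]
    · exact absurd heq hu1
    · have hu0 : 0 < u := one_pos.trans hgt
      have hlt : u ^ (-α) < 1 := Real.rpow_lt_one_of_one_lt_of_neg hgt (by linarith)
      rw [indicator_of_mem (show u ∈ Ioi 1 from hgt), indicator_of_mem (show u ∈ Ioi 0 from hu0)]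
      simp only [G, indicator_of_mem (show u ^ (-α) ∈ Iio 1 from hlt), Complex.real_smul]
      -- Since `α δ = 2`, the Jacobian times the weight `δ t^{-δ-1}` at `t = u^{-α}` is exactly `2
      -- u`; hence the factor `1 / 2` in front.
      have h3 : |(-α)| * u ^ (-α - 1) * (δ * (u ^ (-α)) ^ (-δ - 1)) = 2 * u := by
        rw [abs_neg, abs_of_pos hα, ← Real.rpow_mul hu0.le]
        have : u ^ (-α - 1) * u ^ (-α * (-δ - 1)) = u := by
          rw [← Real.rpow_add hu0]
          conv_rhs => rw [← Real.rpow_one u]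
          congr 1
          rw [hδ]
          field_simp
          ring
        calc α * u ^ (-α - 1) * (δ * u ^ (-α * (-δ - 1)))
            = α * δ * (u ^ (-α - 1) * u ^ (-α * (-δ - 1))) := by ring
          _ = 2 * u := by
            rw [this, hδ]
            field_simp
      rw [← mul_assoc ((|(-α)| * u ^ (-α - 1) : ℝ) : ℂ), ← Complex.ofReal_mul, h3]
      push_cast
      ring
  have e3 : ∫ t in Ioi (0 : ℝ), G t =
      δ * ∫ t in Ioc (0 : ℝ) 1, -(((t ^ (-δ - 1) : ℝ) : ℂ) *
        ((1 - t * (-c)) ^ (-(p.m s : ℂ)) - 1)) := by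
    rw [integral_indicator measurableSet_Iio, Measure.restrict_restrict measurableSet_Iio,
      inter_comm, Ioi_inter_Iio, ← integral_Ioc_eq_integral_Ioo, ← integral_const_mul]
    refine integral_congr_ae (.of_forall fun t => ?_)
    simp only [h]
    push_cast
    ring_nf
  have e0 : ∫ r in Ioi ρ, (r : ℂ) * (1 - (1 + c * (((ρ / r) ^ α : ℝ) : ℂ)) ^ (-(p.m s : ℂ))) =
      ∫ r in Ioi ρ, (r : ℂ) * h ((ρ / r) ^ α) := rfl
  rw [e0, e1, e2, e3, integral_neg, hypergeometricIntegral]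
  ring

end NetworkParams


/-! ### Radial tail integrals and the mean interference beyond a given path-loss. -/

namespace NetworkParams

variable {S : Type*} [Fintype S] (p : NetworkParams S 1)

/-- In the normalization by `P_RB / x` only the ratio of `r` to the radius of loss `x` matters, and
the path-loss constant disappears. -/
lemma div_pathLoss (s : S) {x r : ℝ} (hx : 0 ≤ x) (hr : 0 < r) :
    x / p.pathLoss s r = (p.lossRadius s x / r) ^ p.alp s := by
  conv_lhs => rw [← p.pathLoss_lossRadius s hx]
  rw [pathLoss, pathLoss, mul_div_mul_left _ _ (p.kap_pos s).ne',
    Real.div_rpow (p.lossRadius_nonneg s hx) hr.le]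

section Tail

variable {F : Type*} [NormedAddCommGroup F] [NormedSpace ℝ F]

lemma tail_eq_indicator (s : S) {x : ℝ} (hx : 0 < x) (g : ℝ → F) :
    ∀ r ∈ Ioi (0 : ℝ), (r * p.linkProb s r) •
      (if x < p.pathLoss s r then g (x / p.pathLoss s r) else 0) =
      (Ioi (p.lossRadius s x)).indicator
        (fun r => (r * p.linkProb s r) • g ((p.lossRadius s x / r) ^ p.alp s)) r := by
  intro r hr
  have := p.lt_pathLoss_iff s (le_of_lt hr) hx.le
  rw [p.div_pathLoss s hx.le hr]
  by_cases h : p.lossRadius s x < r <;> simp [h, this]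

lemma integrable_tail (s : S) {x : ℝ} (hx : 0 < x) (g : ℝ → F) :
    Integrable (fun y : EuclideanSpace ℝ (Fin 2) =>
      if x < p.pathLoss s ‖y‖ then g (x / p.pathLoss s ‖y‖) else 0) (p.planarIntensity s) ↔
    IntegrableOn (fun r => (r * p.linkProb s r) • g ((p.lossRadius s x / r) ^ p.alp s))
      (Ioi (p.lossRadius s x)) := by
  rw [p.integrable_norm_planarIntensity s
    (g := fun r => if x < p.pathLoss s r then g (x / p.pathLoss s r) else 0),
    integrableOn_congr_fun (p.tail_eq_indicator s hx g) measurableSet_Ioi, IntegrableOn,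
    integrable_indicator_iff measurableSet_Ioi, IntegrableOn,
    Measure.restrict_restrict measurableSet_Ioi, Ioi_inter_Ioi,
    max_eq_left (p.lossRadius_nonneg s hx.le), IntegrableOn]

lemma integral_tail (s : S) {x : ℝ} (hx : 0 < x) (g : ℝ → F) :
    ∫ y, (if x < p.pathLoss s ‖y‖ then g (x / p.pathLoss s ‖y‖) else 0) ∂(p.planarIntensity s) =
    (2 * Real.pi * p.lamBS * p.Theta s) • ∫ r in Ioi (p.lossRadius s x),
      (r * p.linkProb s r) • g ((p.lossRadius s x / r) ^ p.alp s) := by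
  rw [p.integral_norm_planarIntensity s
    (fun r => if x < p.pathLoss s r then g (x / p.pathLoss s r) else 0),
    setIntegral_congr_fun measurableSet_Ioi (p.tail_eq_indicator s hx g),
    integral_indicator measurableSet_Ioi, Measure.restrict_restrict measurableSet_Ioi,
    Ioi_inter_Ioi, max_eq_left (p.lossRadius_nonneg s hx.le)]

end Tail

/-- Coefficient of the growth in `x` of the mean interference normalized by `P_RB / x`. -/
def tailCoeff (s : S) : ℝ := 2 * Real.pi * p.lamBS * p.Theta s / (p.alp s - 2)

lemma tailCoeff_nonneg (s : S) : 0 ≤ p.tailCoeff s := by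
  have := p.lamBS_pos
  have := p.Theta_pos s
  exact div_nonneg (by positivity) (by linarith [p.two_lt_alp s])

lemma integrableOn_mul_linkProb_rpow (s : S) {ρ : ℝ} (hρ : 0 < ρ) :
    IntegrableOn (fun r => (r * p.linkProb s r) • (ρ / r) ^ p.alp s) (Ioi ρ) := by
  refine (p.integrableOn_rpow_neg s hρ).mono' ?_ ?_
  · have := p.measurable_linkProb s
    exact (by fun_prop : Measurable _).aestronglyMeasurable
  · refine (ae_restrict_iff' measurableSet_Ioi).2 (.of_forall fun r hr => ?_)
    have hr0 : 0 < r := hρ.trans hr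
    have h1 : 0 ≤ (ρ / r) ^ p.alp s := by positivity
    rw [smul_eq_mul, Real.norm_of_nonneg
      (mul_nonneg (mul_nonneg hr0.le (p.linkProb_nonneg s r)) h1)]
    exact mul_le_mul_of_nonneg_right (mul_le_of_le_one_right hr0.le (p.linkProb_le_one s hr0.le)) h1

lemma integrable_lossRatio (s : S) {x : ℝ} (hx : 0 < x) :
    Integrable (fun y : EuclideanSpace ℝ (Fin 2) =>
      if x < p.pathLoss s ‖y‖ then x / p.pathLoss s ‖y‖ else 0) (p.planarIntensity s) :=
  (p.integrable_tail s hx fun t : ℝ => t).2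
    (p.integrableOn_mul_linkProb_rpow s (p.lossRadius_pos s hx))

lemma lossRatio_nonneg (s : S) {x : ℝ} (hx : 0 < x) (y : EuclideanSpace ℝ (Fin 2)) :
    0 ≤ if x < p.pathLoss s ‖y‖ then x / p.pathLoss s ‖y‖ else 0 := by
  split_ifs
  · exact div_nonneg hx.le (p.pathLoss_nonneg s (norm_nonneg y))
  · exact le_rfl

/-- The link probability is bounded by `1`; the remaining power integral is `ρ² / (α - 2)` with `ρ²
= (x / κ)^{2/α}`. -/
lemma lintegral_lossRatio_le (s : S) {x : ℝ} (hx : 0 < x) :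
    ∫⁻ y, ENNReal.ofReal (if x < p.pathLoss s ‖y‖ then x / p.pathLoss s ‖y‖ else 0)
        ∂(p.planarIntensity s) ≤
      ENNReal.ofReal (p.tailCoeff s * (x / p.kap s) ^ (2 / p.alp s)) := by
  have hρ := p.lossRadius_pos s hx
  rw [← ofReal_integral_eq_lintegral_ofReal (p.integrable_lossRatio s hx)
    (.of_forall (p.lossRatio_nonneg s hx)), p.integral_tail s hx fun t : ℝ => t]
  refine ENNReal.ofReal_le_ofReal ?_
  have h1 : ∫ r in Ioi (p.lossRadius s x),
      (r * p.linkProb s r) • (p.lossRadius s x / r) ^ p.alp s ≤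
      ∫ r in Ioi (p.lossRadius s x), r * (p.lossRadius s x / r) ^ p.alp s := by
    refine setIntegral_mono_on (p.integrableOn_mul_linkProb_rpow s hρ)
      (p.integrableOn_rpow_neg s hρ) measurableSet_Ioi fun r hr => ?_
    have hr0 : 0 < r := hρ.trans hr
    exact mul_le_mul_of_nonneg_right
      (mul_le_of_le_one_right hr0.le (p.linkProb_le_one s hr0.le)) (by positivity)
  rw [p.integral_rpow_neg s hρ, p.lossRadius_sq s hx.le] at h1
  have h2 : 0 ≤ 2 * Real.pi * p.lamBS * p.Theta s := by
    have := p.lamBS_pos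
    have := p.Theta_pos s
    positivity
  refine (mul_le_mul_of_nonneg_left h1 h2).trans (le_of_eq ?_)
  rw [tailCoeff]
  ring

/-! ### Integrals of the Laplace transform of the marks -/

lemma sum_sum_lobeWidth : ∑ l₁ ∈ Finset.Icc 1 (p.K Terminal.bs),
    ∑ l₂ ∈ Finset.Icc 1 (p.K Terminal.mt), p.lobeWidth Terminal.bs l₁ / (2 * Real.pi) *
      (p.lobeWidth Terminal.mt l₂ / (2 * Real.pi)) = 1 := by
  rw [← Finset.sum_mul_sum, sum_lobeWidth, sum_lobeWidth, mul_one]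

/-- The lobe weights sum to `1`, so the constant for inactive stations cancels and `1 - p_off`
factors out; it ends up in `λ^{(I)}`. -/
lemma one_sub_markLaplace (s : S) (w : ℂ) :
    1 - p.markLaplace s w = (1 - p.pOff) * ∑ l₁ ∈ Finset.Icc 1 (p.K Terminal.bs),
    ∑ l₂ ∈ Finset.Icc 1 (p.K Terminal.mt),
      ((p.lobeWidth Terminal.bs l₁ / (2 * Real.pi) *
        (p.lobeWidth Terminal.mt l₂ / (2 * Real.pi)) : ℝ) : ℂ) *
        (1 - p.fadingMGF s (w * ((p.gam Terminal.bs l₁ * p.gam Terminal.mt l₂ : ℝ) : ℂ))) := by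
  have h := congrArg (fun t : ℝ => (t : ℂ)) p.sum_sum_lobeWidth
  simp only [Complex.ofReal_sum, Complex.ofReal_one] at h
  simp only [mul_sub, mul_one, Finset.sum_sub_distrib, h]
  rw [markLaplace]
  ring

lemma gam_mul_nonneg {l₁ l₂ : ℕ} (h₁ : l₁ ∈ Finset.Icc 1 (p.K Terminal.bs))
    (h₂ : l₂ ∈ Finset.Icc 1 (p.K Terminal.mt)) :
    0 ≤ p.gam Terminal.bs l₁ * p.gam Terminal.mt l₂ :=
  mul_nonneg (p.gam_nonneg _ _ h₁) (p.gam_nonneg _ _ h₂)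

lemma re_mul_ofReal_nonneg {w : ℂ} (hw : 0 ≤ w.re) {t : ℝ} (ht : 0 ≤ t) : 0 ≤ (w * t).re := by
  rw [Complex.re_mul_ofReal]
  exact mul_nonneg hw ht

lemma measurable_fadingMGF (s : S) : Measurable (p.fadingMGF s) := by
  unfold fadingMGF
  fun_prop

lemma integrableOn_one_sub_fadingMGF (s : S) {z : ℂ} (hz : 0 ≤ z.re) {γ : ℝ} (hγ : 0 ≤ γ) {ρ : ℝ}
    (hρ : 0 < ρ) : IntegrableOn (fun r : ℝ => (r : ℂ) *
      (1 - p.fadingMGF s (z * (((ρ / r) ^ p.alp s : ℝ) : ℂ) * (γ : ℂ)))) (Ioi ρ) := by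
  refine ((p.integrableOn_rpow_neg s hρ).const_mul (‖z‖ * γ * p.Om s)).mono' ?_ ?_
  · have := p.measurable_fadingMGF s
    exact (by fun_prop : Measurable _).aestronglyMeasurable
  · refine (ae_restrict_iff' measurableSet_Ioi).2 (.of_forall fun r hr => ?_)
    have hr0 : 0 < r := hρ.trans hr
    have h0 : 0 ≤ (ρ / r) ^ p.alp s := by positivity
    have h1 := p.norm_one_sub_fadingMGF_le s
      (re_mul_ofReal_nonneg (re_mul_ofReal_nonneg hz h0) hγ)
    rw [norm_mul, norm_mul, Complex.norm_real, Complex.norm_real, Real.norm_of_nonneg h0,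
      Real.norm_of_nonneg hγ] at h1
    rw [norm_mul, Complex.norm_real, Real.norm_of_nonneg hr0.le]
    refine (mul_le_mul_of_nonneg_left h1 hr0.le).trans (le_of_eq ?_)
    ring

/-- For `Re z ≥ 0` the argument `-z γ Ω / m` has nonpositive real part and avoids the cut `[1, ∞)`,
so the integral representation applies. -/
lemma integral_one_sub_fadingMGF (s : S) {z : ℂ} (hz : 0 ≤ z.re) {γ : ℝ} (hγ : 0 ≤ γ) {ρ : ℝ}
    (hρ : 0 < ρ) : ∫ r in Ioi ρ, (r : ℂ) *
      (1 - p.fadingMGF s (z * (((ρ / r) ^ p.alp s : ℝ) : ℂ) * (γ : ℂ))) =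
      ρ ^ 2 / 2 * (gaussHypergeometric (p.m s) (-((2 / p.alp s : ℝ) : ℂ))
        (1 - ((2 / p.alp s : ℝ) : ℂ)) (-(z * ((p.Om s / p.m s * γ : ℝ) : ℂ))) - 1) := by
  have hnn : 0 ≤ p.Om s / p.m s * γ := by
    have := p.Om_pos s
    have := p.m_pos s
    positivity
  rw [gaussHypergeometric_eq_integral _ (p.two_div_alp_lt_one s)
    (neg_mem_cutPlane (re_mul_ofReal_nonneg hz hnn)), ← p.integral_mul_one_sub_cpow s _ hρ]
  refine setIntegral_congr_fun measurableSet_Ioi fun r _ => ?_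
  simp only [fadingMGF]
  push_cast
  ring_nf

lemma integrableOn_one_sub_markLaplace (s : S) {z : ℂ} (hz : 0 ≤ z.re) {ρ : ℝ} (hρ : 0 < ρ) :
    IntegrableOn (fun r : ℝ => (r : ℂ) *
      (1 - p.markLaplace s (z * (((ρ / r) ^ p.alp s : ℝ) : ℂ)))) (Ioi ρ) := by
  have : (fun r : ℝ => (r : ℂ) * (1 - p.markLaplace s (z * (((ρ / r) ^ p.alp s : ℝ) : ℂ)))) =
      fun r : ℝ => ∑ l₁ ∈ Finset.Icc 1 (p.K Terminal.bs), ∑ l₂ ∈ Finset.Icc 1 (p.K Terminal.mt),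
      ((1 - p.pOff) * ((p.lobeWidth Terminal.bs l₁ / (2 * Real.pi) *
        (p.lobeWidth Terminal.mt l₂ / (2 * Real.pi)) : ℝ) : ℂ)) *
        ((r : ℂ) * (1 - p.fadingMGF s (z * (((ρ / r) ^ p.alp s : ℝ) : ℂ) *
          ((p.gam Terminal.bs l₁ * p.gam Terminal.mt l₂ : ℝ) : ℂ)))) := by
    ext r
    rw [one_sub_markLaplace]
    simp only [Finset.mul_sum]
    refine Finset.sum_congr rfl fun l₁ _ => Finset.sum_congr rfl fun l₂ _ => ?_
    ring
  rw [this]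
  refine integrable_finsetSum _ fun l₁ h₁ => integrable_finsetSum _ fun l₂ h₂ => ?_
  exact (p.integrableOn_one_sub_fadingMGF s hz (p.gam_mul_nonneg h₁ h₂) hρ).const_mul _

lemma integral_one_sub_markLaplace (s : S) {z : ℂ} (hz : 0 ≤ z.re) {ρ : ℝ} (hρ : 0 < ρ) :
    ∫ r in Ioi ρ, (r : ℂ) * (1 - p.markLaplace s (z * (((ρ / r) ^ p.alp s : ℝ) : ℂ))) =
      -((1 - p.pOff) * (ρ ^ 2 / 2) * p.calF s z) := by
  have : (fun r : ℝ => (r : ℂ) * (1 - p.markLaplace s (z * (((ρ / r) ^ p.alp s : ℝ) : ℂ)))) =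
      fun r : ℝ => ∑ l₁ ∈ Finset.Icc 1 (p.K Terminal.bs), ∑ l₂ ∈ Finset.Icc 1 (p.K Terminal.mt),
      ((1 - p.pOff) * ((p.lobeWidth Terminal.bs l₁ / (2 * Real.pi) *
        (p.lobeWidth Terminal.mt l₂ / (2 * Real.pi)) : ℝ) : ℂ)) *
        ((r : ℂ) * (1 - p.fadingMGF s (z * (((ρ / r) ^ p.alp s : ℝ) : ℂ) *
          ((p.gam Terminal.bs l₁ * p.gam Terminal.mt l₂ : ℝ) : ℂ)))) := by
    ext r
    rw [one_sub_markLaplace]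
    simp only [Finset.mul_sum]
    refine Finset.sum_congr rfl fun l₁ _ => Finset.sum_congr rfl fun l₂ _ => ?_
    ring
  rw [this, integral_finsetSum _ fun l₁ h₁ => integrable_finsetSum _ fun l₂ h₂ =>
    (p.integrableOn_one_sub_fadingMGF s hz (p.gam_mul_nonneg h₁ h₂) hρ).const_mul _]
  have h1 : ∀ l₁ ∈ Finset.Icc 1 (p.K Terminal.bs),
      ∫ r in Ioi ρ, ∑ l₂ ∈ Finset.Icc 1 (p.K Terminal.mt),
      ((1 - p.pOff) * ((p.lobeWidth Terminal.bs l₁ / (2 * Real.pi) *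
        (p.lobeWidth Terminal.mt l₂ / (2 * Real.pi)) : ℝ) : ℂ)) *
        ((r : ℂ) * (1 - p.fadingMGF s (z * (((ρ / r) ^ p.alp s : ℝ) : ℂ) *
          ((p.gam Terminal.bs l₁ * p.gam Terminal.mt l₂ : ℝ) : ℂ)))) =
      ∑ l₂ ∈ Finset.Icc 1 (p.K Terminal.mt), (1 - p.pOff) * (ρ ^ 2 / 2) *
        (((p.lobeWidth Terminal.bs l₁ / (2 * Real.pi) *
        (p.lobeWidth Terminal.mt l₂ / (2 * Real.pi)) : ℝ) : ℂ) *
        gaussHypergeometric (p.m s) (-((2 / p.alp s : ℝ) : ℂ)) (1 - ((2 / p.alp s : ℝ) : ℂ))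
        (-(z * ((p.Om s / p.m s * p.gam Terminal.bs l₁ * p.gam Terminal.mt l₂ : ℝ) : ℂ))) -
        ((p.lobeWidth Terminal.bs l₁ / (2 * Real.pi) *
        (p.lobeWidth Terminal.mt l₂ / (2 * Real.pi)) : ℝ) : ℂ)) := by
    intro l₁ h₁
    rw [integral_finsetSum _ fun l₂ h₂ =>
      (p.integrableOn_one_sub_fadingMGF s hz (p.gam_mul_nonneg h₁ h₂) hρ).const_mul _]
    refine Finset.sum_congr rfl fun l₂ h₂ => ?_
    rw [integral_const_mul, p.integral_one_sub_fadingMGF s hz (p.gam_mul_nonneg h₁ h₂) hρ,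
      ← mul_assoc (p.Om s / p.m s)]
    ring
  rw [Finset.sum_congr rfl h1]
  have h := congrArg (fun t : ℝ => (t : ℂ)) p.sum_sum_lobeWidth
  simp only [Complex.ofReal_sum, Complex.ofReal_one] at h
  simp only [← Finset.mul_sum, Finset.sum_sub_distrib, h, calF]
  ring

lemma integrable_one_sub_markLaplace (s : S) {z : ℂ} (hz : 0 ≤ z.re) {x : ℝ} (hx : 0 < x) :
    Integrable (fun y : EuclideanSpace ℝ (Fin 2) => if x < p.pathLoss s ‖y‖ then
      1 - p.markLaplace s (z * ((x / p.pathLoss s ‖y‖ : ℝ) : ℂ)) else 0)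
      (p.planarIntensity s) := by
  have hρ := p.lossRadius_pos s hx
  refine (p.integrable_tail s hx fun t : ℝ => 1 - p.markLaplace s (z * (t : ℂ))).2 ?_
  refine (p.integrableOn_one_sub_markLaplace s hz hρ).norm.mono' ?_ ?_
  · have h1 := p.measurable_linkProb s
    have h2 := p.measurable_fadingMGF s
    have h3 : Measurable (p.markLaplace s) := by
      unfold markLaplace
      fun_prop
    exact (by fun_prop : Measurable _).aestronglyMeasurable
  · refine (ae_restrict_iff' measurableSet_Ioi).2 (.of_forall fun r hr => ?_)
    have hr0 : 0 < r := hρ.trans hr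
    rw [norm_smul, norm_mul, norm_mul, Complex.norm_real,
      Real.norm_of_nonneg (p.linkProb_nonneg s r)]
    exact mul_le_mul_of_nonneg_right
      (mul_le_of_le_one_right (norm_nonneg r) (p.linkProb_le_one s hr0.le)) (norm_nonneg _)

/-- The exponent `T_s(z, x)` in terms of the intensity measure of the base stations and of the
Laplace transform of their marks. -/
theorem integral_one_sub_markLaplace_planarIntensity (s : S) {z : ℂ} (hz : 0 ≤ z.re) {x : ℝ}
    (hx : 0 < x) :
    ∫ y, (if x < p.pathLoss s ‖y‖ then
      1 - p.markLaplace s (z * ((x / p.pathLoss s ‖y‖ : ℝ) : ℂ)) else 0)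
      ∂(p.planarIntensity s) = -p.exponent s z x := by
  have hρ := p.lossRadius_pos s hx
  rw [p.integral_tail s hx fun t : ℝ => 1 - p.markLaplace s (z * (t : ℂ)), p.exponent_eq s z hx.le,
    Complex.real_smul]
  have hsq := congrArg (fun t : ℝ => (t : ℂ)) (p.lossRadius_sq s hx.le)
  simp only [Complex.ofReal_pow] at hsq
  have hterm : ∀ r : ℝ, (r * p.linkProb s r) •
      (1 - p.markLaplace s (z * (((p.lossRadius s x / r) ^ p.alp s : ℝ) : ℂ))) =
      (p.linkProb s r : ℂ) * ((r : ℂ) *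
      (1 - p.markLaplace s (z * (((p.lossRadius s x / r) ^ p.alp s : ℝ) : ℂ)))) := fun r => by
    rw [Complex.real_smul]
    push_cast
    ring
  rw [setIntegral_congr_fun measurableSet_Ioi fun r _ => hterm r]
  have hmain := p.integrableOn_one_sub_markLaplace s hz hρ
  have hmain' := p.integral_one_sub_markLaplace s hz hρ
  set h : ℝ → ℂ := fun r => (r : ℂ) *
      (1 - p.markLaplace s (z * (((p.lossRadius s x / r) ^ p.alp s : ℝ) : ℂ))) with hh
  -- If the level `x` lies beyond the ball, only the outer link probability is seen. Otherwise the
  -- tail splits at radius `D 1`.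
  rcases le_or_gt (p.threshold s) x with hle | hlt
  · have hρD : p.D 1 ≤ p.lossRadius s x := by
      rw [threshold_eq_pathLoss] at hle
      by_contra! hcon
      exact absurd ((p.lt_pathLoss_iff s p.D_one_pos.le hx.le).2 hcon) hle.not_gt
    rw [← threshold, heaviside_of_nonneg (sub_nonneg.2 hle),
      heavisideCompl_of_nonneg (sub_nonneg.2 hle)]
    have : ∫ r in Ioi (p.lossRadius s x), (p.linkProb s r : ℂ) * h r =
        p.q s 2 * ∫ r in Ioi (p.lossRadius s x), h r := by
      rw [← integral_const_mul]
      refine setIntegral_congr_fun measurableSet_Ioi fun r hr => ?_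
      have hDr : p.D 1 ≤ r := hρD.trans (le_of_lt hr)
      simp only [p.linkProb_eq s (hρ.trans hr).le, if_neg hDr.not_gt]
    rw [this, hmain', hsq, lamI]
    push_cast
    ring
  · have hD := p.D_one_pos
    have hρD : p.lossRadius s x < p.D 1 := by
      rw [threshold_eq_pathLoss] at hlt
      exact (p.lt_pathLoss_iff s hD.le hx.le).1 hlt
    rw [← threshold, heaviside_of_neg (sub_neg.2 hlt), heavisideCompl_of_neg (sub_neg.2 hlt)]
    set c : ℝ := x / p.pathLoss s (p.D 1) with hc
    have hc0 : 0 ≤ c := div_nonneg hx.le (p.pathLoss_nonneg s hD.le)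
    have hcD := p.div_pathLoss s hx.le hD
    -- Beyond `D 1` the ratio is rewritten relative to `D 1`: `x / L(r) = c (D 1 / r)^α`. The tail
    -- formula then applies with `z c`, the rescaled argument of `ℱ_s` in the exponent.
    have hfar : EqOn h (fun r => (r : ℂ) *
        (1 - p.markLaplace s (z * (c : ℂ) * (((p.D 1 / r) ^ p.alp s : ℝ) : ℂ)))) (Ioi (p.D 1)) := by
      intro r hr
      have hr0 : 0 < r := hD.trans hr
      simp only [hh]
      rw [hc, hcD, mul_assoc z, ← Complex.ofReal_mul, ← Real.mul_rpow (by positivity) (by positivity),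
        div_mul_div_cancel₀ hD.ne']
    have hD1 := p.integral_one_sub_markLaplace s (re_mul_ofReal_nonneg hz hc0) hD
    rw [← setIntegral_congr_fun measurableSet_Ioi hfar] at hD1
    have hnear : ∫ r in Ioc (p.lossRadius s x) (p.D 1), (p.linkProb s r : ℂ) * h r =
        p.q s 1 * ∫ r in Ioc (p.lossRadius s x) (p.D 1), h r := by
      rw [integral_Ioc_eq_integral_Ioo, integral_Ioc_eq_integral_Ioo, ← integral_const_mul]
      refine setIntegral_congr_fun measurableSet_Ioo fun r hr => ?_
      simp only [p.linkProb_eq s (hρ.trans hr.1).le, if_pos hr.2]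
    have hfar' : ∫ r in Ioi (p.D 1), (p.linkProb s r : ℂ) * h r =
        p.q s 2 * ∫ r in Ioi (p.D 1), h r := by
      rw [← integral_const_mul]
      refine setIntegral_congr_fun measurableSet_Ioi fun r hr => ?_
      simp only [p.linkProb_eq s (hD.trans hr).le, if_neg (not_lt_of_gt (mem_Ioi.1 hr))]
    have hint : IntegrableOn (fun r => (p.linkProb s r : ℂ) * h r) (Ioi (p.lossRadius s x)) := by
      refine hmain.norm.mono' ((Complex.measurable_ofReal.comp
        (p.measurable_linkProb s)).aestronglyMeasurable.mul hmain.aestronglyMeasurable) ?_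
      refine (ae_restrict_iff' measurableSet_Ioi).2 (.of_forall fun r hr => ?_)
      rw [norm_mul, Complex.norm_real, Real.norm_of_nonneg (p.linkProb_nonneg s r)]
      exact mul_le_of_le_one_left (norm_nonneg _) (p.linkProb_le_one s (hρ.trans hr).le)
    have hsplit : Ioi (p.lossRadius s x) = Ioc (p.lossRadius s x) (p.D 1) ∪ Ioi (p.D 1) :=
      (Ioc_union_Ioi_eq_Ioi hρD.le).symm
    have hdisj : Disjoint (Ioc (p.lossRadius s x) (p.D 1)) (Ioi (p.D 1)) :=
      Set.disjoint_left.2 fun r hr hr' => not_lt.2 hr.2 hr'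
    rw [hsplit, integrableOn_union] at hint hmain
    have h1 := setIntegral_union hdisj measurableSet_Ioi hint.1 hint.2
    have h2 := setIntegral_union hdisj measurableSet_Ioi hmain.1 hmain.2
    rw [← hsplit] at h1 h2
    rw [hmain', hD1] at h2
    -- The annulus is the difference of two tails, which yields the two `ℱ_s` terms multiplied by
    -- the inner probability.
    have h3 : ∫ r in Ioc (p.lossRadius s x) (p.D 1), h r =
      -((1 - p.pOff) * ((p.lossRadius s x : ℂ) ^ 2 / 2) * p.calF s z) +
        (1 - p.pOff) * ((p.D 1 : ℂ) ^ 2 / 2) * p.calF s (z * c) := by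
      rw [h2]
      ring
    have hzc : (x : ℂ) * z / (p.threshold s : ℂ) = z * c := by
      rw [hc, pathLoss, threshold]
      push_cast
      ring
    rw [h1, hnear, hfar', h3, hD1, hsq, hzc, lamI]
    push_cast
    ring

end NetworkParams


/-! ### Interference from the base stations of a given state -/

namespace Network

open Filter Topology

variable {S Ω : Type*} [Fintype S] (net : Network S Ω) (p : NetworkParams S 1)

/-- Labels of the sources of randomness attached to the base stations in state `s`. -/
def stateSources (s : S) : Set (Source S) := insert (.process s) (⋃ n, markSources s n)

/-- The σ-algebra generated by the base stations in state `s` and their marks. -/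
@[reducible] def stateAlgebra (s : S) : MeasurableSpace Ω :=
  ⨆ i ∈ stateSources s, net.sourceAlgebra i

open Classical in
/-- Contribution of the `n`-th base station in state `s` to the interference beyond the path-loss
`x`, in units of `P_RB`. -/
def tailTerm (s : S) (x : ℝ) (n : ℕ) (ω : Ω) : ℝ :=
  if (n : ℕ∞) < net.count s ω ∧ x < net.loss p s n ω then net.mark p s n ω / net.loss p s n ω else 0

/-- Interference beyond the path-loss `x` from the base stations in state `s`, in units of
`P_RB`. -/
def tailSum (s : S) (x : ℝ) (ω : Ω) : ℝ≥0∞ := ∑' n, ENNReal.ofReal (net.tailTerm p s x n ω)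

lemma loss_nonneg (s : S) (n : ℕ) (ω : Ω) : 0 ≤ net.loss p s n ω :=
  p.pathLoss_nonneg s (norm_nonneg _)

lemma tailTerm_nonneg (s : S) (x : ℝ) (n : ℕ) (ω : Ω) : 0 ≤ net.tailTerm p s x n ω := by
  unfold tailTerm
  split_ifs
  · exact div_nonneg (net.mark_nonneg p s n ω) (net.loss_nonneg p s n ω)
  · exact le_rfl

lemma tailTerm_anti (s : S) {x y : ℝ} (hxy : x ≤ y) (n : ℕ) (ω : Ω) :
    net.tailTerm p s y n ω ≤ net.tailTerm p s x n ω := by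
  unfold tailTerm
  split_ifs with h1 h2 h2
  · exact le_rfl
  · exact absurd ⟨h1.1, hxy.trans_lt h1.2⟩ h2
  · exact div_nonneg (net.mark_nonneg p s n ω) (net.loss_nonneg p s n ω)
  · exact le_rfl

lemma tailSum_anti (s : S) {x y : ℝ} (hxy : x ≤ y) (ω : Ω) :
    net.tailSum p s y ω ≤ net.tailSum p s x ω :=
  ENNReal.tsum_le_tsum fun n => ENNReal.ofReal_le_ofReal (net.tailTerm_anti p s hxy n ω)

/-- Holds surely: a negative fading value contributes nothing on either side, through
`ENNReal.ofReal` on the left and the truncation in `mark` on the right. -/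
lemma interference_eq (x : ℝ) (ω : Ω) :
    net.interference p x ω = ENNReal.ofReal p.PRB * ∑ s, net.tailSum p s x ω := by
  simp only [interference, Finset.mul_sum, tailSum, ← ENNReal.tsum_mul_left]
  refine Finset.sum_congr rfl fun s _ => tsum_congr fun n => ?_
  rw [← ENNReal.ofReal_mul p.PRB_pos.le]
  by_cases h1 : (n : ℕ∞) < net.count s ω ∧ x < net.loss p s n ω
  · by_cases h2 : net.active s n ω = true
    · have hL := net.loss_nonneg p s n ω
      have hG : 0 ≤ p.pattern .bs (net.angle .bs s n ω) * p.pattern .mt (net.angle .mt s n ω) :=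
        mul_nonneg (p.pattern_nonneg _ _) (p.pattern_nonneg _ _)
      rw [if_pos ⟨h1.1, h2, h1.2⟩, tailTerm, if_pos h1, mark, if_pos h2]
      rcases le_total 0 (net.fading s n ω) with h3 | h3
      · rw [max_eq_left h3]
        congr 1
        ring
      · rw [max_eq_right h3, mul_zero, zero_div, mul_zero, ENNReal.ofReal_zero,
          ENNReal.ofReal_eq_zero]
        exact div_nonpos_of_nonpos_of_nonneg
          (mul_nonpos_of_nonneg_of_nonpos (mul_nonneg p.PRB_pos.le hG) h3) hL
    · rw [if_neg (fun h => h2 h.2.1), tailTerm, if_pos h1, mark, if_neg h2]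
      simp
  · rw [if_neg (fun h => h1 ⟨h.1, h.2.2⟩), tailTerm, if_neg h1]
    simp

lemma le_minLoss_iff (s : S) {t : ℝ} (ω : Ω) :
    ENNReal.ofReal t ≤ net.minLoss p s ω ↔
      ∀ n : ℕ, (n : ℕ∞) < net.count s ω → t ≤ net.loss p s n ω := by
  simp only [minLoss, le_iInf_iff]
  exact forall₂_congr fun n _ => ENNReal.ofReal_le_ofReal_iff (net.loss_nonneg p s n ω)

/-! #### Measurability -/

lemma measurable_process (s : S) :
    Measurable[net.stateAlgebra s] fun ω => (net.count s ω, fun n => net.pos s n ω) :=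
  (comap_measurable _).mono
    (le_iSup₂_of_le (f := fun i (_ : i ∈ stateSources s) => net.sourceAlgebra i) (.process s)
      (mem_insert _ _) le_rfl) le_rfl

lemma measurable_count_state (s : S) : Measurable[net.stateAlgebra s] (net.count s) :=
  measurable_fst.comp (net.measurable_process s)

lemma measurable_pos_state (s : S) (n : ℕ) : Measurable[net.stateAlgebra s] (net.pos s n) := by
  have h : Measurable[net.stateAlgebra s] fun ω => fun n => net.pos s n ω :=
    measurable_snd.comp (net.measurable_process s)
  exact (measurable_pi_apply n).comp h

lemma measurable_loss_of {m : MeasurableSpace Ω} (s : S) (n : ℕ) (h : Measurable (net.pos s n)) :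
    Measurable (net.loss p s n) :=
  (p.measurable_pathLoss s).comp h.norm

lemma measurable_loss_state (s : S) (n : ℕ) :
    Measurable[net.stateAlgebra s] (net.loss p s n) :=
  net.measurable_loss_of p s n (net.measurable_pos_state s n)

lemma measurable_mark_state (s : S) (n : ℕ) :
    Measurable[net.stateAlgebra s] (net.mark p s n) :=
  (net.measurable_mark p s n).mono
    (biSup_mono fun _ hi => mem_insert_of_mem _ (mem_iUnion.2 ⟨n, hi⟩)) le_rfl

lemma measurable_minLoss_state (s : S) : Measurable[net.stateAlgebra s] (net.minLoss p s) := by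
  have h : net.minLoss p s = fun ω => ⨅ n : ℕ,
      if (n : ℕ∞) < net.count s ω then ENNReal.ofReal (net.loss p s n ω) else ∞ := by
    ext ω
    refine iInf_congr fun n => ?_
    by_cases hn : (n : ℕ∞) < net.count s ω <;> simp [hn]
  rw [h]
  refine Measurable.iInf fun n => Measurable.ite ?_
    (net.measurable_loss_state p s n).ennreal_ofReal measurable_const
  exact net.measurable_count_state s (MeasurableSet.of_discrete (s := {k : ℕ∞ | (n : ℕ∞) < k}))

/-- Joint in the level and the outcome, because a random level will be inserted, and for any
σ-algebra, because it is used with the ambient one, with that of a single state and with that of all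
stations. -/
lemma measurable_tailTerm_of {m : MeasurableSpace Ω} (s : S) (n : ℕ)
    (h1 : Measurable[m] (net.count s)) (h2 : Measurable[m] (net.loss p s n))
    (h3 : Measurable[m] (net.mark p s n)) :
    Measurable[Prod.instMeasurableSpace] fun u : ℝ × Ω => net.tailTerm p s u.1 n u.2 := by
  refine Measurable.ite ?_ ((h3.div h2).comp measurable_snd) measurable_const
  exact ((h1.comp measurable_snd)
    (MeasurableSet.of_discrete (s := {k : ℕ∞ | (n : ℕ∞) < k}))).inter
    (measurableSet_lt measurable_fst (h2.comp measurable_snd))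

lemma measurable_tailTerm_state (s : S) (x : ℝ) (n : ℕ) :
    Measurable[net.stateAlgebra s] (net.tailTerm p s x n) :=
  (net.measurable_tailTerm_of p s n (net.measurable_count_state s) (net.measurable_loss_state p s n)
    (net.measurable_mark_state p s n)).comp measurable_prodMk_left

lemma measurable_tailSum_state (s : S) (x : ℝ) :
    Measurable[net.stateAlgebra s] (net.tailSum p s x) :=
  let _ := net.stateAlgebra s
  Measurable.tsum fun n => (net.measurable_tailTerm_state p s x n).ennreal_ofReal

variable {mΩ : MeasurableSpace Ω} {μ : Measure Ω} {net p}

namespace IsModel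

lemma stateAlgebra_le (hnet : net.IsModel p μ) (s : S) : net.stateAlgebra s ≤ mΩ :=
  hnet.iSup_sourceAlgebra_le _

lemma measurable_loss (hnet : net.IsModel p μ) (s : S) (n : ℕ) : Measurable (net.loss p s n) :=
  (net.measurable_loss_state p s n).mono (hnet.stateAlgebra_le s) le_rfl

lemma measurable_minLoss (hnet : net.IsModel p μ) (s : S) : Measurable (net.minLoss p s) :=
  (net.measurable_minLoss_state p s).mono (hnet.stateAlgebra_le s) le_rfl

lemma measurable_tailTerm (hnet : net.IsModel p μ) (s : S) (n : ℕ) :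
    Measurable fun u : ℝ × Ω => net.tailTerm p s u.1 n u.2 :=
  net.measurable_tailTerm_of p s n (hnet.poisson s).measurable_count (hnet.measurable_loss s n)
    (hnet.measurable_mark s n)

lemma measurable_tailSum (hnet : net.IsModel p μ) (s : S) :
    Measurable fun u : ℝ × Ω => net.tailSum p s u.1 u.2 :=
  Measurable.tsum fun n => (hnet.measurable_tailTerm s n).ennreal_ofReal

lemma disjoint_process_marks (s : S) :
    Disjoint ({.process s} : Set (Source S)) (⋃ n, markSources s n) := by
  simp [markSources]

lemma indepFun_process_marks (hnet : net.IsModel p μ) (s : S) :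
    IndepFun (fun ω => (net.count s ω, fun n => net.pos s n ω)) (fun ω n => net.mark p s n ω)
      μ := by
  have h := indep_iSup_of_disjoint hnet.sourceAlgebra_le hnet.independent
    (disjoint_process_marks s)
  rw [iSup_singleton] at h
  refine indep_of_indep_of_le_right h ?_
  have hm : Measurable[⨆ i ∈ ⋃ n, markSources s n, net.sourceAlgebra i]
      (fun ω n => net.mark p s n ω) := by
    refine @measurable_pi_lambda _ _ _ (_) _ _ fun n => ?_
    exact (net.measurable_mark p s n).mono (biSup_mono fun i hi => mem_iUnion.2 ⟨n, hi⟩) le_rfl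
  exact hm.comap_le

lemma iIndepFun_marks (hnet : net.IsModel p μ) (s : S) :
    iIndepFun (fun n => net.mark p s n) μ := by
  rw [iIndepFun_iff_iIndep]
  refine iIndep_of_iIndep_of_le (hnet.independent.iSup_of_pairwise_disjoint hnet.sourceAlgebra_le
    (S := fun n => markSources s n) fun n k hnk => ?_) fun n => (net.measurable_mark p s n).comap_le
  simp [markSources, hnk.symm]

/-- Different states use disjoint sets of sources. -/
lemma iIndep_stateAlgebra (hnet : net.IsModel p μ) : iIndep (fun s => net.stateAlgebra s) μ := by
  refine hnet.independent.iSup_of_pairwise_disjoint hnet.sourceAlgebra_le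
    (S := fun s => stateSources s) fun s r hsr => ?_
  simp only [stateSources, markSources]
  rw [Set.disjoint_left]
  rintro i hi hj
  simp only [mem_insert_iff, mem_iUnion, mem_singleton_iff] at hi hj
  rcases hi with rfl | ⟨n, rfl | rfl | rfl | rfl⟩ <;> simp_all

variable [IsProbabilityMeasure μ]

/-! #### Mean of the interference -/

/-- Campbell's inequality with `f(y) = x / L(y)` on `{L(y) > x}` and the mean mark as constant. -/
lemma lintegral_tailSum_le (hnet : net.IsModel p μ) (s : S) {x : ℝ} (hx : 0 < x) :
    ∫⁻ ω, ENNReal.ofReal x * net.tailSum p s x ω ∂μ ≤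
      ENNReal.ofReal (p.tailCoeff s * (x / p.kap s) ^ (2 / p.alp s)) *
        ENNReal.ofReal (p.maxMeanMark s) := by
  let f : EuclideanSpace ℝ (Fin 2) → ℝ≥0∞ := fun y =>
    ENNReal.ofReal (if x < p.pathLoss s ‖y‖ then x / p.pathLoss s ‖y‖ else 0)
  have hpl : Measurable fun y : EuclideanSpace ℝ (Fin 2) => p.pathLoss s ‖y‖ :=
    (p.measurable_pathLoss s).comp measurable_norm
  have hf : Measurable f := (Measurable.ite (measurableSet_lt measurable_const hpl)
    (measurable_const.div hpl) measurable_const).ennreal_ofReal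
  have hind : ∀ n, IndepFun (fun ω => (net.count s ω, net.pos s n ω))
      (fun ω => ENNReal.ofReal (net.mark p s n ω)) μ := fun n =>
    (hnet.indepFun_process_marks s).comp
      (φ := fun u : ℕ∞ × (ℕ → EuclideanSpace ℝ (Fin 2)) => (u.1, u.2 n))
      (ψ := fun v : ℕ → ℝ => ENNReal.ofReal (v n))
      (measurable_fst.prodMk ((measurable_pi_apply n).comp measurable_snd))
      (measurable_pi_apply n).ennreal_ofReal
  have h := (hnet.poisson s).tsum_lintegral_mul_mark_le
    (fun n => (hnet.measurable_mark s n).ennreal_ofReal) hind (hnet.lintegral_mark_le s) hf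
  refine le_trans (le_of_eq ?_) (h.trans (mul_le_mul_left (p.lintegral_lossRatio_le s hx) _))
  simp_rw [tailSum, ← ENNReal.tsum_mul_left]
  have hm : ∀ n, Measurable fun ω => ENNReal.ofReal x * ENNReal.ofReal (net.tailTerm p s x n ω) :=
    fun n => ((hnet.measurable_tailTerm s n).comp
      measurable_prodMk_left).ennreal_ofReal.const_mul _
  rw [lintegral_tsum fun n => (hm n).aemeasurable]
  refine tsum_congr fun n => ?_
  rw [← lintegral_indicator ((hnet.poisson s).measurableSet_lt n)]
  refine lintegral_congr fun ω => ?_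
  have hL := net.loss_nonneg p s n ω
  by_cases h1 : (n : ℕ∞) < net.count s ω
  · rw [indicator_of_mem (show ω ∈ {ω | (n : ℕ∞) < net.count s ω} from h1)]
    by_cases h2 : x < net.loss p s n ω
    · have h2' : x < p.pathLoss s ‖net.pos s n ω‖ := h2
      simp only [f, tailTerm, if_pos h2', if_pos (And.intro h1 h2)]
      rw [← ENNReal.ofReal_mul hx.le]
      change _ = ENNReal.ofReal (x / net.loss p s n ω) * _
      rw [← ENNReal.ofReal_mul (div_nonneg hx.le hL)]
      congr 1
      ring
    · have h2' : ¬ x < p.pathLoss s ‖net.pos s n ω‖ := h2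
      simp [f, tailTerm, h2, h2']
  · rw [indicator_of_notMem (show ω ∉ {ω | (n : ℕ∞) < net.count s ω} from h1)]
    simp [tailTerm, h1]

/-- Finite mean gives finiteness at the levels `1 / (k + 1)`, and monotonicity in the level extends
it to all `x > 0` off a single null set. This is essential for inserting a random level, and it
makes `toReal` of the interference faithful. -/
lemma ae_tailSum_ne_top (hnet : net.IsModel p μ) : ∀ᵐ ω ∂μ, ∀ s, ∀ x : ℝ, 0 < x →
    net.tailSum p s x ω ≠ ∞ := by
  have h1 : ∀ s, ∀ k : ℕ, ∀ᵐ ω ∂μ, net.tailSum p s (1 / (k + 1 : ℝ)) ω ≠ ∞ := by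
    intro s k
    have hk : (0 : ℝ) < 1 / (k + 1 : ℝ) := by positivity
    have hm : Measurable (net.tailSum p s (1 / (k + 1 : ℝ))) :=
      (hnet.measurable_tailSum s).comp measurable_prodMk_left
    have h2 := ((hnet.lintegral_tailSum_le s hk).trans_lt
      (ENNReal.mul_lt_top ENNReal.ofReal_lt_top ENNReal.ofReal_lt_top)).ne
    filter_upwards [ae_lt_top (hm.const_mul _) h2] with ω hω htop
    rw [htop, ENNReal.mul_top (by simpa using hk)] at hω
    exact lt_irrefl _ hω
  filter_upwards [ae_all_iff.2 fun s => ae_all_iff.2 (h1 s)] with ω hω s x hx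
  obtain ⟨k, hk⟩ := exists_nat_one_div_lt hx
  exact ((net.tailSum_anti p s hk.le ω).trans_lt (hω s k).lt_top).ne

end IsModel

lemma summable_tailTerm {s : S} {x : ℝ} {ω : Ω} (h : net.tailSum p s x ω ≠ ∞) :
    Summable fun n => net.tailTerm p s x n ω := by
  have := ENNReal.summable_toReal h
  simpa only [ENNReal.toReal_ofReal (net.tailTerm_nonneg p s x _ ω)] using this

lemma toReal_tailSum (s : S) (x : ℝ) (ω : Ω) :
    (net.tailSum p s x ω).toReal = ∑' n, net.tailTerm p s x n ω := by
  rw [tailSum, ENNReal.tsum_toReal_eq fun n => ENNReal.ofReal_ne_top]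
  simp only [ENNReal.toReal_ofReal (net.tailTerm_nonneg p s x _ ω)]

/-- Right-continuity of the interference beyond `x`. -/
lemma tendsto_toReal_tailSum {s : S} {x : ℝ} {ω : Ω} (h : net.tailSum p s x ω ≠ ∞) {u : ℕ → ℝ}
    (hu : ∀ k, x ≤ u k) (hux : Tendsto u atTop (𝓝 x)) :
    Tendsto (fun k => (net.tailSum p s (u k) ω).toReal) atTop
      (𝓝 (net.tailSum p s x ω).toReal) := by
  simp_rw [toReal_tailSum]
  refine tendsto_tsum_of_dominated_convergence (summable_tailTerm h) (fun n => ?_)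
    (.of_forall fun k n => ?_)
  · refine tendsto_const_nhds.congr' ?_
    -- Each term is eventually constant in `k`: a station strictly beyond `x` stays beyond `u k`
    -- eventually, and one with loss at most `x` is never beyond `u k ≥ x`. Approach from the left
    -- would fail at loss exactly `x`.
    by_cases hn : x < net.loss p s n ω
    · filter_upwards [hux.eventually_lt_const hn] with k hk
      simp only [tailTerm, hn, hk]
    · refine .of_forall fun k => ?_
      have hk : ¬ u k < net.loss p s n ω := fun hk => hn ((hu k).trans_lt hk)
      simp only [tailTerm, hn, hk]
  · rw [Real.norm_of_nonneg (net.tailTerm_nonneg p s _ n ω)]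
    exact net.tailTerm_anti p s (hu k) n ω

end Network


/-! ### Void probability and interference of one link state, jointly. -/

namespace NetworkParams

variable {S : Type*} [Fintype S] (p : NetworkParams S 1)

lemma intensity_zero (s : S) : p.intensity s 0 = 0 := by
  rw [p.intensity_of_le s le_rfl (p.threshold_pos s).le, zero_div,
    Real.zero_rpow (p.two_div_alp_pos s).ne', mul_zero]

lemma measurable_markLaplace (s : S) : Measurable (p.markLaplace s) := by
  have := p.measurable_fadingMGF s
  unfold markLaplace
  fun_prop

lemma measurable_pathLoss_norm (s : S) :
    Measurable fun y : EuclideanSpace ℝ (Fin 2) => p.pathLoss s ‖y‖ :=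
  (p.measurable_pathLoss s).comp measurable_norm

end NetworkParams

namespace Network

open Filter Topology

variable {S Ω : Type*} [Fintype S] {net : Network S Ω} {p : NetworkParams S 1}
  {mΩ : MeasurableSpace Ω} {μ : Measure Ω} [IsProbabilityMeasure μ]

lemma norm_exp_neg_mul_le_one {z : ℂ} (hz : 0 ≤ z.re) {y : ℝ} (hy : 0 ≤ y) :
    ‖Complex.exp (-(z * (y : ℂ)))‖ ≤ 1 :=
  norm_exp_neg_le_one (NetworkParams.re_mul_ofReal_nonneg hz hy)

variable (net p) in
open Classical in
/-- Contribution of the `n`-th base station in state `s` to the interference from the base stations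
with path-loss between `x` and `k`. -/
def windowTerm (s : S) (x k : ℝ) (n : ℕ) (ω : Ω) : ℝ :=
  if net.loss p s n ω < k then net.tailTerm p s x n ω else 0

lemma windowTerm_nonneg (s : S) (x k : ℝ) (n : ℕ) (ω : Ω) : 0 ≤ net.windowTerm p s x k n ω := by
  unfold windowTerm
  split_ifs
  · exact net.tailTerm_nonneg p s x n ω
  · exact le_rfl

lemma windowTerm_le (s : S) (x k : ℝ) (n : ℕ) (ω : Ω) :
    net.windowTerm p s x k n ω ≤ net.tailTerm p s x n ω := by
  unfold windowTerm
  split_ifs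
  · exact le_rfl
  · exact net.tailTerm_nonneg p s x n ω

lemma summable_windowTerm {s : S} {x k : ℝ} {ω : Ω} (h : net.tailSum p s x ω ≠ ∞) :
    Summable fun n => net.windowTerm p s x k n ω :=
  (summable_tailTerm h).of_nonneg_of_le (windowTerm_nonneg s x k · ω) (windowTerm_le s x k · ω)

variable (p) in
open Classical in
/-- Factor associated with a base station of state `s` at `y` with mark `j`. -/
def windowFactor (s : S) (t x k : ℝ) (z : ℂ) (y : EuclideanSpace ℝ (Fin 2)) (j : ℝ) : ℂ :=
  if p.pathLoss s ‖y‖ < t then 0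
  else if x < p.pathLoss s ‖y‖ ∧ p.pathLoss s ‖y‖ < k then
    Complex.exp (-(z * ((x / p.pathLoss s ‖y‖ : ℝ) : ℂ) * ((max j 0 : ℝ) : ℂ)))
  else 1

lemma _root_.Measurable.windowFactor {α : Type*} [MeasurableSpace α] {s : S} {t x k : ℝ} {z : ℂ}
    {X : α → EuclideanSpace ℝ (Fin 2)} {J : α → ℝ} (hX : Measurable X) (hJ : Measurable J) :
    Measurable fun ω => windowFactor p s t x k z (X ω) (J ω) := by
  have h : Measurable fun ω => p.pathLoss s ‖X ω‖ := (p.measurable_pathLoss s).comp hX.norm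
  refine Measurable.ite (measurableSet_lt h measurable_const) measurable_const
    (Measurable.ite ((measurableSet_lt measurable_const h).inter
      (measurableSet_lt h measurable_const)) ?_ measurable_const)
  exact Complex.measurable_exp.comp ((measurable_const.mul (Complex.measurable_ofReal.comp
    (measurable_const.div h))).mul (Complex.measurable_ofReal.comp
      (hJ.max measurable_const))).neg

lemma norm_windowFactor_le (s : S) (t k : ℝ) {x : ℝ} (hx : 0 < x) {z : ℂ} (hz : 0 ≤ z.re)
    (y : EuclideanSpace ℝ (Fin 2)) (j : ℝ) : ‖windowFactor p s t x k z y j‖ ≤ 1 := by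
  unfold windowFactor
  split_ifs
  · simp
  · exact norm_exp_neg_mul_le_one (NetworkParams.re_mul_ofReal_nonneg hz
      (div_nonneg hx.le (p.pathLoss_nonneg s (norm_nonneg y)))) (le_max_right _ _)
  · simp

variable (p) in
open Classical in
/-- Mean of `1 - windowFactor` over the marks. -/
def windowExponent (s : S) (t x k : ℝ) (z : ℂ) (y : EuclideanSpace ℝ (Fin 2)) : ℂ :=
  (p.lossBall s t).indicator (fun _ => 1) y +
    if x < p.pathLoss s ‖y‖ ∧ p.pathLoss s ‖y‖ < k then
      1 - p.markLaplace s (z * ((x / p.pathLoss s ‖y‖ : ℝ) : ℂ)) else 0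

/-- Because `t ≤ x`, the void region and the interference window are disjoint, so the two parts of
`windowExponent` never overlap and later integrate to a sum. -/
lemma IsModel.integral_windowFactor (hnet : net.IsModel p μ) (s : S) {t x : ℝ} (k : ℝ)
    (htx : t ≤ x) (hx : 0 < x) {z : ℂ} (hz : 0 ≤ z.re) (n : ℕ) (y : EuclideanSpace ℝ (Fin 2)) :
    ∫ ω, windowFactor p s t x k z y (net.mark p s n ω) ∂μ = 1 - windowExponent p s t x k z y := by
  by_cases h1 : p.pathLoss s ‖y‖ < t
  · have h2 : ¬ (x < p.pathLoss s ‖y‖ ∧ p.pathLoss s ‖y‖ < k) := fun h =>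
      absurd (h1.trans_le htx) h.1.not_gt
    have h3 : y ∈ p.lossBall s t := h1
    simp [windowFactor, windowExponent, h1, h2, h3]
  · have h3 : y ∉ p.lossBall s t := h1
    by_cases h2 : x < p.pathLoss s ‖y‖ ∧ p.pathLoss s ‖y‖ < k
    · simp only [windowFactor, windowExponent, if_neg h1, if_pos h2, indicator_of_notMem h3,
        max_eq_left (net.mark_nonneg p s n _)]
      rw [hnet.integral_exp_neg_mul_mark s n (NetworkParams.re_mul_ofReal_nonneg hz
        (div_nonneg hx.le (p.pathLoss_nonneg s (norm_nonneg y))))]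
      ring
    · simp [windowFactor, windowExponent, h1, h2, h3]

lemma prod_windowFactor_of_le {s : S} {t x k : ℝ} {z : ℂ} {ω : Ω}
    (h : ENNReal.ofReal t ≤ net.minLoss p s ω) (M : ℕ) :
    ∏ n ∈ Finset.range M, (open Classical in if (n : ℕ∞) < net.count s ω then
      windowFactor p s t x k z (net.pos s n ω) (net.mark p s n ω) else 1) =
    Complex.exp (-(z * ((x * ∑ n ∈ Finset.range M, net.windowTerm p s x k n ω : ℝ) : ℂ))) := by
  rw [le_minLoss_iff] at h
  rw [Finset.mul_sum, Complex.ofReal_sum, Finset.mul_sum, ← Finset.sum_neg_distrib,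
    Complex.exp_sum]
  refine Finset.prod_congr rfl fun n _ => ?_
  by_cases hn : (n : ℕ∞) < net.count s ω
  · have h1 : ¬ p.pathLoss s ‖net.pos s n ω‖ < t := not_lt.2 (h n hn)
    rw [if_pos hn, windowFactor, if_neg h1]
    by_cases h2 : x < net.loss p s n ω
    · by_cases h3 : net.loss p s n ω < k
      · have h4 : x < p.pathLoss s ‖net.pos s n ω‖ ∧ p.pathLoss s ‖net.pos s n ω‖ < k := ⟨h2, h3⟩
        rw [if_pos h4, windowTerm, if_pos h3, tailTerm, if_pos ⟨hn, h2⟩,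
          max_eq_left (net.mark_nonneg p s n _), loss]
        congr 1
        push_cast
        ring
      · have h4 : ¬ (x < p.pathLoss s ‖net.pos s n ω‖ ∧ p.pathLoss s ‖net.pos s n ω‖ < k) :=
          fun h => h3 h.2
        rw [if_neg h4, windowTerm, if_neg h3]
        simp
    · have h4 : ¬ (x < p.pathLoss s ‖net.pos s n ω‖ ∧ p.pathLoss s ‖net.pos s n ω‖ < k) :=
        fun h => h2 h.1
      rw [if_neg h4]
      simp [windowTerm, tailTerm, h2]
  · rw [if_neg hn]
    simp [windowTerm, tailTerm, hn]

open Classical in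
-- A single point with loss below `t` annihilates all later partial products; without one the
-- product is the exponential of the partial sums.
lemma tendsto_prod_windowFactor (s : S) {t x : ℝ} (k : ℝ) (z : ℂ) {ω : Ω}
    (hω : net.tailSum p s x ω ≠ ∞) :
    Tendsto (fun M => ∏ n ∈ Finset.range M, (if (n : ℕ∞) < net.count s ω then
      windowFactor p s t x k z (net.pos s n ω) (net.mark p s n ω) else 1)) atTop
      (𝓝 (if ENNReal.ofReal t ≤ net.minLoss p s ω then
        Complex.exp (-(z * ((x * ∑' n, net.windowTerm p s x k n ω : ℝ) : ℂ))) else 0)) := by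
  by_cases h : ENNReal.ofReal t ≤ net.minLoss p s ω
  · simp only [if_pos h, prod_windowFactor_of_le h]
    have h1 := (summable_windowTerm (k := k) hω).hasSum.tendsto_sum_nat
    have hc : Continuous fun y : ℝ => Complex.exp (-(z * ((x * y : ℝ) : ℂ))) := by fun_prop
    exact (hc.tendsto _).comp h1
  · rw [if_neg h]
    rw [le_minLoss_iff] at h
    push Not at h
    obtain ⟨n, hn, hlt⟩ := h
    refine tendsto_const_nhds.congr' ?_
    filter_upwards [eventually_gt_atTop n] with M hM
    refine (Finset.prod_eq_zero (Finset.mem_range.2 hM) ?_).symm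
    have h1 : p.pathLoss s ‖net.pos s n ω‖ < t := hlt
    rw [if_pos hn, windowFactor, if_pos h1]

open Classical in
-- The outer cutoff `k` makes the factor equal to `1` outside a set of finite intensity, as the
-- Laplace functional requires. Two limits of the same sequence of expectations are compared.
lemma IsModel.integral_void_exp_window (hnet : net.IsModel p μ) (s : S) {t x k : ℝ}
    (htx : t ≤ x) (hx : 0 < x) (hk : x ≤ k) {z : ℂ} (hz : 0 ≤ z.re) :
    ∫ ω, (if ENNReal.ofReal t ≤ net.minLoss p s ω then
      Complex.exp (-(z * ((x * ∑' n, net.windowTerm p s x k n ω : ℝ) : ℂ))) else 0) ∂μ =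
      Complex.exp (-∫ y, windowExponent p s t x k z y ∂(p.planarIntensity s)) := by
  have hK : p.planarIntensity s (p.lossBall s k) < ∞ := by
    rw [p.planarIntensity_lossBall s (hx.le.trans hk)]
    exact ENNReal.ofReal_lt_top
  have hone : ∀ y ∉ p.lossBall s k, ∀ j, windowFactor p s t x k z y j = 1 := by
    intro y hy j
    have h0 : ¬ p.pathLoss s ‖y‖ < k := hy
    have h1 : ¬ p.pathLoss s ‖y‖ < t := fun h => h0 (h.trans_le (htx.trans hk))
    rw [windowFactor, if_neg h1, if_neg fun h => h0 h.2]
  have h1 := (hnet.poisson s).tendsto_integral_prod_marks (hnet.measurable_mark s)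
    (hnet.indepFun_process_marks s) (hnet.iIndepFun_marks s) (p.measurableSet_lossBall s k) hK
    (measurable_fst.windowFactor measurable_snd) (norm_windowFactor_le s t k hx hz) hone
    (hnet.integral_windowFactor s k htx hx hz)
  simp only [sub_sub_cancel] at h1
  have hfac : ∀ n : ℕ, Measurable fun ω => if (n : ℕ∞) < net.count s ω then
      windowFactor p s t x k z (net.pos s n ω) (net.mark p s n ω) else 1 := fun n =>
    Measurable.ite ((hnet.poisson s).measurableSet_lt n)
      (((hnet.poisson s).measurable_point n).windowFactor (hnet.measurable_mark s n))
      measurable_const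
  have h2 : Tendsto (fun M => ∫ ω, ∏ n ∈ Finset.range M, (if (n : ℕ∞) < net.count s ω then
      windowFactor p s t x k z (net.pos s n ω) (net.mark p s n ω) else 1) ∂μ) atTop
      (𝓝 (∫ ω, (if ENNReal.ofReal t ≤ net.minLoss p s ω then
        Complex.exp (-(z * ((x * ∑' n, net.windowTerm p s x k n ω : ℝ) : ℂ))) else 0) ∂μ)) := by
    refine tendsto_integral_of_dominated_convergence (fun _ => (1 : ℝ)) (fun M => ?_)
      (integrable_const _) (fun M => .of_forall fun ω => ?_) ?_
    · exact (Finset.measurable_fun_prod _ fun n _ => hfac n).aestronglyMeasurable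
    · rw [norm_prod]
      refine Finset.prod_le_one (fun _ _ => norm_nonneg _) fun n _ => ?_
      split_ifs
      · exact norm_windowFactor_le s t k hx hz _ _
      · simp
    · filter_upwards [hnet.ae_tailSum_ne_top] with ω hω
      exact tendsto_prod_windowFactor s k z (hω s x hx)
  exact tendsto_nhds_unique h2 h1

/-- As the outer cutoff `x + k` recedes, dominated convergence applies since `1 - markLaplace` is
integrable over the whole tail. The limit separates into a void part and an interference part. -/
lemma integral_windowExponent_tendsto (s : S) {t x : ℝ} (ht : 0 ≤ t) (hx : 0 < x) {z : ℂ}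
    (hz : 0 ≤ z.re) :
    Tendsto (fun k : ℕ => ∫ y, windowExponent p s t x (x + k) z y ∂(p.planarIntensity s)) atTop
      (𝓝 (p.intensity s t - p.exponent s z x)) := by
  classical
  have hB := p.planarIntensity_lossBall s ht
  have hBfin : p.planarIntensity s (p.lossBall s t) ≠ ∞ := by
    rw [hB]
    exact ENNReal.ofReal_ne_top
  have hi1 : Integrable ((p.lossBall s t).indicator fun _ => (1 : ℂ)) (p.planarIntensity s) :=
    (integrable_indicator_iff (p.measurableSet_lossBall s t)).2 (integrableOn_const hBfin)
  have hi2 := p.integrable_one_sub_markLaplace s hz hx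
  have hlim : ∫ y, ((p.lossBall s t).indicator (fun _ => (1 : ℂ)) y +
      if x < p.pathLoss s ‖y‖ then 1 - p.markLaplace s (z * ((x / p.pathLoss s ‖y‖ : ℝ) : ℂ))
      else 0) ∂(p.planarIntensity s) = p.intensity s t - p.exponent s z x := by
    rw [integral_add hi1 hi2, p.integral_one_sub_markLaplace_planarIntensity s hz hx,
      integral_indicator_const _ (p.measurableSet_lossBall s t), measureReal_def, hB,
      ENNReal.toReal_ofReal (p.intensity_nonneg s ht), Complex.real_smul]
    ring
  rw [← hlim]
  refine tendsto_integral_of_dominated_convergence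
    (fun y => ‖(p.lossBall s t).indicator (fun _ => (1 : ℂ)) y‖ +
      ‖if x < p.pathLoss s ‖y‖ then 1 - p.markLaplace s (z * ((x / p.pathLoss s ‖y‖ : ℝ) : ℂ))
        else 0‖) (fun k => ?_) (hi1.norm.add hi2.norm) (fun k => .of_forall fun y => ?_)
    (.of_forall fun y => ?_)
  · have h := p.measurable_pathLoss_norm s
    refine Measurable.aestronglyMeasurable (Measurable.add
      (measurable_const.indicator (p.measurableSet_lossBall s t)) (Measurable.ite
        ((measurableSet_lt measurable_const h).inter (measurableSet_lt h measurable_const))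
        (measurable_const.sub ?_) measurable_const))
    exact (p.measurable_markLaplace s).comp (measurable_const.mul (Complex.measurable_ofReal.comp
      (measurable_const.div h)))
  · refine (norm_add_le _ _).trans (add_le_add le_rfl ?_)
    by_cases h1 : x < p.pathLoss s ‖y‖ <;> by_cases h2 : p.pathLoss s ‖y‖ < x + k <;> simp [h1, h2]
  · refine tendsto_const_nhds.congr' ?_
    have h := tendsto_natCast_atTop_atTop (R := ℝ)
    filter_upwards [h.eventually_gt_atTop (p.pathLoss s ‖y‖ - x)] with k hk
    have h2 : p.pathLoss s ‖y‖ < x + k := by linarith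
    simp [windowExponent, h2]

open Classical in
/-- Joint law of the void probability and of the interference for the base stations of a state. -/
theorem IsModel.integral_void_exp_tailSum (hnet : net.IsModel p μ) (s : S) {t x : ℝ} (ht : 0 ≤ t)
    (htx : t ≤ x) (hx : 0 < x) {z : ℂ} (hz : 0 ≤ z.re) :
    ∫ ω, (if ENNReal.ofReal t ≤ net.minLoss p s ω then
      Complex.exp (-(z * ((x * (net.tailSum p s x ω).toReal : ℝ) : ℂ))) else 0) ∂μ =
      Complex.exp (-(p.intensity s t : ℂ)) * Complex.exp (p.exponent s z x) := by
  have hwin : ∀ k n, Measurable fun ω => net.windowTerm p s x k n ω := fun k n =>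
    Measurable.ite (measurableSet_lt (hnet.measurable_loss s n) measurable_const)
      ((hnet.measurable_tailTerm s n).comp measurable_prodMk_left) measurable_const
  have h1 : Tendsto (fun k : ℕ => ∫ ω, (if ENNReal.ofReal t ≤ net.minLoss p s ω then
      Complex.exp (-(z * ((x * ∑' n, net.windowTerm p s x (x + k) n ω : ℝ) : ℂ))) else 0) ∂μ) atTop
      (𝓝 (∫ ω, (if ENNReal.ofReal t ≤ net.minLoss p s ω then
        Complex.exp (-(z * ((x * (net.tailSum p s x ω).toReal : ℝ) : ℂ))) else 0) ∂μ)) := by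
    refine tendsto_integral_of_dominated_convergence (fun _ => (1 : ℝ)) (fun k => ?_)
      (integrable_const _) (fun k => .of_forall fun ω => ?_) ?_
    · have hsum : AEMeasurable (fun ω => ∑' n, net.windowTerm p s x (x + k) n ω) μ := by
        refine aemeasurable_of_tendsto_metrizable_ae atTop (f := fun (M : ℕ) ω =>
          ∑ n ∈ Finset.range M, net.windowTerm p s x (x + k) n ω) (fun M =>
            (Finset.measurable_fun_sum _ fun n _ => hwin _ n).aemeasurable) ?_
        filter_upwards [hnet.ae_tailSum_ne_top] with ω hω
        exact (summable_windowTerm (hω s x hx)).hasSum.tendsto_sum_nat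
      have hexp : AEMeasurable (fun ω =>
          Complex.exp (-(z * ((x * ∑' n, net.windowTerm p s x (x + k) n ω : ℝ) : ℂ)))) μ :=
        (by fun_prop : Measurable fun y : ℝ => Complex.exp (-(z * ((x * y : ℝ) : ℂ)))).comp_aemeasurable
          hsum
      have hset : MeasurableSet {ω | ENNReal.ofReal t ≤ net.minLoss p s ω} :=
        measurableSet_le measurable_const (hnet.measurable_minLoss s)
      refine (hexp.indicator hset).aestronglyMeasurable.congr (.of_forall fun ω => ?_)
      by_cases h : ENNReal.ofReal t ≤ net.minLoss p s ω <;> simp [h]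
    · split_ifs
      · exact norm_exp_neg_mul_le_one hz
          (mul_nonneg hx.le (tsum_nonneg fun n => windowTerm_nonneg s x _ n ω))
      · simp
    · filter_upwards [hnet.ae_tailSum_ne_top] with ω hω
      by_cases h : ENNReal.ofReal t ≤ net.minLoss p s ω
      · simp only [if_pos h, toReal_tailSum]
        have hc : Continuous fun y : ℝ => Complex.exp (-(z * ((x * y : ℝ) : ℂ))) := by fun_prop
        refine (hc.tendsto _).comp (tendsto_tsum_of_dominated_convergence
          (summable_tailTerm (hω s x hx)) (fun n => ?_) (.of_forall fun k n => ?_))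
        · refine tendsto_const_nhds.congr' ?_
          have h := tendsto_natCast_atTop_atTop (R := ℝ)
          filter_upwards [h.eventually_gt_atTop (net.loss p s n ω - x)] with k hk
          have h2 : net.loss p s n ω < x + k := by linarith
          rw [windowTerm, if_pos h2]
        · rw [Real.norm_of_nonneg (windowTerm_nonneg s x _ n ω)]
          exact windowTerm_le s x _ n ω
      · simp only [if_neg h]
        exact tendsto_const_nhds
  have h2 : Tendsto (fun k : ℕ => ∫ ω, (if ENNReal.ofReal t ≤ net.minLoss p s ω then
      Complex.exp (-(z * ((x * ∑' n, net.windowTerm p s x (x + k) n ω : ℝ) : ℂ))) else 0) ∂μ) atTop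
      (𝓝 (Complex.exp (-(p.intensity s t - p.exponent s z x)))) := by
    refine Tendsto.congr (fun k => (hnet.integral_void_exp_window s htx hx
      (le_add_of_nonneg_right k.cast_nonneg) hz).symm) ?_
    exact ((Complex.continuous_exp.comp continuous_neg).tendsto _).comp
      (integral_windowExponent_tendsto s ht hx hz)
  rw [tendsto_nhds_unique h1 h2, ← Complex.exp_add]
  congr 1
  ring

end Network


/-! ### The moment generating function of the interference -/

lemma Measurable.uncurry_apply {α β γ δ : Type*} [MeasurableSpace α] [MeasurableSpace β]
    [MeasurableSpace γ] [MeasurableSpace δ] {F : β → γ → δ}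
    (hF : Measurable fun u : β × γ => F u.1 u.2) {f : α → β} {g : α → γ} (hf : Measurable f)
    (hg : Measurable g) : Measurable fun a => F (f a) (g a) :=
  hF.comp (hf.prodMk hg)

/-- Moment generating function of the normalized interference beyond the path-loss `x`. -/
def NetworkParams.interferenceMGF {S : Type*} [Fintype S] (p : NetworkParams S 1) (z : ℂ) (x : ℝ) :
    ℂ :=
  Complex.exp (∑ s, p.exponent s z x)

lemma NetworkParams.interferenceMGF_linkState (p : NetworkParams LinkState 1) :
    p.interferenceMGF = p.twoStateMGF := by
  ext z x
  rw [interferenceMGF, twoStateMGF]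
  congr 1
  rw [show (Finset.univ : Finset LinkState) = {LinkState.los, LinkState.nlos} from rfl,
    Finset.sum_pair (by simp)]

/-- Growth in `x` of the mean of the normalized interference. -/
def NetworkParams.meanBound {S : Type*} [Fintype S] (p : NetworkParams S 1) (x : ℝ) : ℝ :=
  ∑ s, p.tailCoeff s * (x / p.kap s) ^ (2 / p.alp s) * p.maxMeanMark s

lemma NetworkParams.meanBound_nonneg {S : Type*} [Fintype S] (p : NetworkParams S 1) {x : ℝ}
    (hx : 0 ≤ x) : 0 ≤ p.meanBound x :=
  Finset.sum_nonneg fun s _ => mul_nonneg (mul_nonneg (p.tailCoeff_nonneg s)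
    (Real.rpow_nonneg (div_nonneg hx (p.kap_pos s).le) _)) (p.maxMeanMark_nonneg s)

namespace Network

open Filter Topology

variable {S Ω : Type*} [Fintype S] (net : Network S Ω) (p : NetworkParams S 1)

/-- Interference beyond the path-loss `x`, in units of `P_RB`. -/
def tailTotal (x : ℝ) (ω : Ω) : ℝ := ∑ s, (net.tailSum p s x ω).toReal

lemma tailTotal_nonneg (x : ℝ) (ω : Ω) : 0 ≤ net.tailTotal p x ω :=
  Finset.sum_nonneg fun _ _ => ENNReal.toReal_nonneg

lemma mul_tailTotal_nonneg {x : ℝ} (hx : 0 ≤ x) (ω : Ω) : 0 ≤ x * net.tailTotal p x ω :=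
  mul_nonneg hx (net.tailTotal_nonneg p x ω)

lemma toReal_interference {x : ℝ} {ω : Ω} (h : ∀ s, net.tailSum p s x ω ≠ ∞) :
    (net.interference p x ω).toReal = p.PRB * net.tailTotal p x ω := by
  rw [interference_eq, ENNReal.toReal_mul, ENNReal.toReal_ofReal p.PRB_pos.le,
    ENNReal.toReal_sum fun s _ => h s, tailTotal]

/-- Smallest path-losses in each state, truncated at `x`. -/
def minVec (x : ℝ) (ω : Ω) (s : S) : ℝ≥0∞ := min (net.minLoss p s ω) (ENNReal.ofReal x)

variable {mΩ : MeasurableSpace Ω} {μ : Measure Ω} {net p}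

namespace IsModel

lemma measurable_tailTotal (hnet : net.IsModel p μ) :
    Measurable fun u : ℝ × Ω => net.tailTotal p u.1 u.2 :=
  Finset.measurable_fun_sum _ fun s _ => (hnet.measurable_tailSum s).ennreal_toReal

lemma measurable_minVec (hnet : net.IsModel p μ) (x : ℝ) : Measurable (net.minVec p x) :=
  measurable_pi_lambda _ fun s => (hnet.measurable_minLoss s).min measurable_const

variable [IsProbabilityMeasure μ]

lemma ae_interference_eq (hnet : net.IsModel p μ) : ∀ᵐ ω ∂μ, ∀ x : ℝ, 0 < x →
    x / p.PRB * (net.interference p x ω).toReal = x * net.tailTotal p x ω := by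
  filter_upwards [hnet.ae_tailSum_ne_top] with ω hω x hx
  rw [net.toReal_interference p fun s => hω s x hx]
  have := p.PRB_pos.ne'
  field_simp

lemma ae_tendsto_tailTotal (hnet : net.IsModel p μ) : ∀ᵐ ω ∂μ, ∀ x : ℝ, 0 < x → ∀ u : ℕ → ℝ,
    (∀ k, x ≤ u k) → Tendsto u atTop (𝓝 x) →
      Tendsto (fun k => net.tailTotal p (u k) ω) atTop (𝓝 (net.tailTotal p x ω)) := by
  filter_upwards [hnet.ae_tailSum_ne_top] with ω hω x hx u hu hux
  exact tendsto_finsetSum _ fun s _ => tendsto_toReal_tailSum (hω s x hx) hu hux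

lemma measurable_exp_tailTotal (hnet : net.IsModel p μ) :
    Measurable fun u : (ℂ × ℝ) × Ω =>
      Complex.exp (-(u.1.1 * ((u.1.2 * net.tailTotal p u.1.2 u.2 : ℝ) : ℂ))) := by
  have h : Measurable fun u : (ℂ × ℝ) × Ω => net.tailTotal p u.1.2 u.2 :=
    hnet.measurable_tailTotal.uncurry_apply (F := net.tailTotal p)
      (measurable_snd.comp measurable_fst) measurable_snd
  have h2 : Measurable fun u : (ℂ × ℝ) × Ω => u.1.2 := by fun_prop
  have h3 : Measurable fun u : (ℂ × ℝ) × Ω => u.1.1 := by fun_prop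
  exact Complex.measurable_exp.comp (h3.mul (Complex.measurable_ofReal.comp (h2.mul h))).neg

lemma measurable_exp_tailTotal_fixed (hnet : net.IsModel p μ) (z : ℂ) (x : ℝ) :
    Measurable fun ω => Complex.exp (-(z * ((x * net.tailTotal p x ω : ℝ) : ℂ))) := by
  have h : Measurable (net.tailTotal p x) :=
    hnet.measurable_tailTotal.uncurry_apply (F := net.tailTotal p) measurable_const measurable_id
  fun_prop

lemma integrable_exp_tailTotal (hnet : net.IsModel p μ) {z : ℂ} (hz : 0 ≤ z.re) {x : ℝ}
    (hx : 0 ≤ x) :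
    Integrable (fun ω => Complex.exp (-(z * ((x * net.tailTotal p x ω : ℝ) : ℂ)))) μ :=
  (integrable_const (1 : ℝ)).mono' (hnet.measurable_exp_tailTotal_fixed z x).aestronglyMeasurable
    (.of_forall fun ω => norm_exp_neg_mul_le_one hz (net.mul_tailTotal_nonneg p hx ω))

open Classical in
-- The states are independent, so the one-state identities multiply. The product form says that the
-- void events are independent of the interference beyond `x`.
lemma integral_forall_void_exp (hnet : net.IsModel p μ) {t : S → ℝ} {x : ℝ} (ht : ∀ s, 0 ≤ t s)
    (htx : ∀ s, t s ≤ x) (hx : 0 < x) {z : ℂ} (hz : 0 ≤ z.re) :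
    ∫ ω in {ω | ∀ s, ENNReal.ofReal (t s) ≤ net.minLoss p s ω},
      Complex.exp (-(z * ((x * net.tailTotal p x ω : ℝ) : ℂ))) ∂μ =
    Complex.exp (-((∑ s, p.intensity s (t s) : ℝ) : ℂ)) * p.interferenceMGF z x := by
  let V : S → Ω → ℂ := fun s ω => if ENNReal.ofReal (t s) ≤ net.minLoss p s ω then
      Complex.exp (-(z * ((x * (net.tailSum p s x ω).toReal : ℝ) : ℂ))) else 0
  have hVm : ∀ s, Measurable[net.stateAlgebra s] (V s) := fun s => by
    have h1 : MeasurableSet[net.stateAlgebra s] {ω | ENNReal.ofReal (t s) ≤ net.minLoss p s ω} :=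
      net.measurable_minLoss_state p s measurableSet_Ici
    have h2 : Measurable fun y : ℝ≥0∞ => Complex.exp (-(z * ((x * y.toReal : ℝ) : ℂ))) := by
      fun_prop
    exact Measurable.ite h1 (h2.comp (net.measurable_tailSum_state p s x)) measurable_const
  have hVind : iIndepFun V μ := by
    rw [iIndepFun_iff_iIndep]
    exact iIndep_of_iIndep_of_le hnet.iIndep_stateAlgebra fun s => (hVm s).comap_le
  have hprod := hVind.integral_fun_prod_eq_prod_integral fun s =>
    ((hVm s).mono (hnet.stateAlgebra_le s) le_rfl).aestronglyMeasurable
  have hset : MeasurableSet {ω | ∀ s, ENNReal.ofReal (t s) ≤ net.minLoss p s ω} := by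
    rw [ofPred_forall]
    exact MeasurableSet.iInter fun s =>
      measurableSet_le measurable_const (hnet.measurable_minLoss s)
  have hV : ∀ ω, ∏ s, V s ω = {ω | ∀ s, ENNReal.ofReal (t s) ≤ net.minLoss p s ω}.indicator
      (fun ω => Complex.exp (-(z * ((x * net.tailTotal p x ω : ℝ) : ℂ)))) ω := by
    intro ω
    by_cases h : ∀ s, ENNReal.ofReal (t s) ≤ net.minLoss p s ω
    · rw [indicator_of_mem (show ω ∈ {ω | ∀ s, ENNReal.ofReal (t s) ≤ net.minLoss p s ω} from h),
        tailTotal, Finset.mul_sum, Complex.ofReal_sum, Finset.mul_sum, ← Finset.sum_neg_distrib,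
        Complex.exp_sum]
      exact Finset.prod_congr rfl fun s _ => if_pos (h s)
    · rw [indicator_of_notMem
        (show ω ∉ {ω | ∀ s, ENNReal.ofReal (t s) ≤ net.minLoss p s ω} from h)]
      push Not at h
      obtain ⟨s, hs⟩ := h
      exact Finset.prod_eq_zero (Finset.mem_univ s) (if_neg hs.not_ge)
  rw [← integral_indicator hset, ← integral_congr_ae (.of_forall hV), hprod]
  have : ∀ s, ∫ ω, V s ω ∂μ = Complex.exp (-(p.intensity s (t s) : ℂ)) *
      Complex.exp (p.exponent s z x) := fun s =>
    hnet.integral_void_exp_tailSum s (ht s) (htx s) hx hz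
  simp_rw [this]
  rw [Finset.prod_mul_distrib, ← Complex.exp_sum, ← Complex.exp_sum,
    NetworkParams.interferenceMGF, Finset.sum_neg_distrib, Complex.ofReal_sum]

/-- The moment generating function of the normalized interference beyond `x`. -/
theorem integral_exp_tailTotal (hnet : net.IsModel p μ) {x : ℝ} (hx : 0 < x) {z : ℂ}
    (hz : 0 ≤ z.re) :
    ∫ ω, Complex.exp (-(z * ((x * net.tailTotal p x ω : ℝ) : ℂ))) ∂μ = p.interferenceMGF z x := by
  have h := hnet.integral_forall_void_exp (t := 0) (fun _ => le_rfl) (fun _ => hx.le) hx hz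
  simpa [NetworkParams.intensity_zero] using h

lemma interferenceMGF_zero (hnet : net.IsModel p μ) {x : ℝ} (hx : 0 < x) :
    p.interferenceMGF 0 x = 1 := by
  rw [← hnet.integral_exp_tailTotal hx (z := 0) (by simp)]
  simp

/-- Joint void probabilities. -/
theorem measureReal_forall_le_minLoss (hnet : net.IsModel p μ) {t : S → ℝ} (ht : ∀ s, 0 ≤ t s) :
    μ.real {ω | ∀ s, ENNReal.ofReal (t s) ≤ net.minLoss p s ω} =
      Real.exp (-∑ s, p.intensity s (t s)) := by
  -- Any positive level above all `t s` will do; at `z = 0` the interference drops out and only the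
  -- void probability remains.
  have hx : 0 < ∑ s, t s + 1 := by
    have := Finset.sum_nonneg fun s (_ : s ∈ Finset.univ) => ht s
    linarith
  have h := hnet.integral_forall_void_exp ht (fun s => (Finset.single_le_sum (fun s _ => ht s)
    (Finset.mem_univ s)).trans (le_add_of_nonneg_right zero_le_one)) hx (z := 0) (by simp)
  rw [hnet.interferenceMGF_zero hx] at h
  simp only [zero_mul, neg_zero, Complex.exp_zero, integral_const, measureReal_restrict_apply_univ,
    Complex.real_smul, mul_one] at h
  exact_mod_cast h

lemma isPiSystem_image_pi_Ici :
    IsPiSystem (pi univ '' pi univ fun _ : S => range (Ici : ℝ≥0∞ → Set ℝ≥0∞)) :=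
  IsPiSystem.pi fun _ => isPiSystem_Ici

lemma generateFrom_image_pi_Ici : (MeasurableSpace.pi : MeasurableSpace (S → ℝ≥0∞)) =
    MeasurableSpace.generateFrom
      (pi univ '' pi univ fun _ : S => range (Ici : ℝ≥0∞ → Set ℝ≥0∞)) := by
  rw [← generateFrom_pi_eq]
  · rw [← borel_eq_generateFrom_Ici, ← BorelSpace.measurable_eq (α := ℝ≥0∞)]
  · exact fun _ => ⟨fun _ => Ici 0, fun _ => mem_range_self 0, by simp [iUnion_const]⟩

/-- The normalized interference beyond `x` is independent of the path-losses smaller than `x`. -/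
theorem setIntegral_exp_tailTotal (hnet : net.IsModel p μ) {x : ℝ} (hx : 0 < x) {z : ℂ}
    (hz : 0 ≤ z.re) {E : Set (S → ℝ≥0∞)} (hE : MeasurableSet E) :
    ∫ ω in net.minVec p x ⁻¹' E, Complex.exp (-(z * ((x * net.tailTotal p x ω : ℝ) : ℂ))) ∂μ =
      μ.real (net.minVec p x ⁻¹' E) * p.interferenceMGF z x := by
  have hint := hnet.integrable_exp_tailTotal hz hx.le
  have hm := hnet.measurable_minVec x
  -- Boxes of half-lines `[t s, ∞]` form a π-system generating the product σ-algebra, and on boxes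
  -- the claim is the factorization of void events and interference.
  induction E, hE using MeasurableSpace.induction_on_inter
    (generateFrom_image_pi_Ici (S := S)) (isPiSystem_image_pi_Ici (S := S)) with
  | empty => simp
  | basic E hE =>
    obtain ⟨F, hF, rfl⟩ := hE
    choose t ht using fun s => hF s (mem_univ s)
    by_cases h : ∀ s, t s ≤ ENNReal.ofReal x
    · have hfin : ∀ s, t s ≠ ∞ := fun s => ((h s).trans_lt ENNReal.ofReal_lt_top).ne
      have hset : net.minVec p x ⁻¹' univ.pi F =
          {ω | ∀ s, ENNReal.ofReal (t s).toReal ≤ net.minLoss p s ω} := by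
        ext ω
        simp only [mem_preimage, Set.mem_pi, mem_univ, true_implies, ← ht, mem_Ici, minVec,
          le_min_iff, ENNReal.ofReal_toReal (hfin _), h, and_true]
        rfl
      rw [hset, hnet.integral_forall_void_exp (fun s => ENNReal.toReal_nonneg)
        (fun s => ENNReal.toReal_le_of_le_ofReal hx.le (h s)) hx hz,
        hnet.measureReal_forall_le_minLoss fun s => ENNReal.toReal_nonneg]
      push_cast
      rfl
    · push Not at h
      obtain ⟨s, hs⟩ := h
      -- A vector truncated at `x` cannot reach a threshold above `x`.
      have hset : net.minVec p x ⁻¹' univ.pi F = ∅ := by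
        refine eq_empty_of_forall_notMem fun ω hω => ?_
        have h1 := hω s (mem_univ s)
        rw [← ht, mem_Ici, minVec, le_min_iff] at h1
        exact absurd h1.2 hs.not_ge
      simp [hset]
  | compl E hE ih =>
    have h1 := integral_add_compl (hm hE) hint
    rw [ih, hnet.integral_exp_tailTotal hx hz] at h1
    rw [preimage_compl, probReal_compl_eq_one_sub (hm hE), eq_sub_of_add_eq' h1]
    push_cast
    ring
  | iUnion f hd hf ih =>
    rw [preimage_iUnion, integral_iUnion (fun i => hm (hf i))
      (fun i j hij => (hd hij).preimage _) hint.integrableOn]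
    simp_rw [ih]
    rw [tsum_mul_right, measureReal_def, measure_iUnion (fun i j hij => (hd hij).preimage _)
      fun i => hm (hf i), ENNReal.tsum_toReal_eq fun _ => measure_ne_top _ _, Complex.ofReal_tsum]
    rfl

/-! #### Bounds of the moment generating function -/

lemma norm_interferenceMGF_le (hnet : net.IsModel p μ) {x : ℝ} (hx : 0 < x) {z : ℂ}
    (hz : 0 ≤ z.re) : ‖p.interferenceMGF z x‖ ≤ 1 := by
  rw [← hnet.integral_exp_tailTotal hx hz]
  refine (norm_integral_le_integral_norm _).trans ?_
  have := integral_mono (hnet.integrable_exp_tailTotal hz hx.le).norm (integrable_const (1 : ℝ))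
    fun ω => norm_exp_neg_mul_le_one hz (net.mul_tailTotal_nonneg p hx.le ω)
  simpa using this

lemma lintegral_mul_tailTotal_le (hnet : net.IsModel p μ) {x : ℝ} (hx : 0 < x) :
    ∫⁻ ω, ENNReal.ofReal (x * net.tailTotal p x ω) ∂μ ≤ ENNReal.ofReal (p.meanBound x) := by
  have hnn : ∀ s, 0 ≤ p.tailCoeff s * (x / p.kap s) ^ (2 / p.alp s) := fun s =>
    mul_nonneg (p.tailCoeff_nonneg s) (Real.rpow_nonneg (div_nonneg hx.le (p.kap_pos s).le) _)
  calc ∫⁻ ω, ENNReal.ofReal (x * net.tailTotal p x ω) ∂μ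
      ≤ ∫⁻ ω, ∑ s, ENNReal.ofReal x * net.tailSum p s x ω ∂μ := by
        refine lintegral_mono fun ω => ?_
        rw [ENNReal.ofReal_mul hx.le, tailTotal,
          ENNReal.ofReal_sum_of_nonneg fun _ _ => ENNReal.toReal_nonneg, Finset.mul_sum]
        exact Finset.sum_le_sum fun s _ => mul_le_mul_right ENNReal.ofReal_toReal_le _
    _ ≤ ∑ s, ENNReal.ofReal (p.tailCoeff s * (x / p.kap s) ^ (2 / p.alp s)) *
        ENNReal.ofReal (p.maxMeanMark s) := by
        have hm : ∀ s, Measurable fun ω => ENNReal.ofReal x * net.tailSum p s x ω := fun s =>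
          ((hnet.measurable_tailSum s).comp measurable_prodMk_left).const_mul _
        rw [lintegral_finsetSum _ fun s _ => hm s]
        exact Finset.sum_le_sum fun s _ => hnet.lintegral_tailSum_le s hx
    _ = ENNReal.ofReal (p.meanBound x) := by
        rw [NetworkParams.meanBound, ENNReal.ofReal_sum_of_nonneg fun s _ =>
          mul_nonneg (hnn s) (p.maxMeanMark_nonneg s)]
        exact Finset.sum_congr rfl fun s _ => (ENNReal.ofReal_mul (hnn s)).symm

/-- First-order bound `|1 - e^{-zV}| ≤ |z| V` under the expectation. It controls the integrals near
`z = 0`. -/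
lemma norm_one_sub_interferenceMGF_le (hnet : net.IsModel p μ) {x : ℝ} (hx : 0 < x) {z : ℂ}
    (hz : 0 ≤ z.re) : ‖1 - p.interferenceMGF z x‖ ≤ ‖z‖ * p.meanBound x := by
  have hm : Measurable fun ω => x * net.tailTotal p x ω :=
    (hnet.measurable_tailTotal.comp measurable_prodMk_left).const_mul x
  have hnn : ∀ᵐ ω ∂μ, 0 ≤ x * net.tailTotal p x ω :=
    .of_forall fun ω => net.mul_tailTotal_nonneg p hx.le ω
  have hle := hnet.lintegral_mul_tailTotal_le hx
  have hint : Integrable (fun ω => x * net.tailTotal p x ω) μ := by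
    refine ⟨hm.aestronglyMeasurable, ?_⟩
    rw [hasFiniteIntegral_iff_ofReal hnn]
    exact hle.trans_lt ENNReal.ofReal_lt_top
  have hmean : ∫ ω, x * net.tailTotal p x ω ∂μ ≤ p.meanBound x := by
    rw [integral_eq_lintegral_of_nonneg_ae hnn hm.aestronglyMeasurable]
    exact ENNReal.toReal_le_of_le_ofReal (p.meanBound_nonneg hx.le) hle
  have h1 : 1 - p.interferenceMGF z x =
      ∫ ω, (1 - Complex.exp (-(z * ((x * net.tailTotal p x ω : ℝ) : ℂ)))) ∂μ := by
    rw [integral_sub (integrable_const _) (hnet.integrable_exp_tailTotal hz hx.le),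
      hnet.integral_exp_tailTotal hx hz]
    simp
  rw [h1]
  calc ‖∫ ω, (1 - Complex.exp (-(z * ((x * net.tailTotal p x ω : ℝ) : ℂ)))) ∂μ‖
      ≤ ∫ ω, ‖z‖ * (x * net.tailTotal p x ω) ∂μ := by
        refine norm_integral_le_of_norm_le (hint.const_mul _) (.of_forall fun ω => ?_)
        have h0 := net.mul_tailTotal_nonneg p hx.le ω
        refine (norm_one_sub_exp_neg_le (NetworkParams.re_mul_ofReal_nonneg hz h0)).trans
          (le_of_eq ?_)
        rw [norm_mul, Complex.norm_real, Real.norm_of_nonneg h0]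
    _ ≤ ‖z‖ * p.meanBound x := by
        rw [integral_const_mul]
        exact mul_le_mul_of_nonneg_left hmean (norm_nonneg _)

/-- A measurable function that agrees with the moment generating function of the interference. -/
lemma exists_measurable_interferenceMGF (hnet : net.IsModel p μ) :
    ∃ M : ℂ × ℝ → ℂ, Measurable M ∧
      ∀ z : ℂ, 0 ≤ z.re → ∀ x : ℝ, 0 < x → M (z, x) = p.interferenceMGF z x :=
  -- Measurability is read off the expectation, since the closed form contains a hypergeometric
  -- function obtained by choice. Agreement is needed only for `Re z ≥ 0` and `x > 0`.
  ⟨fun u => ∫ ω, Complex.exp (-(u.1 * ((u.2 * net.tailTotal p u.2 ω : ℝ) : ℂ))) ∂μ,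
    hnet.measurable_exp_tailTotal.stronglyMeasurable.integral_prod_right'.measurable,
    fun _ hz _ hx => hnet.integral_exp_tailTotal hx hz⟩

lemma tendsto_interferenceMGF (hnet : net.IsModel p μ) {z : ℂ} (hz : 0 ≤ z.re) {x : ℝ}
    (hx : 0 < x) {u : ℕ → ℝ} (hu : ∀ k, x ≤ u k) (hux : Tendsto u atTop (𝓝 x)) :
    Tendsto (fun k => p.interferenceMGF z (u k)) atTop (𝓝 (p.interferenceMGF z x)) := by
  simp_rw [← hnet.integral_exp_tailTotal hx hz,
    ← fun k => hnet.integral_exp_tailTotal (hx.trans_le (hu k)) hz]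
  refine tendsto_integral_of_dominated_convergence (fun _ => (1 : ℝ))
    (fun k => (hnet.measurable_exp_tailTotal_fixed z _).aestronglyMeasurable) (integrable_const _)
    (fun k => .of_forall fun ω => norm_exp_neg_mul_le_one hz
      (net.mul_tailTotal_nonneg p (hx.le.trans (hu k)) ω)) ?_
  filter_upwards [hnet.ae_tendsto_tailTotal] with ω hω
  have hc : Continuous fun y : ℝ => Complex.exp (-(z * (y : ℂ))) := by fun_prop
  exact (hc.tendsto _).comp (hux.mul (hω x hx u hu hux))

end IsModel

end Network


/-! ### Laws with a given cumulative hazard function -/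

/-- A random variable with survival function `exp (-Λ)` has density `Λ' exp (-Λ)`. -/
theorem map_toReal_eq_withDensity {Ω : Type*} [MeasurableSpace Ω] {μ : Measure Ω}
    [IsProbabilityMeasure μ] {X : Ω → ℝ≥0∞} (hX : Measurable X) {Λ Λ' : ℝ → ℝ}
    (hc : ContinuousOn Λ (Ici 0)) (hd : ∀ x, 0 < x → HasDerivWithinAt Λ (Λ' x) (Ici x) x)
    (hpos : ∀ x, 0 < x → 0 ≤ Λ' x)
    (hsurv : ∀ t, 0 ≤ t → μ.real {ω | ENNReal.ofReal t ≤ X ω} = Real.exp (-Λ t)) :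
    (μ.restrict {ω | X ω ≠ ∞}).map (fun ω => (X ω).toReal) =
      (volume.restrict (Ioi 0)).withDensity fun x => ENNReal.ofReal (Λ' x * Real.exp (-Λ x)) := by
  have hXr : Measurable fun ω => (X ω).toReal := hX.ennreal_toReal
  have hge : ∀ t, MeasurableSet {ω | ENNReal.ofReal t ≤ X ω} := fun t =>
    measurableSet_le measurable_const hX
  refine Measure.ext_of_Ico _ _ fun a b hab => ?_
  rw [Measure.map_apply hXr measurableSet_Ico, Measure.restrict_apply (hXr measurableSet_Ico),
    withDensity_apply _ measurableSet_Ico, Measure.restrict_restrict measurableSet_Ico]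
  rcases le_or_gt b 0 with hb | hb
  · have h1 : (fun ω => (X ω).toReal) ⁻¹' Ico a b = ∅ :=
      eq_empty_of_forall_notMem fun ω hω =>
        absurd (hω.2.trans_le hb) ENNReal.toReal_nonneg.not_gt
    have h2 : Ico a b ∩ Ioi 0 = ∅ := eq_empty_of_forall_notMem fun x hx =>
      absurd (hx.1.2.trans_le hb) (lt_asymm hx.2)
    simp [h1, h2]
  -- The variable is nonnegative, so the interval is cut at `0`, where `Λ` is continuous but need
  -- not be differentiable.
  set a' := max a 0 with ha'
  have ha0 : 0 ≤ a' := le_max_right _ _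
  have hab' : a' < b := max_lt hab hb
  have hset : (fun ω => (X ω).toReal) ⁻¹' Ico a b ∩ {ω | X ω ≠ ∞} =
      {ω | ENNReal.ofReal a' ≤ X ω} \ {ω | ENNReal.ofReal b ≤ X ω} := by
    ext ω
    show (a ≤ (X ω).toReal ∧ (X ω).toReal < b) ∧ X ω ≠ ∞ ↔
      ENNReal.ofReal a' ≤ X ω ∧ ¬ ENNReal.ofReal b ≤ X ω
    rw [not_le]
    constructor
    · rintro ⟨⟨h1, h2⟩, h3⟩
      exact ⟨ENNReal.ofReal_le_of_le_toReal (max_le h1 ENNReal.toReal_nonneg),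
        (ENNReal.lt_ofReal_iff_toReal_lt h3).2 h2⟩
    · rintro ⟨h1, h2⟩
      have h3 : X ω ≠ ∞ := (h2.trans ENNReal.ofReal_lt_top).ne
      exact ⟨⟨(le_max_left _ _).trans ((ENNReal.ofReal_le_iff_le_toReal h3).1 h1),
        (ENNReal.lt_ofReal_iff_toReal_lt h3).1 h2⟩, h3⟩
  have hsub : {ω | ENNReal.ofReal b ≤ X ω} ⊆ {ω | ENNReal.ofReal a' ≤ X ω} := fun ω hω =>
    (ENNReal.ofReal_le_ofReal hab'.le).trans hω
  have hIoc : (Ico a b ∩ Ioi 0 : Set ℝ) =ᵐ[volume] Ioc a' b := by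
    rw [show Ioc a' b = Ioc a b ∩ Ioi 0 by
      rw [Ioc_inter_Ioi]]
    exact (Ico_ae_eq_Ioc (μ := volume)).inter (ae_eq_refl _)
  rw [hset, setLIntegral_congr hIoc]
  have hcont : ContinuousOn (fun x => -Real.exp (-Λ x)) (Icc a' b) :=
    (Real.continuous_exp.comp_continuousOn
      (hc.mono fun x hx => ha0.trans hx.1).neg).neg
  have hderiv : ∀ x ∈ Ioo a' b,
      HasDerivWithinAt (fun x => -Real.exp (-Λ x)) (Λ' x * Real.exp (-Λ x)) (Ioi x) x := by
    intro x hx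
    have h := ((hd x (ha0.trans_lt hx.1)).mono Ioi_subset_Ici_self).neg.exp.neg
    refine h.congr_deriv ?_
    rw [mul_neg, neg_neg, mul_comm]
    rfl
  have hnn : ∀ x ∈ Ioo a' b, 0 ≤ Λ' x * Real.exp (-Λ x) := fun x hx =>
    mul_nonneg (hpos x (ha0.trans_lt hx.1)) (Real.exp_pos _).le
  -- No bound on `Λ'` is assumed: nonnegativity of the right derivative of a continuous function
  -- already gives integrability.
  have hint := intervalIntegral.integrableOn_deriv_right_of_nonneg hcont hderiv hnn
  have hFTC := intervalIntegral.integral_eq_sub_of_hasDeriv_right_of_le hab'.le hcont hderiv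
    ((intervalIntegrable_iff_integrableOn_Ioc_of_le hab'.le).2 hint)
  rw [intervalIntegral.integral_of_le hab'.le] at hFTC
  rw [← ofReal_integral_eq_lintegral_ofReal hint, hFTC, ← ofReal_measureReal,
    measureReal_sdiff hsub (hge b), hsurv a' ha0, hsurv b hb.le]
  · congr 1
    ring
  · rw [← restrict_Ioo_eq_restrict_Ioc]
    exact (ae_restrict_iff' measurableSet_Ioo).2 (.of_forall hnn)

/-! ### Bounds on the intensity and moments of the serving density. -/

namespace NetworkParams

open Filter Topology

variable {S : Type*} [Fintype S] (p : NetworkParams S 1)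

/-- A single formula without case distinction, from which continuity and the lower bound are
immediate. -/
lemma intensity_eq_min_max (s : S) {ξ : ℝ} (hξ : 0 ≤ ξ) :
    p.intensity s ξ = Real.pi * p.lamBS * p.Theta s *
      (p.q s 1 * min ((ξ / p.kap s) ^ (2 / p.alp s)) (p.D 1 ^ 2) +
        p.q s 2 * max ((ξ / p.kap s) ^ (2 / p.alp s) - p.D 1 ^ 2) 0) := by
  have hD := p.D_one_pos.le
  have hR := p.lossRadius_nonneg s hξ
  rw [← p.lossRadius_sq s hξ]
  rcases le_total ξ (p.threshold s) with h | h
  · have h1 : p.lossRadius s ξ ≤ p.D 1 := by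
      rw [← not_lt, ← p.pathLoss_lt_iff s hD hξ, not_lt]
      exact h
    have h2 : p.lossRadius s ξ ^ 2 ≤ p.D 1 ^ 2 := by gcongr
    rw [min_eq_left h2, max_eq_right (sub_nonpos.2 h2), p.intensity_of_le s hξ h,
      ← p.lossRadius_sq s hξ]
    ring
  · have h1 : p.D 1 ≤ p.lossRadius s ξ := by
      rw [← not_lt, ← p.lt_pathLoss_iff s hD hξ, not_lt]
      exact h
    have h2 : p.D 1 ^ 2 ≤ p.lossRadius s ξ ^ 2 := by gcongr
    rw [min_eq_right h2, max_eq_left (sub_nonneg.2 h2), p.intensity_of_ge s h,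
      ← p.lossRadius_sq s hξ]
    ring

lemma coeff_pos (s : S) : 0 < Real.pi * p.lamBS * p.Theta s :=
  mul_pos (mul_pos Real.pi_pos p.lamBS_pos) (p.Theta_pos s)

lemma continuousOn_intensity (s : S) : ContinuousOn (p.intensity s) (Ici 0) := by
  have h : Continuous fun ξ : ℝ => (ξ / p.kap s) ^ (2 / p.alp s) :=
    (Real.continuous_rpow_const (p.two_div_alp_pos s).le).comp (continuous_id.div_const _)
  have h2 : Continuous fun ξ : ℝ => Real.pi * p.lamBS * p.Theta s *
      (p.q s 1 * min ((ξ / p.kap s) ^ (2 / p.alp s)) (p.D 1 ^ 2) +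
        p.q s 2 * max ((ξ / p.kap s) ^ (2 / p.alp s) - p.D 1 ^ 2) 0) := by fun_prop
  exact h2.continuousOn.congr fun ξ hξ => p.intensity_eq_min_max s hξ

lemma intensity_ge (s : S) {ξ : ℝ} (hξ : 0 ≤ ξ) :
    Real.pi * p.lamBS * p.Theta s * (p.q s 2 * ((ξ / p.kap s) ^ (2 / p.alp s) - p.D 1 ^ 2)) ≤
      p.intensity s ξ := by
  rw [p.intensity_eq_min_max s hξ]
  refine mul_le_mul_of_nonneg_left ?_ (p.coeff_pos s).le
  have h1 : 0 ≤ p.q s 1 * min ((ξ / p.kap s) ^ (2 / p.alp s)) (p.D 1 ^ 2) :=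
    mul_nonneg (p.q_one_nonneg s) (le_min (Real.rpow_nonneg (div_nonneg hξ (p.kap_pos s).le) _)
      (sq_nonneg _))
  have h2 := mul_le_mul_of_nonneg_left
    (le_max_left ((ξ / p.kap s) ^ (2 / p.alp s) - p.D 1 ^ 2) 0) (p.q_two_nonneg s)
  linarith

lemma intensityDeriv_nonneg (s : S) {ξ : ℝ} (hξ : 0 < ξ) : 0 ≤ p.intensityDeriv s ξ := by
  have h : 0 ≤ (2 / p.alp s) * p.kap s ^ (-(2 / p.alp s)) * ξ ^ (2 / p.alp s - 1) := by
    have := p.two_div_alp_pos s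
    have := p.kap_pos s
    positivity
  rcases lt_or_ge ξ (p.threshold s) with h1 | h1
  · rw [p.intensityDeriv_of_lt s hξ h1]
    exact mul_nonneg (mul_nonneg (p.coeff_pos s).le (p.q_one_nonneg s)) h
  · rw [p.intensityDeriv_of_ge s h1]
    exact mul_nonneg (mul_nonneg (p.coeff_pos s).le (p.q_two_nonneg s)) h

lemma intensityDeriv_le (s : S) {ξ : ℝ} (hξ : 0 < ξ) :
    p.intensityDeriv s ξ ≤ Real.pi * p.lamBS * p.Theta s *
      ((2 / p.alp s) * p.kap s ^ (-(2 / p.alp s)) * ξ ^ (2 / p.alp s - 1)) := by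
  have h : 0 ≤ (2 / p.alp s) * p.kap s ^ (-(2 / p.alp s)) * ξ ^ (2 / p.alp s - 1) := by
    have := p.two_div_alp_pos s
    have := p.kap_pos s
    positivity
  have hc := (p.coeff_pos s).le
  rcases lt_or_ge ξ (p.threshold s) with h1 | h1
  · rw [p.intensityDeriv_of_lt s hξ h1]
    exact mul_le_mul_of_nonneg_right (mul_le_of_le_one_right hc (p.q_le_one s (by simp))) h
  · rw [p.intensityDeriv_of_ge s h1]
    exact mul_le_mul_of_nonneg_right (mul_le_of_le_one_right hc (p.q_le_one s (by simp))) h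

lemma measurable_heaviside : Measurable heaviside :=
  Measurable.ite measurableSet_Ici measurable_const measurable_const

lemma measurable_intensityDeriv (s : S) : Measurable (p.intensityDeriv s) := by
  have h1 := measurable_heaviside
  have h2 : Measurable heavisideCompl := measurable_const.sub h1
  unfold intensityDeriv
  fun_prop

lemma servingDensity_nonneg (s : S) {x : ℝ} (hx : 0 < x) : 0 ≤ p.servingDensity s x :=
  mul_nonneg (p.intensityDeriv_nonneg s hx) (Real.exp_pos _).le

/-- The outer probabilities sum to `1`. Hence some state has stations arbitrarily far out, its
intensity diverges, and a serving station exists almost surely. -/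
lemma exists_q_two_pos : ∃ s, 0 < p.q s 2 := by
  by_contra! h
  have h1 := p.q_sum 2 (by simp)
  have h2 := Finset.sum_nonpos fun s (_ : s ∈ Finset.univ) => h s
  linarith

/-- The total intensity grows at least like a power. -/
lemma exists_le_sum_intensity : ∃ b c δ : ℝ, 0 < b ∧ 0 < δ ∧ ∀ x, 0 ≤ x →
    b * x ^ δ - c ≤ ∑ s, p.intensity s x := by
  obtain ⟨s, hs⟩ := p.exists_q_two_pos
  have hk := p.kap_pos s
  refine ⟨Real.pi * p.lamBS * p.Theta s * p.q s 2 * (p.kap s ^ (2 / p.alp s))⁻¹,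
    Real.pi * p.lamBS * p.Theta s * p.q s 2 * p.D 1 ^ 2, 2 / p.alp s,
    mul_pos (mul_pos (p.coeff_pos s) hs) (inv_pos.2 (Real.rpow_pos_of_pos hk _)),
    p.two_div_alp_pos s, fun x hx => ?_⟩
  refine le_trans (le_of_eq ?_) ((p.intensity_ge s hx).trans
    (Finset.single_le_sum (fun r _ => p.intensity_nonneg r hx) (Finset.mem_univ s)))
  rw [Real.div_rpow hx hk.le]
  ring

lemma tendsto_sum_intensity : Tendsto (fun x => ∑ s, p.intensity s x) atTop atTop := by
  obtain ⟨b, c, δ, hb, hδ, h⟩ := p.exists_le_sum_intensity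
  refine tendsto_atTop_mono' atTop ((eventually_ge_atTop 0).mono h) ?_
  exact tendsto_atTop_add_const_right _ _ ((tendsto_rpow_atTop hδ).const_mul_atTop hb)

lemma measurableOn_servingDensity (s : S) :
    AEMeasurable (p.servingDensity s) (volume.restrict (Ioi 0)) := by
  refine (p.measurable_intensityDeriv s).aemeasurable.mul (Real.measurable_exp.comp_aemeasurable
    (Finset.aemeasurable_fun_sum _ fun r _ => ?_).neg)
  exact ((p.continuousOn_intensity r).mono Ioi_subset_Ici_self).aemeasurable measurableSet_Ioi

/-- Moments of the path-loss of the intended link. -/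
lemma integrableOn_rpow_mul_servingDensity (s : S) {a : ℝ} (ha : -(2 / p.alp s) < a) :
    IntegrableOn (fun x => x ^ a * p.servingDensity s x) (Ioi 0) := by
  obtain ⟨b, c, δ, hb, hδ, h⟩ := p.exists_le_sum_intensity
  -- `Λ_s'` is at most a multiple of `x^{2/α_s - 1}` and `exp (-∑ Λ)` is at most `e^c e^{-b x^δ}`;
  -- the resulting exponent exceeds `-1` precisely when `a > -2 / α_s`, so some negative moments
  -- exist.
  have hint := (integrableOn_rpow_mul_exp_neg_mul_rpow (s := a + 2 / p.alp s - 1) (p := δ) (b := b)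
    (by linarith) hδ hb).const_mul
    (Real.pi * p.lamBS * p.Theta s * ((2 / p.alp s) * p.kap s ^ (-(2 / p.alp s))) * Real.exp c)
  refine hint.mono' ((by fun_prop : Measurable fun x : ℝ => x ^ a).aestronglyMeasurable.mul
    (p.measurableOn_servingDensity s).aestronglyMeasurable) ?_
  refine (ae_restrict_iff' measurableSet_Ioi).2 (.of_forall fun x hx => ?_)
  have hx0 : 0 < x := hx
  have h1 := p.intensityDeriv_le s hx0
  have h2 : Real.exp (-∑ r, p.intensity r x) ≤ Real.exp c * Real.exp (-b * x ^ δ) := by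
    rw [← Real.exp_add]
    refine Real.exp_le_exp.2 ?_
    linarith [h x hx0.le]
  rw [Real.norm_of_nonneg (mul_nonneg (Real.rpow_nonneg hx0.le _) (p.servingDensity_nonneg s hx0)),
    servingDensity]
  have h3 : 0 ≤ Real.pi * p.lamBS * p.Theta s *
      ((2 / p.alp s) * p.kap s ^ (-(2 / p.alp s)) * x ^ (2 / p.alp s - 1)) :=
    (p.intensityDeriv_nonneg s hx0).trans h1
  calc x ^ a * (p.intensityDeriv s x * Real.exp (-∑ r, p.intensity r x))
      ≤ x ^ a * ((Real.pi * p.lamBS * p.Theta s *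
        ((2 / p.alp s) * p.kap s ^ (-(2 / p.alp s)) * x ^ (2 / p.alp s - 1))) *
          (Real.exp c * Real.exp (-b * x ^ δ))) :=
        mul_le_mul_of_nonneg_left (mul_le_mul h1 h2 (Real.exp_pos _).le h3)
          (Real.rpow_nonneg hx0.le _)
    _ = _ := by
        rw [add_sub_assoc, Real.rpow_add hx0]
        ring

lemma integrableOn_servingDensity (s : S) : IntegrableOn (p.servingDensity s) (Ioi 0) := by
  have h := p.integrableOn_rpow_mul_servingDensity s (a := 0) (by linarith [p.two_div_alp_pos s])
  simpa using h

end NetworkParams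


/-! ### The smallest component of a vector -/

section ArgMin

variable {S : Type*} [Finite S] [Nonempty S]

/-- A component at which a vector is smallest. -/
def argMin (f : S → ℝ≥0∞) : S := (Finite.exists_min f).choose

lemma argMin_le (f : S → ℝ≥0∞) (s : S) : f (argMin f) ≤ f s := (Finite.exists_min f).choose_spec s

lemma iInf_eq_argMin (f : S → ℝ≥0∞) : ⨅ s, f s = f (argMin f) :=
  le_antisymm (iInf_le _ _) (le_iInf fun s => argMin_le f s)

/-- The chosen minimizer depends only on the predicate of being a minimizer: equal predicates give
equal choices by proof irrelevance. -/
lemma argMin_eq_of_forall_iff {f g : S → ℝ≥0∞} (h : ∀ x, (∀ y, f x ≤ f y) ↔ ∀ y, g x ≤ g y) :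
    argMin f = argMin g := by
  have key : ∀ (P Q : S → Prop) (_ : P = Q) (hP : ∃ x, P x) (hQ : ∃ x, Q x),
      hP.choose = hQ.choose := by
    rintro P _ rfl hP _
    rfl
  exact key _ _ (funext fun x => propext (h x)) _ _

/-- Truncating above the minimum leaves the set of minimizers unchanged, so the choice agrees even
in case of ties. -/
lemma argMin_min {f : S → ℝ≥0∞} {c : ℝ≥0∞} (h : ⨅ s, f s < c) :
    argMin (fun s => min (f s) c) = argMin f := by
  obtain ⟨y₀, hy₀⟩ := iInf_lt_iff.1 h
  refine argMin_eq_of_forall_iff fun x => ⟨fun hx => ?_, fun hx y => min_le_min_right _ (hx y)⟩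
  have h1 : f x < c := by
    by_contra! hcon
    have h2 := hx y₀
    rw [min_eq_right hcon, le_min_iff] at h2
    exact absurd h2.1 hy₀.not_ge
  intro y
  have h2 := hx y
  rw [min_eq_left h1.le] at h2
  exact h2.trans (min_le_left _ _)

lemma measurable_argMin [MeasurableSpace S] [MeasurableSingletonClass S] :
    Measurable (argMin : (S → ℝ≥0∞) → S) := by
  classical
  refine measurable_to_countable' fun s => ?_
  have hle : ∀ x y : S, MeasurableSet {f : S → ℝ≥0∞ | f x ≤ f y} := fun x y =>
    measurableSet_le (measurable_pi_apply x) (measurable_pi_apply y)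
  have hset : ∀ x : S, MeasurableSet {f : S → ℝ≥0∞ | ∀ y, f x ≤ f y} := fun x => by
    rw [ofPred_forall]
    exact MeasurableSet.iInter fun y => hle x y
  have hunion : argMin ⁻¹' {s} = ⋃ (g : S → ℝ≥0∞) (_ : argMin g = s),
      {f : S → ℝ≥0∞ | ∀ x, (∀ y, f x ≤ f y) ↔ ∀ y, g x ≤ g y} := by
    ext f
    simp only [mem_preimage, mem_singleton_iff, mem_iUnion, exists_prop]
    constructor
    · exact fun hf => ⟨f, hf, fun x => Iff.rfl⟩
    · rintro ⟨g, hg, hfg⟩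
      rw [← hg]
      exact argMin_eq_of_forall_iff hfg
  have hcell : ∀ A : Set S, MeasurableSet {f : S → ℝ≥0∞ | ∀ x, (∀ y, f x ≤ f y) ↔ x ∈ A} := by
    intro A
    rw [ofPred_forall]
    refine MeasurableSet.iInter fun x => ?_
    by_cases hx : x ∈ A
    · simpa only [hx, iff_true] using hset x
    · simp only [hx, iff_false]
      exact (hset x).compl
  -- The uncountable union over `g` is re-indexed by the sets of minimizers, of which there are
  -- finitely many.
  have hunion' : argMin ⁻¹' {s} = ⋃ (A : Set S) (_ : ∃ g : S → ℝ≥0∞, argMin g = s ∧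
      A = {x | ∀ y, g x ≤ g y}), {f : S → ℝ≥0∞ | ∀ x, (∀ y, f x ≤ f y) ↔ x ∈ A} := by
    rw [hunion]
    ext f
    simp only [mem_iUnion, exists_prop]
    constructor
    · rintro ⟨g, hg, hfg⟩
      exact ⟨_, ⟨g, hg, rfl⟩, hfg⟩
    · rintro ⟨_, ⟨g, hg, rfl⟩, hfg⟩
      exact ⟨g, hg, hfg⟩
  rw [hunion']
  exact MeasurableSet.iUnion fun A => MeasurableSet.iUnion fun _ => hcell A

end ArgMin

instance : DiscreteMeasurableSpace LinkState := ⟨fun _ => trivial⟩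

/-! ### The law of the intended link -/

namespace Network

open Filter Topology

variable {S Ω : Type*} [Fintype S] {net : Network S Ω} {p : NetworkParams S 1}
  {mΩ : MeasurableSpace Ω} {μ : Measure Ω}

lemma servingState_eq [Nonempty S] (ω : Ω) :
    net.servingState p ω = argMin fun s => net.minLoss p s ω := rfl

lemma servingLoss_nonneg (ω : Ω) : 0 ≤ net.servingLoss p ω := ENNReal.toReal_nonneg

namespace IsModel

lemma measurable_iInf_minLoss (hnet : net.IsModel p μ) :
    Measurable fun ω => ⨅ s, net.minLoss p s ω :=
  Measurable.iInf fun s => hnet.measurable_minLoss s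

lemma measurable_servingLoss (hnet : net.IsModel p μ) : Measurable (net.servingLoss p) :=
  hnet.measurable_iInf_minLoss.ennreal_toReal

lemma measurable_servingState [Nonempty S] [MeasurableSpace S] [MeasurableSingletonClass S]
    (hnet : net.IsModel p μ) : Measurable (net.servingState p) :=
  measurable_argMin.comp (measurable_pi_lambda _ hnet.measurable_minLoss)

variable [IsProbabilityMeasure μ]

lemma measureReal_le_minLoss (hnet : net.IsModel p μ) (s : S) {t : ℝ} (ht : 0 ≤ t) :
    μ.real {ω | ENNReal.ofReal t ≤ net.minLoss p s ω} = Real.exp (-p.intensity s t) := by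
  classical
  have h := hnet.measureReal_forall_le_minLoss (t := Pi.single s t) (fun r => by
    by_cases hr : r = s
    · subst hr
      simpa using ht
    · simp [hr])
  have h1 : {ω | ∀ r, ENNReal.ofReal (Pi.single (M := fun _ => ℝ) s t r) ≤ net.minLoss p r ω} =
      {ω | ENNReal.ofReal t ≤ net.minLoss p s ω} := by
    ext ω
    constructor
    · intro hω
      have := hω s
      rwa [Pi.single_eq_same] at this
    · intro hω r
      by_cases hr : r = s
      · subst hr
        rwa [Pi.single_eq_same]
      · simp [hr]
  rw [h1, Finset.sum_eq_single s (fun r _ hr => by simp [hr, NetworkParams.intensity_zero])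
    (by simp), Pi.single_eq_same] at h
  exact h

/-- Void probability with threshold `0` for state `s`. The multiplicative form puts the full sum
over the states on the right, as in `servingDensity`. -/
lemma measureReal_le_others (hnet : net.IsModel p μ) (s : S) {t : ℝ} (ht : 0 ≤ t) :
    μ.real {ω | ENNReal.ofReal t ≤ ⨅ (r) (_ : r ≠ s), net.minLoss p r ω} *
      Real.exp (-p.intensity s t) = Real.exp (-∑ r, p.intensity r t) := by
  classical
  have h := hnet.measureReal_forall_le_minLoss (t := fun r => if r = s then 0 else t) (fun r => by
    split_ifs
    · exact le_rfl
    · exact ht)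
  have h1 : {ω | ∀ r, ENNReal.ofReal (if r = s then 0 else t) ≤ net.minLoss p r ω} =
      {ω | ENNReal.ofReal t ≤ ⨅ (r) (_ : r ≠ s), net.minLoss p r ω} := by
    ext ω
    show _ ↔ ENNReal.ofReal t ≤ ⨅ (r) (_ : r ≠ s), net.minLoss p r ω
    rw [le_iInf₂_iff]
    refine forall_congr' fun r => ?_
    by_cases hr : r = s <;> simp [hr]
  rw [h1] at h
  rw [h, ← Real.exp_add]
  congr 1
  have h2 : ∑ r, p.intensity r (if r = s then 0 else t) + p.intensity s t =
      ∑ r, p.intensity r t := by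
    rw [← Finset.add_sum_erase _ _ (Finset.mem_univ s),
      ← Finset.add_sum_erase (a := s) _ (fun r => p.intensity r t) (Finset.mem_univ s), if_pos rfl,
      p.intensity_zero, Finset.sum_congr rfl fun r hr => by rw [if_neg (Finset.ne_of_mem_erase hr)]]
    ring
  linarith

lemma measureReal_le_iInf (hnet : net.IsModel p μ) {t : ℝ} (ht : 0 ≤ t) :
    μ.real {ω | ENNReal.ofReal t ≤ ⨅ s, net.minLoss p s ω} =
      Real.exp (-∑ r, p.intensity r t) := by
  rw [← hnet.measureReal_forall_le_minLoss fun _ => ht]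
  congr 1
  ext ω
  show ENNReal.ofReal t ≤ ⨅ s, net.minLoss p s ω ↔ _
  rw [le_iInf_iff]
  rfl

/-- The total intensity diverges, so the probability that there is no station at all vanishes. This
rules out the default `servingLoss = 0` coming from `toReal ∞`. -/
lemma ae_iInf_minLoss_ne_top (hnet : net.IsModel p μ) :
    ∀ᵐ ω ∂μ, ⨅ s, net.minLoss p s ω ≠ ∞ := by
  have h1 : ∀ t : ℝ, 0 ≤ t → μ.real {ω | ⨅ s, net.minLoss p s ω = ∞} ≤
      Real.exp (-∑ r, p.intensity r t) := fun t ht => by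
    rw [← hnet.measureReal_le_iInf ht]
    refine measureReal_mono fun ω hω => ?_
    have h : ⨅ s, net.minLoss p s ω = ∞ := hω
    show ENNReal.ofReal t ≤ ⨅ s, net.minLoss p s ω
    rw [h]
    exact le_top
  have h2 : Tendsto (fun t => Real.exp (-∑ r, p.intensity r t)) atTop (𝓝 0) :=
    Real.tendsto_exp_neg_atTop_nhds_zero.comp p.tendsto_sum_intensity
  have h3 : μ.real {ω | ⨅ s, net.minLoss p s ω = ∞} ≤ 0 :=
    ge_of_tendsto h2 ((eventually_ge_atTop 0).mono h1)
  rw [ae_iff]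
  have h4 := le_antisymm h3 measureReal_nonneg
  rw [measureReal_eq_zero_iff] at h4
  simpa only [not_not, ne_eq] using h4

/-- The law of the path-loss of the intended link. -/
lemma map_servingLoss (hnet : net.IsModel p μ) :
    μ.map (net.servingLoss p) = (volume.restrict (Ioi 0)).withDensity fun x =>
      ENNReal.ofReal ((∑ s, p.intensityDeriv s x) * Real.exp (-∑ s, p.intensity s x)) := by
  have h := map_toReal_eq_withDensity hnet.measurable_iInf_minLoss
    (Λ := fun x => ∑ s, p.intensity s x) (Λ' := fun x => ∑ s, p.intensityDeriv s x)
    (continuousOn_finsetSum _ fun s _ => p.continuousOn_intensity s)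
    (fun x hx => HasDerivWithinAt.fun_sum fun s _ => p.hasDerivWithinAt_intensity s hx)
    (fun x hx => Finset.sum_nonneg fun s _ => p.intensityDeriv_nonneg s hx)
    (fun t ht => hnet.measureReal_le_iInf ht)
  rw [Measure.restrict_eq_self_of_ae_mem (s := {ω | ⨅ s, net.minLoss p s ω ≠ ∞})
    hnet.ae_iInf_minLoss_ne_top] at h
  exact h

lemma indepFun_minLoss_others (hnet : net.IsModel p μ) (s : S) :
    IndepFun (net.minLoss p s) (fun ω => ⨅ (r) (_ : r ≠ s), net.minLoss p r ω) μ := by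
  have h := indep_iSup_of_disjoint hnet.stateAlgebra_le hnet.iIndep_stateAlgebra
    (S := {s}) (T := {r | r ≠ s}) (Set.disjoint_left.2 fun r hr hr' => hr' hr)
  rw [iSup_singleton] at h
  refine indep_of_indep_of_le h (net.measurable_minLoss_state p s).comap_le ?_
  have hm : Measurable[⨆ r ∈ {r | r ≠ s}, net.stateAlgebra r]
      (fun ω => ⨅ (r) (_ : r ≠ s), net.minLoss p r ω) := by
    let _ := ⨆ r ∈ {r | r ≠ s}, net.stateAlgebra r
    refine Measurable.iInf fun r => ?_
    by_cases hr : r = s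
    · simp [hr]
    · simp only [ne_eq, hr, not_false_eq_true, iInf_pos]
      exact (net.measurable_minLoss_state p r).mono
        (le_iSup₂_of_le (f := fun r (_ : r ∈ {r | r ≠ s}) => net.stateAlgebra r) r hr le_rfl) le_rfl
  exact hm.comap_le

/-- If `s` is the serving state, its smallest loss `X` is at most the smallest loss `Y` of the
others. The event `X ≤ Y` has the stated mass by independence; with ties it may be larger than the
serving event, hence only an inequality. -/
lemma map_servingLoss_restrict_le [Nonempty S] (hnet : net.IsModel p μ) (s : S) {A : Set ℝ}
    (hA : MeasurableSet A) :
    μ {ω | net.servingState p ω = s ∧ ⨅ r, net.minLoss p r ω ≠ ∞ ∧ net.servingLoss p ω ∈ A} ≤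
      ∫⁻ x in A ∩ Ioi 0, ENNReal.ofReal (p.servingDensity s x) := by
  set X := net.minLoss p s with hXdef
  set Y := fun ω => ⨅ (r) (_ : r ≠ s), net.minLoss p r ω with hYdef
  have hX : Measurable X := hnet.measurable_minLoss s
  have hY : Measurable Y := Measurable.iInf fun r => by
    by_cases hr : r = s
    · simp [hr]
    · simpa [hr] using hnet.measurable_minLoss r
  let E : Set (ℝ≥0∞ × ℝ≥0∞) := {u | (u.1 ≠ ∞ ∧ u.1.toReal ∈ A) ∧ u.1 ≤ u.2}
  have hE₁ : MeasurableSet {v : ℝ≥0∞ | v ≠ ∞ ∧ v.toReal ∈ A} :=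
    (measurableSet_singleton ∞).compl.inter (ENNReal.measurable_toReal hA)
  have hE : MeasurableSet E :=
    (measurable_fst hE₁).inter (measurableSet_le measurable_fst measurable_snd)
  have hsub : {ω | net.servingState p ω = s ∧ ⨅ r, net.minLoss p r ω ≠ ∞ ∧
      net.servingLoss p ω ∈ A} ⊆ (fun ω => (X ω, Y ω)) ⁻¹' E := by
    rintro ω ⟨h1, h2, h3⟩
    have h4 : ⨅ r, net.minLoss p r ω = X ω := by
      rw [iInf_eq_argMin, ← servingState_eq, h1]
    rw [servingLoss] at h3
    rw [h4] at h2 h3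
    refine ⟨⟨h2, h3⟩, ?_⟩
    show X ω ≤ Y ω
    rw [← h4]
    exact le_iInf₂ fun r _ => iInf_le _ r
  refine (measure_mono hsub).trans ?_
  rw [← Measure.map_apply (hX.prodMk hY) hE,
    (indepFun_iff_map_prod_eq_prod_map_map hX.aemeasurable hY.aemeasurable).1
      (hnet.indepFun_minLoss_others s), Measure.prod_apply hE]
  have hslice : ∀ v : ℝ≥0∞, μ.map Y (Prod.mk v ⁻¹' E) =
      {v : ℝ≥0∞ | v ≠ ∞ ∧ v.toReal ∈ A}.indicator (fun v => μ {ω | v ≤ Y ω}) v := by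
    intro v
    rw [Measure.map_apply hY (measurable_prodMk_left hE)]
    by_cases hv : v ≠ ∞ ∧ v.toReal ∈ A
    · rw [indicator_of_mem (show v ∈ {v : ℝ≥0∞ | v ≠ ∞ ∧ v.toReal ∈ A} from hv)]
      congr 1
      ext ω
      exact ⟨fun h => h.2, fun h => ⟨hv, h⟩⟩
    · rw [indicator_of_notMem (show v ∉ {v : ℝ≥0∞ | v ≠ ∞ ∧ v.toReal ∈ A} from hv)]
      rw [show Y ⁻¹' (Prod.mk v ⁻¹' E) = ∅ from
        eq_empty_of_forall_notMem fun ω hω => hv hω.1, measure_empty]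
  have hsurvY : ∀ t, 0 ≤ t → μ {ω | ENNReal.ofReal t ≤ Y ω} =
      ENNReal.ofReal (Real.exp (p.intensity s t - ∑ r, p.intensity r t)) := fun t ht => by
    rw [← ofReal_measureReal]
    congr 1
    rw [sub_eq_add_neg, Real.exp_add, ← hnet.measureReal_le_others s ht, Real.exp_neg]
    field_simp
    rfl
  have hmono : Measurable fun t : ℝ => μ {ω | ENNReal.ofReal t ≤ Y ω} := by
    refine Antitone.measurable fun a b hab => measure_mono fun ω hω => ?_
    exact (ENNReal.ofReal_le_ofReal hab).trans hω
  have hlaw := map_toReal_eq_withDensity hX (p.continuousOn_intensity s)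
    (fun x hx => p.hasDerivWithinAt_intensity s hx) (fun x hx => p.intensityDeriv_nonneg s hx)
    (fun t ht => hnet.measureReal_le_minLoss s ht)
  calc ∫⁻ v, μ.map Y (Prod.mk v ⁻¹' E) ∂(μ.map X)
      = ∫⁻ ω, μ.map Y (Prod.mk (X ω) ⁻¹' E) ∂μ :=
        lintegral_map (measurable_measure_prodMk_left hE) hX
    _ = ∫⁻ ω in {ω | X ω ≠ ∞}, A.indicator (fun t => μ {ω | ENNReal.ofReal t ≤ Y ω})
          (X ω).toReal ∂μ := by
        have hfin : MeasurableSet {ω | X ω ≠ ∞} := hX (measurableSet_singleton ∞).compl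
        rw [← lintegral_indicator hfin]
        refine lintegral_congr fun ω => ?_
        rw [hslice]
        by_cases h1 : X ω = ∞
        · simp [indicator, h1]
        · by_cases h2 : (X ω).toReal ∈ A <;> simp [indicator, h1, h2]
    _ = ∫⁻ t, A.indicator (fun t => μ {ω | ENNReal.ofReal t ≤ Y ω}) t
          ∂((μ.restrict {ω | X ω ≠ ∞}).map fun ω => (X ω).toReal) :=
        (lintegral_map (hmono.indicator hA) hX.ennreal_toReal).symm
    _ = ∫⁻ x in Ioi 0, ENNReal.ofReal (p.intensityDeriv s x * Real.exp (-p.intensity s x)) *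
          A.indicator (fun t => μ {ω | ENNReal.ofReal t ≤ Y ω}) x := by
        rw [hlaw, lintegral_withDensity_eq_lintegral_mul₀ _ (hmono.indicator hA).aemeasurable]
        · rfl
        · refine ((p.measurable_intensityDeriv s).aemeasurable.mul
            (Real.measurable_exp.comp_aemeasurable ?_)).ennreal_ofReal
          exact (((p.continuousOn_intensity s).mono Ioi_subset_Ici_self).aemeasurable
            measurableSet_Ioi).neg
    _ = ∫⁻ x in Ioi 0, A.indicator (fun x => ENNReal.ofReal (p.servingDensity s x)) x := by
        refine setLIntegral_congr_fun measurableSet_Ioi fun x hx => ?_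
        have hx0 : 0 < x := hx
        by_cases hxA : x ∈ A
        · simp only [indicator_of_mem hxA]
          rw [hsurvY x hx0.le, ← ENNReal.ofReal_mul
            (mul_nonneg (p.intensityDeriv_nonneg s hx0) (Real.exp_pos _).le), mul_assoc,
            ← Real.exp_add, NetworkParams.servingDensity]
          congr 3
          ring
        · simp [indicator_of_notMem hxA]
    _ = ∫⁻ x in A ∩ Ioi 0, ENNReal.ofReal (p.servingDensity s x) := by
        rw [lintegral_indicator hA, Measure.restrict_restrict hA]
    _ ≤ _ := le_rfl

/-- The joint law of the state and of the path-loss of the intended link. -/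
theorem map_servingLoss_restrict [Nonempty S] [MeasurableSpace S] [MeasurableSingletonClass S]
    (hnet : net.IsModel p μ) (s : S) :
    (μ.restrict {ω | net.servingState p ω = s}).map (net.servingLoss p) =
      (volume.restrict (Ioi 0)).withDensity fun x => ENNReal.ofReal (p.servingDensity s x) := by
  have hS : ∀ r, MeasurableSet {ω | net.servingState p ω = r} := fun r =>
    hnet.measurable_servingState (measurableSet_singleton r)
  have hL := hnet.measurable_servingLoss
  ext A hA
  have hLA : MeasurableSet (net.servingLoss p ⁻¹' A) := hL hA
  set a : S → ℝ≥0∞ := fun r => μ (net.servingLoss p ⁻¹' A ∩ {ω | net.servingState p ω = r}) with ha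
  set b : S → ℝ≥0∞ := fun r => ∫⁻ x in A ∩ Ioi 0, ENNReal.ofReal (p.servingDensity r x) with hb
  have hab : ∀ r, a r ≤ b r := fun r => by
    refine le_trans (le_of_eq ?_) (hnet.map_servingLoss_restrict_le r hA)
    refine measure_congr ?_
    filter_upwards [hnet.ae_iInf_minLoss_ne_top] with ω hω
    refine propext ⟨fun h => ⟨h.2, hω, h.1⟩, fun h => ⟨h.2.2, h.1⟩⟩
  have hbfin : ∀ r, b r ≠ ∞ := fun r => by
    have h := (p.integrableOn_servingDensity r).mono_set (inter_subset_right : A ∩ Ioi 0 ⊆ Ioi 0)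
    exact h.lintegral_lt_top.ne
  have hsumb : ∑ r, b r = μ.map (net.servingLoss p) A := by
    rw [hnet.map_servingLoss, withDensity_apply _ hA, Measure.restrict_restrict hA, hb,
      ← lintegral_finsetSum' _ fun r _ => (((p.measurableOn_servingDensity r).mono_measure
        (Measure.restrict_mono_set _ inter_subset_right)).ennreal_ofReal)]
    refine setLIntegral_congr_fun (hA.inter measurableSet_Ioi) fun x hx => ?_
    rw [← ENNReal.ofReal_sum_of_nonneg fun r _ => p.servingDensity_nonneg r hx.2, Finset.sum_mul]
    rfl
  have hsuma : ∑ r, a r = μ.map (net.servingLoss p) A := by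
    rw [Measure.map_apply hL hA, ha]
    rw [← measure_biUnion_finset]
    · congr 1
      ext ω
      simp
    · intro r _ r' _ hrr'
      exact Set.disjoint_left.2 fun ω h h' => hrr' (h.2.symm.trans h'.2)
    · exact fun r _ => hLA.inter (hS r)
  have hafin : ∀ r, a r ≠ ∞ := fun r => measure_ne_top _ _
  have h1 : ∑ r, (a r).toReal = ∑ r, (b r).toReal := by
    rw [← ENNReal.toReal_sum fun r _ => hafin r, ← ENNReal.toReal_sum fun r _ => hbfin r, hsuma,
      hsumb]
  -- Termwise `a r ≤ b r` with equal finite totals forces equality in every state, without a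
  -- separate argument about ties.
  have h2 := (Finset.sum_eq_sum_iff_of_le fun r _ => ENNReal.toReal_mono (hbfin r) (hab r)).1 h1 s
    (Finset.mem_univ s)
  rw [Measure.map_apply hL hA, Measure.restrict_apply hLA, withDensity_apply _ hA,
    Measure.restrict_restrict hA]
  exact (ENNReal.toReal_eq_toReal_iff' (hafin s) (hbfin s)).1 h2

end IsModel

end Network


/-! ### The interference conditionally on the intended link -/

/-- Discretization from above with mesh `1 / (k + 1)`. -/
def roundUp (k : ℕ) (x : ℝ) : ℝ := ((⌊x * (k + 1)⌋₊ : ℝ) + 1) / (k + 1)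

lemma measurable_roundUp (k : ℕ) : Measurable (roundUp k) := by
  have h : Measurable fun x : ℝ => ⌊x * (k + 1)⌋₊ := Nat.measurable_floor.comp (by fun_prop)
  have h2 : Measurable fun x : ℝ => (⌊x * (k + 1)⌋₊ : ℝ) := (measurable_of_countable _).comp h
  exact (h2.add_const _).div_const _

lemma lt_roundUp (k : ℕ) (x : ℝ) : x < roundUp k x := by
  rw [roundUp, lt_div_iff₀ (by positivity)]
  exact Nat.lt_floor_add_one _

lemma roundUp_pos (k : ℕ) (x : ℝ) : 0 < roundUp k x := by
  rw [roundUp]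
  positivity

lemma roundUp_le (k : ℕ) {x : ℝ} (hx : 0 ≤ x) : roundUp k x ≤ x + 1 / (k + 1) := by
  have hk : (0 : ℝ) < k + 1 := by positivity
  have h := Nat.floor_le (mul_nonneg hx hk.le)
  rw [roundUp, div_le_iff₀ hk, add_mul, one_div_mul_cancel hk.ne']
  linarith

open Filter Topology in
lemma tendsto_roundUp {x : ℝ} (hx : 0 ≤ x) : Tendsto (fun k => roundUp k x) atTop (𝓝 x) := by
  have h : Tendsto (fun k : ℕ => x + 1 / ((k : ℝ) + 1)) atTop (𝓝 (x + 0)) :=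
    tendsto_const_nhds.add tendsto_one_div_add_atTop_nhds_zero_nat
  rw [add_zero] at h
  exact tendsto_of_tendsto_of_tendsto_of_le_of_le tendsto_const_nhds h
    (fun k => (lt_roundUp k x).le) (fun k => roundUp_le k hx)

namespace Network

open Filter Topology

variable {S Ω : Type*} [Fintype S] {net : Network S Ω} {p : NetworkParams S 1}
  {mΩ : MeasurableSpace Ω} {μ : Measure Ω}

variable (net p) in
/-- Interference normalized by `P_RB / L⁽⁰⁾`. -/
def normInterference (ω : Ω) : ℝ := net.servingLoss p ω * net.tailTotal p (net.servingLoss p ω) ω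

lemma normInterference_nonneg (ω : Ω) : 0 ≤ net.normInterference p ω :=
  net.mul_tailTotal_nonneg p (servingLoss_nonneg ω) ω

variable (net p) in
/-- State and path-loss of the intended link. -/
def servingLink [Nonempty S] (ω : Ω) : S × ℝ := (net.servingState p ω, net.servingLoss p ω)

namespace IsModel

lemma measurable_normInterference (hnet : net.IsModel p μ) :
    Measurable (net.normInterference p) :=
  hnet.measurable_servingLoss.mul (hnet.measurable_tailTotal.uncurry_apply
    (F := net.tailTotal p) hnet.measurable_servingLoss measurable_id)

variable [IsProbabilityMeasure μ]

lemma ae_servingLoss_pos (hnet : net.IsModel p μ) : ∀ᵐ ω ∂μ, 0 < net.servingLoss p ω := by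
  refine ae_of_ae_map (p := fun x => 0 < x) hnet.measurable_servingLoss.aemeasurable ?_
  rw [hnet.map_servingLoss]
  exact (withDensity_absolutelyContinuous _ _).ae_le (ae_restrict_mem measurableSet_Ioi)

variable [Nonempty S] [MeasurableSpace S] [MeasurableSingletonClass S]

lemma measurable_servingLink (hnet : net.IsModel p μ) : Measurable (net.servingLink p) :=
  hnet.measurable_servingState.prodMk hnet.measurable_servingLoss

omit [Fintype S] [MeasurableSingletonClass S] in
variable (S) in
/-- Vectors of path-losses whose smallest component is less than `c` and whose rounded smallest
component is `j / (k + 1)`. -/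
def roundCell [Finite S] (E : Set (S × ℝ)) (k j : ℕ) : Set (S → ℝ≥0∞) :=
  {f | ⨅ s, f s < ENNReal.ofReal ((j + 1) / (k + 1)) ∧ (argMin f, (⨅ s, f s).toReal) ∈ E ∧
    ⌊(⨅ s, f s).toReal * (k + 1)⌋₊ = j}

omit [Fintype S] in
lemma measurableSet_roundCell [Finite S] {E : Set (S × ℝ)} (hE : MeasurableSet E) (k j : ℕ) :
    MeasurableSet (roundCell S E k j) := by
  have h : Measurable fun f : S → ℝ≥0∞ => ⨅ s, f s :=
    Measurable.iInf fun s => measurable_pi_apply s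
  have h2 : Measurable fun f : S → ℝ≥0∞ => ⌊(⨅ s, f s).toReal * (k + 1)⌋₊ :=
    Nat.measurable_floor.comp (h.ennreal_toReal.mul_const _)
  exact (measurableSet_lt h measurable_const).inter
    (((measurable_argMin.prodMk h.ennreal_toReal) hE).inter (h2 (measurableSet_singleton j)))

/-- On such a cell the serving loss is strictly below `c = (j + 1) / (k + 1)`, so truncation at `c`
preserves the minimum and the minimizer: the event depends only on losses below `c`. -/
lemma roundCell_iff {E : Set (S × ℝ)} (k j : ℕ) {ω : Ω} (hω : ⨅ s, net.minLoss p s ω ≠ ∞) :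
    (net.servingLink p ω ∈ E ∧ ⌊net.servingLoss p ω * (k + 1)⌋₊ = j) ↔
      net.minVec p ((j + 1) / (k + 1)) ω ∈ roundCell S E k j := by
  set c : ℝ := (j + 1) / (k + 1) with hc
  have hk : (0 : ℝ) < k + 1 := by positivity
  have hinf : ⨅ s, net.minVec p c ω s = min (⨅ s, net.minLoss p s ω) (ENNReal.ofReal c) := by
    simp only [minVec]
    exact (iInf_inf (f := fun s => net.minLoss p s ω) (a := ENNReal.ofReal c)).symm
  have hiff : ⨅ s, net.minLoss p s ω < ENNReal.ofReal c →
      ((net.servingLink p ω ∈ E ∧ ⌊net.servingLoss p ω * (k + 1)⌋₊ = j) ↔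
      net.minVec p c ω ∈ roundCell S E k j) := by
    intro h
    have h1 : argMin (net.minVec p c ω) = net.servingState p ω := argMin_min h
    have h2 : ⨅ s, net.minVec p c ω s = ⨅ s, net.minLoss p s ω := by rw [hinf, min_eq_left h.le]
    show _ ↔ ⨅ s, net.minVec p c ω s < ENNReal.ofReal c ∧
      (argMin (net.minVec p c ω), (⨅ s, net.minVec p c ω s).toReal) ∈ E ∧
      ⌊(⨅ s, net.minVec p c ω s).toReal * (k + 1)⌋₊ = j
    rw [h1, h2]
    exact ⟨fun h3 => ⟨h, h3⟩, fun h3 => h3.2⟩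
  constructor
  · intro h
    refine (hiff ?_).1 h
    rw [ENNReal.lt_ofReal_iff_toReal_lt hω, hc, lt_div_iff₀ hk]
    have := Nat.lt_floor_add_one (net.servingLoss p ω * (k + 1))
    rw [h.2] at this
    exact this
  · intro h
    refine (hiff ?_).2 h
    have h1 := h.1
    rw [hinf, min_lt_iff] at h1
    exact h1.resolve_right (lt_irrefl _)

/-- Summation over cells. On each the level is a constant `c` and the event is determined by the
losses truncated at `c`, which are independent of the interference beyond `c`. -/
lemma setIntegral_exp_roundUp (hnet : net.IsModel p μ) {z : ℂ} (hz : 0 ≤ z.re) {E : Set (S × ℝ)}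
    (hE : MeasurableSet E) (k : ℕ) :
    ∫ ω in net.servingLink p ⁻¹' E, Complex.exp (-(z * ((roundUp k (net.servingLoss p ω) *
      net.tailTotal p (roundUp k (net.servingLoss p ω)) ω : ℝ) : ℂ))) ∂μ =
    ∫ ω in net.servingLink p ⁻¹' E, p.interferenceMGF z (roundUp k (net.servingLoss p ω)) ∂μ := by
  obtain ⟨M, hM, hMeq⟩ := hnet.exists_measurable_interferenceMGF
  have hL := hnet.measurable_servingLoss
  have hr : Measurable fun ω => roundUp k (net.servingLoss p ω) := (measurable_roundUp k).comp hL
  have hfl : Measurable fun ω => ⌊net.servingLoss p ω * (k + 1)⌋₊ :=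
    Nat.measurable_floor.comp (hL.mul_const _)
  have hE' : MeasurableSet (net.servingLink p ⁻¹' E) := hnet.measurable_servingLink hE
  have hcell : ∀ j : ℕ, MeasurableSet (net.servingLink p ⁻¹' E ∩
      {ω | ⌊net.servingLoss p ω * (k + 1)⌋₊ = j}) := fun j =>
    hE'.inter (hfl (measurableSet_singleton j))
  have hunion : net.servingLink p ⁻¹' E = ⋃ j : ℕ, net.servingLink p ⁻¹' E ∩
      {ω | ⌊net.servingLoss p ω * (k + 1)⌋₊ = j} := by
    rw [← inter_iUnion, eq_comm, inter_eq_left]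
    exact fun ω _ => mem_iUnion.2 ⟨_, rfl⟩
  have hdisj : Pairwise (Function.onFun Disjoint fun j : ℕ => net.servingLink p ⁻¹' E ∩
      {ω | ⌊net.servingLoss p ω * (k + 1)⌋₊ = j}) := fun i j hij =>
    Set.disjoint_left.2 fun ω h h' => hij (h.2.symm.trans h'.2)
  have hi1 : Integrable (fun ω => Complex.exp (-(z * ((roundUp k (net.servingLoss p ω) *
      net.tailTotal p (roundUp k (net.servingLoss p ω)) ω : ℝ) : ℂ)))) μ := by
    have h := hnet.measurable_tailTotal.uncurry_apply (F := net.tailTotal p) hr measurable_id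
    refine (integrable_const (1 : ℝ)).mono'
      (Complex.measurable_exp.comp (measurable_const.mul
        (Complex.measurable_ofReal.comp (hr.mul h))).neg).aestronglyMeasurable
      (.of_forall fun ω => norm_exp_neg_mul_le_one hz
        (net.mul_tailTotal_nonneg p (roundUp_pos _ _).le ω))
  have hi2 : Integrable (fun ω => p.interferenceMGF z (roundUp k (net.servingLoss p ω))) μ := by
    have h : Measurable fun ω => M (z, roundUp k (net.servingLoss p ω)) :=
      hM.comp (measurable_const.prodMk hr)
    refine (integrable_const (1 : ℝ)).mono' (h.aestronglyMeasurable.congr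
      (.of_forall fun ω => hMeq z hz _ (roundUp_pos _ _)))
      (.of_forall fun ω => hnet.norm_interferenceMGF_le (roundUp_pos _ _) hz)
  rw [hunion, integral_iUnion hcell hdisj hi1.integrableOn,
    integral_iUnion hcell hdisj hi2.integrableOn]
  refine tsum_congr fun j => ?_
  have hc : (0 : ℝ) < (j + 1) / (k + 1) := by positivity
  have hround : ∀ ω ∈ net.servingLink p ⁻¹' E ∩ {ω | ⌊net.servingLoss p ω * (k + 1)⌋₊ = j},
      roundUp k (net.servingLoss p ω) = (j + 1) / (k + 1) := fun ω hω => by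
    have h : ⌊net.servingLoss p ω * (k + 1)⌋₊ = j := hω.2
    rw [roundUp, h]
  have hae : (net.servingLink p ⁻¹' E ∩ {ω | ⌊net.servingLoss p ω * (k + 1)⌋₊ = j} : Set Ω) =ᵐ[μ]
      net.minVec p ((j + 1) / (k + 1)) ⁻¹' roundCell S E k j := by
    filter_upwards [hnet.ae_iInf_minLoss_ne_top] with ω hω
    exact propext (roundCell_iff k j hω)
  have e1 := setIntegral_congr_fun (μ := μ) (hcell j)
    (f := fun ω => Complex.exp (-(z * ((roundUp k (net.servingLoss p ω) *
      net.tailTotal p (roundUp k (net.servingLoss p ω)) ω : ℝ) : ℂ))))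
    (g := fun ω => Complex.exp (-(z * ((((j : ℝ) + 1) / (k + 1) *
      net.tailTotal p (((j : ℝ) + 1) / (k + 1)) ω : ℝ) : ℂ)))) fun ω hω => by
        simp only [hround ω hω]
  have e2 := setIntegral_congr_fun (μ := μ) (hcell j)
    (f := fun ω => p.interferenceMGF z (roundUp k (net.servingLoss p ω)))
    (g := fun _ => p.interferenceMGF z (((j : ℝ) + 1) / (k + 1))) fun ω hω => by
        simp only [hround ω hω]
  rw [e1, e2, setIntegral_congr_set hae, setIntegral_congr_set hae,
    hnet.setIntegral_exp_tailTotal hc hz (measurableSet_roundCell hE k j), setIntegral_const,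
    Complex.real_smul]

/-- The moment generating function of the normalized interference, on events that depend on the
intended link. -/
theorem setIntegral_exp_normInterference (hnet : net.IsModel p μ) {z : ℂ} (hz : 0 ≤ z.re)
    {E : Set (S × ℝ)} (hE : MeasurableSet E) :
    ∫ ω in net.servingLink p ⁻¹' E, Complex.exp (-(z * (net.normInterference p ω : ℂ))) ∂μ =
    ∫ ω in net.servingLink p ⁻¹' E, p.interferenceMGF z (net.servingLoss p ω) ∂μ := by
  obtain ⟨M, hM, hMeq⟩ := hnet.exists_measurable_interferenceMGF
  have hL := hnet.measurable_servingLoss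
  have hr : ∀ k, Measurable fun ω => roundUp k (net.servingLoss p ω) := fun k =>
    (measurable_roundUp k).comp hL
  have h1 : Tendsto (fun k => ∫ ω in net.servingLink p ⁻¹' E, Complex.exp (-(z *
      ((roundUp k (net.servingLoss p ω) *
        net.tailTotal p (roundUp k (net.servingLoss p ω)) ω : ℝ) : ℂ))) ∂μ) atTop
      (𝓝 (∫ ω in net.servingLink p ⁻¹' E,
        Complex.exp (-(z * (net.normInterference p ω : ℂ))) ∂μ)) := by
    refine tendsto_integral_of_dominated_convergence (fun _ => (1 : ℝ)) (fun k => ?_)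
      (integrable_const _) (fun k => .of_forall fun ω => norm_exp_neg_mul_le_one hz
        (net.mul_tailTotal_nonneg p (roundUp_pos _ _).le ω)) ?_
    · have h := hnet.measurable_tailTotal.uncurry_apply (F := net.tailTotal p) (hr k) measurable_id
      exact (Complex.measurable_exp.comp (measurable_const.mul
        (Complex.measurable_ofReal.comp ((hr k).mul h))).neg).aestronglyMeasurable
    -- The rounded level decreases to `L` only in the sense of staying above it, which is enough for
    -- the right-continuity in the level.
    · filter_upwards [ae_restrict_of_ae hnet.ae_tendsto_tailTotal,
        ae_restrict_of_ae hnet.ae_servingLoss_pos] with ω hω hpos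
      have hc : Continuous fun y : ℝ => Complex.exp (-(z * (y : ℂ))) := by fun_prop
      have ht := tendsto_roundUp hpos.le
      exact (hc.tendsto _).comp (ht.mul (hω _ hpos _ (fun k => (lt_roundUp k _).le) ht))
  have h2 : Tendsto (fun k => ∫ ω in net.servingLink p ⁻¹' E,
      p.interferenceMGF z (roundUp k (net.servingLoss p ω)) ∂μ) atTop
      (𝓝 (∫ ω in net.servingLink p ⁻¹' E, p.interferenceMGF z (net.servingLoss p ω) ∂μ)) := by
    refine tendsto_integral_of_dominated_convergence (fun _ => (1 : ℝ)) (fun k => ?_)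
      (integrable_const _)
      (fun k => .of_forall fun ω => hnet.norm_interferenceMGF_le (roundUp_pos _ _) hz) ?_
    · have h : Measurable fun ω => M (z, roundUp k (net.servingLoss p ω)) :=
        hM.comp (measurable_const.prodMk (hr k))
      exact h.aestronglyMeasurable.congr (.of_forall fun ω => hMeq z hz _ (roundUp_pos _ _))
    · filter_upwards [ae_restrict_of_ae hnet.ae_servingLoss_pos] with ω hpos
      exact hnet.tendsto_interferenceMGF hz hpos (fun k => (lt_roundUp k _).le)
        (tendsto_roundUp hpos.le)
  simp_rw [hnet.setIntegral_exp_roundUp hz hE] at h1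
  exact tendsto_nhds_unique h1 h2

lemma integrable_exp_normInterference (hnet : net.IsModel p μ) {z : ℂ} (hz : 0 ≤ z.re) :
    Integrable (fun ω => Complex.exp (-(z * (net.normInterference p ω : ℂ)))) μ := by
  have h := hnet.measurable_normInterference
  exact (integrable_const (1 : ℝ)).mono' (by fun_prop : Measurable _).aestronglyMeasurable
    (.of_forall fun ω => norm_exp_neg_mul_le_one hz (normInterference_nonneg ω))

lemma comap_servingLink_le (hnet : net.IsModel p μ) :
    MeasurableSpace.comap (net.servingLink p) inferInstance ≤ mΩ :=
  hnet.measurable_servingLink.comap_le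

lemma aestronglyMeasurable_interferenceMGF (hnet : net.IsModel p μ) {z : ℂ} (hz : 0 ≤ z.re) :
    AEStronglyMeasurable[MeasurableSpace.comap (net.servingLink p) inferInstance]
      (fun ω => p.interferenceMGF z (net.servingLoss p ω)) μ := by
  obtain ⟨M, hM, hMeq⟩ := hnet.exists_measurable_interferenceMGF
  refine ⟨fun ω => M (z, (net.servingLink p ω).2), ?_, ?_⟩
  · have h : Measurable fun u : S × ℝ => M (z, u.2) :=
      hM.comp (measurable_const.prodMk measurable_snd)
    exact (h.comp (comap_measurable _)).stronglyMeasurable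
  · filter_upwards [hnet.ae_servingLoss_pos] with ω hω using (hMeq z hz _ hω).symm

lemma integrable_interferenceMGF (hnet : net.IsModel p μ) {z : ℂ} (hz : 0 ≤ z.re) :
    Integrable (fun ω => p.interferenceMGF z (net.servingLoss p ω)) μ := by
  refine (integrable_const (1 : ℝ)).mono'
    ((hnet.aestronglyMeasurable_interferenceMGF hz).mono hnet.comap_servingLink_le) ?_
  filter_upwards [hnet.ae_servingLoss_pos] with ω hω using hnet.norm_interferenceMGF_le hω hz

/-- The conditional moment generating function of the normalized interference. -/
theorem condExp_exp_normInterference (hnet : net.IsModel p μ) {z : ℂ} (hz : 0 ≤ z.re) :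
    μ[fun ω => Complex.exp (-(z * (net.normInterference p ω : ℂ))) |
      MeasurableSpace.comap (net.servingLink p) inferInstance] =ᵐ[μ]
      fun ω => p.interferenceMGF z (net.servingLoss p ω) := by
  refine (ae_eq_condExp_of_forall_setIntegral_eq hnet.comap_servingLink_le
    (hnet.integrable_exp_normInterference hz) (fun _ _ _ =>
      (hnet.integrable_interferenceMGF hz).integrableOn) ?_
    (hnet.aestronglyMeasurable_interferenceMGF hz)).symm
  rintro _ ⟨E, hE, rfl⟩ _
  exact (hnet.setIntegral_exp_normInterference hz hE).symm

end IsModel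

end Network


/-! ### Independence of the intended link and the interference from the intended fading -/

namespace Network

variable {S Ω : Type*} [Fintype S] {net : Network S Ω} {p : NetworkParams S 1}

variable (net) in
/-- The σ-algebra generated by all base stations and their marks. -/
@[reducible] def environment : MeasurableSpace Ω := ⨆ s, net.stateAlgebra s

variable (net p) in
lemma measurable_minLoss_environment (s : S) : Measurable[net.environment] (net.minLoss p s) :=
  (net.measurable_minLoss_state p s).mono (le_iSup (fun s => net.stateAlgebra s) s) le_rfl

variable (net p) in
lemma measurable_servingLoss_environment : Measurable[net.environment] (net.servingLoss p) :=
  let _ := net.environment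
  (Measurable.iInf fun s => net.measurable_minLoss_environment p s).ennreal_toReal

variable (net p) in
lemma measurable_tailTotal_environment :
    @Measurable _ _ (@Prod.instMeasurableSpace _ _ _ net.environment) _
      fun u : ℝ × Ω => net.tailTotal p u.1 u.2 := by
  let _ := net.environment
  refine Finset.measurable_fun_sum _ fun s _ => (Measurable.tsum fun n => ?_).ennreal_toReal
  have hle : net.stateAlgebra s ≤ net.environment := le_iSup (fun s => net.stateAlgebra s) s
  exact (net.measurable_tailTerm_of p s n ((net.measurable_count_state s).mono hle le_rfl)
    ((net.measurable_loss_state p s n).mono hle le_rfl)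
    ((net.measurable_mark_state p s n).mono hle le_rfl)).ennreal_ofReal

variable (net p) in
lemma measurable_normInterference_environment :
    Measurable[net.environment] (net.normInterference p) := by
  let _ := net.environment
  exact (net.measurable_servingLoss_environment p).mul
    ((net.measurable_tailTotal_environment p).uncurry_apply (F := net.tailTotal p)
      (net.measurable_servingLoss_environment p) measurable_id)

variable [Nonempty S] [MeasurableSpace S] [MeasurableSingletonClass S]

variable (net p) in
lemma measurable_servingLink_environment : Measurable[net.environment] (net.servingLink p) := by
  let _ := net.environment
  have h : Measurable (net.servingState p) :=
    measurable_argMin.comp (measurable_pi_lambda _ (net.measurable_minLoss_environment p))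
  exact h.prodMk (net.measurable_servingLoss_environment p)

variable {mΩ : MeasurableSpace Ω} {μ : Measure Ω}

namespace IsModel

omit [Nonempty S] [MeasurableSpace S] [MeasurableSingletonClass S] in
-- The fading of the intended link is a source of its own, attached to no station, so it is
-- independent of everything built from stations and marks.
lemma indep_servingFading_environment (hnet : net.IsModel p μ) (s : S) :
    Indep (MeasurableSpace.comap (net.servingFading s) inferInstance) net.environment μ := by
  have hd : Disjoint ({.serving s} : Set (Source S)) (⋃ r, stateSources r) := by
    simp [stateSources, markSources]
  have h := indep_iSup_of_disjoint hnet.sourceAlgebra_le hnet.independent hd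
  rw [iSup_singleton] at h
  refine indep_of_indep_of_le_right h (iSup_le fun r => ?_)
  exact biSup_mono fun i hi => mem_iUnion.2 ⟨r, hi⟩

/-- The fading power gain of the intended link is independent of the state and the path-loss of
the intended link and of the interference. -/
lemma indepFun_servingFading (hnet : net.IsModel p μ) (s : S) :
    IndepFun (net.servingFading s) (fun ω => (net.servingLink p ω, net.normInterference p ω))
      μ := by
  refine indep_of_indep_of_le_right (hnet.indep_servingFading_environment s) ?_
  let _ := net.environment
  exact ((net.measurable_servingLink_environment p).prodMk
    (net.measurable_normInterference_environment p)).comap_le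

variable [IsProbabilityMeasure μ]

lemma measurableSet_servingState (hnet : net.IsModel p μ) (s : S) :
    MeasurableSet {ω | net.servingState p ω = s} :=
  hnet.measurable_servingState (measurableSet_singleton s)

/-- Transform of the interference on the event that the intended link is in a given state. -/
lemma setIntegral_mul_exp_normInterference (hnet : net.IsModel p μ) (s : S) {h : ℝ → ℂ}
    (hm : Measurable h) {C : ℝ} (hC : ∀ x, 0 ≤ x → ‖h x‖ ≤ C) {z : ℂ} (hz : 0 ≤ z.re) :
    ∫ ω in {ω | net.servingState p ω = s}, h (net.servingLoss p ω) *
      Complex.exp (-(z * (net.normInterference p ω : ℂ))) ∂μ =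
    ∫ x in Ioi 0, h x * p.interferenceMGF z x * (p.servingDensity s x : ℂ) := by
  obtain ⟨M, hM, hMeq⟩ := hnet.exists_measurable_interferenceMGF
  have hMz : Measurable fun x => M (z, x) := hM.comp measurable_prodMk_left
  have hle := hnet.comap_servingLink_le
  have hA : MeasurableSet[MeasurableSpace.comap (net.servingLink p) inferInstance]
      {ω | net.servingState p ω = s} :=
    ⟨Prod.fst ⁻¹' {s}, measurable_fst (measurableSet_singleton s), rfl⟩
  have hL : Measurable[MeasurableSpace.comap (net.servingLink p) inferInstance]
      (net.servingLoss p) := measurable_snd.comp (comap_measurable (net.servingLink p))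
  have hhm : StronglyMeasurable[MeasurableSpace.comap (net.servingLink p) inferInstance]
      fun ω => h (net.servingLoss p ω) := (hm.comp hL).stronglyMeasurable
  have hint := hnet.integrable_exp_normInterference hz
  have hbd : Integrable (fun ω => h (net.servingLoss p ω) *
      Complex.exp (-(z * (net.normInterference p ω : ℂ)))) μ :=
    hint.bdd_mul (c := C) (hhm.mono hle).aestronglyMeasurable
      (.of_forall fun ω => hC _ (servingLoss_nonneg ω))
  -- `h (L)` is measurable with respect to the intended link and comes out of the conditional
  -- expectation, which leaves the interference transform at `L`.
  have hpull := condExp_bilin_of_aestronglyMeasurable_left (ContinuousLinearMap.mul ℝ ℂ)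
    hhm.aestronglyMeasurable hbd hint
  rw [← setIntegral_condExp hle hbd hA]
  have h1 : (fun ω => (μ[fun ω => h (net.servingLoss p ω) *
      Complex.exp (-(z * (net.normInterference p ω : ℂ))) |
        MeasurableSpace.comap (net.servingLink p) inferInstance]) ω) =ᵐ[μ]
      fun ω => h (net.servingLoss p ω) * M (z, net.servingLoss p ω) := by
    refine hpull.trans ?_
    filter_upwards [hnet.condExp_exp_normInterference hz, hnet.ae_servingLoss_pos] with ω hω hpos
    rw [ContinuousLinearMap.mul_apply', hω, hMeq z hz _ hpos]
  rw [setIntegral_congr_ae (hle _ hA) (h1.mono fun ω hω _ => hω)]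
  have h2 := integral_map (μ := μ.restrict {ω | net.servingState p ω = s})
    hnet.measurable_servingLoss.aemeasurable (f := fun x => h x * M (z, x))
    (hm.mul hMz).aestronglyMeasurable
  rw [← h2, hnet.map_servingLoss_restrict s,
    integral_withDensity_eq_integral_toReal_smul₀ (p.measurableOn_servingDensity s).ennreal_ofReal
      (.of_forall fun _ => ENNReal.ofReal_lt_top)]
  refine setIntegral_congr_fun measurableSet_Ioi fun x hx => ?_
  simp only [ENNReal.toReal_ofReal (p.servingDensity_nonneg s hx), Complex.real_smul,
    hMeq z hz x hx]
  ring

/-- Joint transform of the intended fading and the interference on the event that the intended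
link is in a given state. -/
theorem setIntegral_mul_exp_fading_mul_exp_normInterference (hnet : net.IsModel p μ) (s : S)
    {h : ℝ → ℂ} (hm : Measurable h) {C : ℝ} (hC : ∀ x, 0 ≤ x → ‖h x‖ ≤ C) {w z : ℂ}
    (hw : 0 ≤ w.re) (hz : 0 ≤ z.re) :
    ∫ ω in {ω | net.servingState p ω = s}, Complex.exp (-(w * (net.servingFading s ω : ℂ))) *
      (h (net.servingLoss p ω) * Complex.exp (-(z * (net.normInterference p ω : ℂ)))) ∂μ =
    p.fadingMGF s w *
      ∫ x in Ioi 0, h x * p.interferenceMGF z x * (p.servingDensity s x : ℂ) := by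
  rw [← hnet.setIntegral_mul_exp_normInterference s hm hC hz,
    ← hnet.integral_comp_servingFading s hw, ← integral_indicator (hnet.measurableSet_servingState s),
    ← integral_indicator (hnet.measurableSet_servingState s)]
  have hf : Measurable fun x : ℝ => Complex.exp (-(w * (x : ℂ))) := by fun_prop
  -- The event `{s* = s}` is absorbed into a function of the link and the interference, so
  -- independence from the fading applies on the whole space.
  have hg : Measurable fun u : (S × ℝ) × ℝ =>
      ({s} : Set S).indicator (fun _ => h u.1.2 * Complex.exp (-(z * (u.2 : ℂ)))) u.1.1 := by
    have h1 : Measurable fun u : (S × ℝ) × ℝ => h u.1.2 * Complex.exp (-(z * (u.2 : ℂ))) := by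
      fun_prop
    exact h1.indicator (measurable_fst.fst (measurableSet_singleton s))
  have hind := (hnet.indepFun_servingFading s).comp hf hg
  have hU := hnet.measurable_normInterference
  have hp := hind.integral_fun_mul_eq_mul_integral
    (hf.comp (hnet.measurable_serving s)).aestronglyMeasurable
    (hg.comp (hnet.measurable_servingLink.prodMk hU)).aestronglyMeasurable
  refine Eq.trans (integral_congr_ae (.of_forall fun ω => ?_)) (hp.trans (congrArg _ (integral_congr_ae (.of_forall fun ω => ?_))))
  · by_cases hs : net.servingState p ω = s <;> simp [servingLink, indicator, hs]
  · by_cases hs : net.servingState p ω = s <;> simp [servingLink, indicator, hs]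

end IsModel

end Network


/-! ### Moments of the intended link and of the interference -/

namespace NetworkParams

variable {S : Type*} [Fintype S] {B : ℕ} (p : NetworkParams S B)

/-- Ratio of the noise power to the boresight power of a transmitter. -/
def noiseCoeff : ℝ := p.noise / (p.G0 * p.PRB)

lemma noiseCoeff_pos : 0 < p.noiseCoeff := div_pos p.noise_pos (mul_pos p.G0_pos p.PRB_pos)

end NetworkParams

namespace Network

open Filter Topology

variable {S Ω : Type*} [Fintype S] {net : Network S Ω} {p : NetworkParams S 1}
  {mΩ : MeasurableSpace Ω} {μ : Measure Ω}

variable (net p) in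
/-- Noise and interference, in units of the average power of the intended link. -/
def impairment (ω : Ω) : ℝ := p.noiseCoeff * net.servingLoss p ω + net.normInterference p ω / p.G0

lemma impairment_nonneg (ω : Ω) : 0 ≤ net.impairment p ω :=
  add_nonneg (mul_nonneg p.noiseCoeff_pos.le (servingLoss_nonneg ω))
    (div_nonneg (normInterference_nonneg ω) p.G0_pos.le)

lemma mul_servingLoss_le_impairment (ω : Ω) :
    p.noiseCoeff * net.servingLoss p ω ≤ net.impairment p ω :=
  le_add_of_nonneg_right (div_nonneg (normInterference_nonneg ω) p.G0_pos.le)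

lemma iUnion_servingState [Nonempty S] : ⋃ s, {ω | net.servingState p ω = s} = univ :=
  eq_univ_of_forall fun ω =>
    mem_iUnion.2 ⟨net.servingState p ω, show net.servingState p ω = net.servingState p ω from rfl⟩

lemma integrable_of_forall_servingState [Nonempty S] {E : Type*} [NormedAddCommGroup E]
    {f : Ω → E} (hf : ∀ s, IntegrableOn f {ω | net.servingState p ω = s} μ) : Integrable f μ := by
  rw [← integrableOn_univ, ← iUnion_servingState (net := net) (p := p)]
  exact integrableOn_finite_iUnion.2 hf

namespace IsModel

lemma measurable_impairment (hnet : net.IsModel p μ) : Measurable (net.impairment p) :=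
  (hnet.measurable_servingLoss.const_mul _).add (hnet.measurable_normInterference.div_const _)

lemma integrable_servingFading (hnet : net.IsModel p μ) (s : S) :
    Integrable (net.servingFading s) μ := by
  have h := hnet.measurable_serving s
  refine ⟨h.aestronglyMeasurable, ?_⟩
  rw [hasFiniteIntegral_iff_ofReal ((hnet.ae_servingFading_pos s).mono fun _ h => h.le)]
  rw [← lintegral_map (f := ENNReal.ofReal) ENNReal.measurable_ofReal h, hnet.serving_law,
    lintegral_ofReal_gammaMeasure (p.m_pos s) (div_pos (p.m_pos s) (p.Om_pos s))]
  exact ENNReal.ofReal_lt_top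

variable [IsProbabilityMeasure μ]

lemma ae_impairment_pos (hnet : net.IsModel p μ) : ∀ᵐ ω ∂μ, 0 < net.impairment p ω := by
  filter_upwards [hnet.ae_servingLoss_pos] with ω hω
  exact (mul_pos p.noiseCoeff_pos hω).trans_le (mul_servingLoss_le_impairment ω)

/-- Division of numerator and denominator by `P_RB G⁽⁰⁾ / L`, legitimate since `L > 0` and the
interference is finite almost surely. -/
lemma ae_sinr_eq [Nonempty S] (hnet : net.IsModel p μ) : ∀ᵐ ω ∂μ,
    net.sinr p ω = net.servingFading (net.servingState p ω) ω / net.impairment p ω := by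
  filter_upwards [hnet.ae_interference_eq, hnet.ae_servingLoss_pos] with ω h1 h2
  have h3 := h1 _ h2
  change _ = net.normInterference p ω at h3
  have hP := p.PRB_pos
  have hG := p.G0_pos
  have h4 : (net.interference p (net.servingLoss p ω) ω).toReal =
      net.normInterference p ω * p.PRB / net.servingLoss p ω := by
    rw [← h3]
    field_simp
  rw [sinr, impairment, NetworkParams.noiseCoeff, h4]
  have h5 := p.noise_pos
  have h6 : 0 ≤ net.normInterference p ω := normInterference_nonneg ω
  field_simp

variable [Nonempty S] [MeasurableSpace S] [MeasurableSingletonClass S]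

lemma integral_eq_sum_servingState (hnet : net.IsModel p μ) {E : Type*} [NormedAddCommGroup E]
    [NormedSpace ℝ E] {f : Ω → E} (hf : Integrable f μ) :
    ∫ ω, f ω ∂μ = ∑ s, ∫ ω in {ω | net.servingState p ω = s}, f ω ∂μ := by
  rw [← integral_iUnion_fintype (fun s => hnet.measurableSet_servingState s)
    (fun s r hsr => Set.disjoint_left.2 fun ω h h' => hsr (h.symm.trans h'))
    (fun s => hf.integrableOn), iUnion_servingState, setIntegral_univ]

lemma integrableOn_rpow_servingLoss (hnet : net.IsModel p μ) (s : S) {a : ℝ}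
    (ha : -(2 / p.alp s) < a) :
    IntegrableOn (fun ω => net.servingLoss p ω ^ a) {ω | net.servingState p ω = s} μ := by
  have hm : Measurable fun x : ℝ => x ^ a := by fun_prop
  refine (integrable_map_measure (μ := μ.restrict {ω | net.servingState p ω = s})
    (f := net.servingLoss p) (g := fun x : ℝ => x ^ a) hm.aestronglyMeasurable
    hnet.measurable_servingLoss.aemeasurable).1 ?_
  rw [hnet.map_servingLoss_restrict s, integrable_withDensity_iff_integrable_smul₀'
    (p.measurableOn_servingDensity s).ennreal_ofReal (.of_forall fun _ => ENNReal.ofReal_lt_top)]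
  refine (p.integrableOn_rpow_mul_servingDensity s ha).congr_fun (fun x hx => ?_) measurableSet_Ioi
  simp only [ENNReal.toReal_ofReal (p.servingDensity_nonneg s hx), smul_eq_mul]
  ring

lemma integrable_rpow_servingLoss (hnet : net.IsModel p μ) {a : ℝ} (ha : 0 ≤ a) :
    Integrable (fun ω => net.servingLoss p ω ^ a) μ :=
  integrable_of_forall_servingState (net := net) (p := p) fun s => hnet.integrableOn_rpow_servingLoss s
    ((neg_lt_zero.2 (div_pos two_pos (p.alp_pos s))).trans_le ha)

lemma integrable_meanBound_servingLoss (hnet : net.IsModel p μ) :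
    Integrable (fun ω => p.meanBound (net.servingLoss p ω)) μ := by
  refine integrable_finsetSum _ fun s _ => ?_
  simp_rw [Real.div_rpow (servingLoss_nonneg _) (p.kap_pos s).le]
  exact (((hnet.integrable_rpow_servingLoss
    (div_pos two_pos (p.alp_pos s)).le).div_const _).const_mul _).mul_const _

/-- The mean of `U` is recovered from its transform: `(1 - e^{-tU}) / t` tends to `U` as `t = 1 / (k
+ 1) → 0`, its mean is bounded through `|1 - ℳ_I(t | L)| ≤ t · meanBound L`, and Fatou's lemma
concludes. -/
lemma integrable_normInterference (hnet : net.IsModel p μ) :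
    Integrable (net.normInterference p) μ := by
  have hU := hnet.measurable_normInterference
  refine ⟨hU.aestronglyMeasurable, ?_⟩
  rw [hasFiniteIntegral_iff_ofReal (.of_forall normInterference_nonneg)]
  set u : ℕ → Ω → ℝ := fun k ω =>
    ((k : ℝ) + 1) * (1 - Real.exp (-((1 / ((k : ℝ) + 1)) * net.normInterference p ω))) with hu
  have hum : ∀ k, Measurable (u k) := fun k => by fun_prop
  have hk0 : ∀ k : ℕ, (0 : ℝ) < 1 / ((k : ℝ) + 1) := fun k => by positivity
  have hu0 : ∀ k ω, 0 ≤ u k ω := fun k ω => by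
    refine mul_nonneg (by positivity) (sub_nonneg.2 (Real.exp_le_one_iff.2 (neg_nonpos.2 ?_)))
    exact mul_nonneg (hk0 k).le (normInterference_nonneg ω)
  have hlim : ∀ ω, Tendsto (fun k => ENNReal.ofReal (u k ω)) atTop
      (𝓝 (ENNReal.ofReal (net.normInterference p ω))) := fun ω => by
    refine ENNReal.tendsto_ofReal ?_
    have hd : HasDerivAt (fun t : ℝ => 1 - Real.exp (-(t * net.normInterference p ω)))
        (net.normInterference p ω) 0 := by
      have h := ((((hasDerivAt_id (0 : ℝ)).mul_const (net.normInterference p ω)).neg).exp).const_sub 1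
      simpa using h
    have h1 := hd.tendsto_slope_zero_right
    have h2 : Tendsto (fun k : ℕ => 1 / ((k : ℝ) + 1)) atTop (𝓝[>] 0) :=
      tendsto_nhdsWithin_iff.2 ⟨tendsto_one_div_add_atTop_nhds_zero_nat, .of_forall hk0⟩
    refine (h1.comp h2).congr fun k => ?_
    simp [hu]
  have hbound : ∀ k, ∫⁻ ω, ENNReal.ofReal (u k ω) ∂μ ≤
      ENNReal.ofReal (∫ ω, p.meanBound (net.servingLoss p ω) ∂μ) := fun k => by
    set z : ℂ := ((1 / ((k : ℝ) + 1) : ℝ) : ℂ) with hzdef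
    have hz : 0 ≤ z.re := by
      rw [hzdef, Complex.ofReal_re]
      exact (hk0 k).le
    have hzn : ‖z‖ = 1 / ((k : ℝ) + 1) := by
      rw [hzdef, Complex.norm_real, Real.norm_of_nonneg (hk0 k).le]
    have he : ∀ ω, ((u k ω : ℝ) : ℂ) = ((k : ℂ) + 1) * (1 - Complex.exp (-(z * (net.normInterference p ω : ℂ)))) :=
      fun ω => by
        simp only [hu, hzdef]
        push_cast
        rfl
    have hue : Integrable (fun ω => ((u k ω : ℝ) : ℂ)) μ := by
      simp_rw [he]
      exact ((integrable_const 1).sub (hnet.integrable_exp_normInterference hz)).const_mul _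
    have hui : Integrable (u k) μ := by
      simpa using hue.re
    rw [← ofReal_integral_eq_lintegral_ofReal hui (.of_forall (hu0 k))]
    refine ENNReal.ofReal_le_ofReal ?_
    have h1 : ∫ ω, ((u k ω : ℝ) : ℂ) ∂μ =
        ∫ ω, ((k : ℂ) + 1) * (1 - p.interferenceMGF z (net.servingLoss p ω)) ∂μ := by
      simp_rw [he]
      have h2 := hnet.setIntegral_exp_normInterference hz MeasurableSet.univ
      simp only [preimage_univ, setIntegral_univ] at h2
      rw [integral_const_mul, integral_const_mul,
        integral_sub (integrable_const 1) (hnet.integrable_exp_normInterference hz),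
        integral_sub (integrable_const 1) (hnet.integrable_interferenceMGF hz), h2]
    have h3 : (∫ ω, u k ω ∂μ) = ‖∫ ω, ((u k ω : ℝ) : ℂ) ∂μ‖ := by
      rw [integral_complex_ofReal, Complex.norm_real,
        Real.norm_of_nonneg (integral_nonneg (hu0 k))]
    rw [h3, h1]
    refine norm_integral_le_of_norm_le hnet.integrable_meanBound_servingLoss ?_
    filter_upwards [hnet.ae_servingLoss_pos] with ω hω
    have h4 := hnet.norm_one_sub_interferenceMGF_le hω hz
    have h5 : ‖((k : ℂ) + 1)‖ = (k : ℝ) + 1 := by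
      have : ((k : ℂ) + 1) = (((k : ℝ) + 1 : ℝ) : ℂ) := by push_cast; rfl
      rw [this, Complex.norm_real, Real.norm_of_nonneg (by positivity)]
    rw [norm_mul, h5]
    calc ((k : ℝ) + 1) * ‖1 - p.interferenceMGF z (net.servingLoss p ω)‖
        ≤ ((k : ℝ) + 1) * (1 / ((k : ℝ) + 1) * p.meanBound (net.servingLoss p ω)) := by
          rw [hzn] at h4
          gcongr
      _ = p.meanBound (net.servingLoss p ω) := by
          field_simp
  calc ∫⁻ ω, ENNReal.ofReal (net.normInterference p ω) ∂μ
      = ∫⁻ ω, liminf (fun k => ENNReal.ofReal (u k ω)) atTop ∂μ :=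
        lintegral_congr fun ω => (hlim ω).liminf_eq.symm
    _ ≤ liminf (fun k => ∫⁻ ω, ENNReal.ofReal (u k ω) ∂μ) atTop :=
        lintegral_liminf_le fun k => (hum k).ennreal_ofReal
    _ ≤ ENNReal.ofReal (∫ ω, p.meanBound (net.servingLoss p ω) ∂μ) :=
        (liminf_le_liminf (.of_forall hbound)).trans (liminf_const _).le
    _ < ∞ := ENNReal.ofReal_lt_top

lemma integrable_impairment (hnet : net.IsModel p μ) : Integrable (net.impairment p) μ := by
  have h := hnet.integrable_rpow_servingLoss zero_le_one
  simp only [Real.rpow_one] at h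
  exact (h.const_mul _).add (hnet.integrable_normInterference.div_const _)

end IsModel

end Network


/-! ### Two Laplace transforms -/

open Filter Topology

/-- The Frullani integral that represents the logarithm. -/
lemma integral_exp_neg_mul_one_sub_exp_neg_div {y g : ℝ} (hy : 0 < y) (hg : 0 ≤ g)
    (hint : IntegrableOn (fun z => Real.exp (-(z * y)) * (1 - Real.exp (-(z * g))) / z) (Ioi 0)) :
    ∫ z in Ioi 0, Real.exp (-(z * y)) * (1 - Real.exp (-(z * g))) / z = Real.log (1 + g / y) := by
  have hyg : 0 < y + g := by linarith
  have hf : LocallyIntegrableOn (fun z => Real.exp (-z)) (Ioi 0) :=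
    (by fun_prop : Continuous fun z : ℝ => Real.exp (-z)).locallyIntegrable.locallyIntegrableOn _
  have h0 : Tendsto (fun z : ℝ => Real.exp (-z)) (𝓝[>] 0) (𝓝 1) := by
    have h : Continuous fun z : ℝ => Real.exp (-z) := by fun_prop
    have := h.tendsto 0
    simp only [neg_zero, Real.exp_zero] at this
    exact this.mono_left nhdsWithin_le_nhds
  have he : ∀ z : ℝ, Real.exp (-(z * y)) * (1 - Real.exp (-(z * g))) / z =
      z⁻¹ • (Real.exp (-(y * z)) - Real.exp (-((y + g) * z))) := fun z => by
    rw [mul_sub, mul_one, ← Real.exp_add, smul_eq_mul, div_eq_inv_mul]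
    ring_nf
  simp_rw [he] at hint ⊢
  rw [Frullani.integral_Ioi_eq hf hy hyg h0 Real.tendsto_exp_neg_atTop_nhds_zero hint, sub_zero,
    smul_eq_mul, mul_one, add_div, div_self hy.ne']

/-- The Laplace transform of `z ↦ sin (z x) / z`. -/
lemma integral_exp_neg_mul_sin_div {ε : ℝ} (hε : 0 < ε) (x : ℝ) :
    ∫ z in Ioi 0, Real.exp (-(ε * z)) * (Real.sin (z * x) / z) = Real.arctan (x / ε) := by
  have hcos : ∀ t : ℝ, ∫ z in Ioi 0, Real.exp (-(ε * z)) * Real.cos (z * t) = ε / (ε ^ 2 + t ^ 2) := by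
    intro t
    have hw : ((-ε : ℝ) + (t : ℝ) * Complex.I : ℂ).re < 0 := by simpa using hε
    have h := integral_exp_mul_complex_Ioi hw 0
    have h' := integrableOn_exp_mul_complex_Ioi hw 0
    have h1 : ∀ z : ℝ, Real.exp (-(ε * z)) * Real.cos (z * t) =
        (Complex.exp (((-ε : ℝ) + (t : ℝ) * Complex.I : ℂ) * z)).re := fun z => by
      rw [Complex.exp_re]
      simp [mul_comm]
    simp_rw [h1]
    have h2 := integral_re h'
    simp only [RCLike.re_to_complex] at h2
    rw [h2, h]
    simp only [Complex.ofReal_zero, mul_zero, Complex.exp_zero, Complex.div_re, Complex.normSq_apply]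
    simp
    field_simp
  have hmeas : ∀ s : Set ℝ, AEStronglyMeasurable (fun u : ℝ × ℝ => Real.exp (-(ε * u.2)) * Real.cos (u.2 * u.1))
      ((volume.restrict s).prod (volume.restrict (Ioi 0))) := fun s =>
    (by fun_prop : Continuous fun u : ℝ × ℝ => Real.exp (-(ε * u.2)) * Real.cos (u.2 * u.1)).aestronglyMeasurable
  have hexp : IntegrableOn (fun z => Real.exp (-(ε * z))) (Ioi 0) := by
    have := integrableOn_exp_mul_Ioi (neg_lt_zero.2 hε) 0
    simpa [neg_mul] using this
  have : IsFiniteMeasure (volume.restrict (uIoc 0 x)) := by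
    rw [uIoc]
    infer_instance
  have hint : Integrable (Function.uncurry fun t z => Real.exp (-(ε * z)) * Real.cos (z * t))
      ((volume.restrict (uIoc 0 x)).prod (volume.restrict (Ioi 0))) := by
    refine (Integrable.mul_prod (f := fun _ : ℝ => (1 : ℝ)) (integrable_const _) hexp).mono'
      (hmeas _) (.of_forall fun u => ?_)
    rw [Function.uncurry, norm_mul, Real.norm_eq_abs, Real.norm_eq_abs, Real.abs_exp, one_mul]
    exact mul_le_of_le_one_right (Real.exp_pos _).le (Real.abs_cos_le_one _)
  -- Integrating in `t` from `0` to `x` turns `cos (z t)` into `sin (z x) / z` and its transform `ε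
  -- / (ε² + t²)` into an arctangent; `x` may be negative.
  have h := intervalIntegral_integral_swap hint
  simp_rw [hcos] at h
  have hinner : ∫ z in Ioi 0, ∫ t in (0 : ℝ)..x, Real.exp (-(ε * z)) * Real.cos (z * t) =
      ∫ z in Ioi 0, Real.exp (-(ε * z)) * (Real.sin (z * x) / z) := by
    refine setIntegral_congr_fun measurableSet_Ioi fun z hz => ?_
    have hz : z ≠ 0 := ne_of_gt hz
    simp [intervalIntegral.integral_comp_mul_left (fun t => Real.cos t) hz]
    rw [div_eq_inv_mul]
  rw [← hinner, ← h]
  have hd : ∀ t ∈ uIcc 0 x, HasDerivAt (fun t => Real.arctan (t / ε)) (ε / (ε ^ 2 + t ^ 2)) t := by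
    intro t _
    have := ((hasDerivAt_id t).div_const ε).arctan
    refine this.congr_deriv ?_
    simp only [id]
    field_simp
  rw [intervalIntegral.integral_eq_sub_of_hasDerivAt hd]
  · simp
  · refine Continuous.intervalIntegrable ?_ _ _
    refine continuous_const.div (by fun_prop) fun t => ?_
    positivity


/-! ### The average spectral efficiency -/

/-- `A` dominates on `z ≤ 1` and `z^{-1-δ} B` on `z > 1`; each is a product of integrable functions.
-/
lemma integrable_prod_Ioi_of_norm_le {α E : Type*} [MeasurableSpace α] [NormedAddCommGroup E]
    {ν : Measure α} [SFinite ν] {f : ℝ × α → E}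
    (hf : AEStronglyMeasurable f ((volume.restrict (Ioi 0)).prod ν)) {A B : α → ℝ}
    (hA : Integrable A ν) (hB : Integrable B ν) {δ : ℝ} (hδ : 0 < δ)
    (h : ∀ᵐ a ∂ν, ∀ z : ℝ, 0 < z → ‖f (z, a)‖ ≤ A a ∧ ‖f (z, a)‖ ≤ z ^ (-1 - δ) * B a) :
    Integrable f ((volume.restrict (Ioi 0)).prod ν) := by
  have h1 : IntegrableOn (indicator (Ioc (0 : ℝ) 1) fun _ => (1 : ℝ)) (Ioi 0) :=
    ((integrable_indicator_iff measurableSet_Ioc).2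
      (integrableOn_const (by simp))).integrableOn
  have h2 : IntegrableOn (indicator (Ioi (1 : ℝ)) fun z : ℝ => z ^ (-1 - δ)) (Ioi 0) :=
    ((integrable_indicator_iff measurableSet_Ioi).2
      (integrableOn_Ioi_rpow_of_lt (by linarith) one_pos)).integrableOn
  refine ((h1.mul_prod hA).add (h2.mul_prod hB)).mono' hf ?_
  filter_upwards [Measure.quasiMeasurePreserving_snd.ae h,
    Measure.quasiMeasurePreserving_fst.ae (ae_restrict_mem measurableSet_Ioi)] with u hu hu0
  have hu0 : 0 < u.1 := hu0
  obtain ⟨h3, h4⟩ := hu u.1 hu0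
  simp only [Pi.add_apply]
  rcases le_or_gt u.1 1 with hu1 | hu1
  · rw [indicator_of_mem (show u.1 ∈ Ioc (0 : ℝ) 1 from ⟨hu0, hu1⟩),
      indicator_of_notMem (show u.1 ∉ Ioi (1 : ℝ) from not_lt.2 hu1)]
    simpa using h3
  · rw [indicator_of_notMem (show u.1 ∉ Ioc (0 : ℝ) 1 from fun h => h.2.not_gt hu1),
      indicator_of_mem (show u.1 ∈ Ioi (1 : ℝ) from hu1)]
    simpa using h4

lemma Real.exp_neg_le_rpow_neg {t ε : ℝ} (ht : 0 < t) (hε : 0 ≤ ε) (hε' : ε ≤ 1) :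
    Real.exp (-t) ≤ t ^ (-ε) := by
  rw [Real.exp_neg, Real.rpow_neg ht.le]
  refine inv_anti₀ (Real.rpow_pos_of_pos ht _) ?_
  rcases le_total t 1 with h | h
  · exact (Real.rpow_le_one ht.le h hε).trans (Real.one_le_exp ht.le)
  · calc t ^ ε ≤ t ^ (1 : ℝ) := Real.rpow_le_rpow_of_exponent_le h hε'
      _ ≤ Real.exp t := by
        rw [Real.rpow_one]
        linarith [Real.add_one_le_exp t]

lemma Real.exp_neg_mul_div_le {z y ε : ℝ} (hz : 0 < z) (hy : 0 < y) (hε : 0 ≤ ε) (hε' : ε ≤ 1) :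
    Real.exp (-(z * y)) / z ≤ z ^ (-1 - ε) * y ^ (-ε) := by
  have h := Real.exp_neg_le_rpow_neg (mul_pos hz hy) hε hε'
  rw [Real.mul_rpow hz.le hy.le] at h
  rw [sub_eq_add_neg, Real.rpow_add hz, Real.rpow_neg_one, div_eq_inv_mul, mul_assoc]
  exact mul_le_mul_of_nonneg_left h (inv_pos.2 hz).le

namespace NetworkParams

variable {S : Type*} [Fintype S] {B : ℕ} (p : NetworkParams S B)

lemma norm_fadingMGF_le_one (s : S) {w : ℂ} (hw : 0 ≤ w.re) : ‖p.fadingMGF s w‖ ≤ 1 := by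
  have hr : 0 < p.m s / p.Om s := div_pos (p.m_pos s) (p.Om_pos s)
  have : IsProbabilityMeasure (gammaMeasure (p.m s) (p.m s / p.Om s)) :=
    isProbabilityMeasure_gammaMeasure (p.m_pos s) hr
  rw [← p.fadingMGF_eq_integral s hw]
  refine (norm_integral_le_of_norm_le_const (C := 1) ?_).trans (by simp)
  filter_upwards [ae_pos_gammaMeasure _ _] with x hx using
    Network.norm_exp_neg_mul_le_one hw hx.le

end NetworkParams

namespace Network

open Filter Topology

variable {S Ω : Type*} [Fintype S] {net : Network S Ω} {p : NetworkParams S 1}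
  {mΩ : MeasurableSpace Ω} {μ : Measure Ω}

namespace IsModel

variable [IsProbabilityMeasure μ] [Nonempty S] [MeasurableSpace S] [MeasurableSingletonClass S]

/-- Near `z = 0` the integrand is at most `g`. For large `z` the noise gives `e^{-zcL} / z ≤
z^{-1-ε} (cL)^{-ε}`; the choice `ε = 1 / α_s < 2 / α_s` keeps the negative moment of `L` finite. -/
lemma integrable_exp_impairment (hnet : net.IsModel p μ) (s : S) :
    Integrable (fun u : ℝ × Ω => Real.exp (-(u.1 * net.impairment p u.2)) *
      (1 - Real.exp (-(u.1 * net.servingFading s u.2))) / u.1)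
      ((volume.restrict (Ioi 0)).prod (μ.restrict {ω | net.servingState p ω = s})) := by
  have hY := hnet.measurable_impairment
  have hg := hnet.measurable_serving s
  have hα := p.two_lt_alp s
  have hα0 := p.alp_pos s
  have hε : 0 < 1 / p.alp s := by positivity
  have hε1 : 1 / p.alp s ≤ 1 := by
    rw [div_le_one hα0]
    linarith
  have hm : Measurable (fun u : ℝ × Ω => Real.exp (-(u.1 * net.impairment p u.2)) *
      (1 - Real.exp (-(u.1 * net.servingFading s u.2))) / u.1) := by
    have h1 : Measurable fun u : ℝ × Ω => net.impairment p u.2 := hY.comp measurable_snd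
    have h2 : Measurable fun u : ℝ × Ω => net.servingFading s u.2 := hg.comp measurable_snd
    exact ((measurable_fst.mul h1).neg.exp.mul
      (measurable_const.sub (measurable_fst.mul h2).neg.exp)).div measurable_fst
  refine integrable_prod_Ioi_of_norm_le hm.aestronglyMeasurable
    (hnet.integrable_servingFading s).integrableOn
    ((hnet.integrableOn_rpow_servingLoss s (a := -(1 / p.alp s))
      (by rw [neg_lt_neg_iff]; gcongr; norm_num)).const_mul (p.noiseCoeff ^ (-(1 / p.alp s))))
    hε ?_
  filter_upwards [ae_restrict_of_ae (hnet.ae_servingFading_pos s),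
    ae_restrict_of_ae hnet.ae_servingLoss_pos] with ω hg0 hL0 z hz
  have hc := p.noiseCoeff_pos
  have h0 : 0 < 1 - Real.exp (-(z * net.servingFading s ω)) :=
    sub_pos.2 (Real.exp_lt_one_iff.2 (neg_lt_zero.2 (mul_pos hz hg0)))
  have hYc : p.noiseCoeff * net.servingLoss p ω ≤ net.impairment p ω :=
    mul_servingLoss_le_impairment ω
  rw [Real.norm_of_nonneg (by positivity)]
  constructor
  · have h1 : Real.exp (-(z * net.impairment p ω)) ≤ 1 :=
      Real.exp_le_one_iff.2 (neg_nonpos.2 (mul_nonneg hz.le (impairment_nonneg ω)))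
    have h2 : 1 - Real.exp (-(z * net.servingFading s ω)) ≤ z * net.servingFading s ω := by
      linarith [Real.add_one_le_exp (-(z * net.servingFading s ω))]
    rw [div_le_iff₀ hz]
    calc _ ≤ 1 * (z * net.servingFading s ω) := mul_le_mul h1 h2 h0.le zero_le_one
      _ = _ := by ring
  · have h1 : 1 - Real.exp (-(z * net.servingFading s ω)) ≤ 1 := by
      linarith [Real.exp_pos (-(z * net.servingFading s ω))]
    calc _ ≤ Real.exp (-(z * (p.noiseCoeff * net.servingLoss p ω))) * 1 / z := by
          gcongr
      _ ≤ _ := by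
          rw [mul_one]
          refine (Real.exp_neg_mul_div_le hz (mul_pos hc hL0) hε.le hε1).trans (le_of_eq ?_)
          rw [Real.mul_rpow hc.le hL0.le]

/-- `ln (1 + SINR)` on the event that the intended link is in a given state. -/
lemma ae_integral_exp_impairment (hnet : net.IsModel p μ) (s : S) :
    (fun ω => ∫ z in Ioi 0, Real.exp (-(z * net.impairment p ω)) *
      (1 - Real.exp (-(z * net.servingFading s ω))) / z)
      =ᵐ[μ.restrict {ω | net.servingState p ω = s}] fun ω => Real.log (1 + net.sinr p ω) := by
  filter_upwards [(hnet.integrable_exp_impairment s).prod_left_ae,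
    ae_restrict_of_ae (hnet.ae_servingFading_pos s), ae_restrict_of_ae hnet.ae_impairment_pos,
    ae_restrict_of_ae hnet.ae_sinr_eq, ae_restrict_mem (hnet.measurableSet_servingState s)]
    with ω h1 hg hY hsinr hs
  have hs : net.servingState p ω = s := hs
  rw [hsinr, hs]
  exact integral_exp_neg_mul_one_sub_exp_neg_div hY hg.le h1

lemma integrable_log_one_add_sinr (hnet : net.IsModel p μ) :
    Integrable (fun ω => Real.log (1 + net.sinr p ω)) μ :=
  integrable_of_forall_servingState (net := net) (p := p) fun s =>
    (hnet.integrable_exp_impairment s).integral_prod_right.congr (hnet.ae_integral_exp_impairment s)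

omit [Nonempty S] [MeasurableSpace S] [MeasurableSingletonClass S] in
-- The same two bounds after taking expectations, with the interference transform bounded by `1`.
lemma integrable_aseIntegrand (hnet : net.IsModel p μ) (s : S) :
    Integrable (fun u : ℝ × ℝ => p.aseIntegrand p.interferenceMGF s u.1 u.2)
      ((volume.restrict (Ioi 0)).prod (volume.restrict (Ioi 0))) := by
  obtain ⟨M, hM, hMeq⟩ := hnet.exists_measurable_interferenceMGF
  have hα := p.two_lt_alp s
  have hα0 := p.alp_pos s
  have hG := p.G0_pos
  have hc := p.noiseCoeff_pos
  have hε : 0 < 1 / p.alp s := by positivity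
  have hε1 : 1 / p.alp s ≤ 1 := by
    rw [div_le_one hα0]
    linarith
  have hae : ∀ᵐ u ∂((volume.restrict (Ioi (0 : ℝ))).prod (volume.restrict (Ioi (0 : ℝ)))),
      0 < u.1 ∧ 0 < u.2 := by
    filter_upwards [Measure.quasiMeasurePreserving_snd.ae (ae_restrict_mem measurableSet_Ioi),
      Measure.quasiMeasurePreserving_fst.ae (ae_restrict_mem measurableSet_Ioi)] with u h1 h2
      using ⟨h2, h1⟩
  have hm : AEStronglyMeasurable (fun u : ℝ × ℝ => p.aseIntegrand p.interferenceMGF s u.1 u.2)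
      ((volume.restrict (Ioi 0)).prod (volume.restrict (Ioi 0))) := by
    have hd : AEStronglyMeasurable (fun u : ℝ × ℝ => (p.servingDensity s u.2 : ℂ))
        ((volume.restrict (Ioi 0)).prod (volume.restrict (Ioi 0))) :=
      (Complex.measurable_ofReal.comp_aemeasurable
        (p.measurableOn_servingDensity s)).aestronglyMeasurable.comp_snd
    have h1 : Measurable fun u : ℝ × ℝ =>
        Complex.exp (-((u.1 * u.2 * p.noise / (p.G0 * p.PRB) : ℝ) : ℂ)) := by fun_prop
    have h2 : Measurable fun u : ℝ × ℝ => M (((u.1 / p.G0 : ℝ) : ℂ), u.2) :=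
      hM.comp ((by fun_prop : Measurable fun u : ℝ × ℝ => ((u.1 / p.G0 : ℝ) : ℂ)).prodMk
        measurable_snd)
    have h3 : Measurable fun u : ℝ × ℝ => 1 - p.fadingMGF s u.1 :=
      measurable_const.sub ((p.measurable_fadingMGF s).comp
        (Complex.measurable_ofReal.comp measurable_fst))
    refine ((((h1.mul h2).mul h3).aestronglyMeasurable.mul hd).mul
      (by fun_prop : Measurable fun u : ℝ × ℝ => (u.1 : ℂ)⁻¹).aestronglyMeasurable).congr ?_
    filter_upwards [hae] with u hu
    have hz : 0 ≤ (((u.1 / p.G0 : ℝ) : ℂ)).re := by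
      rw [Complex.ofReal_re]
      exact (div_pos hu.1 hG).le
    simp only [Pi.mul_apply, NetworkParams.aseIntegrand]
    rw [hMeq _ hz _ hu.2, div_eq_mul_inv _ (u.1 : ℂ)]
  refine integrable_prod_Ioi_of_norm_le hm
    ((p.integrableOn_servingDensity s).const_mul (p.Om s))
    ((p.integrableOn_rpow_mul_servingDensity s (a := -(1 / p.alp s))
      (by rw [neg_lt_neg_iff]; gcongr; norm_num)).const_mul (2 * p.noiseCoeff ^ (-(1 / p.alp s))))
    hε ?_
  filter_upwards [ae_restrict_mem measurableSet_Ioi] with x hx z hz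
  have hx : 0 < x := hx
  have hd := p.servingDensity_nonneg s hx
  have hz' : 0 ≤ (((z / p.G0 : ℝ) : ℂ)).re := by
    rw [Complex.ofReal_re]
    exact (div_pos hz hG).le
  have hMle := hnet.norm_interferenceMGF_le hx hz'
  have he : ‖Complex.exp (-((z * x * p.noise / (p.G0 * p.PRB) : ℝ) : ℂ))‖ =
      Real.exp (-(z * (p.noiseCoeff * x))) := by
    rw [Complex.norm_exp, ← Complex.ofReal_neg, Complex.ofReal_re, NetworkParams.noiseCoeff]
    congr 2
    ring
  have hnorm : ‖p.aseIntegrand p.interferenceMGF s z x‖ ≤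
      Real.exp (-(z * (p.noiseCoeff * x))) / z * ‖1 - p.fadingMGF s z‖ * p.servingDensity s x := by
    rw [NetworkParams.aseIntegrand, norm_div, norm_mul, norm_mul, norm_mul, he, Complex.norm_real,
      Complex.norm_real, Real.norm_of_nonneg hd, Real.norm_of_nonneg hz.le]
    calc _ ≤ Real.exp (-(z * (p.noiseCoeff * x))) * 1 * ‖1 - p.fadingMGF s z‖ *
          p.servingDensity s x / z := by gcongr
      _ = _ := by ring
  have hz0 : (0 : ℝ) ≤ ((z : ℝ) : ℂ).re := by
    rw [Complex.ofReal_re]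
    exact hz.le
  constructor
  · refine hnorm.trans ?_
    have h1 : Real.exp (-(z * (p.noiseCoeff * x))) ≤ 1 :=
      Real.exp_le_one_iff.2 (neg_nonpos.2 (by positivity))
    have h2 := p.norm_one_sub_fadingMGF_le s hz0
    rw [Complex.norm_real, Real.norm_of_nonneg hz.le] at h2
    calc _ ≤ 1 / z * (z * p.Om s) * p.servingDensity s x := by gcongr
      _ = _ := by field_simp
  · refine hnorm.trans ?_
    have h1 := Real.exp_neg_mul_div_le hz (mul_pos hc hx) hε.le hε1
    have h2 : ‖1 - p.fadingMGF s z‖ ≤ 2 := by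
      have := p.norm_fadingMGF_le_one s hz0
      calc _ ≤ ‖(1 : ℂ)‖ + ‖p.fadingMGF s z‖ := norm_sub_le _ _
        _ ≤ 2 := by rw [norm_one]; linarith
    calc _ ≤ z ^ (-1 - 1 / p.alp s) * (p.noiseCoeff * x) ^ (-(1 / p.alp s)) * 2 *
          p.servingDensity s x := by gcongr
      _ = _ := by
        rw [Real.mul_rpow hc.le hx.le]
        ring

/-- The joint transform of fading and interference is taken at fading arguments `0` and `z`; the
difference produces `1 - ℳ_s(z)`. -/
lemma setIntegral_exp_impairment (hnet : net.IsModel p μ) (s : S) {z : ℝ} (hz : 0 < z) :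
    ((∫ ω in {ω | net.servingState p ω = s}, Real.exp (-(z * net.impairment p ω)) *
      (1 - Real.exp (-(z * net.servingFading s ω))) / z ∂μ : ℝ) : ℂ) =
      ∫ x in Ioi 0, p.aseIntegrand p.interferenceMGF s z x := by
  set h : ℝ → ℂ := fun x => Complex.exp (-((z * (p.noiseCoeff * x) : ℝ) : ℂ)) with hh
  have hm : Measurable h := by fun_prop
  have hC : ∀ x, 0 ≤ x → ‖h x‖ ≤ 1 := fun x hx => by
    rw [hh, Complex.norm_exp, ← Complex.ofReal_neg, Complex.ofReal_re, Real.exp_le_one_iff,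
      neg_nonpos]
    exact mul_nonneg hz.le (mul_nonneg p.noiseCoeff_pos.le hx)
  have hz' : 0 ≤ (((z / p.G0 : ℝ) : ℂ)).re := by
    rw [Complex.ofReal_re]
    exact (div_pos hz p.G0_pos).le
  have hz0 : (0 : ℝ) ≤ ((z : ℝ) : ℂ).re := by
    rw [Complex.ofReal_re]
    exact hz.le
  have e0 := hnet.setIntegral_mul_exp_fading_mul_exp_normInterference s hm hC (w := 0) le_rfl hz'
  have e1 := hnet.setIntegral_mul_exp_fading_mul_exp_normInterference s hm hC hz0 hz'
  have hf0 : p.fadingMGF s 0 = 1 := by simp [NetworkParams.fadingMGF]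
  rw [hf0, one_mul] at e0
  have hi : ∀ w : ℂ, 0 ≤ w.re → IntegrableOn (fun ω =>
      Complex.exp (-(w * (net.servingFading s ω : ℂ))) * (h (net.servingLoss p ω) *
        Complex.exp (-(((z / p.G0 : ℝ) : ℂ) * (net.normInterference p ω : ℂ)))))
      {ω | net.servingState p ω = s} μ := fun w hw => by
    have hgm := hnet.measurable_serving s
    have hhm : Measurable fun ω => h (net.servingLoss p ω) := hm.comp hnet.measurable_servingLoss
    have h1 : Integrable (fun ω => h (net.servingLoss p ω) *
        Complex.exp (-(((z / p.G0 : ℝ) : ℂ) * (net.normInterference p ω : ℂ)))) μ :=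
      (hnet.integrable_exp_normInterference hz').bdd_mul (c := 1) hhm.aestronglyMeasurable
        (.of_forall fun ω => hC _ (servingLoss_nonneg ω))
    refine (h1.bdd_mul (c := 1) (by fun_prop : Measurable _).aestronglyMeasurable ?_).integrableOn
    filter_upwards [hnet.ae_servingFading_pos s] with ω hω using norm_exp_neg_mul_le_one hw hω.le
  have hleft : ∀ ω, ((Real.exp (-(z * net.impairment p ω)) *
      (1 - Real.exp (-(z * net.servingFading s ω))) / z : ℝ) : ℂ) =
      (z : ℂ)⁻¹ * (Complex.exp (-(0 * (net.servingFading s ω : ℂ))) * (h (net.servingLoss p ω) *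
        Complex.exp (-(((z / p.G0 : ℝ) : ℂ) * (net.normInterference p ω : ℂ)))) -
        Complex.exp (-((z : ℂ) * (net.servingFading s ω : ℂ))) * (h (net.servingLoss p ω) *
        Complex.exp (-(((z / p.G0 : ℝ) : ℂ) * (net.normInterference p ω : ℂ))))) := fun ω => by
    have h1 : h (net.servingLoss p ω) *
        Complex.exp (-(((z / p.G0 : ℝ) : ℂ) * (net.normInterference p ω : ℂ))) =
        Complex.exp (-((z : ℂ) * (net.impairment p ω : ℂ))) := by
      rw [hh, ← Complex.exp_add, impairment]
      congr 1
      push_cast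
      ring
    rw [h1, zero_mul, neg_zero, Complex.exp_zero]
    push_cast
    ring
  rw [← integral_complex_ofReal]
  simp_rw [hleft]
  rw [integral_const_mul, integral_sub (hi 0 le_rfl) (hi _ hz0), e0, e1, ← one_sub_mul,
    ← integral_const_mul, ← integral_const_mul]
  refine integral_congr_ae (.of_forall fun x => ?_)
  simp only [NetworkParams.aseIntegrand, hh]
  rw [show z * x * p.noise / (p.G0 * p.PRB) = z * (p.noiseCoeff * x) by
    rw [NetworkParams.noiseCoeff]
    ring]
  ring

/-- The mean of `ln (1 + SINR)`. -/
theorem integral_log_one_add_sinr (hnet : net.IsModel p μ) :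
    ((∫ ω, Real.log (1 + net.sinr p ω) ∂μ : ℝ) : ℂ) =
      ∑ s, ∫ x in Ioi 0, ∫ z in Ioi 0, p.aseIntegrand p.interferenceMGF s z x := by
  rw [hnet.integral_eq_sum_servingState hnet.integrable_log_one_add_sinr, Complex.ofReal_sum]
  refine Finset.sum_congr rfl fun s _ => ?_
  have h1 := integral_integral_swap (f := fun z ω => Real.exp (-(z * net.impairment p ω)) *
    (1 - Real.exp (-(z * net.servingFading s ω))) / z) (hnet.integrable_exp_impairment s)
  have h2 := integral_integral_swap (f := fun z x => p.aseIntegrand p.interferenceMGF s z x)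
    (hnet.integrable_aseIntegrand s)
  rw [← integral_congr_ae (hnet.ae_integral_exp_impairment s), ← h1, ← h2,
    ← integral_complex_ofReal]
  exact setIntegral_congr_fun measurableSet_Ioi fun z hz => hnet.setIntegral_exp_impairment s hz

end IsModel

end Network


/-! ### The potential throughput -/

open Filter Topology

namespace NetworkParams

variable {S : Type*} [Fintype S] {B : ℕ} (p : NetworkParams S B)

/-- The imaginary part bounds `|1 + j z Ω / m|` below by `z Ω / m`. On the imaginary axis the noise
factor has modulus `1`, so this decay alone gives convergence at infinity. -/
lemma norm_fadingMGF_I_mul_le (s : S) {z : ℝ} (hz : 0 < z) :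
    ‖p.fadingMGF s (Complex.I * z)‖ ≤ (p.Om s / p.m s) ^ (-p.m s) * z ^ (-p.m s) := by
  have hc : 0 < p.Om s / p.m s := div_pos (p.Om_pos s) (p.m_pos s)
  have hzc : 0 < z * (p.Om s / p.m s) := mul_pos hz hc
  have him : (1 + Complex.I * (z : ℂ) * ((p.Om s / p.m s : ℝ) : ℂ)).im = z * (p.Om s / p.m s) := by
    rw [Complex.add_im, Complex.one_im, zero_add, mul_assoc, ← Complex.ofReal_mul, Complex.I_mul_im,
      Complex.ofReal_re]
  have hle : z * (p.Om s / p.m s) ≤ ‖1 + Complex.I * (z : ℂ) * ((p.Om s / p.m s : ℝ) : ℂ)‖ := by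
    rw [← him]
    exact (le_abs_self _).trans (Complex.abs_im_le_norm _)
  have hne : 1 + Complex.I * (z : ℂ) * ((p.Om s / p.m s : ℝ) : ℂ) ≠ 0 :=
    norm_pos_iff.1 (hzc.trans_le hle)
  rw [fadingMGF, Complex.norm_cpow_of_ne_zero hne, ← Real.mul_rpow hc.le hz.le, mul_comm _ z]
  simp only [Complex.neg_re, Complex.ofReal_re, Complex.neg_im, Complex.ofReal_im, neg_zero,
    mul_zero, Real.exp_zero, div_one]
  exact Real.rpow_le_rpow_of_nonpos hzc hle (neg_nonpos.2 (p.m_pos s).le)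

end NetworkParams

/-- Taking the imaginary part removes the real constant `1`, so the product is controlled by the
deviations of its factors from `1`. Each is `O(z)` below, which compensates the division by `z`. -/
lemma Complex.abs_im_mul_mul_le {a b c : ℂ} (hb : ‖b‖ ≤ 1) (hc : ‖c‖ ≤ 1) :
    |(a * b * c).im| ≤ ‖1 - a‖ + ‖1 - b‖ + ‖1 - c‖ := by
  have h : a * b * c = 1 - ((1 - a) * b * c + (1 - b) * c + (1 - c)) := by ring
  have h2 : (a * b * c).im = -((1 - a) * b * c + (1 - b) * c + (1 - c)).im := by
    rw [h, Complex.sub_im, Complex.one_im, zero_sub]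
  rw [h2, abs_neg]
  refine (Complex.abs_im_le_norm _).trans ((norm_add₃_le).trans ?_)
  rw [norm_mul, norm_mul, norm_mul]
  have h3 : ‖1 - a‖ * ‖b‖ * ‖c‖ ≤ ‖1 - a‖ * 1 * 1 := by gcongr
  have h4 : ‖1 - b‖ * ‖c‖ ≤ ‖1 - b‖ * 1 := by gcongr
  linarith

lemma tendsto_arctan_mul_nat {x : ℝ} (hx : x ≠ 0) :
    Tendsto (fun k : ℕ => Real.arctan (x / (1 / ((k : ℝ) + 1)))) atTop
      (𝓝 (Real.pi / 2 * (1 - 2 * (Iic (0 : ℝ)).indicator 1 x))) := by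
  have hk : Tendsto (fun k : ℕ => (k : ℝ) + 1) atTop atTop :=
    tendsto_atTop_add_const_right _ _ tendsto_natCast_atTop_atTop
  simp only [div_div_eq_mul_div, div_one]
  rcases lt_or_gt_of_ne hx with h | h
  · rw [indicator_of_mem (show x ∈ Iic (0 : ℝ) from h.le)]
    have h1 := (Real.tendsto_arctan_atBot.mono_right nhdsWithin_le_nhds).comp
      (hk.const_mul_atTop_of_neg h)
    convert h1 using 2
    · rfl
    · rw [Pi.one_apply]
      ring
  · rw [indicator_of_notMem (show x ∉ Iic (0 : ℝ) from not_le.2 h)]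
    have h1 := (Real.tendsto_arctan_atTop.mono_right nhdsWithin_le_nhds).comp
      (hk.const_mul_atTop h)
    convert h1 using 2
    · rfl
    · rw [mul_zero, sub_zero, mul_one]

namespace Network

variable {S Ω : Type*} [Fintype S] {net : Network S Ω} {p : NetworkParams S 1}
  {mΩ : MeasurableSpace Ω} {μ : Measure Ω}

variable (net p) in
/-- The SINR is at least `T` if this margin is nonpositive and the intended link is in state `s`. -/
def margin (T : ℝ) (s : S) (ω : Ω) : ℝ := T * net.impairment p ω - net.servingFading s ω

namespace IsModel

variable [IsProbabilityMeasure μ]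

lemma measurable_margin (hnet : net.IsModel p μ) (T : ℝ) (s : S) : Measurable (net.margin p T s) :=
  (hnet.measurable_impairment.const_mul T).sub (hnet.measurable_serving s)

lemma integrable_ptIntegrand (hnet : net.IsModel p μ) {T : ℝ} (hT : 0 < T) (s : S) :
    Integrable (fun u : ℝ × ℝ => p.ptIntegrand p.interferenceMGF T s u.1 u.2)
      ((volume.restrict (Ioi 0)).prod (volume.restrict (Ioi 0))) := by
  obtain ⟨M, hM, hMeq⟩ := hnet.exists_measurable_interferenceMGF
  have hG := p.G0_pos
  have hc := p.noiseCoeff_pos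
  have hz' : ∀ z : ℝ, 0 ≤ (-(Complex.I * ((z * T / p.G0 : ℝ) : ℂ))).re := fun z => by
    rw [Complex.neg_re, Complex.I_mul_re, Complex.ofReal_im, neg_zero, neg_zero]
  have hae : ∀ᵐ u ∂((volume.restrict (Ioi (0 : ℝ))).prod (volume.restrict (Ioi (0 : ℝ)))),
      0 < u.2 := Measure.quasiMeasurePreserving_snd.ae (ae_restrict_mem measurableSet_Ioi)
  have hm : AEStronglyMeasurable (fun u : ℝ × ℝ => p.ptIntegrand p.interferenceMGF T s u.1 u.2)
      ((volume.restrict (Ioi 0)).prod (volume.restrict (Ioi 0))) := by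
    have hd : AEStronglyMeasurable (fun u : ℝ × ℝ => p.servingDensity s u.2)
        ((volume.restrict (Ioi 0)).prod (volume.restrict (Ioi 0))) :=
      (p.measurableOn_servingDensity s).aestronglyMeasurable.comp_snd
    have h1 : Measurable fun u : ℝ × ℝ =>
        Complex.exp (Complex.I * ((u.1 * u.2 * p.noise * T / (p.G0 * p.PRB) : ℝ) : ℂ)) := by fun_prop
    have h2 : Measurable fun u : ℝ × ℝ => M (-(Complex.I * ((u.1 * T / p.G0 : ℝ) : ℂ)), u.2) :=
      hM.comp ((by fun_prop : Measurable fun u : ℝ × ℝ =>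
        -(Complex.I * ((u.1 * T / p.G0 : ℝ) : ℂ))).prodMk measurable_snd)
    have h3 : Measurable fun u : ℝ × ℝ => p.fadingMGF s (Complex.I * u.1) :=
      (p.measurable_fadingMGF s).comp (by fun_prop)
    refine (((Complex.measurable_im.comp ((h1.mul h3).mul h2)).aestronglyMeasurable.mul hd).mul
      (by fun_prop : Measurable fun u : ℝ × ℝ => (u.1)⁻¹).aestronglyMeasurable).congr ?_
    filter_upwards [hae] with u hu
    simp only [Pi.mul_apply, NetworkParams.ptIntegrand, Function.comp_apply]
    rw [hMeq _ (hz' _) _ hu, div_eq_mul_inv _ u.1]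
  have hmb : IntegrableOn (fun x => p.meanBound x * p.servingDensity s x) (Ioi 0) := by
    simp_rw [NetworkParams.meanBound, Finset.sum_mul]
    refine integrable_finsetSum _ fun r _ => ?_
    have h0 : 0 < 2 / p.alp r := div_pos two_pos (p.alp_pos r)
    have h1 : IntegrableOn (fun x => p.tailCoeff r * p.maxMeanMark r / p.kap r ^ (2 / p.alp r) *
        (x ^ (2 / p.alp r) * p.servingDensity s x)) (Ioi 0) :=
      (p.integrableOn_rpow_mul_servingDensity s (a := 2 / p.alp r)
        ((neg_lt_zero.2 (div_pos two_pos (p.alp_pos s))).trans h0)).const_mul _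
    refine h1.congr_fun (fun x hx => ?_) measurableSet_Ioi
    have hx : 0 < x := hx
    simp only
    rw [Real.div_rpow hx.le (p.kap_pos r).le]
    ring
  have hx1 := p.integrableOn_rpow_mul_servingDensity s (a := 1)
    ((neg_lt_zero.2 (div_pos two_pos (p.alp_pos s))).trans one_pos)
  refine integrable_prod_Ioi_of_norm_le hm
    (((hx1.const_mul (p.noiseCoeff * T)).add ((p.integrableOn_servingDensity s).const_mul
      (p.Om s))).add (hmb.const_mul (T / p.G0)))
    ((p.integrableOn_servingDensity s).const_mul ((p.Om s / p.m s) ^ (-p.m s))) (p.m_pos s) ?_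
  filter_upwards [ae_restrict_mem measurableSet_Ioi] with x hx z hz
  have hx : 0 < x := hx
  have hd := p.servingDensity_nonneg s hx
  have hMle := hnet.norm_interferenceMGF_le hx (hz' z)
  have hIz : 0 ≤ (Complex.I * (z : ℂ)).re := by
    rw [Complex.I_mul_re, Complex.ofReal_im, neg_zero]
  have hfle := p.norm_fadingMGF_le_one s hIz
  have he : ‖Complex.exp (Complex.I * ((z * x * p.noise * T / (p.G0 * p.PRB) : ℝ) : ℂ))‖ = 1 := by
    rw [mul_comm, Complex.norm_exp_ofReal_mul_I]
  rw [NetworkParams.ptIntegrand, norm_div, norm_mul, Real.norm_eq_abs, Real.norm_of_nonneg hd,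
    Real.norm_of_nonneg hz.le]
  constructor
  · have h1 : ‖1 - Complex.exp (Complex.I * ((z * x * p.noise * T / (p.G0 * p.PRB) : ℝ) : ℂ))‖ ≤
        z * (p.noiseCoeff * T * x) := by
      rw [norm_sub_rev]
      refine (Real.norm_exp_I_mul_ofReal_sub_one_le).trans (le_of_eq ?_)
      have h0 : z * x * p.noise * T / (p.G0 * p.PRB) = z * (p.noiseCoeff * T * x) := by
        rw [NetworkParams.noiseCoeff]
        ring
      rw [h0, Real.norm_of_nonneg (by positivity)]
    have h2 : ‖1 - p.fadingMGF s (Complex.I * z)‖ ≤ z * p.Om s := by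
      refine (p.norm_one_sub_fadingMGF_le s hIz).trans (le_of_eq ?_)
      rw [norm_mul, Complex.norm_I, one_mul, Complex.norm_real, Real.norm_of_nonneg hz.le]
    have h3 : ‖1 - p.interferenceMGF (-(Complex.I * ((z * T / p.G0 : ℝ) : ℂ))) x‖ ≤
        z * (T / p.G0 * p.meanBound x) := by
      refine (hnet.norm_one_sub_interferenceMGF_le hx (hz' z)).trans (le_of_eq ?_)
      rw [norm_neg, norm_mul, Complex.norm_I, one_mul, Complex.norm_real,
        Real.norm_of_nonneg (by positivity)]
      ring
    have h4 := (Complex.abs_im_mul_mul_le hfle hMle).trans (add_le_add_three h1 h2 h3)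
    rw [div_le_iff₀ hz]
    refine (mul_le_mul_of_nonneg_right h4 hd).trans (le_of_eq ?_)
    simp only [Pi.add_apply, Real.rpow_one]
    ring
  · have h1 := (Complex.abs_im_le_norm (Complex.exp (Complex.I *
      ((z * x * p.noise * T / (p.G0 * p.PRB) : ℝ) : ℂ)) * p.fadingMGF s (Complex.I * z) *
        p.interferenceMGF (-(Complex.I * ((z * T / p.G0 : ℝ) : ℂ))) x))
    rw [norm_mul, norm_mul, he, one_mul] at h1
    have h2 := h1.trans (mul_le_mul (p.norm_fadingMGF_I_mul_le s hz) hMle (norm_nonneg _)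
      (mul_nonneg (Real.rpow_nonneg (div_pos (p.Om_pos s) (p.m_pos s)).le _)
        (Real.rpow_nonneg hz.le _)))
    calc _ ≤ (p.Om s / p.m s) ^ (-p.m s) * z ^ (-p.m s) * 1 * p.servingDensity s x / z := by gcongr
      _ = _ := by
        rw [sub_eq_add_neg, Real.rpow_add hz, Real.rpow_neg_one]
        field_simp

variable [Nonempty S] [MeasurableSpace S] [MeasurableSingletonClass S]

lemma integrable_margin (hnet : net.IsModel p μ) (T : ℝ) (s : S) :
    Integrable (net.margin p T s) μ :=
  (hnet.integrable_impairment.const_mul T).sub (hnet.integrable_servingFading s)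

/-- The fading has a density and is independent of the impairment. Without atoms at `0` the sign in
the inversion formula is almost surely `± 1`. -/
lemma ae_margin_ne_zero (hnet : net.IsModel p μ) (T : ℝ) (s : S) :
    ∀ᵐ ω ∂μ, net.margin p T s ω ≠ 0 := by
  have hg := hnet.measurable_serving s
  have hY := hnet.measurable_impairment
  have hind : IndepFun (net.impairment p) (net.servingFading s) μ :=
    ((hnet.indepFun_servingFading s).symm).comp
      (φ := fun u : (S × ℝ) × ℝ => p.noiseCoeff * u.1.2 + u.2 / p.G0) (ψ := id) (by fun_prop)
      measurable_id
  have hE : MeasurableSet {u : ℝ × ℝ | T * u.1 - u.2 = 0} :=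
    (by fun_prop : Measurable fun u : ℝ × ℝ => T * u.1 - u.2) (measurableSet_singleton 0)
  have h : (μ.map fun ω => (net.impairment p ω, net.servingFading s ω))
      {u : ℝ × ℝ | T * u.1 - u.2 = 0} = 0 := by
    rw [(indepFun_iff_map_prod_eq_prod_map_map hY.aemeasurable hg.aemeasurable).1 hind,
      Measure.measure_prod_null hE]
    refine .of_forall fun y => ?_
    have h1 : Prod.mk y ⁻¹' {u : ℝ × ℝ | T * u.1 - u.2 = 0} ⊆ {T * y} := fun g hg => by
      have : T * y - g = 0 := hg
      rw [mem_singleton_iff]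
      linarith
    refine measure_mono_null h1 ?_
    rw [hnet.serving_law]
    exact (withDensity_absolutelyContinuous _ _) (measure_singleton _)
  rw [Measure.map_apply (hY.prodMk hg) hE] at h
  rw [ae_iff]
  simp only [ne_eq, not_not]
  exact h

/-- Imaginary part of the joint transform at fading argument `jz` and interference argument `-jzT /
G⁽⁰⁾`, both on the boundary of the half-plane where it is known. -/
lemma setIntegral_sin_margin (hnet : net.IsModel p μ) (T : ℝ) (s : S) (z : ℝ) :
    ∫ ω in {ω | net.servingState p ω = s}, Real.sin (z * net.margin p T s ω) / z ∂μ =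
      ∫ x in Ioi 0, p.ptIntegrand p.interferenceMGF T s z x := by
  set h : ℝ → ℂ := fun x => Complex.exp (Complex.I * ((z * (p.noiseCoeff * x) * T : ℝ) : ℂ)) with hh
  have hm : Measurable h := by fun_prop
  have hC : ∀ x, 0 ≤ x → ‖h x‖ ≤ 1 := fun x _ => by
    rw [hh, Complex.norm_exp_I_mul_ofReal]
  have hz' : 0 ≤ (-(Complex.I * ((z * T / p.G0 : ℝ) : ℂ))).re := by
    rw [Complex.neg_re, Complex.I_mul_re, Complex.ofReal_im, neg_zero, neg_zero]
  have hIz : 0 ≤ (Complex.I * (z : ℂ)).re := by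
    rw [Complex.I_mul_re, Complex.ofReal_im, neg_zero]
  have e := hnet.setIntegral_mul_exp_fading_mul_exp_normInterference s hm hC hIz hz'
  have hX := hnet.measurable_margin T s
  have hprod : ∀ ω, Complex.exp (-(Complex.I * z * (net.servingFading s ω : ℂ))) *
      (h (net.servingLoss p ω) * Complex.exp (-(-(Complex.I * ((z * T / p.G0 : ℝ) : ℂ)) *
        (net.normInterference p ω : ℂ)))) =
      Complex.exp (((z * net.margin p T s ω : ℝ) : ℂ) * Complex.I) := fun ω => by
    rw [hh, ← Complex.exp_add, ← Complex.exp_add, margin, impairment]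
    congr 1
    push_cast
    ring
  simp_rw [hprod] at e
  have hi : IntegrableOn (fun ω => Complex.exp (((z * net.margin p T s ω : ℝ) : ℂ) * Complex.I))
      {ω | net.servingState p ω = s} μ := by
    refine (integrable_const (1 : ℝ)).mono' (by fun_prop : Measurable _).aestronglyMeasurable
      (.of_forall fun ω => ?_)
    rw [Complex.norm_exp_ofReal_mul_I]
  have him := integral_im hi
  simp only [RCLike.im_to_complex, Complex.exp_ofReal_mul_I_im] at him
  have hprodx : ∀ᵐ x ∂(volume.restrict (Ioi (0 : ℝ))), p.ptIntegrand p.interferenceMGF T s z x =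
      (p.fadingMGF s (Complex.I * z) * (h x *
        p.interferenceMGF (-(Complex.I * ((z * T / p.G0 : ℝ) : ℂ))) x *
          (p.servingDensity s x : ℂ))).im / z := .of_forall fun x => by
    rw [NetworkParams.ptIntegrand, ← mul_assoc, Complex.im_mul_ofReal,
      show z * x * p.noise * T / (p.G0 * p.PRB) = z * (p.noiseCoeff * x) * T by
        rw [NetworkParams.noiseCoeff]
        ring]
    congr 3
    ring
  obtain ⟨M, hM, hMeq⟩ := hnet.exists_measurable_interferenceMGF
  have hint : IntegrableOn (fun x => p.fadingMGF s (Complex.I * z) * (h x *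
        p.interferenceMGF (-(Complex.I * ((z * T / p.G0 : ℝ) : ℂ))) x *
          (p.servingDensity s x : ℂ))) (Ioi 0) := by
    have hMm : Measurable fun x => M (-(Complex.I * ((z * T / p.G0 : ℝ) : ℂ)), x) :=
      hM.comp measurable_prodMk_left
    have h1 : IntegrableOn (fun x => (p.servingDensity s x : ℂ)) (Ioi 0) :=
      (p.integrableOn_servingDensity s).ofReal
    have h2 : IntegrableOn (fun x => h x * M (-(Complex.I * ((z * T / p.G0 : ℝ) : ℂ)), x) *
        (p.servingDensity s x : ℂ)) (Ioi 0) := by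
      refine h1.bdd_mul (c := 1 * 1) (hm.mul hMm).aestronglyMeasurable ?_
      filter_upwards [ae_restrict_mem measurableSet_Ioi] with x hx
      have hx : 0 < x := hx
      rw [norm_mul, hMeq _ hz' x hx]
      exact mul_le_mul (hC x hx.le) (hnet.norm_interferenceMGF_le hx hz') (norm_nonneg _)
        zero_le_one
    refine Integrable.const_mul (h2.congr_fun (fun x hx => ?_) measurableSet_Ioi) _
    simp only [hMeq _ hz' x hx]
  have himx := integral_im hint
  simp only [RCLike.im_to_complex] at himx
  rw [integral_congr_ae hprodx, integral_div, integral_div, him, himx, e, integral_const_mul]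

/-- Before averaging, `sin (z X) / z` is not absolutely integrable at infinity; the damping makes
Fubini available, with `|X|` as the remaining factor. -/
lemma integrable_exp_mul_sin_margin (hnet : net.IsModel p μ) (T : ℝ) (s : S) {ε : ℝ}
    (hε : 0 < ε) :
    Integrable (fun u : ℝ × Ω => Real.exp (-(ε * u.1)) * (Real.sin (u.1 * net.margin p T s u.2) /
      u.1)) ((volume.restrict (Ioi 0)).prod (μ.restrict {ω | net.servingState p ω = s})) := by
  have hX := hnet.measurable_margin T s
  have hX2 : Measurable fun u : ℝ × Ω => net.margin p T s u.2 := hX.comp measurable_snd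
  have hexp : IntegrableOn (fun z => Real.exp (-(ε * z))) (Ioi 0) := by
    have := integrableOn_exp_mul_Ioi (neg_lt_zero.2 hε) 0
    simpa [neg_mul] using this
  refine (hexp.mul_prod (hnet.integrable_margin T s).integrableOn.norm).mono'
    (by fun_prop : Measurable _).aestronglyMeasurable ?_
  filter_upwards [Measure.quasiMeasurePreserving_fst.ae (ae_restrict_mem measurableSet_Ioi)]
    with u hu
  have hu : 0 < u.1 := hu
  rw [norm_mul, norm_div, Real.norm_eq_abs, Real.abs_exp, Real.norm_of_nonneg hu.le,
    Real.norm_eq_abs, Real.norm_eq_abs]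
  refine mul_le_mul_of_nonneg_left ?_ (Real.exp_pos _).le
  rw [div_le_iff₀ hu]
  refine Real.abs_sin_le_abs.trans (le_of_eq ?_)
  rw [abs_mul, abs_of_pos hu, mul_comm]

lemma ae_margin_nonpos_iff (hnet : net.IsModel p μ) (T : ℝ) (s : S) : ∀ᵐ ω ∂μ,
    net.servingState p ω = s → (net.margin p T s ω ∈ Iic (0 : ℝ) ↔ T ≤ net.sinr p ω) := by
  filter_upwards [hnet.ae_impairment_pos, hnet.ae_sinr_eq] with ω hY hsinr hs
  rw [hsinr, hs, le_div_iff₀ hY, margin, mem_Iic, sub_nonpos]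

/-- Gil-Pelaez inversion by Abel summation: damp, exchange the integrals to get the mean of `arctan
(X / ε)`, and let `ε = 1 / (k + 1)` tend to `0` on both sides. -/
lemma integral_ptIntegrand (hnet : net.IsModel p μ) {T : ℝ} (hT : 0 < T) (s : S) :
    ∫ x in Ioi 0, ∫ z in Ioi 0, p.ptIntegrand p.interferenceMGF T s z x =
      Real.pi / 2 * (μ.real {ω | net.servingState p ω = s} -
        2 * μ.real (net.margin p T s ⁻¹' Iic 0 ∩ {ω | net.servingState p ω = s})) := by
  have hI := hnet.integrable_ptIntegrand hT s
  have hX := hnet.measurable_margin T s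
  rw [← integral_integral_swap (f := fun z x => p.ptIntegrand p.interferenceMGF T s z x) hI]
  have hk : ∀ k : ℕ, (0 : ℝ) < 1 / ((k : ℝ) + 1) := fun k => by positivity
  have hswap : ∀ k : ℕ, ∫ z in Ioi 0, Real.exp (-(1 / ((k : ℝ) + 1) * z)) *
      ∫ x in Ioi 0, p.ptIntegrand p.interferenceMGF T s z x =
      ∫ ω in {ω | net.servingState p ω = s},
        Real.arctan (net.margin p T s ω / (1 / ((k : ℝ) + 1))) ∂μ := fun k => by
    simp_rw [← integral_exp_neg_mul_sin_div (hk k)]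
    rw [← integral_integral_swap (f := fun z ω => Real.exp (-(1 / ((k : ℝ) + 1) * z)) *
      (Real.sin (z * net.margin p T s ω) / z)) (hnet.integrable_exp_mul_sin_margin T s (hk k))]
    refine setIntegral_congr_fun measurableSet_Ioi fun z _ => ?_
    rw [integral_const_mul, hnet.setIntegral_sin_margin T s z]
  -- After averaging, the `z`-integral converges absolutely without damping, so its own modulus
  -- dominates.
  have h1 : Tendsto (fun k : ℕ => ∫ z in Ioi 0, Real.exp (-(1 / ((k : ℝ) + 1) * z)) *
      ∫ x in Ioi 0, p.ptIntegrand p.interferenceMGF T s z x) atTop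
      (𝓝 (∫ z in Ioi 0, ∫ x in Ioi 0, p.ptIntegrand p.interferenceMGF T s z x)) := by
    have hIz := hI.integral_prod_left
    refine tendsto_integral_of_dominated_convergence
      (fun z => ‖∫ x in Ioi 0, p.ptIntegrand p.interferenceMGF T s z x‖)
      (fun k => (by fun_prop : Measurable fun z : ℝ =>
        Real.exp (-(1 / ((k : ℝ) + 1) * z))).aestronglyMeasurable.mul hIz.aestronglyMeasurable)
      hIz.norm (fun k => ?_) (.of_forall fun z => ?_)
    · filter_upwards [ae_restrict_mem measurableSet_Ioi] with z hz
      have hz : 0 < z := hz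
      rw [norm_mul, Real.norm_eq_abs, Real.abs_exp]
      exact mul_le_of_le_one_left (norm_nonneg _)
        (Real.exp_le_one_iff.2 (neg_nonpos.2 (mul_pos (hk k) hz).le))
    · have hc : Continuous fun t : ℝ => Real.exp (-(t * z)) := by fun_prop
      have := (hc.tendsto 0).comp tendsto_one_div_add_atTop_nhds_zero_nat
      simp only [zero_mul, neg_zero, Real.exp_zero] at this
      simpa using this.mul_const (∫ x in Ioi 0, p.ptIntegrand p.interferenceMGF T s z x)
  have h2 : Tendsto (fun k : ℕ => ∫ ω in {ω | net.servingState p ω = s},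
        Real.arctan (net.margin p T s ω / (1 / ((k : ℝ) + 1))) ∂μ) atTop
      (𝓝 (∫ ω in {ω | net.servingState p ω = s},
        Real.pi / 2 * (1 - 2 * (Iic (0 : ℝ)).indicator 1 (net.margin p T s ω)) ∂μ)) := by
    refine tendsto_integral_of_dominated_convergence (fun _ => Real.pi / 2) (fun k => ?_)
      (integrable_const _) (fun k => .of_forall fun ω => ?_) ?_
    · exact (Real.continuous_arctan.measurable.comp (hX.div_const _)).aestronglyMeasurable
    · rw [Real.norm_eq_abs]
      exact (abs_lt.2 ⟨Real.neg_pi_div_two_lt_arctan _, Real.arctan_lt_pi_div_two _⟩).le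
    · filter_upwards [ae_restrict_of_ae (hnet.ae_margin_ne_zero T s)] with ω hω
      exact tendsto_arctan_mul_nat hω
  simp_rw [hswap] at h1
  rw [tendsto_nhds_unique h1 h2, integral_const_mul]
  have h3 : ∫ ω in {ω | net.servingState p ω = s},
      (Iic (0 : ℝ)).indicator (1 : ℝ → ℝ) (net.margin p T s ω) ∂μ =
      μ.real (net.margin p T s ⁻¹' Iic 0 ∩ {ω | net.servingState p ω = s}) := by
    rw [← measureReal_restrict_apply (hX measurableSet_Iic),
      ← integral_indicator_one (hX measurableSet_Iic)]
    rfl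
  have h4 : Integrable (fun ω => 2 * (Iic (0 : ℝ)).indicator (1 : ℝ → ℝ) (net.margin p T s ω))
      (μ.restrict {ω | net.servingState p ω = s}) := by
    have hm : Measurable fun ω => (Iic (0 : ℝ)).indicator (1 : ℝ → ℝ) (net.margin p T s ω) :=
      (measurable_one.indicator measurableSet_Iic).comp hX
    refine ((integrable_const (1 : ℝ)).mono' hm.aestronglyMeasurable
      (.of_forall fun ω => ?_)).const_mul 2
    by_cases h : net.margin p T s ω ∈ Iic (0 : ℝ) <;> simp [indicator, h]
  rw [integral_sub (integrable_const _) h4, integral_const_mul, h3]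
  simp

/-- The distribution of the SINR. -/
theorem measureReal_le_sinr (hnet : net.IsModel p μ) {T : ℝ} (hT : 0 < T) :
    μ.real {ω | T ≤ net.sinr p ω} = 1 / 2 -
      (∑ s, ∫ x in Ioi 0, ∫ z in Ioi 0, p.ptIntegrand p.interferenceMGF T s z x) / Real.pi := by
  -- The state probabilities sum to `1`; this total produces the term `1 / 2`.
  have h1 := hnet.integral_eq_sum_servingState (integrable_const (1 : ℝ))
  simp only [integral_const, smul_eq_mul, mul_one, probReal_univ,
    measureReal_restrict_apply_univ] at h1
  have h2 : {ω | T ≤ net.sinr p ω} =ᵐ[μ]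
      ⋃ s, (net.margin p T s ⁻¹' Iic 0 ∩ {ω | net.servingState p ω = s} : Set Ω) := by
    filter_upwards [ae_all_iff.2 fun s => hnet.ae_margin_nonpos_iff T s] with ω hω
    refine propext ⟨fun h => mem_iUnion.2 ⟨net.servingState p ω, (hω _ rfl).2 h, rfl⟩, fun h => ?_⟩
    obtain ⟨s, h3, h4⟩ := mem_iUnion.1 h
    exact (hω s h4).1 h3
  have h3 : μ.real {ω | T ≤ net.sinr p ω} =
      ∑ s, μ.real (net.margin p T s ⁻¹' Iic 0 ∩ {ω | net.servingState p ω = s}) := by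
    rw [measureReal_congr h2]
    exact measureReal_iUnion_fintype (fun s r hsr => Set.disjoint_left.2 fun ω h h' =>
      hsr (h.2.symm.trans h'.2)) fun s =>
        (hnet.measurable_margin T s measurableSet_Iic).inter (hnet.measurableSet_servingState s)
  simp_rw [hnet.integral_ptIntegrand hT]
  rw [← Finset.mul_sum, Finset.sum_sub_distrib, ← Finset.mul_sum, ← h1, ← h3]
  have := Real.pi_pos
  field_simp
  ring

end IsModel

end Network


/-! ### The mean number of links -/

namespace Network

variable {S Ω : Type*} [Fintype S] {net : Network S Ω} {p : NetworkParams S 1}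

lemma lossCount_eq (s : S) (ξ : ℝ) (ω : Ω) :
    net.lossCount p s ξ ω = pointCount (net.count s) (net.pos s) (p.lossBall s ξ) ω := by
  rw [lossCount, pointCount, pointCount]
  congr 1
  ext n
  exact and_congr_right fun _ => ⟨fun h => h.2, fun h => ⟨net.loss_nonneg p s n ω, h⟩⟩

lemma IsModel.lintegral_lossCount {mΩ : MeasurableSpace Ω} {μ : Measure Ω} [IsProbabilityMeasure μ]
    (hnet : net.IsModel p μ) (s : S) {ξ : ℝ} (hξ : 0 ≤ ξ) :
    ∫⁻ ω, (net.lossCount p s ξ ω : ℝ≥0∞) ∂μ = ENNReal.ofReal (p.intensity s ξ) := by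
  simp_rw [lossCount_eq]
  rw [(hnet.poisson s).lintegral_pointCount (p.measurableSet_lossBall s ξ),
    p.planarIntensity_lossBall s hξ]

end Network

end


/-! ### Assembly for two link states. -/

theorem corollary3 {Ω : Type*} [MeasurableSpace Ω] (μ : Measure Ω) [IsProbabilityMeasure μ]
    (p : NetworkParams LinkState 1) (net : Network LinkState Ω) (hnet : net.IsModel p μ) :
    -- the ASE formula
    (Integrable (fun ω => Real.log (1 + net.sinr p ω)) μ ∧
      (∀ s, IntegrableOn (fun u : ℝ × ℝ => p.aseIntegrand p.twoStateMGF s u.1 u.2)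
        (Ioi 0 ×ˢ Ioi 0)) ∧
      ((net.ase p μ : ℝ) : ℂ) = ((p.lamMT * p.pSel / Real.log 2 : ℝ) : ℂ) *
        ∑ s, ∫ x in Ioi (0 : ℝ), ∫ z in Ioi (0 : ℝ), p.aseIntegrand p.twoStateMGF s z x) ∧
    -- the PT formula
    (∀ T : ℝ, 0 < T →
      (∀ s, IntegrableOn (fun u : ℝ × ℝ => p.ptIntegrand p.twoStateMGF T s u.1 u.2)
        (Ioi 0 ×ˢ Ioi 0)) ∧
      net.pt p μ T = p.lamMT * p.pSel * Real.logb 2 (1 + T) *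
        (1 / 2 - (∑ s, ∫ x in Ioi (0 : ℝ), ∫ z in Ioi (0 : ℝ),
          p.ptIntegrand p.twoStateMGF T s z x) / Real.pi)) ∧
    -- moment generating function of the interference beyond a given path-loss
    (∀ z : ℂ, 0 ≤ z.re → ∀ x : ℝ, 0 < x →
      ∫ ω, Complex.exp (-(z * ((x / p.PRB * (net.interference p x ω).toReal : ℝ) : ℂ))) ∂μ =
        Complex.exp (p.exponent .los z x + p.exponent .nlos z x)) ∧
    -- the same, conditionally on the state and the path-loss of the intended link
    (∀ z : ℂ, 0 ≤ z.re →
      μ[fun ω => Complex.exp (-(z * ((net.servingLoss p ω / p.PRB *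
          (net.interference p (net.servingLoss p ω) ω).toReal : ℝ) : ℂ))) |
        MeasurableSpace.comap (fun ω => (net.servingState p ω, net.servingLoss p ω))
          inferInstance] =ᵐ[μ]
        fun ω => Complex.exp (p.exponent .los z (net.servingLoss p ω) +
          p.exponent .nlos z (net.servingLoss p ω))) ∧
    -- the intensity measure of the path-loss process
    (∀ s, ∀ ξ : ℝ, 0 ≤ ξ →
      ∫⁻ ω, (net.lossCount p s ξ ω : ℝ≥0∞) ∂μ = ENNReal.ofReal (p.intensity s ξ) ∧
      p.intensity s ξ =
        Real.pi * p.lamBS * p.Theta s * p.q s 1 *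
            ((ξ / p.kap s) ^ (2 / p.alp s) * heavisideCompl (ξ - p.kap s * p.D 1 ^ p.alp s) +
              p.D 1 ^ 2 * heaviside (ξ - p.kap s * p.D 1 ^ p.alp s)) +
          Real.pi * p.lamBS * p.Theta s * p.q s 2 *
            ((ξ / p.kap s) ^ (2 / p.alp s) - p.D 1 ^ 2) *
              heaviside (ξ - p.kap s * p.D 1 ^ p.alp s)) ∧
    -- its derivative
    (∀ s, ∀ ξ : ℝ, 0 < ξ →
      p.intensityDeriv s ξ =
        Real.pi * p.lamBS * p.Theta s * p.q s 1 * (2 / p.alp s) * p.kap s ^ (-(2 / p.alp s)) *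
            ξ ^ (2 / p.alp s - 1) * heavisideCompl (ξ - p.kap s * p.D 1 ^ p.alp s) +
          Real.pi * p.lamBS * p.Theta s * p.q s 2 * (2 / p.alp s) * p.kap s ^ (-(2 / p.alp s)) *
            ξ ^ (2 / p.alp s - 1) * heaviside (ξ - p.kap s * p.D 1 ^ p.alp s) ∧
      HasDerivWithinAt (p.intensity s) (p.intensityDeriv s ξ) (Ici ξ) ξ ∧
      (ξ ≠ p.kap s * p.D 1 ^ p.alp s → HasDerivAt (p.intensity s) (p.intensityDeriv s ξ) ξ)) ∧
    -- the exponents of the interference moment generating function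
    (∀ r, ∀ z : ℂ, ∀ x : ℝ, 0 ≤ x →
      p.exponent r z x =
        ((Real.pi * p.lamI * p.Theta r * p.q r 1 : ℝ) : ℂ) *
            ((((x / p.kap r) ^ (2 / p.alp r) : ℝ) : ℂ) * p.calF r z *
                (heavisideCompl (x - p.kap r * p.D 1 ^ p.alp r) : ℂ) -
              (p.D 1 : ℂ) ^ 2 *
                p.calF r ((x : ℂ) * z / ((p.kap r * p.D 1 ^ p.alp r : ℝ) : ℂ)) *
                (heavisideCompl (x - p.kap r * p.D 1 ^ p.alp r) : ℂ)) +
          ((Real.pi * p.lamI * p.Theta r * p.q r 2 : ℝ) : ℂ) *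
            ((((x / p.kap r) ^ (2 / p.alp r) : ℝ) : ℂ) * p.calF r z *
                (heaviside (x - p.kap r * p.D 1 ^ p.alp r) : ℂ) +
              (p.D 1 : ℂ) ^ 2 *
                p.calF r ((x : ℂ) * z / ((p.kap r * p.D 1 ^ p.alp r : ℝ) : ℂ)) *
                (heavisideCompl (x - p.kap r * p.D 1 ^ p.alp r) : ℂ))) := by
  have hM := p.interferenceMGF_linkState
  have hMexp : ∀ z x, p.interferenceMGF z x =
      Complex.exp (p.exponent .los z x + p.exponent .nlos z x) := fun z x => by
    rw [hM, NetworkParams.twoStateMGF]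
  rw [← hM]
  refine ⟨⟨hnet.integrable_log_one_add_sinr, fun s => ?_, ?_⟩, fun T hT => ⟨fun s => ?_, ?_⟩,
    fun z hz x hx => ?_, fun z hz => ?_,
    fun s ξ hξ => ⟨hnet.lintegral_lossCount s hξ, p.intensity_eq s hξ⟩,
    fun s ξ hξ => ⟨p.intensityDeriv_eq s hξ, p.hasDerivWithinAt_intensity s hξ,
      p.hasDerivAt_intensity s hξ⟩, fun r z x hx => p.exponent_eq r z hx⟩
  · rw [IntegrableOn, Measure.volume_eq_prod, ← Measure.prod_restrict]
    exact hnet.integrable_aseIntegrand s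
  · rw [Network.ase, Complex.ofReal_mul, hnet.integral_log_one_add_sinr]
  · rw [IntegrableOn, Measure.volume_eq_prod, ← Measure.prod_restrict]
    exact hnet.integrable_ptIntegrand hT s
  · rw [Network.pt, hnet.measureReal_le_sinr hT]
  · rw [← hMexp, ← hnet.integral_exp_tailTotal hx hz]
    refine integral_congr_ae ?_
    filter_upwards [hnet.ae_interference_eq] with ω hω
    rw [hω x hx]
  · simp_rw [← hMexp]
    refine (condExp_congr_ae ?_).trans (hnet.condExp_exp_normInterference hz)
    filter_upwards [hnet.ae_interference_eq, hnet.ae_servingLoss_pos] with ω hω h0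
    rw [hω _ h0, Network.normInterference]
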